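/- Let $S^2$ be the unit sphere with round metric $\sigma_{AB}$, covariant derivative $\nabla$, volume form $\epsilon_{AB}$, Laplacian $\Delta$ and coordinate functions $\tilde X^k$ ($k=1,2,3$), and let $Y^A=\epsilon^{AB}\nabla_B\tilde X^k$. Consider vacuum null infinity data on $(-\infty,\infty)\times S^2$: smooth fields $m(u,x)$ (mass aspect), $N_A(u,x)$ (angular momentum aspect) and $C_{AB}(u,x)$ (shear; symmetric and traceless), with news $N_{AB}=\partial_uC_{AB}$, satisfying the Einstein equations at null infinity $$\partial_u m=-\tfrac18N_{AB}N^{AB}+\tfrac14\nabla^A\nabla^BN_{AB},$$ $$\partial_uN_A=\nabla_Am-\tfrac14\nabla^D(\nabla_D\nabla^EC_{EA}-\nabla_A\nabla^EC_{ED})+\tfrac14\nabla_A(C_{BE}N^{BE})-\tfrac14\nabla_B(C^{BD}N_{DA})+\tfrac12C_{AB}\nabla_DN^{DB}.$$ The classical angular momentum is $\tilde J^k(u)=\int_{S^2}Y^A\big[N_A-\tfrac14C_A{}^{D}\nabla^EC_{DE}\big]$ and the linear momentum is $P^k(u)=\int_{S^2}2m\tilde X^k$. The total flux of such a quantity is the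 difference of its limits, e.g. $\tilde J^k(+)-\tilde J^k(-)$, where $(\pm)$ denotes the limit as $u\to\pm\infty$. For $f\in C^\infty(S^2)$, the supertranslation $u=\bar u+f(x)$ replaces the data by vacuum null infinity data $(\bar m,\bar N_A,\bar C_{AB})$ in the coordinates $(\bar u,x)$ with $$\bar C_{AB}(\bar u,x)=C_{AB}(\bar u+f,x)-2\nabla_A\nabla_Bf+\Delta f\,\sigma_{AB},$$ $$\bar m(\bar u,x)=\Big(m+\tfrac12\nabla^BN_{BD}\nabla^Df+\tfrac14\partial_uN_{BD}\nabla^Bf\nabla^Df+\tfrac14N_{BD}\nabla^B\nabla^Df\Big)(\bar u+f,x)$$ ($\bar N_A$ being any solution of its evolution equation; its initial value does not affect the flux). Let $\tilde J^k_f(\pm)$ be the limits of the angular momentum of the new data. The total flux of $\tilde J^k$ is called supertranslation invariant if, for all $k$, it is unchanged by every supertranslation $f$ supported in the modes $\ell\ge2$, and it is equivariant under ordinary translations $f=\alpha_0+\alpha_i\tilde X^i$, i.e. it then changes by $\alpha_i\,\varepsilon^{ik}{}_{j}\,(P^j(+)-P^j(-))$. A function has mode $\ell$ if $\Delta h=-\ell(\ell+1)h$.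 **Theorem.** Suppose that for some $\varepsilon>0$, $N_{AB}(u,x)=O(|u|^{-1-\varepsilon})$ as $u\to\pm\infty$, uniformly on $S^2$ together with its derivatives along $S^2$ up to third order. Then: 1. The limits $m(\pm)=\lim_{u\to\pm\infty}m(u,\cdot)$ exist and are $C^1$ functions on $S^2$. For every $f\in C^\infty(S^2)$ the supertranslated data exist. 2. For every $f\in C^\infty(S^2)$ and every $k$, the limits $\tilde J^k(\pm)$ and $\tilde J^k_f(\pm)$ exist and $$\big(\tilde J^k_f(+)-\tilde J^k_f(-)\big)-\big(\tilde J^k(+)-\tilde J^k(-)\big)=-2\int_{S^2}f\,Y^A\nabla_A\big(m(+)-m(-)\big).$$ 3. The total flux of the classical angular momentum is supertranslation invariant if and only if $m(+)-m(-)$ is supported in the modes $\ell\le1$. 4. Let $g=-UV\,du^2-2U\,du\,dr+r^2h_{AB}(dx^A+W^Adu)(dx^B+W^Bdu)$, $\det h=\det\sigma$, be a Bondi-Sachs metric whose coefficients are smooth functions of $(u,1/r,x)$ up to $1/r=0$ and whose mass aspect, angular momentum aspect and shear are the given ones, i.e. $$U=1-\tfrac{1}{16r^2}|C|^2+O(r^{-3}),$$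 $$V=1-\tfrac{2m}{r}+\tfrac1{r^2}\big(\tfrac13\nabla^AN_A+\tfrac14\nabla^AC_{AB}\nabla_DC^{BD}+\tfrac1{16}|C|^2\big)+O(r^{-3}),$$ $$W^A=\tfrac1{2r^2}\nabla_BC^{AB}+\tfrac1{r^3}\big(\tfrac23N^A-\tfrac1{16}\nabla^A|C|^2-\tfrac12C^{AB}\nabla^DC_{BD}\big)+O(r^{-4}),$$ $$h_{AB}=\sigma_{AB}+\tfrac{C_{AB}}r+\tfrac1{4r^2}|C|^2\sigma_{AB}+O(r^{-3}).$$ Let $L=\partial_r$, $\underline L=\frac2U(\partial_u-W^D\partial_D-\frac V2\partial_r)$ and $\rho=\frac14R(\underline L,L,\underline L,L)$, where $R(X,Y,W,Z)=\langle (D_XD_Y-D_YD_X-D_{[X,Y]})Z,W\rangle$. Then $P=\lim_{r\to\infty}r^3\rho$ exists and has limits as $u\to\pm\infty$, and if $\lim_{u\to\infty}P-\lim_{u\to-\infty}P$ is supported in the modes $\ell\le1$, then so is $m(+)-m(-)$ (so that the total flux of the classical angular momentum is supertranslation invariant). -/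

import Mathlib

open MeasureTheory Filter Topology
open scoped ContDiff

noncomputable section

/-! ### Tensor calculus on the round unit sphere

Tensors on the unit sphere in `ℝ³` are written with Cartesian indices in `Fin 3`: a covector field
is a tangential `S2 → Fin 3 → ℝ`, a 2-tensor a tangential `S2 → Fin 3 → Fin 3 → ℝ`.  Indices are
raised and lowered with the Euclidean metric, which induces the round metric.  Covariant
derivatives are tangential projections of Euclidean derivatives (Gauss formula). -/

/-- Euclidean three-space. -/
abbrev E3 : Type := EuclideanSpace ℝ (Fin 3)

/-- The unit sphere in Euclidean three-space. -/
abbrev S2 : Type := Metric.sphere (0 : E3) 1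

/-- The direction `y / |y|` (with an arbitrary value at `y = 0`). -/
def dir (y : E3) : S2 :=
  if h : y = 0 then ⟨EuclideanSpace.single 0 1, by simp⟩
  else ⟨‖y‖⁻¹ • y, by
    simp [norm_smul, inv_mul_cancel₀ (norm_ne_zero_iff.mpr h)]⟩

/-- The extension of a function on the sphere that is constant along rays from the origin. -/
def radialExt {F : Type*} (f : S2 → F) : E3 → F := fun y => f (dir y)

/-- `f` is a `C^n` function on the sphere. -/
def SphereContDiff (n : WithTop ℕ∞) (f : S2 → ℝ) : Prop :=
  ContDiffOn ℝ n (radialExt f) {y | y ≠ 0}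

/-- `F` is smooth on `ℝ × S²`. -/
def CylinderSmooth (F : ℝ → S2 → ℝ) : Prop :=
  ContDiffOn ℝ ∞ (fun p : ℝ × E3 => radialExt (F p.1) p.2) {p | p.2 ≠ 0}

/-- Integral over the sphere with respect to surface area. -/
def sphereIntegral (f : S2 → ℝ) : ℝ :=
  ∫ x, f x ∂((volume : Measure E3).toSphere)

/-- Kronecker delta. -/
def kron {n : ℕ} (i j : Fin n) : ℝ := if i = j then 1 else 0

/-- The Levi-Civita symbol with `eps3 0 1 2 = 1`. -/
def eps3 (i j k : Fin 3) : ℝ :=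
  (((j : ℕ) : ℝ) - ((i : ℕ) : ℝ)) * (((k : ℕ) : ℝ) - ((i : ℕ) : ℝ)) *
    (((k : ℕ) : ℝ) - ((j : ℕ) : ℝ)) / 2

/-- The round metric `σ_{ij} = δ_{ij} - x_i x_j`, which is also the projection to the tangent
plane. -/
def roundMetric (x : S2) (i j : Fin 3) : ℝ := kron i j - x.1 i * x.1 j

/-- The volume form `ε_{ij}` of the sphere, oriented by the outward normal. -/
def volForm (x : S2) (i j : Fin 3) : ℝ := ∑ k, eps3 i j k * x.1 k

/-- The standard coordinate function `X^k` restricted to the sphere. -/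
def coordFn (k : Fin 3) (x : S2) : ℝ := x.1 k

/-- The gradient `∇_i f`. -/
def grad (f : S2 → ℝ) (x : S2) (i : Fin 3) : ℝ :=
  fderiv ℝ (radialExt f) x.1 (EuclideanSpace.single i 1)

/-- The covariant derivative `∇_k w_i` of a covector field. -/
def cov1 (w : S2 → Fin 3 → ℝ) (x : S2) (k i : Fin 3) : ℝ :=
  ∑ b, roundMetric x i b * grad (fun z => w z b) x k

/-- The covariant derivative `∇_k T_{ij}` of a 2-tensor field. -/
def cov2 (T : S2 → Fin 3 → Fin 3 → ℝ) (x : S2) (k i j : Fin 3) : ℝ :=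
  ∑ b, ∑ c, roundMetric x i b * roundMetric x j c * grad (fun z => T z b c) x k

/-- The divergence `∇^i w_i`. -/
def div1 (w : S2 → Fin 3 → ℝ) (x : S2) : ℝ := ∑ i, cov1 w x i i

/-- The divergence `∇^i T_{ij}`. -/
def div2 (T : S2 → Fin 3 → Fin 3 → ℝ) (x : S2) (j : Fin 3) : ℝ := ∑ i, cov2 T x i i j

/-- The Hessian `∇_i ∇_j f`. -/
def hess (f : S2 → ℝ) : S2 → Fin 3 → Fin 3 → ℝ := cov1 (grad f)

/-- The Laplacian of the round sphere. -/
def lap (f : S2 → ℝ) : S2 → ℝ := div1 (grad f)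

/-- The full contraction `S_{ij} T^{ij}`. -/
def contract (S T : Fin 3 → Fin 3 → ℝ) : ℝ := ∑ i, ∑ j, S i j * T i j

/-- The rotation field `Y^A = ε^{AB} ∇_B X^k`. -/
def rotField (k : Fin 3) (x : S2) (a : Fin 3) : ℝ := ∑ b, volForm x a b * grad (coordFn k) x b

/-- A smooth function of mode `ℓ`, i.e. `Δ f = -ℓ(ℓ+1) f`. -/
def IsMode (l : ℕ) (f : S2 → ℝ) : Prop :=
  SphereContDiff ∞ f ∧ ∀ x, lap f x = -((l : ℝ) * ((l : ℝ) + 1)) * f x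

/-- `f` is supported in the modes `ℓ ≤ 1`. -/
def SupportedLeOne (f : S2 → ℝ) : Prop :=
  ∃ f₀ f₁ : S2 → ℝ, IsMode 0 f₀ ∧ IsMode 1 f₁ ∧ ∀ x, f x = f₀ x + f₁ x

/-- `f` is supported in the modes `ℓ ≥ 2`, i.e. it is `L²`-orthogonal to the modes `0` and `1`. -/
def SupportedGeTwo (f : S2 → ℝ) : Prop :=
  ∀ l : ℕ, l ≤ 1 → ∀ g : S2 → ℝ, IsMode l g → sphereIntegral (fun x => f x * g x) = 0

/-! ### Data at null infinity -/

/-- Fields on `ℝ × S²` (retarded time and direction): mass aspect `m`, angular momentum aspect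
`N_A` and shear `C_{AB}`. -/
structure NullInfinityData where
  /-- mass aspect `m(u, x)` -/
  m : ℝ → S2 → ℝ
  /-- angular momentum aspect `N_A(u, x)` -/
  N : ℝ → S2 → Fin 3 → ℝ
  /-- shear tensor `C_{AB}(u, x)` -/
  C : ℝ → S2 → Fin 3 → Fin 3 → ℝ

namespace NullInfinityData

/-- The news tensor `N_{AB} = ∂_u C_{AB}`. -/
def news (D : NullInfinityData) (u : ℝ) (x : S2) (i j : Fin 3) : ℝ :=
  deriv (fun t => D.C t x i j) u

/-- The antisymmetric tensor `∇_B ∇^E C_{EA} - ∇_A ∇^E C_{EB}`. -/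
def curlShear (D : NullInfinityData) (u : ℝ) (x : S2) (b a : Fin 3) : ℝ :=
  cov1 (div2 (D.C u)) x b a - cov1 (div2 (D.C u)) x a b

/-- Right-hand side of the mass loss formula,
`-1/8 N_{AB} N^{AB} + 1/4 ∇^A ∇^B N_{AB}`. -/
def massRate (D : NullInfinityData) (u : ℝ) (x : S2) : ℝ :=
  -(1 / 8) * contract (D.news u x) (D.news u x) + (1 / 4) * div1 (div2 (D.news u)) x

/-- Right-hand side of the evolution equation of the angular momentum aspect,
`∇_A m - 1/4 ∇^D(∇_D ∇^E C_{EA} - ∇_A ∇^E C_{ED}) + 1/4 ∇_A(C_{BE} N^{BE})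
- 1/4 ∇_B(C^{BD} N_{DA}) + 1/2 C_{AB} ∇_D N^{DB}`. -/
def angularRate (D : NullInfinityData) (u : ℝ) (x : S2) (a : Fin 3) : ℝ :=
  grad (D.m u) x a - (1 / 4) * div2 (D.curlShear u) x a
    + (1 / 4) * grad (fun z => contract (D.C u z) (D.news u z)) x a
    - (1 / 4) * div2 (fun z b c => ∑ d, D.C u z b d * D.news u z d c) x a
    + (1 / 2) * ∑ b, D.C u x a b * div2 (D.news u) x b

/-- Smooth null infinity data subject to the vacuum Einstein equations at null infinity: all fields
are smooth tensor fields on the sphere depending smoothly on `u`, the shear is symmetric and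
traceless, and `m` and `N_A` obey their evolution equations. -/
structure IsVacuum (D : NullInfinityData) : Prop where
  smooth_m : CylinderSmooth D.m
  smooth_N : ∀ i, CylinderSmooth (fun u x => D.N u x i)
  smooth_C : ∀ i j, CylinderSmooth (fun u x => D.C u x i j)
  tangent_N : ∀ u x, ∑ i, D.N u x i * x.1 i = 0
  tangent_C : ∀ u x i, ∑ j, D.C u x i j * x.1 j = 0
  symm_C : ∀ u x i j, D.C u x i j = D.C u x j i
  trace_C : ∀ u x, ∑ i, D.C u x i i = 0
  evol_m : ∀ u x, HasDerivAt (fun t => D.m t x) (D.massRate u x) u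
  evol_N : ∀ u x a, HasDerivAt (fun t => D.N t x a) (D.angularRate u x a) u

/-- The news is `O(|u|^{-1-ε})` as `u → ±∞`, uniformly on the sphere, together with its
derivatives along the sphere up to third order. -/
def NewsDecay (D : NullInfinityData) (ε : ℝ) : Prop :=
  ∃ K R : ℝ, 0 < R ∧ ∀ u : ℝ, R ≤ |u| → ∀ (x : S2) (i j : Fin 3) (n : ℕ), n ≤ 3 →
    ‖iteratedFDeriv ℝ n (radialExt (fun z => D.news u z i j)) x.1‖ ≤ K * |u| ^ (-1 - ε)

/-- The classical angular momentum
`J^k(u) = ∫ ε^{AB} ∇_B X^k (N_A - 1/4 C_A^D ∇^E C_{DE})`. -/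
def angularMomentum (D : NullInfinityData) (k : Fin 3) (u : ℝ) : ℝ :=
  sphereIntegral (fun x => ∑ a, rotField k x a *
    (D.N u x a - (1 / 4) * ∑ d, D.C u x a d * div2 (D.C u) x d))

/-- The linear momentum `P^k(u) = ∫ 2 m X^k`. -/
def linearMomentum (D : NullInfinityData) (k : Fin 3) (u : ℝ) : ℝ :=
  sphereIntegral (fun x => 2 * D.m u x * coordFn k x)

/-- `D'` consists of the fields of `D` in the coordinates `(ū, x)` with `u = ū + f(x)`: again
vacuum null infinity data, with
`C̄_{AB}(ū, x) = C_{AB}(ū + f, x) - 2 ∇_A ∇_B f + Δ f σ_{AB}` and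
`m̄(ū, x) = (m + 1/2 ∇^B N_{BD} ∇^D f + 1/4 ∂_u N_{BD} ∇^B f ∇^D f
  + 1/4 N_{BD} ∇^B ∇^D f)(ū + f, x)`. -/
structure IsSupertranslate (D : NullInfinityData) (f : S2 → ℝ) (D' : NullInfinityData) :
    Prop where
  vacuum : D'.IsVacuum
  shear : ∀ u x i j, D'.C u x i j =
    D.C (u + f x) x i j - 2 * hess f x i j + lap f x * roundMetric x i j
  mass : ∀ u x, D'.m u x = D.m (u + f x) x
    + (1 / 2) * ∑ d, div2 (D.news (u + f x)) x d * grad f x d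
    + (1 / 4) * ∑ b, ∑ d, deriv (fun t => D.news t x b d) (u + f x) * grad f x b * grad f x d
    + (1 / 4) * contract (D.news (u + f x) x) (hess f x)

end NullInfinityData

/-- The quantity `J(u)` has limits `J(±)` as `u → ±∞`, and its total flux `J(+) - J(-)` is `Φ`. -/
def HasTotalFlux (J : ℝ → ℝ) (Φ : ℝ) : Prop :=
  ∃ Jp Jm : ℝ, Tendsto J atTop (𝓝 Jp) ∧ Tendsto J atBot (𝓝 Jm) ∧ Φ = Jp - Jm

namespace NullInfinityData

/-- The total flux of the classical angular momentum is supertranslation invariant: it is unchanged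
by the supertranslations of modes `ℓ ≥ 2`, and it is equivariant under the ordinary translations
`f = α₀ + α_i X^i`, under which `J^k(+) - J^k(-)` changes by
`α_i ε^{ik}_j (P^j(+) - P^j(-))`. -/
def FluxSupertranslationInvariant (D : NullInfinityData) : Prop :=
  (∀ (f : S2 → ℝ) (D' : NullInfinityData), SphereContDiff ∞ f → SupportedGeTwo f →
    D.IsSupertranslate f D' →
    ∀ k, ∃ Φ, HasTotalFlux (D.angularMomentum k) Φ ∧ HasTotalFlux (D'.angularMomentum k) Φ) ∧
  (∀ (α₀ : ℝ) (α : Fin 3 → ℝ) (D' : NullInfinityData),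
    D.IsSupertranslate (fun x => α₀ + ∑ i, α i * coordFn i x) D' →
    ∀ k, ∃ (Φ Φ' : ℝ) (Q : Fin 3 → ℝ), HasTotalFlux (D.angularMomentum k) Φ ∧
      HasTotalFlux (D'.angularMomentum k) Φ' ∧
      (∀ j, HasTotalFlux (D.linearMomentum j) (Q j)) ∧
      Φ' - Φ = ∑ i, ∑ j, α i * eps3 i k j * Q j)

end NullInfinityData

/-! ### Curvature of a Lorentzian metric in coordinates on `ℝ⁴` -/

/-- The partial derivative `∂_a F`. -/
def partial4 (a : Fin 4) (F : (Fin 4 → ℝ) → ℝ) (p : Fin 4 → ℝ) : ℝ :=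
  fderiv ℝ F p (Pi.single a 1)

/-- The Christoffel symbols `Γ^a_{bc}`. -/
def christoffel (g : (Fin 4 → ℝ) → Matrix (Fin 4) (Fin 4) ℝ) (a b c : Fin 4)
    (p : Fin 4 → ℝ) : ℝ :=
  (1 / 2) * ∑ d, (g p)⁻¹ a d * (partial4 b (fun q => g q d c) p
    + partial4 c (fun q => g q d b) p - partial4 d (fun q => g q b c) p)

/-- The component `d` of `R(∂_a, ∂_b) ∂_c`, with
`R(X, Y) Z = D_X D_Y Z - D_Y D_X Z - D_{[X, Y]} Z`. -/
def riemannUp (g : (Fin 4 → ℝ) → Matrix (Fin 4) (Fin 4) ℝ) (d a b c : Fin 4)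
    (p : Fin 4 → ℝ) : ℝ :=
  partial4 a (christoffel g d b c) p - partial4 b (christoffel g d a c) p
    + ∑ e, (christoffel g d a e p * christoffel g e b c p
      - christoffel g d b e p * christoffel g e a c p)

/-- `R(X, Y, W, Z) = ⟨R(X, Y) Z, W⟩`. -/
def riemann (g : (Fin 4 → ℝ) → Matrix (Fin 4) (Fin 4) ℝ) (p X Y W Z : Fin 4 → ℝ) : ℝ :=
  ∑ a, ∑ b, ∑ c, ∑ d, ∑ e, X a * Y b * Z c * W e * g p d e * riemannUp g d a b c p

/-! ### Bondi-Sachs metrics -/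

/-- The coefficients of a Bondi-Sachs metric
`-U V du² - 2 U du dr + r² h_{AB} (dx^A + W^A du) (dx^B + W^B du)` near null infinity, as functions
of `u`, `s = 1/r` and `x`.  They are smooth up to null infinity `s = 0`, so that they have
differentiable expansions in inverse powers of `r`. -/
structure BondiSachsMetric where
  U : ℝ → ℝ → S2 → ℝ
  V : ℝ → ℝ → S2 → ℝ
  W : ℝ → ℝ → S2 → Fin 3 → ℝ
  h : ℝ → ℝ → S2 → Fin 3 → Fin 3 → ℝ
  smooth_U : ∀ (u : ℝ) (x : S2),
    ContDiffAt ℝ ∞ (fun p : ℝ × ℝ × E3 => radialExt (U p.1 p.2.1) p.2.2) (u, 0, x.1)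
  smooth_V : ∀ (u : ℝ) (x : S2),
    ContDiffAt ℝ ∞ (fun p : ℝ × ℝ × E3 => radialExt (V p.1 p.2.1) p.2.2) (u, 0, x.1)
  smooth_W : ∀ (u : ℝ) (x : S2) (i : Fin 3),
    ContDiffAt ℝ ∞ (fun p : ℝ × ℝ × E3 => radialExt (W p.1 p.2.1) p.2.2 i) (u, 0, x.1)
  smooth_h : ∀ (u : ℝ) (x : S2) (i j : Fin 3),
    ContDiffAt ℝ ∞ (fun p : ℝ × ℝ × E3 => radialExt (h p.1 p.2.1) p.2.2 i j) (u, 0, x.1)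
  tangent_W : ∀ u s x, ∑ i, W u s x i * x.1 i = 0
  tangent_h : ∀ u s x i, ∑ j, h u s x i j * x.1 j = 0
  symm_h : ∀ u s x i j, h u s x i j = h u s x j i
  /-- `det h_{AB} = det σ_{AB}` -/
  det_h : ∀ (u : ℝ) (x : S2), ∀ᶠ s in 𝓝[>] (0 : ℝ),
    Matrix.det (Matrix.of fun i j => h u s x i j + x.1 i * x.1 j) = 1

namespace BondiSachsMetric

/-- The point `(u, y)`, `y = r x`, of `ℝ × ℝ³` with Bondi-Sachs coordinates `(u, r, x)`. -/
def point (u r : ℝ) (x : S2) : Fin 4 → ℝ := Fin.cons u (fun i : Fin 3 => r * x.1 i)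

/-- The spatial part `y` of a point `(u, y)`. -/
def spatial (p : Fin 4 → ℝ) : E3 := WithLp.toLp 2 (fun i : Fin 3 => p i.succ)

/-- The components of the metric at `(u, y)`, `y = r x ≠ 0`, in the coordinates `(u, y)` of
`ℝ × ℝ³`; here `dr = x · dy` and `dx = r⁻¹ (dy - x dr)`. -/
def metric (G : BondiSachsMetric) (p : Fin 4 → ℝ) : Matrix (Fin 4) (Fin 4) ℝ :=
  let u : ℝ := p 0
  let r : ℝ := ‖spatial p‖
  let x : S2 := dir (spatial p)
  let du : Fin 4 → ℝ := Fin.cons 1 (fun _ : Fin 3 => 0)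
  let dr : Fin 4 → ℝ := Fin.cons 0 (fun j : Fin 3 => x.1 j)
  let dx : Fin 3 → Fin 4 → ℝ := fun i => Fin.cons 0 (fun j : Fin 3 => r⁻¹ * roundMetric x i j)
  Matrix.of fun a b =>
    -(G.U u r⁻¹ x * G.V u r⁻¹ x) * du a * du b
    - G.U u r⁻¹ x * (du a * dr b + dr a * du b)
    + r ^ 2 * ∑ i, ∑ j, G.h u r⁻¹ x i j *
      (dx i a + G.W u r⁻¹ x i * du a) * (dx j b + G.W u r⁻¹ x j * du b)

/-- The null vector `L = ∂_r`. -/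
def nullL (x : S2) : Fin 4 → ℝ := Fin.cons 0 (fun i : Fin 3 => x.1 i)

/-- The null vector `L̲ = (2/U) (∂_u - W^D ∂_D - (V/2) ∂_r)`. -/
def nullLbar (G : BondiSachsMetric) (u r : ℝ) (x : S2) : Fin 4 → ℝ :=
  Fin.cons (2 / G.U u r⁻¹ x) (fun i : Fin 3 => 2 / G.U u r⁻¹ x *
    (-(r * G.W u r⁻¹ x i) - G.V u r⁻¹ x / 2 * x.1 i))

/-- The curvature component `ρ = 1/4 R(L̲, L, L̲, L)`. -/
def rho (G : BondiSachsMetric) (u r : ℝ) (x : S2) : ℝ :=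
  (1 / 4) * riemann G.metric (point u r x) (G.nullLbar u r x) (nullL x) (G.nullLbar u r x) (nullL x)

/-- `P = lim_{r → ∞} r³ ρ` is the rescaled curvature component at null infinity. -/
def HasRescaledRho (G : BondiSachsMetric) (P : ℝ → S2 → ℝ) : Prop :=
  ∀ u x, Tendsto (fun r : ℝ => r ^ 3 * G.rho u r x) atTop (𝓝 (P u x))

/-- The mass aspect, angular momentum aspect and shear of the metric are those of `D`, i.e. its
coefficients have the Bondi-Sachs expansions in `1/r` given by `D`. -/
structure HasNullInfinityData (G : BondiSachsMetric) (D : NullInfinityData) : Prop where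
  expand_U : ∀ u x, (fun r : ℝ => G.U u r⁻¹ x
      - (1 - contract (D.C u x) (D.C u x) / (16 * r ^ 2))) =O[atTop] fun r : ℝ => (r ^ 3)⁻¹
  expand_V : ∀ u x, (fun r : ℝ => G.V u r⁻¹ x
      - (1 - 2 * D.m u x / r + (r ^ 2)⁻¹ * ((1 / 3) * div1 (D.N u) x
        + (1 / 4) * ∑ b, div2 (D.C u) x b * div2 (D.C u) x b
        + (1 / 16) * contract (D.C u x) (D.C u x)))) =O[atTop] fun r : ℝ => (r ^ 3)⁻¹
  expand_W : ∀ u x a, (fun r : ℝ => G.W u r⁻¹ x a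
      - ((2 * r ^ 2)⁻¹ * div2 (D.C u) x a
        + (r ^ 3)⁻¹ * ((2 / 3) * D.N u x a
          - (1 / 16) * grad (fun z => contract (D.C u z) (D.C u z)) x a
          - (1 / 2) * ∑ b, D.C u x a b * div2 (D.C u) x b))) =O[atTop] fun r : ℝ => (r ^ 4)⁻¹
  expand_h : ∀ u x i j, (fun r : ℝ => G.h u r⁻¹ x i j
      - (roundMetric x i j + D.C u x i j / r
        + contract (D.C u x) (D.C u x) / (4 * r ^ 2) * roundMetric x i j))
        =O[atTop] fun r : ℝ => (r ^ 3)⁻¹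

end BondiSachsMetric

end

noncomputable section

/-! ### Calculus of functions on the sphere -/

/-! Everything rests on one formula for the flux. Differentiating the angular momentum and
integrating by parts over the sphere gives `∂_u J = -1/4 ∫ N^{AB} (L_Y C)_{AB}`: gradients and the
curl term integrate to zero against the Killing field `Y`, and the quadratic terms combine by an
identity special to symmetric traceless tensors in two dimensions (`traceless_derivative_identity`,
`sphereIntegral_angular_rate`).

Under `u = ū + f` the news is merely shifted. The Lie derivative of the shear acquires `N · Y f`
from the chain rule and `-2 Hess (Y f)` from the static terms, because a rotation is an isometry and
commutes with the Hessian; pure trace terms are invisible to `N`. The new flux density is therefore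
a fixed density `fluxDensity` evaluated at `(ū + f, x)`. The news is integrable in time, so Fubini
and translation invariance in `u` remove the shift. After two integrations by parts the extra terms
are `2 Y f (-1/8 |N|² + 1/4 ∇∇N)`, that is, `2 Y f ∂_u m`. Integration in `u` gives `2 ∫ (Y f) h`
with `h = m(+) - m(-)`, and antisymmetry of `Y` gives the stated formula (`IsVacuum.flux_sub`,
`IsVacuum.exists_flux`).

Invariance under modes `ℓ ≥ 2` says that each `Y_k h` is orthogonal to all of them. The projection
to `ℓ ≤ 1` is self-adjoint, so each `Y_k h` is a combination of `1` and the coordinates. Rotational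
derivatives determine the gradient, hence `h`, a priori only `C¹`, is smooth; and `Δ h = ∑ Y_k Y_k
h` is then a dipole, so `h` minus a dipole is harmonic, i.e. constant (`supportedLeOne_of_forall`).
Conversely rotations commute with `Δ` and preserve each mode. For translations, `Y` maps coordinates
to coordinates, which turns the formula into the change of linear momentum.

For the curvature statement, `L̲` and `L` are frozen to constant vectors at the point considered.
Then `R(L̲, L, L̲, L)` consists of second derivatives of metric components and of products of
Christoffel symbols. Orders of decay show that the products are `O(r⁻⁴)`, so only `∂_r² V` and `L̲
∂_r U` matter at order `r⁻³`. The result is `P = -2 m - 1/4 C_{AB} N^{AB}` (`tendsto_rho`). The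
shear is bounded and the news decays, hence `P(±) = -2 m(±)`, and the modes of `P` and of `m` are
the same question.

On the technical side, functions on the sphere are studied through their extensions constant along
rays, with Cartesian components; rotations give integration by parts without charts. -/

theorem coe_dir {y : E3} (h : y ≠ 0) : (dir y).1 = ‖y‖⁻¹ • y := by
  simp [dir, h]

theorem S2.norm_coe (x : S2) : ‖x.1‖ = 1 := by
  simp

theorem S2.coe_ne_zero (x : S2) : x.1 ≠ 0 := by
  intro h
  have := S2.norm_coe x
  rw [h] at this
  simp at this

@[simp] theorem dir_coe (x : S2) : dir x.1 = x := by
  apply Subtype.ext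
  rw [coe_dir (S2.coe_ne_zero x), S2.norm_coe]
  simp

theorem dir_smul {c : ℝ} (hc : 0 < c) (y : E3) : dir (c • y) = dir y := by
  by_cases h : y = 0
  · simp [h]
  · have h' : c • y ≠ 0 := smul_ne_zero hc.ne' h
    apply Subtype.ext
    rw [coe_dir h, coe_dir h', norm_smul, Real.norm_of_nonneg hc.le, smul_smul]
    congr 1
    field_simp

theorem contDiffAt_dir {n : WithTop ℕ∞} {y : E3} (h : y ≠ 0) :
    ContDiffAt ℝ n (fun z => (dir z).1) y := by
  have : (fun z : E3 => (dir z).1) =ᶠ[𝓝 y] fun z => ‖z‖⁻¹ • z := by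
    filter_upwards [isOpen_ne.mem_nhds h] with z hz
    exact coe_dir hz
  refine ContDiffAt.congr_of_eventuallyEq ?_ this
  exact ((contDiffAt_norm ℝ h).inv (norm_ne_zero_iff.mpr h)).smul contDiffAt_id

@[simp] theorem radialExt_coe {F : Type*} (f : S2 → F) (x : S2) : radialExt f x.1 = f x := by
  simp [radialExt]

theorem radialExt_eq_comp {F : Type*} (f : S2 → F) :
    radialExt f = radialExt f ∘ fun z => (dir z).1 := by
  funext y; simp [radialExt]

theorem isOpen_ne_zero : IsOpen {y : E3 | y ≠ 0} := isOpen_ne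

theorem isOpen_cyl : IsOpen {p : ℝ × E3 | p.2 ≠ 0} := isOpen_ne_zero.preimage continuous_snd

theorem SphereContDiff.contDiffAt {n : WithTop ℕ∞} {f : S2 → ℝ} (hf : SphereContDiff n f) {y : E3}
    (hy : y ≠ 0) : ContDiffAt ℝ n (radialExt f) y :=
  ContDiffOn.contDiffAt hf (isOpen_ne_zero.mem_nhds hy)

/-- The extension is unchanged by precomposition with the direction map, which is smooth off the
origin; this carries regularity from the unit sphere to every ray. -/
theorem SphereContDiff.of_contDiffAt {n : WithTop ℕ∞} {f : S2 → ℝ}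
    (hf : ∀ x : S2, ContDiffAt ℝ n (radialExt f) x.1) : SphereContDiff n f := by
  intro y hy
  rw [radialExt_eq_comp]
  exact ((hf (dir y)).comp y (contDiffAt_dir hy)).contDiffWithinAt

theorem SphereContDiff.differentiableAt {n : WithTop ℕ∞} {f : S2 → ℝ} (hf : SphereContDiff n f)
    (hn : n ≠ 0) (x : S2) : DifferentiableAt ℝ (radialExt f) x.1 :=
  (hf.contDiffAt (S2.coe_ne_zero x)).differentiableAt hn

theorem SphereContDiff.of_le {n m : WithTop ℕ∞} {f : S2 → ℝ} (hf : SphereContDiff n f)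
    (h : m ≤ n) : SphereContDiff m f := ContDiffOn.of_le hf h

theorem SphereContDiff.continuous {n : WithTop ℕ∞} {f : S2 → ℝ} (hf : SphereContDiff n f) :
    Continuous f := by
  have : f = fun x : S2 => radialExt f x.1 := by funext x; simp
  rw [this, continuous_iff_continuousAt]
  intro x
  exact (hf.contDiffAt (S2.coe_ne_zero x)).continuousAt.comp continuous_subtype_val.continuousAt

attribute [fun_prop] SphereContDiff

section SphereRules
variable {n : WithTop ℕ∞} {f g : S2 → ℝ}

@[fun_prop] theorem SphereContDiff.const (c : ℝ) : SphereContDiff n (fun _ => c) :=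
  contDiffOn_const

@[fun_prop] theorem SphereContDiff.add (hf : SphereContDiff n f) (hg : SphereContDiff n g) :
    SphereContDiff n (fun x => f x + g x) := ContDiffOn.add hf hg

@[fun_prop] theorem SphereContDiff.sub (hf : SphereContDiff n f) (hg : SphereContDiff n g) :
    SphereContDiff n (fun x => f x - g x) := ContDiffOn.sub hf hg

@[fun_prop] theorem SphereContDiff.mul (hf : SphereContDiff n f) (hg : SphereContDiff n g) :
    SphereContDiff n (fun x => f x * g x) := ContDiffOn.mul hf hg

@[fun_prop] theorem SphereContDiff.neg (hf : SphereContDiff n f) :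
    SphereContDiff n (fun x => - f x) := ContDiffOn.neg hf

@[fun_prop] theorem SphereContDiff.sum {ι : Type*} {s : Finset ι} {f : ι → S2 → ℝ}
    (hf : ∀ i ∈ s, SphereContDiff n (f i)) :
    SphereContDiff n (fun x => ∑ i ∈ s, f i x) := ContDiffOn.sum hf

@[fun_prop] theorem SphereContDiff.coord (i : Fin 3) :
    SphereContDiff n (fun x : S2 => x.1 i) := by
  intro y hy
  exact ((EuclideanSpace.proj (𝕜 := ℝ) i).contDiff.contDiffAt.comp y
    (contDiffAt_dir hy)).contDiffWithinAt

@[fun_prop] theorem SphereContDiff.coordFn (i : Fin 3) : SphereContDiff n (coordFn i) :=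
  SphereContDiff.coord i

@[fun_prop] theorem SphereContDiff.roundMetric (i j : Fin 3) :
    SphereContDiff n (fun x => roundMetric x i j) := by
  unfold _root_.roundMetric; fun_prop

/-- The gradient is a function on the sphere again: its extension reads the Euclidean derivative at
`dir y`, not at `y`. Composition with the direction map therefore costs just the one derivative. -/
theorem SphereContDiff.grad_of_le {m : WithTop ℕ∞} (hf : SphereContDiff n f) (h : m + 1 ≤ n)
    (i : Fin 3) : SphereContDiff m (fun x => grad f x i) := by
  refine .of_contDiffAt fun x => ?_
  have h1 : ContDiffAt ℝ m (fderiv ℝ (radialExt f)) (dir x.1).1 :=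
    (hf.contDiffAt (S2.coe_ne_zero _)).fderiv_right h
  exact (h1.comp x.1 (contDiffAt_dir (S2.coe_ne_zero x))).clm_apply contDiffAt_const

@[fun_prop] theorem SphereContDiff.grad (hf : SphereContDiff ∞ f) (i : Fin 3) :
    SphereContDiff ∞ (fun x => grad f x i) := hf.grad_of_le (by simp) i

end SphereRules

/-! ### Leibniz rules and the derivative of the direction map -/

section GradRules
variable {f g : S2 → ℝ} {x : S2}

abbrev SDiffAt (f : S2 → ℝ) (x : S2) : Prop := DifferentiableAt ℝ (radialExt f) x.1

theorem grad_const (c : ℝ) (i : Fin 3) : grad (fun _ => c) x i = 0 := by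
  have : radialExt (fun _ : S2 => c) = fun _ => c := rfl
  simp [grad, this]

theorem grad_add' (hf : SDiffAt f x) (hg : SDiffAt g x) (i : Fin 3) :
    grad (fun z => f z + g z) x i = grad f x i + grad g x i := by
  have : radialExt (fun z => f z + g z) = radialExt f + radialExt g := rfl
  simp [grad, this, fderiv_add hf hg]

theorem grad_sub' (hf : SDiffAt f x) (hg : SDiffAt g x) (i : Fin 3) :
    grad (fun z => f z - g z) x i = grad f x i - grad g x i := by
  have : radialExt (fun z => f z - g z) = radialExt f - radialExt g := rfl
  simp [grad, this, fderiv_sub hf hg]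

theorem grad_neg (i : Fin 3) : grad (fun z => - f z) x i = - grad f x i := by
  have : radialExt (fun z => - f z) = - radialExt f := rfl
  simp [grad, this, fderiv_neg]

theorem grad_mul' (hf : SDiffAt f x) (hg : SDiffAt g x) (i : Fin 3) :
    grad (fun z => f z * g z) x i = f x * grad g x i + grad f x i * g x := by
  have : radialExt (fun z => f z * g z) = radialExt f * radialExt g := rfl
  simp [grad, this, fderiv_mul hf hg]
  ring

theorem grad_const_mul (c : ℝ) (i : Fin 3) :
    grad (fun z => c * f z) x i = c * grad f x i := by
  have : radialExt (fun z => c * f z) = c • radialExt f := rfl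
  simp [grad, this, fderiv_const_smul_field]

theorem grad_sum' {ι : Type*} {s : Finset ι} {f : ι → S2 → ℝ}
    (hf : ∀ i ∈ s, SDiffAt (f i) x) (k : Fin 3) :
    grad (fun z => ∑ i ∈ s, f i z) x k = ∑ i ∈ s, grad (f i) x k := by
  have : radialExt (fun z => ∑ i ∈ s, f i z) = fun y => ∑ i ∈ s, radialExt (f i) y := rfl
  simp [grad, this, fderiv_fun_sum hf]

theorem hasFDerivAt_norm_coe (x : S2) :
    HasFDerivAt (fun z : E3 => ‖z‖) (innerSL ℝ x.1) x.1 := by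
  have h1 : HasFDerivAt (fun z : E3 => ‖z‖ ^ 2) (2 • innerSL ℝ x.1) x.1 :=
    (hasStrictFDerivAt_norm_sq x.1).hasFDerivAt
  have h2 := h1.sqrt (by simp)
  simp only [Real.sqrt_sq (norm_nonneg _)] at h2
  refine h2.congr_fderiv ?_
  ext v
  simp

/-- At a unit vector the norm has derivative `⟨x, ·⟩`, so normalization removes exactly the radial
part: the derivative is the projection to the tangent plane. -/
theorem hasFDerivAt_dir (x : S2) :
    HasFDerivAt (fun z => (dir z).1)
      (ContinuousLinearMap.id ℝ E3 - (innerSL ℝ x.1).smulRight x.1) x.1 := by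
  have hx := S2.coe_ne_zero x
  have : (fun z : E3 => (dir z).1) =ᶠ[𝓝 x.1] fun z => ‖z‖⁻¹ • z := by
    filter_upwards [isOpen_ne.mem_nhds hx] with z hz
    exact coe_dir hz
  refine HasFDerivAt.congr_of_eventuallyEq ?_ this
  have h2 := hasFDerivAt_norm_coe x
  have h3 := (((hasDerivAt_inv (x := ‖x.1‖) (by simp)).comp_hasFDerivAt x.1 h2)).smul
    (hasFDerivAt_id x.1)
  refine h3.congr_fderiv ?_
  ext v
  simp
  ring

theorem fderiv_radialExt (f : S2 → ℝ) (x : S2) (v : E3) :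
    fderiv ℝ (radialExt f) x.1 v = ∑ i, grad f x i * v i := by
  have : v = ∑ i, v i • EuclideanSpace.single i (1 : ℝ) := by
    ext j; simp [Finset.sum_apply, Pi.single_apply]
  conv_lhs => rw [this]
  simp [grad, mul_comm]

theorem S2.sum_sq (x : S2) : ∑ i, x.1 i * x.1 i = 1 := by
  have := S2.norm_coe x
  rw [EuclideanSpace.norm_eq, Real.sqrt_eq_one] at this
  simpa [sq] using this

theorem fderiv_radialExt_self (f : S2 → ℝ) (x : S2) : fderiv ℝ (radialExt f) x.1 x.1 = 0 := by
  by_cases hf : SDiffAt f x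
  · have h1 : HasFDerivAt (radialExt f) (fderiv ℝ (radialExt f) (dir x.1).1) (dir x.1).1 := by
      simpa using hf.hasFDerivAt
    have h2 := h1.comp x.1 (hasFDerivAt_dir x)
    rw [← radialExt_eq_comp] at h2
    have h3 := h2.fderiv
    have h4 := congrArg (fun L => L x.1) h3
    simpa using h4
  -- Without differentiability `fderiv` is zero by convention, so tangentiality of `grad` needs no
  -- regularity of `f`.
  · rw [fderiv_zero_of_not_differentiableAt hf]; simp

theorem sum_coord_mul_grad (f : S2 → ℝ) (x : S2) : ∑ i, x.1 i * grad f x i = 0 := by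
  rw [← fderiv_radialExt_self f x, fderiv_radialExt f]
  simp [mul_comm]

theorem grad_coord (i j : Fin 3) : grad (fun z : S2 => z.1 j) x i = roundMetric x i j := by
  have : radialExt (fun z : S2 => z.1 j)
    = (EuclideanSpace.proj (𝕜 := ℝ) j) ∘ fun z : E3 => (dir z).1 := rfl
  rw [grad, this, ((EuclideanSpace.proj (𝕜 := ℝ) j).hasFDerivAt.comp x.1 (hasFDerivAt_dir x)).fderiv]
  simp [roundMetric, kron, EuclideanSpace.inner_single_right, eq_comm]

theorem grad_coordFn (i j : Fin 3) : grad (coordFn j) x i = roundMetric x i j := grad_coord i j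

end GradRules

/-! ### Derivatives off the unit sphere and second derivatives -/

section GradSmooth
variable {f g : S2 → ℝ} {x : S2}

theorem SphereContDiff.sdiffAt (hf : SphereContDiff ∞ f) (x : S2) : SDiffAt f x :=
  hf.differentiableAt (by simp) x

theorem grad_add (hf : SphereContDiff ∞ f) (hg : SphereContDiff ∞ g) (i : Fin 3) :
    grad (fun z => f z + g z) x i = grad f x i + grad g x i :=
  grad_add' (hf.sdiffAt x) (hg.sdiffAt x) i

theorem grad_sub (hf : SphereContDiff ∞ f) (hg : SphereContDiff ∞ g) (i : Fin 3) :
    grad (fun z => f z - g z) x i = grad f x i - grad g x i :=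
  grad_sub' (hf.sdiffAt x) (hg.sdiffAt x) i

theorem grad_mul (hf : SphereContDiff ∞ f) (hg : SphereContDiff ∞ g) (i : Fin 3) :
    grad (fun z => f z * g z) x i = f x * grad g x i + grad f x i * g x :=
  grad_mul' (hf.sdiffAt x) (hg.sdiffAt x) i

theorem grad_sum {ι : Type*} {s : Finset ι} {f : ι → S2 → ℝ}
    (hf : ∀ i, SphereContDiff ∞ (f i)) (k : Fin 3) :
    grad (fun z => ∑ i ∈ s, f i z) x k = ∑ i ∈ s, grad (f i) x k :=
  grad_sum' (fun i _ => (hf i).sdiffAt x) k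

/-- A function homogeneous of degree 0 has a derivative homogeneous of degree -1. -/
theorem fderiv_radialExt_of_ne_zero {f : S2 → ℝ} {y : E3} (hy : y ≠ 0)
    (hf : SDiffAt f (dir y)) (v : E3) :
    fderiv ℝ (radialExt f) y v = ‖y‖⁻¹ * fderiv ℝ (radialExt f) (dir y).1 v := by
  have hn : 0 < ‖y‖⁻¹ := inv_pos.mpr (norm_pos_iff.mpr hy)
  have h0 : radialExt f = radialExt f ∘ fun z => ‖y‖⁻¹ • z := by
    funext z; simp [radialExt, dir_smul hn]
  have h1 : HasFDerivAt (fun z : E3 => ‖y‖⁻¹ • z) (‖y‖⁻¹ • ContinuousLinearMap.id ℝ E3) y :=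
    (‖y‖⁻¹ • ContinuousLinearMap.id ℝ E3).hasFDerivAt
  have h2 : HasFDerivAt (radialExt f) (fderiv ℝ (radialExt f) (dir y).1)
      ((fun z : E3 => ‖y‖⁻¹ • z) y) := by
    show HasFDerivAt _ _ (‖y‖⁻¹ • y)
    rw [← coe_dir hy]
    exact hf.hasFDerivAt
  have h3 := (h2.comp y h1).fderiv
  rw [← h0] at h3
  rw [h3]
  simp

theorem grad_dir {f : S2 → ℝ} {y : E3} (hy : y ≠ 0) (hf : SDiffAt f (dir y)) (i : Fin 3) :
    grad f (dir y) i = ‖y‖ * fderiv ℝ (radialExt f) y (EuclideanSpace.single i 1) := by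
  rw [fderiv_radialExt_of_ne_zero hy hf, grad]
  field_simp [norm_ne_zero_iff.mpr hy]

theorem two_le_smooth : (2 : WithTop ℕ∞) ≤ ∞ := by
  show ((2 : ℕ∞) : WithTop ℕ∞) ≤ ((⊤ : ℕ∞) : WithTop ℕ∞)
  exact WithTop.coe_le_coe.2 le_top

/-- Tangential Cartesian derivatives commute up to first order terms. -/
theorem grad_grad_comm (hf : SphereContDiff ∞ f) (x : S2) (i j : Fin 3) :
    grad (fun z => grad f z j) x i = grad (fun z => grad f z i) x j
      + x.1 i * grad f x j - x.1 j * grad f x i := by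
  have hx := S2.coe_ne_zero x
  have hF : ContDiffAt ℝ ∞ (radialExt f) x.1 := hf.contDiffAt hx
  -- Near the sphere the extension of `grad f` is `‖y‖` times the Euclidean derivative.
  -- Differentiating the factor `‖y‖` produces the first order term, and the rest is the Euclidean
  -- Hessian, whose symmetry yields the commutator.
  have key : ∀ a b : Fin 3, grad (fun z => grad f z a) x b
      = x.1 b * grad f x a + fderiv ℝ (fderiv ℝ (radialExt f)) x.1 (EuclideanSpace.single b 1)
        (EuclideanSpace.single a 1) := by
    intro a b
    have he : radialExt (fun z => grad f z a) =ᶠ[𝓝 x.1]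
        fun y => ‖y‖ * fderiv ℝ (radialExt f) y (EuclideanSpace.single a 1) := by
      filter_upwards [isOpen_ne.mem_nhds hx] with y hy
      exact grad_dir hy (hf.sdiffAt _) a
    have h2 := hasFDerivAt_norm_coe x
    have h3 : DifferentiableAt ℝ (fderiv ℝ (radialExt f)) x.1 :=
      (hF.fderiv_right (m := ∞) (by simp)).differentiableAt (by simp)
    have h4 := h2.mul (h3.hasFDerivAt.clm_apply
      (hasFDerivAt_const (EuclideanSpace.single a (1:ℝ)) x.1))
    rw [grad, he.fderiv_eq]
    erw [h4.fderiv]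
    simp [EuclideanSpace.inner_single_right, grad]
    ring
  have hs : IsSymmSndFDerivAt ℝ (radialExt f) x.1 := hF.isSymmSndFDerivAt (by simpa using two_le_smooth)
  rw [key j i, key i j, hs (EuclideanSpace.single i 1) (EuclideanSpace.single j 1)]
  ring

end GradSmooth

/-! ### Smooth functions on the cylinder -/

section Cylinder
variable {F G : ℝ → S2 → ℝ}

theorem CylinderSmooth.contDiffAt (hF : CylinderSmooth F) (u : ℝ) {y : E3} (hy : y ≠ 0) :
    ContDiffAt ℝ ∞ (fun p : ℝ × E3 => radialExt (F p.1) p.2) (u, y) :=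
  ContDiffOn.contDiffAt hF (isOpen_cyl.mem_nhds hy)

@[simp] theorem CylinderSmooth.add (hF : CylinderSmooth F) (hG : CylinderSmooth G) :
    CylinderSmooth (fun u x => F u x + G u x) := ContDiffOn.add hF hG

@[simp] theorem CylinderSmooth.sub (hF : CylinderSmooth F) (hG : CylinderSmooth G) :
    CylinderSmooth (fun u x => F u x - G u x) := ContDiffOn.sub hF hG

@[simp] theorem CylinderSmooth.mul (hF : CylinderSmooth F) (hG : CylinderSmooth G) :
    CylinderSmooth (fun u x => F u x * G u x) := ContDiffOn.mul hF hG

@[simp] theorem CylinderSmooth.sum {ι : Type*} {s : Finset ι} {F : ι → ℝ → S2 → ℝ}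
    (hF : ∀ i ∈ s, CylinderSmooth (F i)) :
    CylinderSmooth (fun u x => ∑ i ∈ s, F i u x) := ContDiffOn.sum hF

@[simp] theorem CylinderSmooth.static {f : S2 → ℝ} (hf : SphereContDiff ∞ f) :
    CylinderSmooth (fun _ x => f x) := by
  intro p hp
  exact ((hf.contDiffAt hp).comp p contDiffAt_snd).contDiffWithinAt

@[simp] theorem CylinderSmooth.const (c : ℝ) : CylinderSmooth (fun _ _ => c) :=
  CylinderSmooth.static (SphereContDiff.const c)

@[simp] theorem CylinderSmooth.slice (hF : CylinderSmooth F) (u : ℝ) :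
    SphereContDiff ∞ (F u) := by
  intro y hy
  exact ((hF.contDiffAt u hy).comp y
    (contDiffAt_const.prodMk contDiffAt_id)).contDiffWithinAt

theorem CylinderSmooth.continuous (hF : CylinderSmooth F) :
    Continuous (fun p : ℝ × S2 => F p.1 p.2) := by
  have : (fun p : ℝ × S2 => F p.1 p.2)
      = (fun p : ℝ × E3 => radialExt (F p.1) p.2) ∘ fun p : ℝ × S2 => (p.1, p.2.1) := by
    funext p; simp
  rw [this, continuous_iff_continuousAt]
  intro p
  have h1 : Continuous fun p : ℝ × S2 => (p.1, p.2.1) := by fun_prop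
  exact ContinuousAt.comp (hF.contDiffAt p.1 (S2.coe_ne_zero p.2)).continuousAt h1.continuousAt

theorem CylinderSmooth.hasDerivAt_fderiv (hF : CylinderSmooth F) (u : ℝ) {y : E3} (hy : y ≠ 0) :
    HasDerivAt (fun t => F t (dir y))
      (fderiv ℝ (fun p : ℝ × E3 => radialExt (F p.1) p.2) (u, y) (1, 0)) u := by
  have h1 := ((hF.contDiffAt u hy).differentiableAt (by simp)).hasFDerivAt
  have h2 : HasDerivAt (fun t : ℝ => (t, y)) ((1 : ℝ), (0 : E3)) u :=
    (hasDerivAt_id u).prodMk (hasDerivAt_const u y)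
  exact h1.comp_hasDerivAt u h2

theorem CylinderSmooth.hasDerivAt (hF : CylinderSmooth F) (u : ℝ) (x : S2) :
    HasDerivAt (fun t => F t x) (deriv (fun t => F t x) u) u := by
  have := hF.hasDerivAt_fderiv u (S2.coe_ne_zero x)
  rw [dir_coe] at this
  exact this.differentiableAt.hasDerivAt

@[simp] theorem CylinderSmooth.dt (hF : CylinderSmooth F) :
    CylinderSmooth (fun u x => deriv (fun t => F t x) u) := by
  intro p hp
  have h1 : ContDiffAt ℝ ∞ (fun q => fderiv ℝ (fun p : ℝ × E3 => radialExt (F p.1) p.2) q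
      ((1 : ℝ), (0 : E3))) p :=
    ((hF.contDiffAt p.1 hp).fderiv_right (m := ∞) (by simp)).clm_apply contDiffAt_const
  refine (h1.congr_of_eventuallyEq ?_).contDiffWithinAt
  filter_upwards [isOpen_cyl.mem_nhds hp] with q hq
  exact (hF.hasDerivAt_fderiv q.1 hq).deriv

theorem CylinderSmooth.fderiv_slice (hF : CylinderSmooth F) (u : ℝ) {y : E3} (hy : y ≠ 0)
    (v : E3) : fderiv ℝ (radialExt (F u)) y v
      = fderiv ℝ (fun p : ℝ × E3 => radialExt (F p.1) p.2) (u, y) (0, v) := by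
  have h1 := ((hF.contDiffAt u hy).differentiableAt (by simp)).hasFDerivAt
  have h2 : HasFDerivAt (fun z : E3 => (u, z)) (ContinuousLinearMap.inr ℝ ℝ E3) y :=
    hasFDerivAt_prodMk_right u y
  have h3 := (h1.comp y h2).fderiv
  have : ((fun p : ℝ × E3 => radialExt (F p.1) p.2) ∘ fun z : E3 => (u, z)) = radialExt (F u) := rfl
  rw [this] at h3
  rw [h3]; simp

@[simp] theorem CylinderSmooth.grad (hF : CylinderSmooth F) (i : Fin 3) :
    CylinderSmooth (fun u x => _root_.grad (F u) x i) := by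
  intro p hp
  have hd : ((dir p.2).1) ≠ 0 := S2.coe_ne_zero _
  have h0 : ContDiffAt ℝ ∞ (fun q : ℝ × E3 => (q.1, (dir q.2).1)) p :=
    contDiffAt_fst.prodMk ((contDiffAt_dir hp).comp p contDiffAt_snd)
  have h1 : ContDiffAt ℝ ∞ (fderiv ℝ (fun p : ℝ × E3 => radialExt (F p.1) p.2))
      (p.1, (dir p.2).1) :=
    ((hF.contDiffAt p.1 hd).fderiv_right (m := ∞) (by simp))
  have h2 := (h1.comp p h0).clm_apply
    (contDiffAt_const (c := ((0 : ℝ), (EuclideanSpace.single i (1:ℝ) : E3))))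
  refine (h2.congr_of_eventuallyEq ?_).contDiffWithinAt
  refine Eventually.of_forall fun q => ?_
  exact hF.fderiv_slice q.1 (S2.coe_ne_zero _) _

/-- The time derivative commutes with tangential derivatives. -/
theorem CylinderSmooth.hasDerivAt_grad (hF : CylinderSmooth F) (u : ℝ) (x : S2) (i : Fin 3) :
    HasDerivAt (fun t => _root_.grad (F t) x i) (_root_.grad (fun z => deriv (fun t => F t z) u) x i) u := by
  have hx := S2.coe_ne_zero x
  set Φ := fun p : ℝ × E3 => radialExt (F p.1) p.2 with hΦ
  have hc : ContDiffAt ℝ ∞ Φ (u, x.1) := hF.contDiffAt u hx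
  have h3 : DifferentiableAt ℝ (fderiv ℝ Φ) (u, x.1) :=
      (hc.fderiv_right (m := ∞) (by simp)).differentiableAt (by simp)
  set e : E3 := EuclideanSpace.single i 1
  have h4 : HasDerivAt (fun t => fderiv ℝ Φ (t, x.1) ((0 : ℝ), e))
      (fderiv ℝ (fderiv ℝ Φ) (u, x.1) (1, 0) (0, e)) u := by
    have h2 : HasDerivAt (fun t : ℝ => (t, x.1)) ((1 : ℝ), (0 : E3)) u :=
      (hasDerivAt_id u).prodMk (hasDerivAt_const u x.1)
    have h6 : HasDerivAt (fun t => fderiv ℝ Φ (t, x.1)) (fderiv ℝ (fderiv ℝ Φ) (u, x.1) (1, 0)) u :=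
      h3.hasFDerivAt.comp_hasDerivAt u h2
    exact (ContinuousLinearMap.apply ℝ ℝ ((0 : ℝ), e)).hasFDerivAt.comp_hasDerivAt u h6
  have h5 : _root_.grad (fun z => deriv (fun t => F t z) u) x i
      = fderiv ℝ (fderiv ℝ Φ) (u, x.1) (0, e) (1, 0) := by
    have he : radialExt (fun z => deriv (fun t => F t z) u) =ᶠ[𝓝 x.1]
        fun y => fderiv ℝ Φ (u, y) ((1 : ℝ), (0 : E3)) := by
      filter_upwards [isOpen_ne.mem_nhds hx] with y hy
      exact (hF.hasDerivAt_fderiv u hy).deriv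
    have h2 : HasFDerivAt (fun z : E3 => (u, z)) (ContinuousLinearMap.inr ℝ ℝ E3) x.1 :=
      hasFDerivAt_prodMk_right u x.1
    have h6 : HasFDerivAt (fun y : E3 => fderiv ℝ Φ (u, y))
        ((fderiv ℝ (fderiv ℝ Φ) (u, x.1)).comp (ContinuousLinearMap.inr ℝ ℝ E3)) x.1 :=
      HasFDerivAt.comp (f := fun y : E3 => (u, y)) x.1 h3.hasFDerivAt h2
    have h7 : HasFDerivAt (fun y : E3 => fderiv ℝ Φ (u, y) ((1 : ℝ), (0 : E3))) _ x.1 :=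
      (ContinuousLinearMap.apply ℝ ℝ ((1 : ℝ), (0 : E3))).hasFDerivAt.comp x.1 h6
    rw [_root_.grad, he.fderiv_eq, h7.fderiv]
    simp [e]
  -- Both sides are mixed second derivatives of one function on the product `ℝ × E3`, so symmetry of
  -- the second derivative finishes the proof.
  have hs : IsSymmSndFDerivAt ℝ Φ (u, x.1) := hc.isSymmSndFDerivAt (by simpa using two_le_smooth)
  rw [h5, hs]
  convert h4 using 1
  funext t
  exact hF.fderiv_slice t hx e

theorem CylinderSmooth.deriv_grad (hF : CylinderSmooth F) (u : ℝ) (x : S2) (i : Fin 3) :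
    deriv (fun t => _root_.grad (F t) x i) u
      = _root_.grad (fun z => deriv (fun t => F t z) u) x i :=
  (hF.hasDerivAt_grad u x i).deriv

theorem CylinderSmooth.shift (hF : CylinderSmooth F) {f : S2 → ℝ} (hf : SphereContDiff ∞ f) :
    CylinderSmooth (fun u x => F (u + f x) x) := by
  intro p hp
  have h0 : ContDiffAt ℝ ∞ (fun q : ℝ × E3 => (q.1 + radialExt f q.2, q.2)) p :=
    (contDiffAt_fst.add ((hf.contDiffAt hp).comp p contDiffAt_snd)).prodMk contDiffAt_snd
  exact ((hF.contDiffAt (p.1 + radialExt f p.2) hp).comp p h0).contDiffWithinAt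

/-- Chain rule for `x ↦ F (u + f x, x)`. -/
theorem CylinderSmooth.grad_shift (hF : CylinderSmooth F) {f : S2 → ℝ}
    (hf : SphereContDiff ∞ f) (u : ℝ) (x : S2) (i : Fin 3) :
    _root_.grad (fun z => F (u + f z) z) x i = _root_.grad (F (u + f x)) x i
      + deriv (fun t => F t x) (u + f x) * _root_.grad f x i := by
  have hx := S2.coe_ne_zero x
  set Φ := fun p : ℝ × E3 => radialExt (F p.1) p.2 with hΦ
  have h1 : HasFDerivAt Φ (fderiv ℝ Φ (u + f x, x.1)) (u + radialExt f x.1, x.1) := by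
    rw [radialExt_coe]
    exact ((hF.contDiffAt (u + f x) hx).differentiableAt (by simp)).hasFDerivAt
  have h2 : HasFDerivAt (fun y : E3 => (u + radialExt f y, y))
      ((fderiv ℝ (radialExt f) x.1).prod (ContinuousLinearMap.id ℝ E3)) x.1 :=
    ((hf.sdiffAt x).hasFDerivAt.const_add u).prodMk (hasFDerivAt_id x.1)
  have h3 := (HasFDerivAt.comp (f := fun y : E3 => (u + radialExt f y, y)) x.1 h1 h2).fderiv
  have h4 : (Φ ∘ fun y : E3 => (u + radialExt f y, y))
    = radialExt (fun z => F (u + f z) z) := rfl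
  rw [h4] at h3
  have h5 := (hF.hasDerivAt_fderiv (u + f x) hx).deriv
  rw [dir_coe] at h5
  rw [_root_.grad, h3, _root_.grad, hF.fderiv_slice _ hx, h5]
  simp only [ContinuousLinearMap.coe_comp, Function.comp_apply, ContinuousLinearMap.prod_apply,
    ContinuousLinearMap.coe_id', id]
  have h6 : ∀ (A : ℝ × E3 →L[ℝ] ℝ) (a : ℝ) (v : E3), A (a, v) = A (0, v) + A (1, 0) * a := by
    intro A a v
    rw [mul_comm, ← smul_eq_mul, ← map_smul, ← map_add]
    simp
  rw [h6, _root_.grad]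

end Cylinder
end

noncomputable section

/-! ### Primitives in retarded time -/

/-- The substitution `∫₀ᵘ F(t) dt = u ∫₀¹ F(u t) dt` moves `u` into the integrand. The integral over
`(0, 1]` is then the value at `0` of a convolution of an indicator function with a kernel depending
smoothly on the parameter `(u, y)`, and such convolutions are smooth in the parameter. -/
theorem CylinderSmooth.primitive {F : ℝ → S2 → ℝ} (hF : CylinderSmooth F) :
    CylinderSmooth (fun u x => ∫ t in (0 : ℝ)..u, F t x) := by
  -- The cutoff is `1` on `[-1, 1]`, where the kernel is evaluated, and vanishes outside `[-2, 2]`,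
  -- which gives the kernel the compact support that the convolution theorem asks for.
  let χ : ContDiffBump (0 : ℝ) := ⟨1, 2, by norm_num, by norm_num⟩
  let Φ := fun p : ℝ × E3 => radialExt (F p.1) p.2
  let g : ℝ × E3 → ℝ → ℝ := fun p t => χ t * (p.1 * Φ (-(p.1 * t), p.2))
  let f : ℝ → ℝ := (Set.Ioc (0 : ℝ) 1).indicator fun _ => 1
  have hf : LocallyIntegrable f volume := by
    apply Integrable.locallyIntegrable
    exact (integrable_indicator_iff measurableSet_Ioc).2 (by simp)
  have hg : ContDiffOn ℝ ∞ (↿g) ({p : ℝ × E3 | p.2 ≠ 0} ×ˢ Set.univ) := by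
    intro q hq
    have hq' : q.1.2 ≠ 0 := hq.1
    have h1 : ContDiffAt ℝ ∞ (fun q : (ℝ × E3) × ℝ => (-(q.1.1 * q.2), q.1.2)) q := by fun_prop
    have h2 : ContDiffAt ℝ ∞ (fun q : (ℝ × E3) × ℝ => Φ (-(q.1.1 * q.2), q.1.2)) q :=
      ContDiffAt.comp (g := Φ) q (hF.contDiffAt (-(q.1.1 * q.2)) hq') h1
    have h3 : ContDiffAt ℝ ∞ (fun q : (ℝ × E3) × ℝ => χ q.2) q :=
      χ.contDiff.contDiffAt.comp q contDiffAt_snd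
    have h4 : ContDiffAt ℝ ∞ (fun q : (ℝ × E3) × ℝ => q.1.1) q := by fun_prop
    exact (h3.mul (h4.mul h2)).contDiffWithinAt
  have hk : ∀ p : ℝ × E3, ∀ t : ℝ, p ∈ {p : ℝ × E3 | p.2 ≠ 0} →
      t ∉ Metric.closedBall (0 : ℝ) 2 → g p t = 0 := by
    intro p t _ ht
    have : χ t = 0 := χ.zero_of_le_dist (by
      simp only [Metric.mem_closedBall, not_le] at ht
      exact ht.le)
    simp [g, this]
  have key := contDiffOn_convolution_right_with_param_comp (n := ⊤) (ContinuousLinearMap.mul ℝ ℝ)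
    (v := fun _ => (0 : ℝ)) contDiffOn_const (μ := volume) (f := f) isOpen_cyl
    (isCompact_closedBall (0 : ℝ) 2) hk hf hg
  refine key.congr ?_
  intro p _
  rw [convolution_def]
  have h1 : ∀ t : ℝ, (ContinuousLinearMap.mul ℝ ℝ) (f t) (g p (0 - t))
      = (Set.Ioc (0 : ℝ) 1).indicator (fun t => p.1 * Φ (p.1 * t, p.2)) t := by
    intro t
    by_cases ht : t ∈ Set.Ioc (0 : ℝ) 1
    · have : χ (-t) = 1 := χ.one_of_mem_closedBall (by
        simp [χ, abs_of_pos ht.1, ht.2])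
      simp [f, g, ht, this]
    · simp [f, ht]
  simp_rw [h1]
  rw [integral_indicator measurableSet_Ioc, ← intervalIntegral.integral_of_le zero_le_one,
    intervalIntegral.integral_const_mul]
  have h2 := intervalIntegral.smul_integral_comp_mul_left (a := 0) (b := 1)
    (fun t => Φ (t, p.2)) p.1
  simp only [smul_eq_mul, mul_zero, mul_one] at h2
  rw [h2]
  rfl

theorem CylinderSmooth.continuous_left {F : ℝ → S2 → ℝ} (hF : CylinderSmooth F) (x : S2) :
    Continuous (fun u => F u x) :=
  hF.continuous.comp (continuous_id.prodMk continuous_const)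

theorem CylinderSmooth.hasDerivAt_primitive {F : ℝ → S2 → ℝ} (hF : CylinderSmooth F) (u : ℝ)
    (x : S2) : HasDerivAt (fun u => ∫ t in (0 : ℝ)..u, F t x) (F u x) u :=
  intervalIntegral.integral_hasDerivAt_right ((hF.continuous_left x).intervalIntegrable _ _)
    (hF.continuous_left x).stronglyMeasurable.stronglyMeasurableAtFilter
    (hF.continuous_left x).continuousAt

/-! ### Integration over the sphere -/

theorem integrable_sphere {f : S2 → ℝ} (hf : Continuous f) :
    Integrable f (volume : Measure E3).toSphere :=
  hf.integrable_of_hasCompactSupport (HasCompactSupport.of_compactSpace f)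

theorem sphereIntegral_add {f g : S2 → ℝ} (hf : Continuous f) (hg : Continuous g) :
    sphereIntegral (fun x => f x + g x) = sphereIntegral f + sphereIntegral g :=
  integral_add (integrable_sphere hf) (integrable_sphere hg)

theorem sphereIntegral_sub {f g : S2 → ℝ} (hf : Continuous f) (hg : Continuous g) :
    sphereIntegral (fun x => f x - g x) = sphereIntegral f - sphereIntegral g :=
  integral_sub (integrable_sphere hf) (integrable_sphere hg)

theorem sphereIntegral_const_mul (c : ℝ) (f : S2 → ℝ) :
    sphereIntegral (fun x => c * f x) = c * sphereIntegral f :=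
  integral_const_mul c f

theorem sphereIntegral_neg (f : S2 → ℝ) :
    sphereIntegral (fun x => - f x) = - sphereIntegral f := integral_neg f

theorem sphereIntegral_sum {ι : Type*} {s : Finset ι} {f : ι → S2 → ℝ}
    (hf : ∀ i ∈ s, Continuous (f i)) :
    sphereIntegral (fun x => ∑ i ∈ s, f i x) = ∑ i ∈ s, sphereIntegral (f i) :=
  integral_finsetSum s fun i hi => integrable_sphere (hf i hi)

/-- Surface area of the sphere. -/
def sphereArea : ℝ := ((volume : Measure E3).toSphere).real Set.univ

theorem sphereIntegral_const (c : ℝ) : sphereIntegral (fun _ => c) = sphereArea * c := by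
  simp [sphereIntegral, sphereArea]

theorem sphereArea_pos : 0 < sphereArea := by
  rw [sphereArea, measureReal_def, ENNReal.toReal_pos_iff]
  refine ⟨?_, measure_lt_top _ _⟩
  exact IsOpen.measure_pos _ isOpen_univ ⟨dir 0, trivial⟩

theorem abs_sphereIntegral_le {f : S2 → ℝ} {K : ℝ} (hK : ∀ x, |f x| ≤ K) :
    |sphereIntegral f| ≤ sphereArea * K := by
  have := norm_integral_le_of_norm_le_const (μ := (volume : Measure E3).toSphere) (f := f) (C := K)
    (Eventually.of_forall hK)
  rw [mul_comm]
  exact this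

/-- Compactness of `[t - 1, t + 1] × S²` supplies a constant dominating function. -/
theorem hasDerivAt_sphereIntegral {F F' : ℝ → S2 → ℝ} (hF : ∀ t, Continuous (F t))
    (hF' : Continuous fun p : ℝ × S2 => F' p.1 p.2)
    (h : ∀ t x, HasDerivAt (fun t => F t x) (F' t x) t) (t : ℝ) :
    HasDerivAt (fun t => sphereIntegral (F t)) (sphereIntegral (F' t)) t := by
  obtain ⟨K, hK⟩ := (((isCompact_Icc (a := t - 1) (b := t + 1)).prod
    (isCompact_univ (X := S2))).exists_bound_of_continuousOn hF'.continuousOn)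
  refine (hasDerivAt_integral_of_dominated_loc_of_deriv_le (s := Set.Icc (t - 1) (t + 1))
    (bound := fun _ => K) (Icc_mem_nhds (by linarith) (by linarith))
    (Eventually.of_forall fun t => (hF t).aestronglyMeasurable) (integrable_sphere (hF t))
    (Continuous.aestronglyMeasurable (hF'.comp (continuous_const.prodMk continuous_id)))
    (Eventually.of_forall fun x s hs => hK (s, x) ⟨hs, trivial⟩) (integrable_const K)
    (Eventually.of_forall fun x s _ => h s x)).2

theorem CylinderSmooth.hasDerivAt_sphereIntegral {F : ℝ → S2 → ℝ} (hF : CylinderSmooth F)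
    (u : ℝ) : HasDerivAt (fun u => sphereIntegral (F u))
      (sphereIntegral (fun x => deriv (fun t => F t x) u)) u :=
  _root_.hasDerivAt_sphereIntegral (fun t => (hF.slice t).continuous) hF.dt.continuous
    hF.hasDerivAt u

/-! ### Rotations -/

/-- The action of a linear isometry on the sphere. -/
def sphereMap (R : E3 ≃ₗᵢ[ℝ] E3) (x : S2) : S2 := ⟨R x.1, by simp⟩

theorem continuous_sphereMap (R : E3 ≃ₗᵢ[ℝ] E3) : Continuous (sphereMap R) :=
  (R.continuous.comp continuous_subtype_val).subtype_mk _

/-- The surface measure of a set is defined through the Lebesgue measure of the cone over it, and a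
linear isometry maps cones to cones and preserves Lebesgue measure. -/
theorem map_sphereMap (R : E3 ≃ₗᵢ[ℝ] E3) :
    ((volume : Measure E3).toSphere).map (sphereMap R) = (volume : Measure E3).toSphere := by
  ext s hs
  have hm := (continuous_sphereMap R).measurable
  rw [Measure.map_apply hm hs, Measure.toSphere_apply' _ (hm hs), Measure.toSphere_apply' _ hs]
  congr 1
  refine Eq.trans ?_ (R.measurePreserving.measure_preimage_equiv (f := R.toMeasurableEquiv) _)
  congr 1
  show _ = R ⁻¹' _
  ext y
  simp only [Set.mem_smul, Set.mem_image, Set.mem_preimage]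
  constructor
  · rintro ⟨a, ha, _, ⟨x, hx, rfl⟩, rfl⟩
    exact ⟨a, ha, R x.1, ⟨_, hx, rfl⟩, (map_smul R a x.1).symm⟩
  · rintro ⟨a, ha, _, ⟨x, hx, rfl⟩, h⟩
    refine ⟨a, ha, R.symm x.1, ⟨⟨R.symm x.1, by simp⟩, ?_, rfl⟩, ?_⟩
    · convert hx
      apply Subtype.ext
      simp [sphereMap]
    · apply R.injective
      rw [map_smul, R.apply_symm_apply]
      exact h

theorem sphereIntegral_comp_sphereMap (R : E3 ≃ₗᵢ[ℝ] E3) {f : S2 → ℝ} (hf : Continuous f) :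
    sphereIntegral (fun x => f (sphereMap R x)) = sphereIntegral f := by
  unfold sphereIntegral
  conv_rhs => rw [← map_sphereMap R]
  rw [integral_map (continuous_sphereMap R).aemeasurable hf.aestronglyMeasurable]

/-- The infinitesimal rotation `y ↦ e_k × y`. -/
def crossE (k : Fin 3) : E3 →ₗ[ℝ] E3 where
  toFun y := WithLp.toLp 2 fun a => ∑ c, eps3 a k c * y c
  map_add' y z := by ext a; simp [mul_add, Finset.sum_add_distrib]
  map_smul' c y := by
    ext a
    simp only [PiLp.smul_apply, smul_eq_mul, Finset.mul_sum, RingHom.id_apply]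
    exact Finset.sum_congr rfl fun _ _ => by ring

theorem crossE_apply (k : Fin 3) (y : E3) (a : Fin 3) :
    crossE k y a = ∑ c, eps3 a k c * y c := rfl

/-- Rotation by the angle `t` about the axis `e_k`. -/
def rotLin (k : Fin 3) (t : ℝ) : E3 →ₗ[ℝ] E3 :=
  Real.cos t • LinearMap.id + Real.sin t • crossE k
    + (1 - Real.cos t) • ((EuclideanSpace.proj (𝕜 := ℝ) k).toLinearMap.smulRight
      (EuclideanSpace.single k (1 : ℝ)))

theorem rotLin_apply (k : Fin 3) (t : ℝ) (y : E3) :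
    rotLin k t y = Real.cos t • y + Real.sin t • crossE k y
      + (1 - Real.cos t) • (y k • EuclideanSpace.single k (1 : ℝ)) := rfl

theorem norm_rotLin (k : Fin 3) (t : ℝ) (y : E3) : ‖rotLin k t y‖ = ‖y‖ := by
  rw [← sq_eq_sq₀ (norm_nonneg _) (norm_nonneg _), EuclideanSpace.norm_sq_eq,
    EuclideanSpace.norm_sq_eq, rotLin_apply]
  have := Real.sin_sq_add_cos_sq t
  fin_cases k <;>
  · simp [Fin.sum_univ_three, crossE_apply, eps3]
    grind

def rotIso (k : Fin 3) (t : ℝ) : E3 ≃ₗᵢ[ℝ] E3 :=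
  LinearIsometry.toLinearIsometryEquiv ⟨rotLin k t, norm_rotLin k t⟩ rfl

theorem rotIso_apply (k : Fin 3) (t : ℝ) (y : E3) : rotIso k t y = rotLin k t y := by
  simp [rotIso]

/-- This is `e_k × x`: the normal part of `∇ X^k` drops out because the volume form annihilates `x`.
In this form `Y` is linear in `x` and generates the rotations `rotIso`. -/
theorem rotField_eq (k : Fin 3) (x : S2) (a : Fin 3) :
    rotField k x a = ∑ c, eps3 a k c * x.1 c := by
  have h := S2.sum_sq x
  simp only [rotField, grad_coordFn, volForm, roundMetric, kron, Fin.sum_univ_three] at h ⊢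
  fin_cases k <;> fin_cases a <;> simp [eps3] <;> grind

/-- The derivative of `f` along the rotation field. -/
def rotDeriv (k : Fin 3) (f : S2 → ℝ) (x : S2) : ℝ := ∑ a, rotField k x a * grad f x a

theorem hasDerivAt_rotLin (k : Fin 3) (t : ℝ) (y : E3) :
    HasDerivAt (fun t => rotLin k t y) (crossE k (rotLin k t y)) t := by
  have h1 : HasDerivAt (fun t => rotLin k t y)
      ((-Real.sin t) • y + Real.cos t • crossE k y
        + (-(-Real.sin t)) • (y k • EuclideanSpace.single k (1 : ℝ))) t := by
    simp only [rotLin_apply]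
    exact (((Real.hasDerivAt_cos t).smul_const y).add
      ((Real.hasDerivAt_sin t).smul_const (crossE k y))).add
      (((Real.hasDerivAt_cos t).const_sub 1).smul_const _)
  convert h1 using 1
  ext a
  rw [rotLin_apply]
  fin_cases k <;> fin_cases a <;> simp [Fin.sum_univ_three, crossE_apply, eps3] <;> ring

theorem hasDerivAt_comp_rot {f : S2 → ℝ} (hf : SphereContDiff 1 f) (k : Fin 3) (t : ℝ) (x : S2) :
    HasDerivAt (fun t => f (sphereMap (rotIso k t) x))
      (rotDeriv k f (sphereMap (rotIso k t) x)) t := by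
  have h0 : ∀ t, (sphereMap (rotIso k t) x).1 = rotLin k t x.1 := fun t => rotIso_apply k t _
  have h1 := (hf.differentiableAt one_ne_zero (sphereMap (rotIso k t) x)).hasFDerivAt
  have h2 : HasDerivAt (fun t => (sphereMap (rotIso k t) x).1)
      (crossE k (sphereMap (rotIso k t) x).1) t := by
    simp only [h0]
    exact hasDerivAt_rotLin k t x.1
  have h3 := HasFDerivAt.comp_hasDerivAt t h1 h2
  have h4 : (radialExt f ∘ fun t => (sphereMap (rotIso k t) x).1)
      = fun t => f (sphereMap (rotIso k t) x) := by
    funext s; simp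
  rw [h4] at h3
  refine h3.congr_deriv ?_
  rw [fderiv_radialExt, rotDeriv]
  refine Finset.sum_congr rfl fun a _ => ?_
  rw [rotField_eq, crossE_apply, mul_comm]

@[fun_prop] theorem SphereContDiff.rotField {n : WithTop ℕ∞} (k a : Fin 3) :
    SphereContDiff n (fun x => rotField k x a) := by
  simp only [rotField_eq]; fun_prop

@[fun_prop] theorem SphereContDiff.rotDeriv {f : S2 → ℝ} (hf : SphereContDiff ∞ f) (k : Fin 3) :
    SphereContDiff ∞ (rotDeriv k f) := by
  unfold _root_.rotDeriv; fun_prop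

theorem SphereContDiff.continuous_grad {f : S2 → ℝ} (hf : SphereContDiff 1 f) (i : Fin 3) :
    Continuous (fun x => _root_.grad f x i) :=
  (hf.grad_of_le (m := 0) (by simp) i).continuous

theorem SphereContDiff.continuous_rotDeriv {f : S2 → ℝ} (hf : SphereContDiff 1 f) (k : Fin 3) :
    Continuous (_root_.rotDeriv k f) := by
  unfold _root_.rotDeriv
  have := hf.continuous_grad
  have h2 : ∀ a, Continuous fun x => _root_.rotField k x a := fun a =>
    (SphereContDiff.rotField (n := 1) k a).continuous
  fun_prop

theorem continuous_rot (k : Fin 3) :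
    Continuous fun p : ℝ × S2 => sphereMap (rotIso k p.1) p.2 := by
  refine Continuous.subtype_mk ?_ _
  simp only [rotIso_apply, rotLin_apply]
  have h : Continuous (crossE k) := (crossE k).continuous_of_finiteDimensional
  have h1 : Continuous fun p : ℝ × S2 => crossE k p.2.1 := h.comp (by fun_prop)
  have h2 : Continuous fun p : ℝ × S2 => p.2.1 k :=
    (EuclideanSpace.proj (𝕜 := ℝ) k).continuous.comp (by fun_prop)
  fun_prop

/-- Rotation invariance of the surface measure: derivatives along rotations integrate to zero. -/
theorem sphereIntegral_rotDeriv {f : S2 → ℝ} (hf : SphereContDiff 1 f) (k : Fin 3) :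
    sphereIntegral (rotDeriv k f) = 0 := by
  have h1 := hasDerivAt_sphereIntegral (F := fun t x => f (sphereMap (rotIso k t) x))
    (F' := fun t x => rotDeriv k f (sphereMap (rotIso k t) x))
    (fun t => hf.continuous.comp (continuous_sphereMap _))
    ((hf.continuous_rotDeriv k).comp (continuous_rot k))
    (fun t x => hasDerivAt_comp_rot hf k t x) 0
  simp only [sphereIntegral_comp_sphereMap _ hf.continuous] at h1
  have h2 := h1.unique (hasDerivAt_const (0 : ℝ) (sphereIntegral f))
  rwa [sphereIntegral_comp_sphereMap _ (hf.continuous_rotDeriv k)] at h2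

theorem rotDeriv_mul {f g : S2 → ℝ} (hf : SphereContDiff 1 f) (hg : SphereContDiff 1 g)
    (k : Fin 3) (x : S2) :
    rotDeriv k (fun z => f z * g z) x = f x * rotDeriv k g x + rotDeriv k f x * g x := by
  simp only [rotDeriv, grad_mul' (hf.differentiableAt one_ne_zero x)
    (hg.differentiableAt one_ne_zero x), Finset.mul_sum, Finset.sum_mul, ← Finset.sum_add_distrib]
  exact Finset.sum_congr rfl fun _ _ => by ring

theorem sphereIntegral_mul_rotDeriv {f g : S2 → ℝ} (hf : SphereContDiff 1 f)
    (hg : SphereContDiff 1 g) (k : Fin 3) :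
    sphereIntegral (fun x => f x * rotDeriv k g x)
      = - sphereIntegral (fun x => g x * rotDeriv k f x) := by
  have h := sphereIntegral_rotDeriv (hf.mul hg) k
  have h1 : rotDeriv k (fun z => f z * g z)
    = fun x => f x * rotDeriv k g x + g x * rotDeriv k f x := by
    funext x
    rw [rotDeriv_mul hf hg]; ring
  have h2 := sphereIntegral_add (f := fun x => f x * rotDeriv k g x)
    (g := fun x => g x * rotDeriv k f x) (hf.continuous.mul (hg.continuous_rotDeriv k))
    (hg.continuous.mul (hf.continuous_rotDeriv k))
  rw [h1, h2] at h
  linarith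

theorem rotDeriv_coord (k j : Fin 3) (x : S2) :
    rotDeriv k (coordFn j) x = ∑ c, eps3 j k c * x.1 c := by
  have h := S2.sum_sq x
  simp only [rotDeriv, grad_coordFn, rotField_eq, roundMetric, kron, Fin.sum_univ_three] at h ⊢
  fin_cases k <;> fin_cases j <;> simp [eps3] <;> grind

/-- The gradient is determined by the derivatives along rotations. -/
theorem grad_eq_rotDeriv (f : S2 → ℝ) (x : S2) (i : Fin 3) :
    grad f x i = ∑ j, ∑ k, -(eps3 i j k * (x.1 j * rotDeriv k f x)) := by
  have h := S2.sum_sq x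
  have h' := sum_coord_mul_grad f x
  simp only [rotDeriv, rotField_eq, Fin.sum_univ_three] at h h' ⊢
  -- The rotational derivatives are the components of `x × ∇f`. The claim is `∇f = -x × (x × ∇f)`,
  -- which uses only `|x| = 1` and `x · ∇f = 0`.
  have key : ∀ i : Fin 3, -grad f x i * (x.1 0 * x.1 0 + x.1 1 * x.1 1 + x.1 2 * x.1 2 - 1)
    + x.1 i * (x.1 0 * grad f x 0 + x.1 1 * grad f x 1 + x.1 2 * grad f x 2) = 0 := by
    intro i; rw [h, h']; ring
  have key := key i
  fin_cases i <;> simp [eps3] at key ⊢ <;> linarith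

/-- The divergence theorem for Cartesian components of tangential derivatives. -/
theorem sphereIntegral_grad {f : S2 → ℝ} (hf : SphereContDiff 1 f) (i : Fin 3) :
    sphereIntegral (fun x => grad f x i) = 2 * sphereIntegral (fun x => x.1 i * f x) := by
  have hc : ∀ j, Continuous fun x : S2 => x.1 j := fun j =>
    (SphereContDiff.coord (n := 1) j).continuous
  have hr := fun k => hf.continuous_rotDeriv k
  simp only [grad_eq_rotDeriv]
  rw [sphereIntegral_sum (fun j _ => by fun_prop)]
  -- The rotation is moved onto the coordinate `x_j`. This leaves the contraction `∑ ε_{ijk} ε_{jkc}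
  -- = 2 δ_{ic}`, the origin of the factor 2 (the mean curvature of the sphere).
  have h1 : ∀ j : Fin 3, sphereIntegral (fun x => ∑ k, -(eps3 i j k * (x.1 j * rotDeriv k f x)))
      = ∑ k, ∑ c, eps3 i j k * eps3 j k c * sphereIntegral (fun x => x.1 c * f x) := by
    intro j
    rw [sphereIntegral_sum (fun k _ => by fun_prop)]
    refine Finset.sum_congr rfl fun k _ => ?_
    rw [sphereIntegral_neg, sphereIntegral_const_mul]
    have h2 := sphereIntegral_mul_rotDeriv (SphereContDiff.coordFn (n := 1) j) hf k
    have h3 : (fun x => f x * rotDeriv k (coordFn j) x)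
        = fun x => ∑ c, eps3 j k c * (x.1 c * f x) := by
      funext x
      rw [rotDeriv_coord, Finset.mul_sum]
      exact Finset.sum_congr rfl fun _ _ => by ring
    rw [h3, sphereIntegral_sum (fun c _ => by have := hf.continuous; fun_prop)] at h2
    simp only [sphereIntegral_const_mul] at h2
    unfold coordFn at h2
    rw [h2, mul_neg, neg_neg, Finset.mul_sum]
    exact Finset.sum_congr rfl fun _ _ => by ring
  rw [Finset.sum_congr rfl fun j _ => h1 j]
  simp only [Fin.sum_univ_three]
  fin_cases i <;> simp [eps3] <;> ring

/-- Integral of the divergence of a tangential vector field. -/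
theorem sphereIntegral_div {w : Fin 3 → S2 → ℝ} (hw : ∀ i, SphereContDiff 1 (w i))
    (ht : ∀ x, ∑ i, x.1 i * w i x = 0) :
    sphereIntegral (fun x => ∑ i, grad (w i) x i) = 0 := by
  rw [sphereIntegral_sum (fun i _ => (hw i).continuous_grad i)]
  simp only [sphereIntegral_grad (hw _)]
  rw [← Finset.mul_sum, ← sphereIntegral_sum]
  · simp [ht, sphereIntegral]
  · intro i _
    exact (SphereContDiff.coord (n := 1) i).continuous.mul (hw i).continuous
end

noncomputable section

/-! ### Identities for tangential derivatives -/

/-- A gradient is already tangential in its derivative index, so contracting it with the projection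
changes nothing. For 2-tensors (`div2_eq`) only the free index still has to be projected. -/
theorem div1_eq (w : S2 → Fin 3 → ℝ) (x : S2) :
    div1 w x = ∑ i, grad (fun z => w z i) x i := by
  have h := fun b => sum_coord_mul_grad (fun z => w z b) x
  simp only [Fin.sum_univ_three] at h
  simp only [div1, cov1, roundMetric, kron, Fin.sum_univ_three]
  simp
  linear_combination -(x.1 0) * h 0 - x.1 1 * h 1 - x.1 2 * h 2

theorem lap_eq (f : S2 → ℝ) (x : S2) : lap f x = ∑ i, grad (fun z => grad f z i) x i :=
  div1_eq _ x

theorem div2_eq (T : S2 → Fin 3 → Fin 3 → ℝ) (x : S2) (j : Fin 3) :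
    div2 T x j = ∑ c, roundMetric x j c * ∑ i, grad (fun z => T z i c) x i := by
  have h := fun b c => sum_coord_mul_grad (fun z => T z b c) x
  have h1 : ∀ c, ∑ i, ∑ b, roundMetric x i b * grad (fun z => T z b c) x i
      = ∑ i, grad (fun z => T z i c) x i := fun c => div1_eq (fun z b => T z b c) x
  simp only [div2, cov2]
  simp only [Fin.sum_univ_three] at h1 ⊢
  linear_combination roundMetric x j 0 * h1 0 + roundMetric x j 1 * h1 1
    + roundMetric x j 2 * h1 2

theorem sum_roundMetric_mul_coord (x : S2) (i : Fin 3) : ∑ j, roundMetric x i j * x.1 j = 0 := by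
  have h := S2.sum_sq x
  simp only [roundMetric, kron, Fin.sum_univ_three] at h ⊢
  fin_cases i <;> simp
  · linear_combination -(x.1 0) * h
  · linear_combination -(x.1 1) * h
  · linear_combination -(x.1 2) * h

theorem roundMetric_comm (x : S2) (i j : Fin 3) : roundMetric x i j = roundMetric x j i := by
  simp only [roundMetric, kron, eq_comm (a := i)]; ring

/-- Projection does nothing to tangential vectors. -/
theorem sum_roundMetric_mul {x : S2} {v : Fin 3 → ℝ} (hv : ∑ i, x.1 i * v i = 0) (i : Fin 3) :
    ∑ j, roundMetric x i j * v j = v i := by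
  simp only [roundMetric, kron, Fin.sum_univ_three] at hv ⊢
  fin_cases i <;> simp
  · linear_combination -(x.1 0) * hv
  · linear_combination -(x.1 1) * hv
  · linear_combination -(x.1 2) * hv

/-- Leibniz rule for `∑ i, x i * w i`, for components `w` of a tangential field. -/
theorem sum_coord_mul_grad_of_tangent {w : Fin 3 → S2 → ℝ} (hw : ∀ i, SphereContDiff ∞ (w i))
    (ht : ∀ x, ∑ i, x.1 i * w i x = 0) (x : S2) (k : Fin 3) :
    ∑ i, x.1 i * grad (w i) x k = - w k x := by
  have h0 : (fun z : S2 => ∑ i, z.1 i * w i z) = fun _ => 0 := funext ht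
  have h1 : grad (fun z : S2 => ∑ i, z.1 i * w i z) x k = 0 := by rw [h0, grad_const]
  rw [grad_sum (fun i => by fun_prop)] at h1
  simp only [grad_mul (SphereContDiff.coord _) (hw _), grad_coord, Finset.sum_add_distrib] at h1
  rw [sum_roundMetric_mul (ht x)] at h1
  linarith

theorem sum_coord_mul_grad_grad {f : S2 → ℝ} (hf : SphereContDiff ∞ f) (x : S2) (k : Fin 3) :
    ∑ i, x.1 i * grad (fun z => grad f z i) x k = - grad f x k :=
  sum_coord_mul_grad_of_tangent (w := fun i z => grad f z i) (fun i => hf.grad i)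
    (sum_coord_mul_grad f) x k

/-- Differentiating `x · ∇f = 0` shows that the normal component of `∂_i ∇f` is `-∇_i f`; projecting
it away adds `x_j ∇_i f`. -/
theorem hess_eq {f : S2 → ℝ} (hf : SphereContDiff ∞ f) (x : S2) (i j : Fin 3) :
    hess f x i j = grad (fun z => grad f z j) x i + x.1 j * grad f x i := by
  have h := sum_coord_mul_grad_grad hf x i
  simp only [hess, cov1, roundMetric, kron, Fin.sum_univ_three] at h ⊢
  fin_cases j <;> simp
  · linear_combination -(x.1 0) * h
  · linear_combination -(x.1 1) * h
  · linear_combination -(x.1 2) * h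

theorem grad_rotField (k a i : Fin 3) (x : S2) :
    grad (fun z => rotField k z a) x i = eps3 a k i - rotField k x a * x.1 i := by
  simp only [rotField_eq]
  rw [grad_sum (fun c => by fun_prop)]
  simp only [grad_const_mul, grad_coord, roundMetric, mul_sub, Finset.sum_sub_distrib,
    Finset.sum_mul]
  congr 1
  · simp [kron]
  · exact Finset.sum_congr rfl fun _ _ => by ring

theorem sum_coord_mul_rotField (k : Fin 3) (x : S2) : ∑ a, x.1 a * rotField k x a = 0 := by
  simp only [rotField_eq, Fin.sum_univ_three]
  fin_cases k <;> simp [eps3] <;> ring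

/-- Rotations commute with Cartesian derivatives up to the rotation of the index. -/
theorem rotDeriv_grad {f : S2 → ℝ} (hf : SphereContDiff ∞ f) (k i : Fin 3) (x : S2) :
    rotDeriv k (fun z => grad f z i) x
      = grad (rotDeriv k f) x i - ∑ a, eps3 a k i * grad f x a := by
  have h1 : grad (rotDeriv k f) x i = ∑ a, (rotField k x a * grad (fun z => grad f z a) x i
      + (eps3 a k i - rotField k x a * x.1 i) * grad f x a) := by
    unfold rotDeriv
    rw [grad_sum (fun a => by fun_prop)]
    refine Finset.sum_congr rfl fun a _ => ?_
    rw [grad_mul (by fun_prop) (by fun_prop), grad_rotField]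
  have hY := sum_coord_mul_rotField k x
  have c := fun a => grad_grad_comm hf x a i
  rw [h1]
  unfold rotDeriv
  simp only [Fin.sum_univ_three] at hY ⊢
  linear_combination rotField k x 0 * c 0 + rotField k x 1 * c 1 + rotField k x 2 * c 2
    + grad f x i * hY

theorem rotDeriv_sum {ι : Type*} {s : Finset ι} {f : ι → S2 → ℝ}
    (hf : ∀ i, SphereContDiff ∞ (f i)) (k : Fin 3) (x : S2) :
    rotDeriv k (fun z => ∑ i ∈ s, f i z) x = ∑ i ∈ s, rotDeriv k (f i) x := by
  unfold rotDeriv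
  simp only [grad_sum hf, Finset.mul_sum]
  exact Finset.sum_comm

theorem eps3_swap (a k i : Fin 3) : eps3 i k a = - eps3 a k i := by
  simp only [eps3]; ring

@[fun_prop] theorem SphereContDiff.lap {f : S2 → ℝ} (hf : SphereContDiff ∞ f) :
    SphereContDiff ∞ (lap f) := by
  have : _root_.lap f = fun x => ∑ i, _root_.grad (fun z => _root_.grad f z i) x i :=
    funext (lap_eq f)
  rw [this]
  fun_prop

/-- Rotations are isometries. Concretely, `rotDeriv_grad` is applied twice, and the terms that
rotate indices cancel in the trace by antisymmetry. -/
theorem lap_rotDeriv {f : S2 → ℝ} (hf : SphereContDiff ∞ f) (k : Fin 3) (x : S2) :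
    lap (rotDeriv k f) x = rotDeriv k (lap f) x := by
  have h0 : lap f = fun x => ∑ i, grad (fun z => grad f z i) x i := funext (lap_eq f)
  have h1 : ∀ i, rotDeriv k (fun z => grad (fun z => grad f z i) z i) x
      = grad (rotDeriv k fun z => grad f z i) x i
        - ∑ a, eps3 a k i * grad (fun z => grad f z i) x a :=
    fun i => rotDeriv_grad (by fun_prop) k i x
  have h2 : ∀ i, grad (rotDeriv k fun z => grad f z i) x i
      = grad (fun z => grad (rotDeriv k f) z i) x i
        - ∑ a, eps3 a k i * grad (fun z => grad f z a) x i := by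
    intro i
    have : (rotDeriv k fun z => grad f z i)
      = fun z => grad (rotDeriv k f) z i - ∑ a, eps3 a k i * grad f z a :=
      funext fun z => rotDeriv_grad hf k i z
    rw [this, grad_sub (by fun_prop) (by fun_prop), grad_sum (fun a => by fun_prop)]
    simp only [grad_const_mul]
  rw [h0, rotDeriv_sum (fun i => by fun_prop), lap_eq]
  simp only [h1, h2]
  simp only [Fin.sum_univ_three, eps3]
  fin_cases k <;> simp <;> ring

/-- Green's formula. -/
theorem sphereIntegral_mul_lap {f g : S2 → ℝ} (hf : SphereContDiff ∞ f)
    (hg : SphereContDiff ∞ g) :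
    sphereIntegral (fun x => g x * lap f x)
      = - sphereIntegral (fun x => ∑ i, grad g x i * grad f x i) := by
  have h := sphereIntegral_div (w := fun i x => g x * grad f x i)
    (fun i => SphereContDiff.of_le (n := ∞) (by fun_prop) (by simp)) (fun x => by
      have := sum_coord_mul_grad f x
      simp only [Fin.sum_univ_three] at this ⊢
      linear_combination g x * this)
  have h1 : (fun x => ∑ i, grad (fun x => g x * grad f x i) x i)
      = fun x => g x * lap f x + ∑ i, grad g x i * grad f x i := by
    funext x
    simp only [grad_mul hg (hf.grad _), Finset.sum_add_distrib, lap_eq, Finset.mul_sum]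
  rw [h1, sphereIntegral_add (SphereContDiff.continuous (n := ∞) (by fun_prop))
    (SphereContDiff.continuous (n := ∞) (by fun_prop))] at h
  linarith

/-- The extension has vanishing derivative on punctured space, which is connected in dimension
greater than one. -/
theorem eq_const_of_grad_eq_zero {f : S2 → ℝ} (hf : SphereContDiff 1 f)
    (h : ∀ x i, grad f x i = 0) : ∃ c, ∀ x, f x = c := by
  have h1 : IsPreconnected {y : E3 | y ≠ 0} := by
    have : 1 < Module.rank ℝ E3 := by
      rw [← Module.finrank_eq_rank, finrank_euclideanSpace_fin]
      norm_num
    exact (isConnected_compl_singleton_of_one_lt_rank this 0).isPreconnected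
  have h2 : ∀ y ∈ {y : E3 | y ≠ 0}, fderiv ℝ (radialExt f) y = 0 := by
    intro y hy
    ext v
    rw [fderiv_radialExt_of_ne_zero hy (hf.differentiableAt one_ne_zero _), fderiv_radialExt]
    simp [h]
  have hd : DifferentiableOn ℝ (radialExt f) {y : E3 | y ≠ 0} :=
    ContDiffOn.differentiableOn hf one_ne_zero
  obtain ⟨c, hc⟩ := isOpen_ne_zero.exists_is_const_of_fderiv_eq_zero h1 hd h2
  exact ⟨c, fun x => by rw [← hc x.1 (S2.coe_ne_zero x), radialExt_coe]⟩

theorem eq_zero_of_sphereIntegral_eq_zero {f : S2 → ℝ} (hf : Continuous f) (h0 : ∀ x, 0 ≤ f x)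
    (h : sphereIntegral f = 0) (x : S2) : f x = 0 := by
  have h1 := (integral_eq_zero_iff_of_nonneg h0 (integrable_sphere hf)).1 h
  exact congrFun ((hf.ae_eq_iff_eq _ continuous_const).1 h1) x

/-- Green's formula with `g = f` makes the Dirichlet energy vanish. -/
theorem eq_const_of_lap_eq_zero {f : S2 → ℝ} (hf : SphereContDiff ∞ f) (h : ∀ x, lap f x = 0) :
    ∃ c, ∀ x, f x = c := by
  have h1 := sphereIntegral_mul_lap hf hf
  simp only [h, mul_zero] at h1
  have h2 : sphereIntegral (fun x => ∑ i, grad f x i * grad f x i) = 0 := by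
    have : sphereIntegral (fun _ => 0) = 0 := by simp [sphereIntegral]
    linarith
  have h3 := eq_zero_of_sphereIntegral_eq_zero (SphereContDiff.continuous (n := ∞) (by fun_prop))
    (fun x => Finset.sum_nonneg fun i _ => mul_self_nonneg _) h2
  refine eq_const_of_grad_eq_zero (hf.of_le (by simp)) fun x i => ?_
  have h4 := (Finset.sum_eq_zero_iff_of_nonneg (fun i _ => mul_self_nonneg _)).1 (h3 x) i
    (Finset.mem_univ i)
  exact mul_self_eq_zero.1 h4

/-- Together with `lap_coord_mul` this makes `x_i f + ∇_i f` harmonic whenever `Δ f = -2 f`, which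
classifies the first mode. -/
theorem lap_grad {f : S2 → ℝ} (hf : SphereContDiff ∞ f) (i : Fin 3) (x : S2) :
    lap (fun z => grad f z i) x = grad (lap f) x i - 2 * x.1 i * lap f x := by
  have h0 : lap f = fun x => ∑ i, grad (fun z => grad f z i) x i := funext (lap_eq f)
  have h1 : ∀ j, (fun z => grad (fun z => grad f z i) z j)
      = fun z => grad (fun z => grad f z j) z i + z.1 j * grad f z i - z.1 i * grad f z j :=
    fun j => funext fun z => grad_grad_comm hf z j i
  have h2 : ∀ j, grad (fun z => grad (fun z => grad f z i) z j) x j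
      = grad (fun z => grad (fun z => grad f z j) z i) x j
        + (x.1 j * grad (fun z => grad f z i) x j + roundMetric x j j * grad f x i)
        - (x.1 i * grad (fun z => grad f z j) x j + roundMetric x j i * grad f x j) := by
    intro j
    rw [h1, grad_sub (by fun_prop) (by fun_prop), grad_add (by fun_prop) (by fun_prop),
      grad_mul (by fun_prop) (by fun_prop), grad_mul (by fun_prop) (by fun_prop), grad_coord,
      grad_coord]
  have h3 : ∀ j, grad (fun z => grad (fun z => grad f z j) z i) x j
      = grad (fun z => grad (fun z => grad f z j) z j) x i
        + x.1 j * grad (fun z => grad f z j) x i - x.1 i * grad (fun z => grad f z j) x j :=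
    fun j => grad_grad_comm (hf.grad j) x j i
  have h4 := sum_coord_mul_grad_grad hf x i
  have h5 := sum_coord_mul_grad (fun z => grad f z i) x
  have h6 : ∑ j, roundMetric x i j * grad f x j = grad f x i :=
    sum_roundMetric_mul (sum_coord_mul_grad f x) i
  have h7 : ∑ j, roundMetric x j j = 2 := by
    have := S2.sum_sq x
    simp only [Fin.sum_univ_three, roundMetric, kron] at this ⊢
    simp
    linear_combination -this
  rw [lap_eq, h0, grad_sum (fun j => by fun_prop)]
  simp only [h2, h3]
  simp only [roundMetric_comm x _ i, Fin.sum_univ_three] at h4 h5 h6 h7 ⊢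
  linear_combination h4 + h5 - h6 + grad f x i * h7

theorem lap_coord_mul {f : S2 → ℝ} (hf : SphereContDiff ∞ f) (i : Fin 3) (x : S2) :
    lap (fun z => z.1 i * f z) x = x.1 i * lap f x + 2 * grad f x i - 2 * x.1 i * f x := by
  have h1 : ∀ j, (fun z => grad (fun z => z.1 i * f z) z j)
      = fun z => z.1 i * grad f z j + (kron j i - z.1 j * z.1 i) * f z := fun j => funext fun z => by
    rw [grad_mul (by fun_prop) hf, grad_coord, roundMetric]
  have h2 : ∀ j, grad (fun z => grad (fun z => z.1 i * f z) z j) x j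
      = x.1 i * grad (fun z => grad f z j) x j + roundMetric x j i * grad f x j
       + ((kron j i - x.1 j * x.1 i) * grad f x j
        - (x.1 j * roundMetric x j i + roundMetric x j j * x.1 i) * f x) := by
    intro j
    rw [h1, grad_add (by fun_prop) (by fun_prop), grad_mul (by fun_prop) (by fun_prop),
      grad_mul (by fun_prop) (by fun_prop), grad_sub (by fun_prop) (by fun_prop), grad_const,
      grad_mul (by fun_prop) (by fun_prop), grad_coord, grad_coord]
    ring
  have h6 : ∑ j, roundMetric x i j * grad f x j = grad f x i :=
    sum_roundMetric_mul (sum_coord_mul_grad f x) i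
  have h6' : ∑ j, (kron j i - x.1 j * x.1 i) * grad f x j = grad f x i := by
    rw [← h6]
    exact Finset.sum_congr rfl fun j _ => by rw [roundMetric_comm]; rfl
  have h7 : ∑ j, roundMetric x j j = 2 := by
    have := S2.sum_sq x
    simp only [Fin.sum_univ_three, roundMetric, kron] at this ⊢
    simp
    linear_combination -this
  have h8 := sum_roundMetric_mul_coord x i
  rw [lap_eq, lap_eq]
  simp only [h2]
  simp only [roundMetric_comm x _ i, Fin.sum_univ_three] at h6 h6' h7 h8 ⊢
  linear_combination h6 + h6' - x.1 i * f x * h7 - f x * h8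

theorem lap_add {f g : S2 → ℝ} (hf : SphereContDiff ∞ f) (hg : SphereContDiff ∞ g) (x : S2) :
    lap (fun z => f z + g z) x = lap f x + lap g x := by
  have : ∀ i, (fun z => grad (fun z => f z + g z) z i) = fun z => grad f z i + grad g z i :=
    fun i => funext fun z => grad_add hf hg i
  simp only [lap_eq, this, grad_add (hf.grad _) (hg.grad _), Finset.sum_add_distrib]

theorem lap_const_mul (c : ℝ) (f : S2 → ℝ) (x : S2) :
    lap (fun z => c * f z) x = c * lap f x := by
  simp only [lap_eq, grad_const_mul, Finset.mul_sum]

theorem lap_const (c : ℝ) (x : S2) : lap (fun _ => c) x = 0 := by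
  simp only [lap_eq, grad_const, Finset.sum_const_zero]

theorem lap_coordFn (i : Fin 3) (x : S2) : lap (coordFn i) x = -2 * coordFn i x := by
  have h := lap_coord_mul (SphereContDiff.const 1) i x
  simp only [mul_one, lap_const, grad_const] at h
  change lap (fun z : S2 => z.1 i) x = -2 * x.1 i
  rw [h]; ring

/-! ### Modes -/

theorem IsMode.eq_const {f : S2 → ℝ} (hf : IsMode 0 f) : ∃ c, ∀ x, f x = c :=
  eq_const_of_lap_eq_zero hf.1 fun x => by rw [hf.2]; simp

/-- The functions `x_i f + ∇_i f` are the components of the Euclidean gradient of the extension of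
`f` that is homogeneous of degree 1. For mode one they are harmonic on the sphere, hence constants
`c_i`, and contraction with `x` recovers `f = ∑ c_i x_i`. -/
theorem IsMode.eq_linear {f : S2 → ℝ} (hf : IsMode 1 f) :
    ∃ c : Fin 3 → ℝ, ∀ x, f x = ∑ i, c i * coordFn i x := by
  have hs := hf.1
  have hl : lap f = fun x => (-2) * f x := by
    funext x; rw [hf.2]; norm_num
  have h1 : ∀ i, ∃ c, ∀ x, x.1 i * f x + grad f x i = c := by
    intro i
    refine eq_const_of_lap_eq_zero (by fun_prop) fun x => ?_
    rw [lap_add (by fun_prop) (by fun_prop), lap_coord_mul hs, lap_grad hs, hl, grad_const_mul]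
    ring
  choose c hc using h1
  refine ⟨c, fun x => ?_⟩
  have h2 := S2.sum_sq x
  have h3 := sum_coord_mul_grad f x
  simp only [← hc _ x, coordFn, Fin.sum_univ_three] at h2 h3 ⊢
  linear_combination -(f x) * h2 - h3

theorem IsMode.rotDeriv {l : ℕ} {f : S2 → ℝ} (hf : IsMode l f) (k : Fin 3) :
    IsMode l (rotDeriv k f) := by
  refine ⟨hf.1.rotDeriv k, fun x => ?_⟩
  have : lap f = fun x => -((l : ℝ) * (l + 1)) * f x := funext hf.2
  rw [lap_rotDeriv hf.1, this]
  simp only [_root_.rotDeriv, grad_const_mul, Finset.mul_sum]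
  exact Finset.sum_congr rfl fun _ _ => by ring
end

/-! ### Projection to the modes `ℓ ≤ 1` and functions orthogonal to `ℓ ≥ 2` -/

noncomputable section

/-- The fundamental lemma of the calculus of variations: the test function is a bump at `x₀` so
narrow that `g` keeps the sign of `g x₀` on its support. Multiplication by `g x₀` treats both signs
at once. -/
theorem eq_zero_of_forall_sphereIntegral_eq_zero {g : S2 → ℝ} (hg : Continuous g)
    (h : ∀ φ : S2 → ℝ, SphereContDiff ∞ φ → sphereIntegral (fun x => φ x * g x) = 0) (x₀ : S2) :
    g x₀ = 0 := by
  by_contra hne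
  have hpos : ∀ᶠ x in 𝓝 x₀, 0 < g x * g x₀ :=
    (hg.mul continuous_const).continuousAt.eventually (lt_mem_nhds (mul_self_pos.2 hne))
  obtain ⟨δ, hδ, hball⟩ := Metric.eventually_nhds_iff.1 hpos
  let χ : ContDiffBump x₀.1 := ⟨δ / 2, δ, by positivity, by linarith⟩
  let φ : S2 → ℝ := fun x => χ x.1
  have hφ : SphereContDiff ∞ φ := by
    intro y hy
    exact (χ.contDiff.contDiffAt.comp y (contDiffAt_dir hy)).contDiffWithinAt
  have h1 : sphereIntegral (fun x => φ x * g x * g x₀) = 0 := by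
    have h2 : (fun x => φ x * g x * g x₀) = fun x => g x₀ * (φ x * g x) := by
      funext x; ring
    rw [h2, sphereIntegral_const_mul, h φ hφ, mul_zero]
  have h3 := eq_zero_of_sphereIntegral_eq_zero (f := fun x => φ x * g x * g x₀)
    ((hφ.continuous.mul hg).mul continuous_const) (fun x => by
      rw [mul_assoc]
      by_cases hx : dist x x₀ < δ
      · exact mul_nonneg χ.nonneg (hball hx).le
      · have : φ x = 0 := χ.zero_of_le_dist (not_lt.1 hx)
        simp [this]) h1 x₀
  have h4 : φ x₀ = 1 := χ.one_of_mem_closedBall (Metric.mem_closedBall_self (by positivity))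
  rw [h4, one_mul] at h3
  exact hne (mul_self_eq_zero.1 h3)

theorem sphereIntegral_coordFn (i : Fin 3) : sphereIntegral (coordFn i) = 0 := by
  have h := sphereIntegral_grad (SphereContDiff.const 1) i
  simp only [grad_const, mul_one] at h
  have h0 : sphereIntegral (fun _ => 0) = 0 := by simp [sphereIntegral]
  have h1 : sphereIntegral (fun x => x.1 i) = 0 := by linarith
  exact h1

/-- The divergence theorem for `∇_i X^j = δ_{ij} - x_i x_j` reads `A δ_{ij} - I = 2 I`. The
numerical value of the area `A` is never needed. -/
theorem sphereIntegral_coordFn_mul (i j : Fin 3) :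
    sphereIntegral (fun x => coordFn i x * coordFn j x) = sphereArea / 3 * kron i j := by
  have h := sphereIntegral_grad (SphereContDiff.coordFn j) i
  have hc : ∀ i, Continuous (coordFn i) := fun i =>
    (SphereContDiff.coordFn (n := 1) i).continuous
  have h1 : (fun x => grad (coordFn j) x i)
      = fun x => kron i j - coordFn i x * coordFn j x := by
    funext x; rw [grad_coordFn]; rfl
  rw [h1, sphereIntegral_sub (by fun_prop) (by fun_prop), sphereIntegral_const] at h
  change _ = 2 * sphereIntegral (fun x => coordFn i x * coordFn j x) at h
  linarith

/-- The modes `ℓ ≥ 2` are obtained by subtracting the mean and the dipole moments. -/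
theorem supportedGeTwo_sub_projection {φ : S2 → ℝ} (hφ : SphereContDiff ∞ φ) :
    SupportedGeTwo (fun x => φ x - (sphereIntegral φ / sphereArea
      + ∑ i, 3 / sphereArea * sphereIntegral (fun x => φ x * coordFn i x) * coordFn i x)) := by
  have hA := sphereArea_pos.ne'
  have hc : ∀ i, Continuous (coordFn i) := fun i =>
    (SphereContDiff.coordFn (n := 1) i).continuous
  have hφc := hφ.continuous
  have h0 : sphereIntegral (fun x => φ x - (sphereIntegral φ / sphereArea
      + ∑ i, 3 / sphereArea * sphereIntegral (fun x => φ x * coordFn i x) * coordFn i x)) = 0 := by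
    rw [sphereIntegral_sub hφc (by fun_prop), sphereIntegral_add (by fun_prop) (by fun_prop),
      sphereIntegral_const, sphereIntegral_sum (fun i _ => by fun_prop)]
    have : ∀ i c, sphereIntegral (fun x => c * coordFn i x) = 0 := fun i c => by
      rw [sphereIntegral_const_mul, sphereIntegral_coordFn, mul_zero]
    simp only [this, Finset.sum_const_zero]
    field_simp
    ring
  have h1 : ∀ j, sphereIntegral (fun x => (φ x - (sphereIntegral φ / sphereArea
      + ∑ i, 3 / sphereArea * sphereIntegral (fun x => φ x * coordFn i x) * coordFn i x))
        * coordFn j x) = 0 := by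
    intro j
    have h2 : (fun x => (φ x - (sphereIntegral φ / sphereArea
      + ∑ i, 3 / sphereArea * sphereIntegral (fun x => φ x * coordFn i x) * coordFn i x))
        * coordFn j x) = fun x => φ x * coordFn j x - (sphereIntegral φ / sphereArea * coordFn j x
      + ∑ i, 3 / sphereArea * sphereIntegral (fun x => φ x * coordFn i x)
          * (coordFn i x * coordFn j x)) := by
      funext x
      rw [sub_mul, add_mul, Finset.sum_mul]
      simp only [mul_assoc]
    rw [h2, sphereIntegral_sub (by fun_prop) (by fun_prop), sphereIntegral_add (by fun_prop)
      (by fun_prop), sphereIntegral_const_mul, sphereIntegral_sum (fun i _ => by fun_prop),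
      sphereIntegral_coordFn]
    simp only [sphereIntegral_const_mul, sphereIntegral_coordFn_mul, kron]
    simp
    field_simp
    ring
  intro l hl g hg
  interval_cases l
  · obtain ⟨c, hgc⟩ := hg.eq_const
    have : g = fun _ => c := funext hgc
    rw [this]
    simp only [mul_comm _ c]
    rw [sphereIntegral_const_mul, h0, mul_zero]
  · obtain ⟨c, hgc⟩ := hg.eq_linear
    have : g = fun x => ∑ i, c i * coordFn i x := funext hgc
    rw [this]
    simp only [Finset.mul_sum, mul_left_comm _ (c _)]
    rw [sphereIntegral_sum (fun i _ => by fun_prop)]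
    simp only [sphereIntegral_const_mul]
    exact Finset.sum_eq_zero fun i _ => by rw [h1 i, mul_zero]

/-- With `P` the projection to `ℓ ≤ 1` and `g = Y_k h`, self-adjointness gives `⟨φ, g - P g⟩ = ⟨φ -
P φ, g⟩ = 0` for every smooth `φ`, hence `g = P g`. -/
theorem rotDeriv_eq_affine {h : S2 → ℝ} (hh : SphereContDiff 1 h) {k : Fin 3}
    (H : ∀ f, SphereContDiff ∞ f → SupportedGeTwo f →
      sphereIntegral (fun x => f x * rotDeriv k h x) = 0) :
    ∃ (a : ℝ) (b : Fin 3 → ℝ), ∀ x, rotDeriv k h x = a + ∑ i, b i * coordFn i x := by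
  have hA := sphereArea_pos.ne'
  have hc : ∀ i, Continuous (coordFn i) := fun i =>
    (SphereContDiff.coordFn (n := 1) i).continuous
  have hr := hh.continuous_rotDeriv k
  set g := rotDeriv k h with hg
  refine ⟨sphereIntegral g / sphereArea,
    fun i => 3 / sphereArea * sphereIntegral (fun x => coordFn i x * g x), fun x => ?_⟩
  rw [← sub_eq_zero]
  refine eq_zero_of_forall_sphereIntegral_eq_zero (g := fun x => g x - (sphereIntegral g / sphereArea
    + ∑ i, 3 / sphereArea * sphereIntegral (fun x => coordFn i x * g x) * coordFn i x))
    (by fun_prop) (fun φ hφ => ?_) x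
  have hφc := hφ.continuous
  have h1 := H _ (by fun_prop) (supportedGeTwo_sub_projection hφ)
  have h2 : (fun x => (φ x - (sphereIntegral φ / sphereArea
      + ∑ i, 3 / sphereArea * sphereIntegral (fun x => φ x * coordFn i x) * coordFn i x)) * g x)
      = fun x => φ x * g x - (sphereIntegral φ / sphereArea * g x
        + ∑ i, 3 / sphereArea * sphereIntegral (fun x => φ x * coordFn i x)
          * (coordFn i x * g x)) := by
    funext x
    rw [sub_mul, add_mul, Finset.sum_mul]
    simp only [mul_assoc]
  have h3 : (fun x => φ x * (g x - (sphereIntegral g / sphereArea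
      + ∑ i, 3 / sphereArea * sphereIntegral (fun x => coordFn i x * g x) * coordFn i x)))
      = fun x => φ x * g x - (sphereIntegral g / sphereArea * φ x
        + ∑ i, 3 / sphereArea * sphereIntegral (fun x => coordFn i x * g x)
          * (φ x * coordFn i x)) := by
    funext x
    rw [mul_sub, mul_add, Finset.mul_sum, mul_comm (φ x) (_ / _)]
    simp only [mul_left_comm]
  rw [h2, sphereIntegral_sub (by fun_prop) (by fun_prop), sphereIntegral_add (by fun_prop)
    (by fun_prop), sphereIntegral_const_mul, sphereIntegral_sum (fun i _ => by fun_prop)] at h1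
  rw [h3, sphereIntegral_sub (by fun_prop) (by fun_prop), sphereIntegral_add (by fun_prop)
    (by fun_prop), sphereIntegral_const_mul, sphereIntegral_sum (fun i _ => by fun_prop)]
  simp only [sphereIntegral_const_mul, Fin.sum_univ_three] at h1 ⊢
  linear_combination h1

/-- The hypothesis makes all three rotational derivatives of `h` affine in the coordinates. These
determine the gradient, which upgrades `h` from `C¹` to smooth, and the sum of squares of rotations
then computes `Δ h`. -/
theorem supportedLeOne_of_forall {h : S2 → ℝ} (hh : SphereContDiff 1 h)
    (H : ∀ k f, SphereContDiff ∞ f → SupportedGeTwo f →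
      sphereIntegral (fun x => f x * rotDeriv k h x) = 0) : SupportedLeOne h := by
  choose a b hab using fun k => rotDeriv_eq_affine hh (H k)
  have hab' : ∀ k, rotDeriv k h = fun x => a k + ∑ i, b k i * coordFn i x :=
    fun k => funext (hab k)
  have hgrad : ∀ i, SphereContDiff ∞ (fun x => grad h x i) := by
    intro i
    have : (fun x => grad h x i)
        = fun x : S2 => ∑ j, ∑ k, -(eps3 i j k * (x.1 j * (a k + ∑ i, b k i * coordFn i x))) := by
      funext x
      rw [grad_eq_rotDeriv]
      simp only [hab]
    rw [this]
    fun_prop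
  -- The derivative of the extension at `y` is `‖y‖⁻¹` times the gradient at `dir y`, already known
  -- to be smooth; so the extension is `C^{n+1}` for every `n`.
  have hs : SphereContDiff ∞ h := by
    refine contDiffOn_infty.2 fun n => ?_
    refine ContDiffOn.of_le (n := (n : WithTop ℕ∞) + 1) ?_ le_self_add
    rw [contDiffOn_succ_iff_fderiv_of_isOpen isOpen_ne_zero]
    refine ⟨ContDiffOn.differentiableOn hh one_ne_zero, by simp, ?_⟩
    rw [contDiffOn_clm_apply]
    intro v
    have h1 : ∀ y ∈ {y : E3 | y ≠ 0}, fderiv ℝ (radialExt h) y v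
        = ‖y‖⁻¹ * ∑ i, radialExt (fun x => grad h x i) y * v i := by
      intro y hy
      rw [fderiv_radialExt_of_ne_zero hy (hh.differentiableAt one_ne_zero _), fderiv_radialExt]
      rfl
    refine ContDiffOn.congr ?_ h1
    have h2 : ContDiffOn ℝ n (fun y : E3 => ‖y‖⁻¹) {y | y ≠ 0} := fun y hy =>
      ((contDiffAt_norm ℝ hy).inv (norm_ne_zero_iff.mpr hy)).contDiffWithinAt
    refine h2.mul (ContDiffOn.sum fun i _ => ContDiffOn.mul ?_ contDiffOn_const)
    exact (hgrad i).of_le (by exact_mod_cast le_top)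
  have hlap : ∀ x, lap h x = ∑ c, (∑ k, ∑ i, b k i * eps3 i k c) * coordFn c x := by
    intro x
    have h0 : ∀ k, SphereContDiff ∞ (fun x : S2 => a k + ∑ i, b k i * coordFn i x) :=
      fun k => by fun_prop
    have h1 : ∀ k, rotDeriv k (rotDeriv k h) x = ∑ i, b k i * rotDeriv k (coordFn i) x := by
      intro k
      rw [hab']
      unfold rotDeriv
      simp only [grad_add (SphereContDiff.const _) (SphereContDiff.sum (n := ∞)
        (f := fun i x => b k i * coordFn i x) (fun i _ => by fun_prop) (s := Finset.univ)),
        grad_const, zero_add, grad_sum (f := fun i x => b k i * coordFn i x) (fun i => by fun_prop),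
        grad_const_mul, Finset.mul_sum]
      rw [Finset.sum_comm]
      exact Finset.sum_congr rfl fun _ _ => Finset.sum_congr rfl fun _ _ => by ring
    -- The Casimir identity: the Laplacian of the sphere is the sum of the squares of the three
    -- rotations.
    have h2 : lap h x = ∑ k, rotDeriv k (rotDeriv k h) x := by
      have h3 : ∀ i, (fun z => grad h z i)
          = fun z : S2 => ∑ j, ∑ k, -(eps3 i j k * (z.1 j * rotDeriv k h z)) :=
        fun i => funext fun z => grad_eq_rotDeriv h z i
      have h4 : ∀ i k, grad (rotDeriv k h) x i
          = ∑ j, ∑ l, -(eps3 i j l * (x.1 j * rotDeriv l (rotDeriv k h) x)) :=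
        fun i k => grad_eq_rotDeriv _ x i
      have h5 : ∀ i, grad (fun z : S2 => ∑ j, ∑ k, -(eps3 i j k * (z.1 j * rotDeriv k h z))) x i
          = ∑ j, ∑ k, -(eps3 i j k * (x.1 j * grad (rotDeriv k h) x i
            + roundMetric x i j * rotDeriv k h x)) := by
        intro i
        rw [grad_sum (fun j => by fun_prop)]
        refine Finset.sum_congr rfl fun j _ => ?_
        rw [grad_sum (fun j => by fun_prop)]
        refine Finset.sum_congr rfl fun k _ => ?_
        rw [grad_neg, grad_const_mul, grad_mul (by fun_prop) (by fun_prop), grad_coord]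
      rw [lap_eq]
      simp only [h3, h5]
      unfold rotDeriv
      simp only [rotField_eq, roundMetric, kron, Fin.sum_univ_three, eps3]
      simp
      ring
    rw [h2]
    simp only [h1, rotDeriv_coord, coordFn, Fin.sum_univ_three]
    ring
  -- The dipole that shares the Laplacian of `h` is `-1/2` times that Laplacian, since the
  -- eigenvalue is `-2`. The remainder is harmonic, hence of mode zero.
  refine ⟨fun x => h x - ∑ c, (-(1 / 2) * ∑ k, ∑ i, b k i * eps3 i k c) * coordFn c x,
    fun x => ∑ c, (-(1 / 2) * ∑ k, ∑ i, b k i * eps3 i k c) * coordFn c x,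
    ⟨by fun_prop, fun x => ?_⟩, ⟨by fun_prop, fun x => ?_⟩, fun x => by ring⟩
  all_goals
    have hl : ∀ c : Fin 3 → ℝ, lap (fun x => ∑ i, c i * coordFn i x) x
        = ∑ i, c i * (-2 * coordFn i x) := by
      intro c
      simp only [Fin.sum_univ_three]
      rw [lap_add (by fun_prop) (by fun_prop), lap_add (by fun_prop) (by fun_prop)]
      simp only [lap_const_mul, lap_coordFn]
  · have h1 : (fun x => h x - ∑ c, (-(1 / 2) * ∑ k, ∑ i, b k i * eps3 i k c) * coordFn c x)
        = fun x => h x + (-1) * ∑ c, (-(1 / 2) * ∑ k, ∑ i, b k i * eps3 i k c) * coordFn c x := by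
      funext x; ring
    rw [h1, lap_add hs (by fun_prop), lap_const_mul, hl, hlap]
    simp only [Fin.sum_univ_three]
    push_cast
    ring
  · rw [hl]
    simp only [Fin.sum_univ_three]
    push_cast
    ring
end

noncomputable section

/-! ### Symmetric traceless tensors -/

section Closure

theorem cov1_eq (w : S2 → Fin 3 → ℝ) :
    cov1 w = fun x k i => ∑ b, roundMetric x i b * grad (fun z => w z b) x k := rfl

@[fun_prop] theorem SphereContDiff.cov1 {w : S2 → Fin 3 → ℝ}
    (hw : ∀ i, SphereContDiff ∞ (fun x => w x i)) (k i : Fin 3) :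
    SphereContDiff ∞ (fun x => cov1 w x k i) := by
  simp only [cov1_eq]; fun_prop

@[fun_prop] theorem SphereContDiff.div1 {w : S2 → Fin 3 → ℝ}
    (hw : ∀ i, SphereContDiff ∞ (fun x => w x i)) :
    SphereContDiff ∞ (fun x => div1 w x) := by
  simp only [div1_eq]; fun_prop

@[fun_prop] theorem SphereContDiff.div2 {T : S2 → Fin 3 → Fin 3 → ℝ}
    (hT : ∀ i j, SphereContDiff ∞ (fun x => T x i j)) (j : Fin 3) :
    SphereContDiff ∞ (fun x => div2 T x j) := by
  simp only [div2_eq]; fun_prop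

@[fun_prop] theorem SphereContDiff.contract {S T : S2 → Fin 3 → Fin 3 → ℝ}
    (hS : ∀ i j, SphereContDiff ∞ (fun x => S x i j))
    (hT : ∀ i j, SphereContDiff ∞ (fun x => T x i j)) :
    SphereContDiff ∞ (fun x => contract (S x) (T x)) := by
  unfold _root_.contract; fun_prop

@[fun_prop] theorem SphereContDiff.hess {f : S2 → ℝ} (hf : SphereContDiff ∞ f) (i j : Fin 3) :
    SphereContDiff ∞ (fun x => hess f x i j) := by
  unfold _root_.hess; fun_prop

theorem CylinderSmooth.cov1 {w : ℝ → S2 → Fin 3 → ℝ}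
    (hw : ∀ i, CylinderSmooth (fun u x => w u x i)) (k i : Fin 3) :
    CylinderSmooth (fun u x => cov1 (w u) x k i) := by
  simp only [cov1_eq]
  exact CylinderSmooth.sum fun b _ => (CylinderSmooth.static (by fun_prop)).mul ((hw b).grad k)

theorem CylinderSmooth.div1 {w : ℝ → S2 → Fin 3 → ℝ}
    (hw : ∀ i, CylinderSmooth (fun u x => w u x i)) :
    CylinderSmooth (fun u x => div1 (w u) x) := by
  simp only [div1_eq]
  exact CylinderSmooth.sum fun b _ => (hw b).grad b

theorem CylinderSmooth.div2 {T : ℝ → S2 → Fin 3 → Fin 3 → ℝ}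
    (hT : ∀ i j, CylinderSmooth (fun u x => T u x i j)) (j : Fin 3) :
    CylinderSmooth (fun u x => div2 (T u) x j) := by
  simp only [div2_eq]
  exact CylinderSmooth.sum fun b _ => (CylinderSmooth.static (by fun_prop)).mul
    (CylinderSmooth.sum fun i _ => (hT i b).grad i)

theorem CylinderSmooth.contract {S T : ℝ → S2 → Fin 3 → Fin 3 → ℝ}
    (hS : ∀ i j, CylinderSmooth (fun u x => S u x i j))
    (hT : ∀ i j, CylinderSmooth (fun u x => T u x i j)) :
    CylinderSmooth (fun u x => contract (S u x) (T u x)) :=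
  CylinderSmooth.sum fun i _ => CylinderSmooth.sum fun j _ => (hS i j).mul (hT i j)

end Closure

/-- Smooth symmetric traceless tangential 2-tensors. -/
structure IsSTT (T : S2 → Fin 3 → Fin 3 → ℝ) : Prop where
  smooth : ∀ i j, SphereContDiff ∞ (fun x => T x i j)
  tangent : ∀ x i, ∑ j, T x i j * x.1 j = 0
  symm : ∀ x i j, T x i j = T x j i
  trace : ∀ x, ∑ i, T x i i = 0

theorem IsSTT.tangent_left {T : S2 → Fin 3 → Fin 3 → ℝ} (hT : IsSTT T) (x : S2) (j : Fin 3) :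
    ∑ i, x.1 i * T x i j = 0 := by
  rw [← hT.tangent x j]
  exact Finset.sum_congr rfl fun i _ => by rw [hT.symm x i j, mul_comm]

theorem exists_frame (x : S2) : ∃ p q : Fin 3 → ℝ,
    ∀ a b, p a * p b + q a * q b + x.1 a * x.1 b = kron a b := by
  -- The vector `x` is placed at index 2 and completed to an orthonormal basis. The result is stated
  -- as a completeness relation so that it can be substituted for a Kronecker delta.
  have ho : Orthonormal ℝ (({2} : Set (Fin 3)).domRestrict fun _ => x.1) :=
    ⟨fun i => S2.norm_coe x, fun i j h => absurd (Subsingleton.elim i j) h⟩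
  obtain ⟨b, hb⟩ := ho.exists_orthonormalBasis_extension_of_card_eq (by simp)
  refine ⟨b 0, b 1, fun i j => ?_⟩
  have h := b.sum_inner_mul_inner (EuclideanSpace.single i 1) (EuclideanSpace.single j 1)
  rw [Fin.sum_univ_three, hb 2 rfl] at h
  simp [EuclideanSpace.inner_single_left, EuclideanSpace.inner_single_right] at h
  rw [h]
  simp [kron, eq_comm]

/-- Symmetric traceless tensors on a plane form a two-dimensional space, with `α = N(p, p)` and `β =
N(p, q)` as coordinates. -/
theorem exists_frame_traceless (x : S2) {N : Fin 3 → Fin 3 → ℝ} (ht : ∀ i, ∑ j, N i j * x.1 j = 0)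
    (hs : ∀ i j, N i j = N j i) (htr : ∑ i, N i i = 0) {p q : Fin 3 → ℝ}
    (hpq : ∀ a b, p a * p b + q a * q b + x.1 a * x.1 b = kron a b) :
    ∃ α β : ℝ, ∀ i j, N i j = α * (p i * p j - q i * q j) + β * (p i * q j + q i * p j) := by
  have h0 : ∀ i j, ∑ a, ∑ b, kron i a * N a b * kron b j = N i j := by
    intro i j; simp [kron]
  simp only [← hpq] at h0
  have h1 : ∑ a, ∑ b, kron a b * N a b = ∑ i, N i i := by simp [kron]
  simp only [← hpq, htr] at h1
  have ht' : ∀ j, ∑ i, x.1 i * N i j = 0 := fun j => by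
    rw [← ht j]
    exact Finset.sum_congr rfl fun i _ => by rw [hs i j, mul_comm]
  refine ⟨∑ a, ∑ b, p a * N a b * p b, ∑ a, ∑ b, p a * N a b * q b, fun i j => ?_⟩
  have h01 := hs 0 1
  have h02 := hs 0 2
  have h12 := hs 1 2
  have h2 : ∑ a, ∑ b, q a * N a b * q b = - ∑ a, ∑ b, p a * N a b * p b := by
    simp only [Fin.sum_univ_three] at h1 ht ⊢
    linear_combination h1 - x.1 0 * ht 0 - x.1 1 * ht 1 - x.1 2 * ht 2
  have h3 : ∑ a, ∑ b, q a * N a b * p b = ∑ a, ∑ b, p a * N a b * q b := by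
    simp only [Fin.sum_univ_three, h01, h02, h12]
    ring
  have h4 : N i j = p i * p j * (∑ a, ∑ b, p a * N a b * p b)
      + p i * q j * (∑ a, ∑ b, p a * N a b * q b) + q i * p j * (∑ a, ∑ b, q a * N a b * p b)
      + q i * q j * (∑ a, ∑ b, q a * N a b * q b) := by
    rw [← h0 i j]
    simp only [Fin.sum_univ_three] at ht ht' ⊢
    linear_combination x.1 i * ((p 0 * p j + q 0 * q j + x.1 0 * x.1 j) * ht' 0
      + (p 1 * p j + q 1 * q j + x.1 1 * x.1 j) * ht' 1
      + (p 2 * p j + q 2 * q j + x.1 2 * x.1 j) * ht' 2)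
      + x.1 j * ((p i * p 0 + q i * q 0) * ht 0 + (p i * p 1 + q i * q 1) * ht 1
        + (p i * p 2 + q i * q 2) * ht 2)
  rw [h4, h2, h3]
  ring

/-- The two-dimensional identity for derivatives of symmetric traceless tensors. -/
theorem traceless_derivative_identity (x : S2) {N : Fin 3 → Fin 3 → ℝ} {Y : Fin 3 → ℝ}
    {c : Fin 3 → Fin 3 → Fin 3 → ℝ} (hY : ∑ i, x.1 i * Y i = 0)
    (ht : ∀ i, ∑ j, N i j * x.1 j = 0) (hs : ∀ i j, N i j = N j i) (htr : ∑ i, N i i = 0)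
    (cx : ∀ a b, ∑ i, x.1 i * c i a b = 0) (cs : ∀ i a b, c i a b = c i b a)
    (ctr : ∀ i, ∑ a, c i a a = 0) (cn : ∀ i, ∑ a, ∑ b, x.1 a * x.1 b * c i a b = 0) :
    (∑ a, ∑ i, ∑ b, Y a * N i b * c i a b) + ∑ a, ∑ d, ∑ i, Y a * N a d * c i i d
      = ∑ a, ∑ i, ∑ b, Y a * N i b * c a i b := by
  obtain ⟨p, q, hpq⟩ := exists_frame x
  obtain ⟨α, β, hN⟩ := exists_frame_traceless x ht hs htr hpq
  set T : (Fin 3 → ℝ) → (Fin 3 → ℝ) → (Fin 3 → ℝ) → ℝ :=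
    fun u v w => ∑ i, ∑ a, ∑ b, c i a b * u i * v a * w b with hT
  have Tsym : ∀ u v w, T u v w = T u w v := by
    intro u v w
    simp only [hT]
    refine Finset.sum_congr rfl fun i _ => ?_
    rw [Finset.sum_comm]
    refine Finset.sum_congr rfl fun a _ => Finset.sum_congr rfl fun b _ => ?_
    rw [cs]; ring
  -- The trace over `p` and `q` is the full trace minus the component in the normal direction, and
  -- both vanish by `ctr` and `cn`.
  have Ttr : ∀ u, T u p p + T u q q = 0 := by
    intro u
    have h1 : ∀ i, ∑ a, ∑ b, kron a b * c i a b = 0 := fun i => by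
      rw [← ctr i]; simp [kron]
    simp only [← hpq] at h1
    simp only [hT, Fin.sum_univ_three] at h1 cn ⊢
    linear_combination u 0 * (h1 0 - cn 0) + u 1 * (h1 1 - cn 1) + u 2 * (h1 2 - cn 2)
  have Tdiv : ∀ v : Fin 3 → ℝ, ∑ d, ∑ i, v d * c i i d = T p p v + T q q v := by
    intro v
    have h1 : ∀ d, ∑ i, c i i d = ∑ i, ∑ a, kron i a * c i a d := fun i => by simp [kron]
    simp only [← hpq] at h1
    simp only [hT, Fin.sum_univ_three] at h1 cx ⊢
    linear_combination v 0 * h1 0 + v 1 * h1 1 + v 2 * h1 2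
      + v 0 * (x.1 0 * cx 0 0 + x.1 1 * cx 1 0 + x.1 2 * cx 2 0)
      + v 1 * (x.1 0 * cx 0 1 + x.1 1 * cx 1 1 + x.1 2 * cx 2 1)
      + v 2 * (x.1 0 * cx 0 2 + x.1 1 * cx 1 2 + x.1 2 * cx 2 2)
  obtain ⟨y, z, hYy⟩ : ∃ y z : ℝ, ∀ i, Y i = y * p i + z * q i := by
    refine ⟨∑ a, p a * Y a, ∑ a, q a * Y a, fun i => ?_⟩
    have h1 : ∑ a, kron i a * Y a = Y i := by simp [kron]
    simp only [← hpq] at h1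
    simp only [Fin.sum_univ_three] at h1 hY ⊢
    linear_combination -h1 + x.1 i * hY
  have e1 : (∑ a, ∑ i, ∑ b, Y a * N i b * c i a b)
      = α * (y * T p p p + z * T p q p - y * T q p q - z * T q q q)
        + β * (y * T p p q + z * T p q q + y * T q p p + z * T q q p) := by
    simp only [hYy, hN, hT, Fin.sum_univ_three]
    ring
  have e3 : (∑ a, ∑ i, ∑ b, Y a * N i b * c a i b)
      = α * (y * T p p p + z * T q p p - y * T p q q - z * T q q q)
        + β * (y * T p p q + z * T q p q + y * T p q p + z * T q q p) := by
    simp only [hYy, hN, hT, Fin.sum_univ_three]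
    ring
  -- The completeness relation says that the matrix with columns `p`, `q`, `x` has a right inverse,
  -- its transpose. The transpose is then also a left inverse, which is orthonormality.
  have o1 : ∑ a, p a * p a = 1 ∧ ∑ a, q a * q a = 1 ∧ ∑ a, p a * q a = 0 := by
    let M : Matrix (Fin 3) (Fin 3) ℝ := Matrix.of fun a j => ![p a, q a, x.1 a] j
    have hM : M * M.transpose = 1 := by
      ext a b
      rw [Matrix.mul_apply, Fin.sum_univ_three, Matrix.one_apply]
      exact hpq a b
    have hM' := mul_eq_one_comm.1 hM
    have h0 := congrFun (congrFun hM' 0) 0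
    have h1 := congrFun (congrFun hM' 1) 1
    have h2 := congrFun (congrFun hM' 0) 1
    simp only [Matrix.mul_apply, M, Matrix.transpose_apply, Matrix.of_apply, Matrix.one_apply] at h0 h1 h2
    exact ⟨by simpa using h0, by simpa using h1, by simpa using h2⟩
  have e2 : (∑ a, ∑ d, ∑ i, Y a * N a d * c i i d)
      = ∑ d, ∑ i, (α * (y * p d - z * q d) + β * (y * q d + z * p d)) * c i i d := by
    have hv : ∀ d, ∑ a, Y a * N a d = α * (y * p d - z * q d) + β * (y * q d + z * p d) := by
      intro d
      obtain ⟨h1, h2, h3⟩ := o1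
      simp only [hYy, hN, Fin.sum_univ_three] at h1 h2 h3 ⊢
      linear_combination (α * y * p d + β * y * q d) * h1 + (-α * z * q d + β * z * p d) * h2
        + (α * z * p d - α * y * q d + β * y * p d + β * z * q d) * h3
    rw [Finset.sum_comm]
    refine Finset.sum_congr rfl fun d _ => ?_
    rw [Finset.sum_comm]
    refine Finset.sum_congr rfl fun i _ => ?_
    rw [← hv d, Finset.sum_mul]
  have Tlin : ∀ u, T u u (fun d => α * (y * p d - z * q d) + β * (y * q d + z * p d))
      = α * (y * T u u p - z * T u u q) + β * (y * T u u q + z * T u u p) := by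
    intro u
    simp only [hT, Fin.sum_univ_three]
    ring
  rw [e1, e2, e3, Tdiv, Tlin, Tlin]
  -- In the frame both sides are combinations of components of `T`; they agree modulo symmetry and
  -- tracelessness in the last two slots.
  linear_combination α * y * (Ttr p + Tsym q q p) + α * z * (-Ttr q + Tsym p q p) +
    β * y * (Ttr q - Tsym p q p ) + β * z * (Ttr p - Tsym q p q)
end

noncomputable section

/-! ### The rate of change of the angular momentum -/

/-- Lie derivative along the rotation field of a tangential 2-tensor. -/
def lieRot (k : Fin 3) (T : S2 → Fin 3 → Fin 3 → ℝ) (x : S2) (i j : Fin 3) : ℝ :=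
  rotDeriv k (fun z => T z i j) x + ∑ a, eps3 a k i * T x a j + ∑ a, eps3 a k j * T x i a

theorem SphereContDiff.smooth_one {f : S2 → ℝ} (hf : SphereContDiff ∞ f) :
    SphereContDiff 1 f := hf.of_le (by simp)

theorem sum_mul_div2_aux (v : Fin 3 → ℝ) (T : S2 → Fin 3 → Fin 3 → ℝ) (x : S2) :
    ∑ j, v j * div2 T x j
      = ∑ c, (∑ j, roundMetric x c j * v j) * ∑ i, grad (fun z => T z i c) x i := by
  simp only [div2_eq, Finset.mul_sum (Finset.univ) (fun c => roundMetric _ _ c * _),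
    Finset.sum_mul]
  rw [Finset.sum_comm]
  refine Finset.sum_congr rfl fun c _ => Finset.sum_congr rfl fun j _ => ?_
  rw [roundMetric_comm x j c]; ring

theorem sum_mul_div2 {x : S2} {v : Fin 3 → ℝ} (hv : ∑ i, x.1 i * v i = 0)
    (T : S2 → Fin 3 → Fin 3 → ℝ) :
    ∑ j, v j * div2 T x j = ∑ c, v c * ∑ i, grad (fun z => T z i c) x i := by
  rw [sum_mul_div2_aux]
  simp only [sum_roundMetric_mul hv]

theorem sum_coord_mul_div2 (T : S2 → Fin 3 → Fin 3 → ℝ) (x : S2) :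
    ∑ j, x.1 j * div2 T x j = 0 := by
  rw [sum_mul_div2_aux]
  simp only [sum_roundMetric_mul_coord, zero_mul, Finset.sum_const_zero]

/-- Integration by parts for the divergence of a tensor contracted with a tangential field. -/
theorem sphereIntegral_mul_div2 {v : Fin 3 → S2 → ℝ} {T : S2 → Fin 3 → Fin 3 → ℝ}
    (hv : ∀ i, SphereContDiff ∞ (v i)) (hvt : ∀ x, ∑ i, x.1 i * v i x = 0)
    (hT : ∀ i j, SphereContDiff ∞ (fun x => T x i j))
    (hTt : ∀ x j, ∑ i, x.1 i * T x i j = 0) :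
    sphereIntegral (fun x => ∑ a, v a x * div2 T x a)
      = - sphereIntegral (fun x => ∑ i, ∑ a, grad (v a) x i * T x i a) := by
  have h := sphereIntegral_div (w := fun i x => ∑ a, v a x * T x i a)
    (fun i => SphereContDiff.smooth_one (by fun_prop)) (fun x => by
      have := hTt x
      simp only [Fin.sum_univ_three] at this ⊢
      linear_combination v 0 x * this 0 + v 1 x * this 1 + v 2 x * this 2)
  have h1 : (fun x => ∑ i, grad (fun x => ∑ a, v a x * T x i a) x i)
      = fun x => (∑ a, v a x * div2 T x a) + ∑ i, ∑ a, grad (v a) x i * T x i a := by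
    funext x
    have h2 : ∀ i, grad (fun x => ∑ a, v a x * T x i a) x i
        = ∑ a, (v a x * grad (fun z => T z i a) x i + grad (v a) x i * T x i a) := fun i => by
      rw [grad_sum (fun a => by fun_prop)]
      exact Finset.sum_congr rfl fun a _ => grad_mul (hv a) (hT i a) i
    rw [sum_mul_div2 (v := fun a => v a x) (hvt x)]
    simp only [h2]
    simp only [Fin.sum_univ_three]
    ring
  rw [h1, sphereIntegral_add (SphereContDiff.continuous (n := ∞) (by fun_prop))
    (SphereContDiff.continuous (n := ∞) (by fun_prop))] at h
  linarith

/-- The derivative of `Y` is a constant antisymmetric matrix up to a normal term that `T`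
annihilates. Thus only the antisymmetric part of `T` contributes, as befits a Killing field. -/
theorem sphereIntegral_rotField_mul_div2 (k : Fin 3) {T : S2 → Fin 3 → Fin 3 → ℝ}
    (hT : ∀ i j, SphereContDiff ∞ (fun x => T x i j))
    (hTt : ∀ x j, ∑ i, x.1 i * T x i j = 0) :
    sphereIntegral (fun x => ∑ a, rotField k x a * div2 T x a)
      = - sphereIntegral (fun x => ∑ i, ∑ a, eps3 a k i * T x i a) := by
  rw [sphereIntegral_mul_div2 (v := fun a x => rotField k x a) (fun i => by fun_prop)
    (sum_coord_mul_rotField k) hT hTt]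
  congr 2
  funext x
  have h := hTt x
  simp only [grad_rotField, Fin.sum_univ_three] at h ⊢
  linear_combination -(rotField k x 0) * h 0 - rotField k x 1 * h 1 - rotField k x 2 * h 2

theorem cov1_of_tangent {w : S2 → Fin 3 → ℝ} (hw : ∀ i, SphereContDiff ∞ (fun x => w x i))
    (ht : ∀ x, ∑ i, x.1 i * w x i = 0) (x : S2) (k i : Fin 3) :
    cov1 w x k i = grad (fun z => w z i) x k + x.1 i * w x k := by
  have h := sum_coord_mul_grad_of_tangent hw ht x k
  simp only [cov1, roundMetric, kron, Fin.sum_univ_three] at h ⊢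
  fin_cases i <;> simp
  · linear_combination -(x.1 0) * h
  · linear_combination -(x.1 1) * h
  · linear_combination -(x.1 2) * h

/-- The linear curl term does not contribute to the angular momentum flux. -/
theorem sphereIntegral_rotField_mul_curl (k : Fin 3) {C : S2 → Fin 3 → Fin 3 → ℝ} (hC : IsSTT C) :
    sphereIntegral (fun x => ∑ a, rotField k x a
      * div2 (fun z b a => cov1 (div2 C) z b a - cov1 (div2 C) z a b) x a) = 0 := by
  have hs := hC.smooth
  have hE : ∀ i, SphereContDiff ∞ (fun x => div2 C x i) := fun i => by fun_prop
  have hcov := cov1_of_tangent hE (sum_coord_mul_div2 C)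
  rw [sphereIntegral_rotField_mul_div2 k (fun i j => by fun_prop)]
  · have h1 : (fun x => ∑ i, ∑ a, eps3 a k i * (cov1 (div2 C) x i a - cov1 (div2 C) x a i))
        = fun x => (∑ i, ∑ a, 2 * eps3 a k i * grad (fun z => div2 C z a) x i)
          + ∑ i, ∑ a, 2 * eps3 a k i * (x.1 a * div2 C x i) := by
      funext x
      simp only [hcov, eps3, Fin.sum_univ_three]
      fin_cases k <;> simp <;> ring
    have hx : ∀ i j, Continuous (fun x : S2 => x.1 i * div2 C x j) := fun i j =>
      SphereContDiff.continuous (n := ∞) (by fun_prop)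
    have hg : ∀ i j, Continuous (fun x : S2 => grad (fun z => div2 C z j) x i) := fun i j =>
      SphereContDiff.continuous (n := ∞) (by fun_prop)
    rw [h1, sphereIntegral_add (by fun_prop) (by fun_prop)]
    have h2 : sphereIntegral (fun x => ∑ i, ∑ a, 2 * eps3 a k i * grad (fun z => div2 C z a) x i)
        = ∑ i, ∑ a, 2 * eps3 a k i * (2 * sphereIntegral (fun x => x.1 i * div2 C x a)) := by
      rw [sphereIntegral_sum (fun i _ => by fun_prop)]
      refine Finset.sum_congr rfl fun i _ => ?_
      rw [sphereIntegral_sum (fun i _ => by fun_prop)]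
      refine Finset.sum_congr rfl fun a _ => ?_
      rw [sphereIntegral_const_mul, sphereIntegral_grad (hE a).smooth_one]
    have h3 : sphereIntegral (fun x => ∑ i, ∑ a, 2 * eps3 a k i * (x.1 a * div2 C x i))
        = ∑ i, ∑ a, 2 * eps3 a k i * sphereIntegral (fun x => x.1 a * div2 C x i) := by
      rw [sphereIntegral_sum (fun i _ => by fun_prop)]
      refine Finset.sum_congr rfl fun i _ => ?_
      rw [sphereIntegral_sum (fun i _ => by fun_prop)]
      refine Finset.sum_congr rfl fun a _ => ?_
      rw [sphereIntegral_const_mul]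
    -- The shear is symmetric, so it pairs to zero with the antisymmetric derivative of the Killing
    -- field.
    have h4 : sphereIntegral (fun x => ∑ a, rotField k x a * div2 C x a) = 0 := by
      rw [sphereIntegral_rotField_mul_div2 k hs hC.tangent_left]
      have : (fun x => ∑ i, ∑ a, eps3 a k i * C x i a) = fun _ => 0 := by
        funext x
        have h01 := hC.symm x 0 1
        have h02 := hC.symm x 0 2
        have h12 := hC.symm x 1 2
        simp only [eps3, Fin.sum_univ_three, h01, h02, h12]
        fin_cases k <;> simp <;> ring
      rw [this]; simp [sphereIntegral]
    have h5 : sphereIntegral (fun x => ∑ a, rotField k x a * div2 C x a)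
        = ∑ a, ∑ c, eps3 a k c * sphereIntegral (fun x => x.1 c * div2 C x a) := by
      have : (fun x => ∑ a, rotField k x a * div2 C x a)
          = fun x => ∑ a, ∑ c, eps3 a k c * (x.1 c * div2 C x a) := by
        funext x
        simp only [rotField_eq, Finset.sum_mul, mul_assoc]
      rw [this, sphereIntegral_sum (fun i _ => by fun_prop)]
      refine Finset.sum_congr rfl fun i _ => ?_
      rw [sphereIntegral_sum (fun i _ => by fun_prop)]
      refine Finset.sum_congr rfl fun a _ => ?_
      rw [sphereIntegral_const_mul]
    rw [h5] at h4
    rw [h2, h3]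
    simp only [eps3, Fin.sum_univ_three] at h4 ⊢
    fin_cases k <;> simp at h4 ⊢ <;> linarith
  · intro x j
    have h1 := sum_coord_mul_grad (fun z => div2 C z j) x
    have h2 := sum_coord_mul_grad_of_tangent hE (sum_coord_mul_div2 C) x j
    have h3 := sum_coord_mul_div2 C x
    have h4 := S2.sum_sq x
    simp only [hcov, Fin.sum_univ_three] at h1 h2 h3 h4 ⊢
    linear_combination h1 - h2 + x.1 j * h3 - div2 C x j * h4

/-! ### The terms of the angular momentum flux quadratic in shear and news -/

section Rate
variable {C N : S2 → Fin 3 → Fin 3 → ℝ}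

theorem sphereIntegral_rotField_mul_div2_mul (hC : IsSTT C) (hN : IsSTT N) (k : Fin 3) :
    sphereIntegral (fun x => ∑ a, rotField k x a *
        div2 (fun z b c => ∑ d, C z b d * N z d c) x a)
      = - sphereIntegral (fun x => ∑ i, ∑ a, eps3 a k i * ∑ d, C x i d * N x d a) := by
  have hs := hC.smooth
  have hs' := hN.smooth
  refine sphereIntegral_rotField_mul_div2 k (fun i j => by fun_prop) fun x j => ?_
  have h := hC.tangent_left x
  simp only [Fin.sum_univ_three] at h ⊢
  linear_combination N x 0 j * h 0 + N x 1 j * h 1 + N x 2 j * h 2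

theorem sphereIntegral_rotField_mul_mul_div2 (hC : IsSTT C) (hN : IsSTT N) (k : Fin 3) :
    sphereIntegral (fun x => ∑ a, rotField k x a * ∑ b, C x a b * div2 N x b)
      = - sphereIntegral (fun x => (∑ i, ∑ a, ∑ b, eps3 a k i * C x a b * N x i b)
          + ∑ a, ∑ i, ∑ b, rotField k x a * N x i b * grad (fun z => C z a b) x i) := by
  have hs := hC.smooth
  have hs' := hN.smooth
  have h := sphereIntegral_mul_div2 (v := fun b x => ∑ a, rotField k x a * C x a b) (T := N)
    (fun i => by fun_prop) (fun x => by
      have h := hC.tangent x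
      simp only [Fin.sum_univ_three] at h ⊢
      linear_combination rotField k x 0 * h 0 + rotField k x 1 * h 1 + rotField k x 2 * h 2)
    hs' hN.tangent_left
  have h1 : (fun x => ∑ a, rotField k x a * ∑ b, C x a b * div2 N x b)
      = fun x => ∑ b, (∑ a, rotField k x a * C x a b) * div2 N x b := by
    funext x
    simp only [Fin.sum_univ_three]; ring
  rw [h1, h]
  congr 2
  funext x
  have h2 : ∀ b i, grad (fun x => ∑ a, rotField k x a * C x a b) x i
      = ∑ a, (rotField k x a * grad (fun z => C z a b) x i
        + (eps3 a k i - rotField k x a * x.1 i) * C x a b) := fun b i => by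
    rw [grad_sum (fun a => by fun_prop)]
    refine Finset.sum_congr rfl fun a _ => ?_
    rw [grad_mul (by fun_prop) (by fun_prop), grad_rotField]
  have h3 := hN.tangent_left x
  simp only [h2]
  simp only [Fin.sum_univ_three] at h3 ⊢
  linear_combination -(rotField k x 0 * C x 0 0 + rotField k x 1 * C x 1 0
      + rotField k x 2 * C x 2 0) * h3 0
    - (rotField k x 0 * C x 0 1 + rotField k x 1 * C x 1 1 + rotField k x 2 * C x 2 1) * h3 1
    - (rotField k x 0 * C x 0 2 + rotField k x 1 * C x 1 2 + rotField k x 2 * C x 2 2) * h3 2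

/-- In `N · L_Y C` the transport term `Y^a N^{ib} ∂_a C_{ib}` is not of divergence type.
`traceless_derivative_identity`, applied to `c = ∂C`, trades it for exactly the terms that
integration by parts produces from the evolution equation. -/
theorem contract_lieRot (hC : IsSTT C) (hN : IsSTT N) (k : Fin 3) (x : S2) :
    contract (N x) (lieRot k C x)
      = (∑ a, ∑ i, ∑ b, rotField k x a * N x i b * grad (fun z => C z a b) x i)
        + (∑ a, rotField k x a * ∑ d, N x a d * div2 C x d)
        + (∑ i, ∑ a, ∑ b, eps3 a k i * C x a b * N x i b)
        - ∑ i, ∑ a, eps3 a k i * ∑ d, C x i d * N x d a := by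
  have hs := hC.smooth
  have key := traceless_derivative_identity x (N := N x) (Y := rotField k x)
    (c := fun i a b => grad (fun z => C z a b) x i) (sum_coord_mul_rotField k x) (hN.tangent x)
    (hN.symm x) (hN.trace x) (fun a b => sum_coord_mul_grad _ x)
    (fun i a b => by
      have : (fun z => C z a b) = fun z => C z b a := funext fun z => hC.symm z a b
      rw [this])
    (fun i => by
      rw [← grad_sum (fun a => hs a a)]
      simp only [hC.trace, grad_const])
    (fun i => by
      have h1 : ∀ b, ∑ a, x.1 a * grad (fun z => C z a b) x i = - C x i b := fun b =>
        sum_coord_mul_grad_of_tangent (w := fun a z => C z a b) (fun a => hs a b)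
          (fun z => hC.tangent_left z b) x i
      have h2 := hC.tangent x i
      simp only [Fin.sum_univ_three] at h1 h2 ⊢
      linear_combination x.1 0 * h1 0 + x.1 1 * h1 1 + x.1 2 * h1 2 - h2)
  have h1 : (∑ a, rotField k x a * ∑ d, N x a d * div2 C x d)
      = ∑ a, ∑ d, ∑ i, rotField k x a * N x a d * grad (fun z => C z i d) x i := by
    refine Finset.sum_congr rfl fun a _ => ?_
    have h2 := sum_mul_div2 (x := x) (v := N x a) (by
      rw [← hN.tangent x a]; exact Finset.sum_congr rfl fun _ _ => mul_comm _ _) C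
    rw [h2, Finset.mul_sum]
    refine Finset.sum_congr rfl fun d _ => ?_
    rw [Finset.mul_sum, Finset.mul_sum]
    exact Finset.sum_congr rfl fun i _ => by ring
  rw [h1, key]
  have h01 := hN.symm x 0 1
  have h02 := hN.symm x 0 2
  have h12 := hN.symm x 1 2
  have g01 := hC.symm x 0 1
  have g02 := hC.symm x 0 2
  have g12 := hC.symm x 1 2
  simp only [contract, lieRot, rotDeriv, Fin.sum_univ_three, eps3, h01, h02, h12, g01, g02, g12]
  fin_cases k <;> simp <;> ring

/-- The angular momentum flux density is `-1/4 N^{AB} (L_Y C)_{AB}` up to a divergence. -/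
theorem sphereIntegral_angular_rate (hC : IsSTT C) (hN : IsSTT N) {m : S2 → ℝ}
    (hm : SphereContDiff ∞ m) (k : Fin 3) :
    sphereIntegral (fun x => ∑ a, rotField k x a *
      ((grad m x a
        - (1 / 4) * div2 (fun z b a => cov1 (div2 C) z b a - cov1 (div2 C) z a b) x a
        + (1 / 4) * grad (fun z => contract (C z) (N z)) x a
        - (1 / 4) * div2 (fun z b c => ∑ d, C z b d * N z d c) x a
        + (1 / 2) * ∑ b, C x a b * div2 N x b)
        - (1 / 4) * ∑ d, (N x a d * div2 C x d + C x a d * div2 N x d)))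
      = -(1 / 4) * sphereIntegral (fun x => contract (N x) (lieRot k C x)) := by
  have hs := hC.smooth
  have hs' := hN.smooth
  have i1 := sphereIntegral_rotDeriv hm.smooth_one k
  have i2 := sphereIntegral_rotField_mul_curl k hC
  have i3 := sphereIntegral_rotDeriv (f := fun z => contract (C z) (N z))
    (SphereContDiff.smooth_one (by fun_prop)) k
  have i4 := sphereIntegral_rotField_mul_div2_mul hC hN k
  have i5 := sphereIntegral_rotField_mul_mul_div2 hC hN k
  set f1 := rotDeriv k m with hf1
  set f2 := fun x => ∑ a, rotField k x a
      * div2 (fun z b a => cov1 (div2 C) z b a - cov1 (div2 C) z a b) x a with hf2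
  set f3 := rotDeriv k (fun z => contract (C z) (N z)) with hf3
  set f4 := fun x => ∑ a, rotField k x a *
        div2 (fun z b c => ∑ d, C z b d * N z d c) x a with hf4
  set f5 := fun x => ∑ a, rotField k x a * ∑ b, C x a b * div2 N x b with hf5
  set f6 := fun x => ∑ a, rotField k x a * ∑ d, N x a d * div2 C x d with hf6
  set g4 := fun x => ∑ i, ∑ a, eps3 a k i * ∑ d, C x i d * N x d a with hg4
  set g5 := fun x => (∑ i, ∑ a, ∑ b, eps3 a k i * C x a b * N x i b)
          + ∑ a, ∑ i, ∑ b, rotField k x a * N x i b * grad (fun z => C z a b) x i with hg5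
  have c1 : Continuous f1 := SphereContDiff.continuous (n := ∞) (by fun_prop)
  have c2 : Continuous f2 := SphereContDiff.continuous (n := ∞) (by fun_prop)
  have c3 : Continuous f3 := SphereContDiff.continuous (n := ∞) (by fun_prop)
  have c4 : Continuous f4 := SphereContDiff.continuous (n := ∞) (by fun_prop)
  have c5 : Continuous f5 := SphereContDiff.continuous (n := ∞) (by fun_prop)
  have c6 : Continuous f6 := SphereContDiff.continuous (n := ∞) (by fun_prop)
  have d4 : Continuous g4 := SphereContDiff.continuous (n := ∞) (by fun_prop)
  have d5 : Continuous g5 := SphereContDiff.continuous (n := ∞) (by fun_prop)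
  have e1 : (fun x => ∑ a, rotField k x a *
      ((grad m x a
        - (1 / 4) * div2 (fun z b a => cov1 (div2 C) z b a - cov1 (div2 C) z a b) x a
        + (1 / 4) * grad (fun z => contract (C z) (N z)) x a
        - (1 / 4) * div2 (fun z b c => ∑ d, C z b d * N z d c) x a
        + (1 / 2) * ∑ b, C x a b * div2 N x b)
        - (1 / 4) * ∑ d, (N x a d * div2 C x d + C x a d * div2 N x d)))
      = fun x => (((f1 x - (1 / 4) * f2 x) + ((1 / 4) * f3 x - (1 / 4) * f4 x)) + (1 / 4) * f5 x)
        - (1 / 4) * f6 x := by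
    funext x
    simp only [hf1, hf2, hf3, hf4, hf5, hf6, rotDeriv, Fin.sum_univ_three]
    ring
  have e2 : (fun x => contract (N x) (lieRot k C x)) = fun x => g5 x + f6 x - g4 x := by
    funext x
    rw [contract_lieRot hC hN]
    simp only [hg4, hg5, hf6]
    ring
  rw [e1, e2, sphereIntegral_sub (by fun_prop) (by fun_prop), sphereIntegral_add (by fun_prop)
    (by fun_prop), sphereIntegral_add (by fun_prop) (by fun_prop), sphereIntegral_sub (by fun_prop)
    (by fun_prop), sphereIntegral_sub (by fun_prop) (by fun_prop), sphereIntegral_sub (by fun_prop)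
    (by fun_prop), sphereIntegral_add (by fun_prop) (by fun_prop)]
  simp only [sphereIntegral_const_mul, i1, i2, i3, i4, i5]
  ring

end Rate
end

noncomputable section

/-! ### Uniform bounds for tangential derivatives -/

/-- Tangential derivatives of order at most `n` are `O(w u)`, uniformly for `u ∈ S`. -/
def GradBound (S : Set ℝ) (w : ℝ → ℝ) : ℕ → (ℝ → S2 → ℝ) → Prop
  | 0, F => ∃ K, ∀ u ∈ S, ∀ x, |F u x| ≤ K * w u
  | n + 1, F => (∃ K, ∀ u ∈ S, ∀ x, |F u x| ≤ K * w u) ∧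
      ∀ i, GradBound S w n (fun u x => grad (F u) x i)

namespace GradBound
variable {S S' : Set ℝ} {w w₁ w₂ : ℝ → ℝ} {n : ℕ} {F G : ℝ → S2 → ℝ}

theorem bound (h : GradBound S w n F) : ∃ K, ∀ u ∈ S, ∀ x, |F u x| ≤ K * w u := by
  cases n with
  | zero => exact h
  | succ n => exact h.1

theorem pred (h : GradBound S w (n + 1) F) : GradBound S w n F := by
  induction n generalizing F with
  | zero => exact h.1
  | succ n ih => exact ⟨h.1, fun i => ih (h.2 i)⟩

theorem grad (h : GradBound S w (n + 1) F) (i : Fin 3) :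
    GradBound S w n (fun u x => grad (F u) x i) := h.2 i

theorem union (hw : ∀ u, 0 ≤ w u) (h : GradBound S w n F) (h' : GradBound S' w n F) :
    GradBound (S ∪ S') w n F := by
  induction n generalizing F with
  | zero =>
    obtain ⟨K, hK⟩ := h
    obtain ⟨K', hK'⟩ := h'
    refine ⟨max K K', fun u hu x => ?_⟩
    rcases hu with hu | hu
    · exact (hK u hu x).trans (mul_le_mul_of_nonneg_right (le_max_left _ _) (hw u))
    · exact (hK' u hu x).trans (mul_le_mul_of_nonneg_right (le_max_right _ _) (hw u))
  | succ n ih =>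
    obtain ⟨K, hK⟩ := h.1
    obtain ⟨K', hK'⟩ := h'.1
    refine ⟨⟨max K K', fun u hu x => ?_⟩, fun i => ih (h.2 i) (h'.2 i)⟩
    rcases hu with hu | hu
    · exact (hK u hu x).trans (mul_le_mul_of_nonneg_right (le_max_left _ _) (hw u))
    · exact (hK' u hu x).trans (mul_le_mul_of_nonneg_right (le_max_right _ _) (hw u))

theorem of_isCompact (hS : IsCompact S) (hw : Continuous w) (hw0 : ∀ u, 0 < w u)
    (hF : CylinderSmooth F) : GradBound S w n F := by
  have key : ∀ {F : ℝ → S2 → ℝ}, CylinderSmooth F → ∃ K, ∀ u ∈ S, ∀ x, |F u x| ≤ K * w u := by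
    intro F hF
    obtain ⟨K, hK⟩ := (hS.prod (isCompact_univ (X := S2))).exists_bound_of_continuousOn
      (f := fun p : ℝ × S2 => F p.1 p.2 / w p.1)
      ((hF.continuous.div (hw.comp continuous_fst) fun p => (hw0 p.1).ne').continuousOn)
    refine ⟨K, fun u hu x => ?_⟩
    have h := hK (u, x) ⟨hu, trivial⟩
    rwa [Real.norm_eq_abs, abs_div, abs_of_pos (hw0 u), div_le_iff₀ (hw0 u)] at h
  induction n generalizing F with
  | zero => exact key hF
  | succ n ih => exact ⟨key hF, fun i => ih (hF.grad i)⟩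

theorem add (hF : CylinderSmooth F) (hG : CylinderSmooth G) (h : GradBound S w n F)
    (h' : GradBound S w n G) : GradBound S w n (fun u x => F u x + G u x) := by
  have key : ∀ {F G : ℝ → S2 → ℝ}, (∃ K, ∀ u ∈ S, ∀ x, |F u x| ≤ K * w u) →
      (∃ K, ∀ u ∈ S, ∀ x, |G u x| ≤ K * w u) → ∃ K, ∀ u ∈ S, ∀ x, |F u x + G u x| ≤ K * w u := by
    rintro F G ⟨K, hK⟩ ⟨K', hK'⟩
    refine ⟨K + K', fun u hu x => (abs_add_le _ _).trans ?_⟩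
    rw [add_mul]
    exact add_le_add (hK u hu x) (hK' u hu x)
  induction n generalizing F G with
  | zero => exact key h h'
  | succ n ih =>
    refine ⟨key h.1 h'.1, fun i => ?_⟩
    have := ih (hF.grad i) (hG.grad i) (h.2 i) (h'.2 i)
    simpa only [grad_add (hF.slice _) (hG.slice _)] using this

theorem zero : GradBound S w n (fun _ _ => 0) := by
  induction n with
  | zero => exact ⟨0, by simp⟩
  | succ n ih =>
    refine ⟨⟨0, by simp⟩, fun i => ?_⟩
    simpa only [grad_const] using ih

theorem sum {ι : Type*} {s : Finset ι} {F : ι → ℝ → S2 → ℝ} (hF : ∀ i, CylinderSmooth (F i))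
    (h : ∀ i, GradBound S w n (F i)) : GradBound S w n (fun u x => ∑ i ∈ s, F i u x) := by
  classical
  induction s using Finset.induction_on with
  | empty => simpa using zero
  | insert a s ha ih =>
    simp only [Finset.sum_insert ha]
    exact add (hF a) (CylinderSmooth.sum fun i _ => hF i) (h a) ih

theorem mul (hw : ∀ u, w₁ u * w₂ u ≤ w u) (hw₁ : ∀ u, 0 ≤ w₁ u) (hw₂ : ∀ u, 0 ≤ w₂ u)
    (hF : CylinderSmooth F) (hG : CylinderSmooth G)
    (h : GradBound S w₁ n F) (h' : GradBound S w₂ n G) :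
    GradBound S w n (fun u x => F u x * G u x) := by
  have key : ∀ {F G : ℝ → S2 → ℝ}, (∃ K, ∀ u ∈ S, ∀ x, |F u x| ≤ K * w₁ u) →
      (∃ K, ∀ u ∈ S, ∀ x, |G u x| ≤ K * w₂ u) → ∃ K, ∀ u ∈ S, ∀ x, |F u x * G u x| ≤ K * w u := by
    rintro F G ⟨K, hK⟩ ⟨K', hK'⟩
    refine ⟨|K| * |K'|, fun u hu x => ?_⟩
    rw [abs_mul]
    have h1 : |F u x| ≤ |K| * w₁ u :=
      (hK u hu x).trans (mul_le_mul_of_nonneg_right (le_abs_self K) (hw₁ u))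
    have h2 : |G u x| ≤ |K'| * w₂ u :=
      (hK' u hu x).trans (mul_le_mul_of_nonneg_right (le_abs_self K') (hw₂ u))
    calc |F u x| * |G u x| ≤ (|K| * w₁ u) * (|K'| * w₂ u) :=
          mul_le_mul h1 h2 (abs_nonneg _) (mul_nonneg (abs_nonneg _) (hw₁ u))
      _ = |K| * |K'| * (w₁ u * w₂ u) := by ring
      _ ≤ |K| * |K'| * w u := mul_le_mul_of_nonneg_left (hw u) (by positivity)
  induction n generalizing F G with
  | zero => exact key h h'
  | succ n ih =>
    refine ⟨key h.1 h'.1, fun i => ?_⟩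
    simp only [grad_mul (hF.slice _) (hG.slice _)]
    exact add (hF.mul (hG.grad i)) ((hF.grad i).mul hG) (ih hF (hG.grad i) h.pred (h'.2 i))
      (ih (hF.grad i) hG (h.2 i) h'.pred)

theorem static {f : S2 → ℝ} (hf : SphereContDiff ∞ f) :
    GradBound S (fun _ => 1) n (fun _ x => f x) := by
  induction n generalizing f with
  | zero =>
    obtain ⟨K, hK⟩ := isCompact_univ.exists_bound_of_continuousOn hf.continuous.continuousOn
    exact ⟨K, fun u _ x => by simpa using hK x trivial⟩
  | succ n ih =>
    obtain ⟨K, hK⟩ := isCompact_univ.exists_bound_of_continuousOn hf.continuous.continuousOn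
    exact ⟨⟨K, fun u _ x => by simpa using hK x trivial⟩, fun i => ih (hf.grad i)⟩

theorem static_mul (hw : ∀ u, 0 ≤ w u) {f : S2 → ℝ} (hf : SphereContDiff ∞ f)
    (hG : CylinderSmooth G) (h : GradBound S w n G) :
    GradBound S w n (fun u x => f x * G u x) :=
  mul (w₁ := fun _ => 1) (fun u => by simp) (fun _ => zero_le_one) hw (CylinderSmooth.static hf) hG
    (static hf) h

/-- Bounds on full Euclidean derivatives bound iterated tangential derivatives. -/
theorem of_iteratedFDeriv (hF : ∀ u, SphereContDiff ∞ (F u))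
    (h : ∃ K, ∀ u ∈ S, ∀ x : S2, ∀ m ≤ n, ‖iteratedFDeriv ℝ m (radialExt (F u)) x.1‖ ≤ K * w u) :
    GradBound S w n F := by
  have hbase : ∀ {F : ℝ → S2 → ℝ} {n : ℕ}, (∃ K, ∀ u ∈ S, ∀ x : S2, ∀ m ≤ n,
      ‖iteratedFDeriv ℝ m (radialExt (F u)) x.1‖ ≤ K * w u) →
      ∃ K, ∀ u ∈ S, ∀ x, |F u x| ≤ K * w u := by
    rintro F n ⟨K, hK⟩
    refine ⟨K, fun u hu x => ?_⟩
    have := hK u hu x 0 (Nat.zero_le _)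
    rwa [norm_iteratedFDeriv_zero, radialExt_coe, Real.norm_eq_abs] at this
  induction n generalizing F with
  | zero => exact hbase h
  | succ n ih =>
    refine ⟨hbase h, fun i => ih (fun u => (hF u).grad i) ?_⟩
    obtain ⟨K, hK⟩ := h
    set s : Set E3 := {y | y ≠ 0} with hs
    have hso : IsOpen s := isOpen_ne_zero
    have hsu := hso.uniqueDiffOn (𝕜 := ℝ)
    have hnorm : ContDiffOn ℝ ∞ (fun y : E3 => ‖y‖) s := fun y hy =>
      (contDiffAt_norm ℝ hy).contDiffWithinAt
    -- Passing to the tangential gradient introduces the factor `‖y‖` (see `grad_dir`); its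
    -- derivatives are bounded on the compact sphere and enter through the Leibniz formula.
    have hM : ∀ m, ∃ M, ∀ x : S2, ‖iteratedFDerivWithin ℝ m (fun y : E3 => ‖y‖) s x.1‖ ≤ M := by
      intro m
      have hc : ContinuousOn (iteratedFDerivWithin ℝ m (fun y : E3 => ‖y‖) s) s :=
        hnorm.continuousOn_iteratedFDerivWithin (by exact_mod_cast le_top) hsu
      have hc' : Continuous fun x : S2 => iteratedFDerivWithin ℝ m (fun y : E3 => ‖y‖) s x.1 :=
        hc.comp_continuous continuous_subtype_val S2.coe_ne_zero
      obtain ⟨M, hM⟩ := isCompact_univ.exists_bound_of_continuousOn hc'.continuousOn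
      exact ⟨M, fun x => hM x trivial⟩
    choose M hM using hM
    -- One constant has to serve all orders `m ≤ n`; the Leibniz constants are nonnegative, so their
    -- sum over `m` dominates each.
    refine ⟨∑ m ∈ Finset.range (n + 1), ∑ j ∈ Finset.range (m + 1), (m.choose j : ℝ) * M j * K,
      fun u hu x m hm => ?_⟩
    have hx : x.1 ∈ s := S2.coe_ne_zero x
    set e : E3 := EuclideanSpace.single i 1 with he
    have heq : Set.EqOn (radialExt fun x => _root_.grad (F u) x i)
        (fun y => ‖y‖ * fderiv ℝ (radialExt (F u)) y e) s := fun y hy =>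
      grad_dir hy ((hF u).sdiffAt _) i
    have hd : ContDiffOn ℝ ∞ (fderiv ℝ (radialExt (F u))) s := fun y hy =>
      (((hF u).contDiffAt hy).fderiv_right (m := ∞) (by simp)).contDiffWithinAt
    have h0 : 0 ≤ K * w u := (norm_nonneg _).trans (hK u hu x 0 (Nat.zero_le _))
    have hMn : ∀ j, 0 ≤ M j := fun j => (norm_nonneg _).trans (hM j x)
    have hle : ‖iteratedFDeriv ℝ m (radialExt fun x => _root_.grad (F u) x i) x.1‖
        ≤ ∑ j ∈ Finset.range (m + 1), (m.choose j : ℝ) * M j * (K * w u) := by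
      rw [← iteratedFDerivWithin_of_isOpen m hso hx, iteratedFDerivWithin_congr heq hx]
      refine (norm_iteratedFDerivWithin_mul_le hnorm (hd.clm_apply contDiffOn_const) hsu hx
        (n := m) (by exact_mod_cast le_top)).trans ?_
      refine Finset.sum_le_sum fun j hj => ?_
      have hb : ‖iteratedFDerivWithin ℝ (m - j) (fun y => fderiv ℝ (radialExt (F u)) y e) s x.1‖
          ≤ K * w u := by
        rw [iteratedFDerivWithin_of_isOpen _ hso hx]
        refine (norm_iteratedFDeriv_clm_apply_const (N := ∞) (n := m - j)
          (hd.contDiffAt (hso.mem_nhds hx)) (WithTop.coe_le_coe.2 (le_top : ((m - j : ℕ) : ℕ∞) ≤ ⊤))).trans ?_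
        rw [norm_iteratedFDeriv_fderiv, he, PiLp.norm_single, norm_one, one_mul]
        exact hK u hu x _ (by omega)
      exact mul_le_mul (mul_le_mul_of_nonneg_left (hM j x) (Nat.cast_nonneg _)) hb (norm_nonneg _)
        (mul_nonneg (Nat.cast_nonneg _) (hMn j))
    refine hle.trans ?_
    rw [Finset.sum_mul]
    have h1 : ∀ m', ∑ j ∈ Finset.range (m' + 1), (m'.choose j : ℝ) * M j * (K * w u)
        = (∑ j ∈ Finset.range (m' + 1), (m'.choose j : ℝ) * M j * K) * w u := fun m' => by
      rw [Finset.sum_mul]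
      exact Finset.sum_congr rfl fun j _ => by ring
    rw [h1]
    refine Finset.single_le_sum (f := fun m' =>
      (∑ j ∈ Finset.range (m' + 1), (m'.choose j : ℝ) * M j * K) * w u) (fun m' _ => ?_)
      (Finset.mem_range.2 (by omega : m < n + 1))
    rw [← h1]
    exact Finset.sum_nonneg fun j _ =>
      mul_nonneg (mul_nonneg (Nat.cast_nonneg _) (hMn j)) h0

end GradBound

/-! ### The decay rate -/

/-- The integrable weight `(1 + |u|) ^ (-(1 + ε))`. -/
def decay (ε : ℝ) (u : ℝ) : ℝ := (1 + |u|) ^ (-(1 + ε))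

theorem decay_pos (ε u : ℝ) : 0 < decay ε u := Real.rpow_pos_of_pos (by positivity) _

theorem continuous_decay (ε : ℝ) : Continuous (decay ε) := by
  unfold decay
  exact (continuous_const.add continuous_abs).rpow_const fun u =>
    Or.inl (by positivity : (0 : ℝ) < 1 + |u|).ne'

theorem decay_le_one {ε : ℝ} (hε : 0 < ε) (u : ℝ) : decay ε u ≤ 1 :=
  Real.rpow_le_one_of_one_le_of_nonpos (by linarith [abs_nonneg u]) (by linarith)

theorem integrable_decay {ε : ℝ} (hε : 0 < ε) : Integrable (decay ε) := by
  have := integrable_one_add_norm (E := ℝ) (μ := volume) (r := 1 + ε) (by simpa using hε)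
  simp only [Real.norm_eq_abs] at this
  exact this

/-- Weights at times differing by a bounded amount are comparable, because `1 + |u| ≤ (1 + M)(1 + |u
+ a|)`. A supertranslation by a function on the compact sphere therefore keeps all decay. -/
theorem decay_add_le {ε : ℝ} (hε : 0 < ε) {M : ℝ} {a : ℝ} (ha : |a| ≤ M) (u : ℝ) :
    decay ε (u + a) ≤ (1 + M) ^ (1 + ε) * decay ε u := by
  have hM : 0 ≤ M := (abs_nonneg a).trans ha
  have h1 : 1 + |u| ≤ (1 + M) * (1 + |u + a|) := by
    have h2 : |u| ≤ |u + a| + |a| := by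
      have := abs_sub (u + a) a
      simpa using this
    nlinarith [abs_nonneg (u + a)]
  have h3 : (1 + |u|) ^ (1 + ε) ≤ (1 + M) ^ (1 + ε) * (1 + |u + a|) ^ (1 + ε) := by
    rw [← Real.mul_rpow (by positivity) (by positivity)]
    exact Real.rpow_le_rpow (by positivity) h1 (by linarith)
  have hp : 0 < (1 + |u|) ^ (1 + ε) := Real.rpow_pos_of_pos (by positivity) _
  have hq : 0 < (1 + |u + a|) ^ (1 + ε) := Real.rpow_pos_of_pos (by positivity) _
  unfold decay
  rw [Real.rpow_neg (by positivity), Real.rpow_neg (by positivity), ← div_eq_mul_inv,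
    le_div_iff₀ hp, inv_mul_le_iff₀ hq]
  linarith

theorem rpow_le_decay {ε : ℝ} (hε : 0 < ε) {R u : ℝ} (hR : 0 < R) (hu : R ≤ |u|) :
    |u| ^ (-1 - ε) ≤ (1 + R⁻¹) ^ (1 + ε) * decay ε u := by
  have hu0 : 0 < |u| := hR.trans_le hu
  have h1 : 1 + |u| ≤ (1 + R⁻¹) * |u| := by
    have : 1 ≤ R⁻¹ * |u| := by
      rw [inv_mul_eq_div, le_div_iff₀ hR]; linarith
    linarith
  have h3 : (1 + |u|) ^ (1 + ε) ≤ (1 + R⁻¹) ^ (1 + ε) * |u| ^ (1 + ε) := by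
    rw [← Real.mul_rpow (by positivity) (by positivity)]
    exact Real.rpow_le_rpow (by positivity) h1 (by linarith)
  have hp : 0 < (1 + |u|) ^ (1 + ε) := Real.rpow_pos_of_pos (by positivity) _
  have hq : 0 < |u| ^ (1 + ε) := Real.rpow_pos_of_pos (by positivity) _
  unfold decay
  rw [show -1 - ε = -(1 + ε) by ring, Real.rpow_neg (by positivity), Real.rpow_neg (by positivity),
    ← div_eq_mul_inv, le_div_iff₀ hp, inv_mul_le_iff₀ hq]
  linarith

/-! ### Limits in retarded time -/

theorem integrable_of_decay {ε : ℝ} (hε : 0 < ε) {g : ℝ → ℝ} (hg : Continuous g) {K : ℝ}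
    (hK : ∀ u, |g u| ≤ K * decay ε u) : Integrable g :=
  ((integrable_decay hε).const_mul K).mono' hg.aestronglyMeasurable (Eventually.of_forall hK)

theorem tendsto_of_decay {ε : ℝ} (hε : 0 < ε) {J g : ℝ → ℝ} (hg : Continuous g) {K : ℝ}
    (hK : ∀ u, |g u| ≤ K * decay ε u) (hJ : ∀ u, HasDerivAt J (g u) u) :
    Tendsto J atTop (𝓝 (J 0 + ∫ t in Set.Ioi 0, g t)) ∧
      Tendsto J atBot (𝓝 (J 0 - ∫ t in Set.Iic 0, g t)) := by
  have hi := integrable_of_decay hε hg hK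
  have h1 : ∀ a b, ∫ t in a..b, g t = J b - J a := fun a b =>
    intervalIntegral.integral_eq_sub_of_hasDerivAt (fun u _ => hJ u) (hg.intervalIntegrable _ _)
  have h2 := intervalIntegral_tendsto_integral_Ioi 0 hi.integrableOn tendsto_id
  have h3 := intervalIntegral_tendsto_integral_Iic 0 hi.integrableOn tendsto_id
  simp only [h1, id] at h2 h3
  constructor
  · have := h2.const_add (J 0)
    simpa using this
  · have := h3.const_sub (J 0)
    simpa using this

theorem hasTotalFlux_of_decay {ε : ℝ} (hε : 0 < ε) {J g : ℝ → ℝ} (hg : Continuous g) {K : ℝ}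
    (hK : ∀ u, |g u| ≤ K * decay ε u) (hJ : ∀ u, HasDerivAt J (g u) u) :
    HasTotalFlux J (∫ u, g u) := by
  have hi := integrable_of_decay hε hg hK
  obtain ⟨h1, h2⟩ := tendsto_of_decay hε hg hK hJ
  refine ⟨_, _, h1, h2, ?_⟩
  rw [← intervalIntegral.integral_Iic_add_Ioi (b := 0) hi.integrableOn hi.integrableOn]
  ring

theorem abs_le_of_decay {ε : ℝ} (hε : 0 < ε) {J g : ℝ → ℝ} (hg : Continuous g) {K : ℝ}
    (hK : ∀ u, |g u| ≤ K * decay ε u) (hJ : ∀ u, HasDerivAt J (g u) u) (u : ℝ) :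
    |J u| ≤ |J 0| + K * ∫ t, decay ε t := by
  have h1 : ∫ t in (0 : ℝ)..u, g t = J u - J 0 :=
    intervalIntegral.integral_eq_sub_of_hasDerivAt (fun u _ => hJ u) (hg.intervalIntegrable _ _)
  have h2 : |∫ t in (0 : ℝ)..u, g t| ≤ K * ∫ t, decay ε t := by
    rw [← integral_const_mul]
    refine (intervalIntegral.norm_integral_le_integral_norm_uIoc (f := g) (a := 0) (b := u)
      (μ := volume)).trans ?_
    have hK0 : ∀ t, 0 ≤ K * decay ε t := fun t => (abs_nonneg _).trans (hK t)
    have hi := (integrable_decay hε).const_mul K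
    refine (setIntegral_mono (integrable_of_decay hε hg hK).norm.integrableOn hi.integrableOn
      hK).trans ?_
    exact setIntegral_le_integral hi (Eventually.of_forall hK0)
  have h3 : J u = J 0 + ∫ t in (0 : ℝ)..u, g t := by rw [h1]; ring
  rw [h3]
  exact (abs_add_le _ _).trans (by linarith)

/-- Time integrals of functions with integrable `C¹` bounds are `C¹`. -/
theorem GradBound.sphereContDiff_integral {ε : ℝ} (hε : 0 < ε) {G : ℝ → S2 → ℝ}
    (hG : CylinderSmooth G) (h : GradBound Set.univ (decay ε) 1 G) (T : Set ℝ) :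
    SphereContDiff 1 (fun x => ∫ t in T, G t x) := by
  obtain ⟨K, hK⟩ := h.bound
  choose K' hK' using fun i => (h.grad i).bound
  set Φ := fun p : ℝ × E3 => radialExt (G p.1) p.2 with hΦ
  set A : ℝ → E3 → E3 →L[ℝ] ℝ :=
    fun t y => (fderiv ℝ Φ (t, y)).comp (ContinuousLinearMap.inr ℝ ℝ E3) with hA
  have hder : ∀ t, ∀ y : E3, y ≠ 0 → HasFDerivAt (radialExt (G t)) (A t y) y := by
    intro t y hy
    exact HasFDerivAt.comp (f := fun z : E3 => (t, z)) (g := Φ) y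
      ((hG.contDiffAt t hy).differentiableAt (by simp)).hasFDerivAt (hasFDerivAt_prodMk_right t y)
  have hAc : ∀ p : ℝ × E3, p.2 ≠ 0 → ContinuousAt (fun p : ℝ × E3 => A p.1 p.2) p := by
    intro p hp
    have h1 : ContinuousAt (fderiv ℝ Φ) p :=
      ((hG.contDiffAt p.1 hp).fderiv_right (m := 0) (by simp)).continuousAt
    exact ((ContinuousLinearMap.compL ℝ E3 (ℝ × E3) ℝ).flip
      (ContinuousLinearMap.inr ℝ ℝ E3)).continuous.continuousAt.comp h1
  have hAt : ∀ y : E3, y ≠ 0 → Continuous (fun t => A t y) := fun y hy =>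
    continuous_iff_continuousAt.2 fun t =>
      ContinuousAt.comp (g := fun p : ℝ × E3 => A p.1 p.2) (f := fun t => (t, y)) (hAc (t, y) hy)
        (by fun_prop)
  -- Derivatives of extensions scale like `‖y‖⁻¹`, which is at most 2 here; this gives domination
  -- uniform on a neighbourhood of the sphere.
  have hbound : ∀ t, ∀ y : E3, 1 / 2 < ‖y‖ → ‖A t y‖ ≤ (2 * ∑ i, |K' i|) * decay ε t := by
    intro t y hy
    have hy0 : y ≠ 0 := by rintro rfl; norm_num at hy
    have hs : 0 ≤ ∑ i, |K' i| := Finset.sum_nonneg fun i _ => abs_nonneg _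
    refine ContinuousLinearMap.opNorm_le_bound _
      (mul_nonneg (by positivity) (decay_pos _ _).le) fun v => ?_
    rw [← (hder t y hy0).fderiv, fderiv_radialExt_of_ne_zero hy0 ((hG.slice t).sdiffAt _),
      fderiv_radialExt, Real.norm_eq_abs, abs_mul, abs_of_nonneg (by positivity)]
    have h1 : ‖y‖⁻¹ ≤ 2 := by
      rw [inv_le_comm₀ (by linarith) (by norm_num)]; linarith
    have h2 : |∑ i, _root_.grad (G t) (dir y) i * v i| ≤ (∑ i, |K' i|) * decay ε t * ‖v‖ := by
      refine (Finset.abs_sum_le_sum_abs _ _).trans ?_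
      rw [Finset.sum_mul, Finset.sum_mul]
      refine Finset.sum_le_sum fun i _ => ?_
      rw [abs_mul]
      refine mul_le_mul ((hK' i t trivial _).trans ?_) (PiLp.norm_apply_le v i) (abs_nonneg _)
        (mul_nonneg (abs_nonneg _) (decay_pos _ _).le)
      exact mul_le_mul_of_nonneg_right (le_abs_self _) (decay_pos _ _).le
    calc ‖y‖⁻¹ * |∑ i, _root_.grad (G t) (dir y) i * v i|
        ≤ 2 * ((∑ i, |K' i|) * decay ε t * ‖v‖) := mul_le_mul h1 h2 (abs_nonneg _) (by norm_num)
      _ = _ := by ring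
  have hbi : Integrable (fun t => (2 * ∑ i, |K' i|) * decay ε t) (volume.restrict T) :=
    ((integrable_decay hε).const_mul _).integrableOn
  have hopen : IsOpen {y : E3 | 1 / 2 < ‖y‖} := isOpen_lt continuous_const continuous_norm
  refine .of_contDiffAt fun x => ?_
  rw [contDiffAt_one_iff]
  refine ⟨fun y => ∫ t in T, A t y, {y | 1 / 2 < ‖y‖},
    hopen.mem_nhds (by simp; norm_num), ?_, ?_⟩
  · intro y hy
    have hy0 : y ≠ 0 := by rintro rfl; norm_num at hy
    refine ContinuousAt.continuousWithinAt ?_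
    refine continuousAt_of_dominated (bound := fun t => (2 * ∑ i, |K' i|) * decay ε t) ?_ ?_ hbi ?_
    · filter_upwards [isOpen_ne.mem_nhds hy0] with z hz
      exact (hAt z hz).aestronglyMeasurable
    · filter_upwards [hopen.mem_nhds hy] with z hz
      exact Eventually.of_forall fun t => hbound t z hz
    · refine Eventually.of_forall fun t => ?_
      exact ContinuousAt.comp (g := fun p : ℝ × E3 => A p.1 p.2) (f := fun z => (t, z))
        (hAc (t, y) hy0) (by fun_prop)
  · intro y hy
    have hy0 : y ≠ 0 := by rintro rfl; norm_num at hy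
    refine hasFDerivAt_integral_of_dominated_of_fderiv_le (F := fun y t => radialExt (G t) y)
      (F' := fun y t => A t y) (bound := fun t => (2 * ∑ i, |K' i|) * decay ε t)
      (hopen.mem_nhds hy) ?_ ?_ (hAt y hy0).aestronglyMeasurable ?_ hbi ?_
    · exact Eventually.of_forall fun z => (hG.continuous_left (dir z)).aestronglyMeasurable
    · exact (integrable_of_decay hε (hG.continuous_left (dir y))
        fun u => hK u trivial _).integrableOn
    · exact Eventually.of_forall fun t z hz => hbound t z hz
    · refine Eventually.of_forall fun t z hz => hder t z ?_
      rintro rfl; norm_num at hz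

/-- Fubini together with a translation of retarded time depending on the direction. -/
theorem integral_sphereIntegral_shift {ε : ℝ} (hε : 0 < ε) {q : ℝ → S2 → ℝ}
    (hq : Continuous fun p : ℝ × S2 => q p.1 p.2) {K : ℝ} (hK : ∀ u x, |q u x| ≤ K * decay ε u)
    {f : S2 → ℝ} (hf : Continuous f) :
    ∫ u, sphereIntegral (fun x => q (u + f x) x) = sphereIntegral (fun x => ∫ u, q u x) := by
  obtain ⟨M, hM⟩ := isCompact_univ.exists_bound_of_continuousOn hf.continuousOn
  have hK' : ∀ u x, |q (u + f x) x| ≤ (|K| * (1 + M) ^ (1 + ε)) * decay ε u := by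
    intro u x
    refine (hK _ _).trans ?_
    have h1 := decay_add_le hε (hM x trivial) u
    calc K * decay ε (u + f x) ≤ |K| * decay ε (u + f x) :=
          mul_le_mul_of_nonneg_right (le_abs_self K) (decay_pos _ _).le
      _ ≤ |K| * ((1 + M) ^ (1 + ε) * decay ε u) := mul_le_mul_of_nonneg_left h1 (abs_nonneg K)
      _ = _ := by ring
  have hc : Continuous fun p : ℝ × S2 => q (p.1 + f p.2) p.2 :=
    hq.comp ((continuous_fst.add (hf.comp continuous_snd)).prodMk continuous_snd)
  have hi : Integrable (fun p : ℝ × S2 => q (p.1 + f p.2) p.2)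
      (volume.prod (volume : Measure E3).toSphere) := by
    refine Integrable.mono' (g := fun p : ℝ × S2 => ((|K| * (1 + M) ^ (1 + ε)) * decay ε p.1) * 1)
      (((integrable_decay hε).const_mul _).mul_prod (integrable_const 1))
      hc.aestronglyMeasurable (Eventually.of_forall fun p => ?_)
    rw [mul_one]
    exact hK' p.1 p.2
  unfold sphereIntegral
  rw [integral_integral_swap hi]
  congr 1
  funext x
  -- For each fixed direction `f x` is a constant, and Lebesgue measure in `u` is translation
  -- invariant.
  exact integral_add_right_eq_self (fun u => q u x) (f x)
end

noncomputable section

/-! ### Closure of bounds and smoothness under tensor operations -/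

namespace GradBound
variable {S : Set ℝ} {w : ℝ → ℝ} {n : ℕ}

theorem div1 {v : ℝ → S2 → Fin 3 → ℝ}
    (hv : ∀ i, CylinderSmooth (fun u x => v u x i))
    (h : ∀ i, GradBound S w (n + 1) (fun u x => v u x i)) :
    GradBound S w n (fun u x => div1 (v u) x) := by
  simp only [div1_eq]
  exact sum (fun i => (hv i).grad i) fun i => (h i).grad i

theorem div2 (hw : ∀ u, 0 ≤ w u) {T : ℝ → S2 → Fin 3 → Fin 3 → ℝ}
    (hT : ∀ i j, CylinderSmooth (fun u x => T u x i j))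
    (h : ∀ i j, GradBound S w (n + 1) (fun u x => T u x i j)) (j : Fin 3) :
    GradBound S w n (fun u x => div2 (T u) x j) := by
  simp only [div2_eq]
  refine sum (fun c => ?_) fun c => ?_
  · exact (CylinderSmooth.static (by fun_prop)).mul (CylinderSmooth.sum fun i _ => (hT i c).grad i)
  · exact static_mul hw (by fun_prop) (CylinderSmooth.sum fun i _ => (hT i c).grad i)
      (sum (fun i => (hT i c).grad i) fun i => (h i c).grad i)

/-- Integrate in time from `u = 0`: initial values are bounded by compactness and the rate is
integrable. Tangential derivatives commute with `∂_u`, so every order is treated alike. -/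
theorem of_deriv {ε : ℝ} (hε : 0 < ε) {F : ℝ → S2 → ℝ} (hF : CylinderSmooth F)
    (h : GradBound Set.univ (decay ε) n (fun u x => deriv (fun t => F t x) u)) :
    GradBound Set.univ (fun _ => 1) n F := by
  have key : ∀ {F : ℝ → S2 → ℝ}, CylinderSmooth F →
      (∃ K, ∀ u ∈ Set.univ, ∀ x, |deriv (fun t => F t x) u| ≤ K * decay ε u) →
      ∃ K, ∀ u ∈ (Set.univ : Set ℝ), ∀ x, |F u x| ≤ K * 1 := by
    rintro F hF ⟨K, hK⟩
    obtain ⟨M, hM⟩ := isCompact_univ.exists_bound_of_continuousOn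
      (hF.slice 0).continuous.continuousOn
    refine ⟨M + K * ∫ t, decay ε t, fun u _ x => ?_⟩
    rw [mul_one]
    refine (abs_le_of_decay hε (hF.dt.continuous_left x) (fun u => hK u trivial x)
      (fun u => hF.hasDerivAt u x) u).trans ?_
    exact add_le_add_left (hM x trivial) _
  induction n generalizing F with
  | zero => exact key hF h
  | succ n ih =>
    refine ⟨key hF h.1, fun i => ih (hF.grad i) ?_⟩
    simpa only [hF.deriv_grad] using h.2 i

end GradBound

theorem CylinderSmooth.rotDeriv {F : ℝ → S2 → ℝ} (hF : CylinderSmooth F) (k : Fin 3) :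
    CylinderSmooth (fun u x => rotDeriv k (F u) x) :=
  CylinderSmooth.sum fun a _ => (CylinderSmooth.static (by fun_prop)).mul (hF.grad a)

theorem CylinderSmooth.lieRot {T : ℝ → S2 → Fin 3 → Fin 3 → ℝ}
    (hT : ∀ i j, CylinderSmooth (fun u x => T u x i j)) (k i j : Fin 3) :
    CylinderSmooth (fun u x => lieRot k (T u) x i j) :=
  (((hT i j).rotDeriv k).add (CylinderSmooth.sum fun a _ =>
    (CylinderSmooth.const _).mul (hT a j))).add
    (CylinderSmooth.sum fun a _ => (CylinderSmooth.const _).mul (hT i a))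

theorem GradBound.rotDeriv {S : Set ℝ} {w : ℝ → ℝ} {n : ℕ} (hw : ∀ u, 0 ≤ w u) {F : ℝ → S2 → ℝ}
    (hF : CylinderSmooth F) (h : GradBound S w (n + 1) F) (k : Fin 3) :
    GradBound S w n (fun u x => rotDeriv k (F u) x) :=
  sum (fun a => (CylinderSmooth.static (by fun_prop)).mul (hF.grad a))
    fun a => static_mul hw (by fun_prop) (hF.grad a) (h.grad a)

theorem GradBound.lieRot {S : Set ℝ} {w : ℝ → ℝ} {n : ℕ} (hw : ∀ u, 0 ≤ w u)
    {T : ℝ → S2 → Fin 3 → Fin 3 → ℝ}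
    (hT : ∀ i j, CylinderSmooth (fun u x => T u x i j))
    (h : ∀ i j, GradBound S w (n + 1) (fun u x => T u x i j)) (k i j : Fin 3) :
    GradBound S w n (fun u x => lieRot k (T u) x i j) := by
  have h1 : ∀ (c : ℝ) i j, CylinderSmooth (fun u x => c * T u x i j) := fun c i j =>
    (CylinderSmooth.const _).mul (hT i j)
  have h2 : ∀ (c : ℝ) i j, GradBound S w n (fun u x => c * T u x i j) := fun c i j =>
    static_mul hw (by fun_prop) (hT i j) (h i j).pred
  exact add (((hT i j).rotDeriv k).add (CylinderSmooth.sum fun a _ => h1 _ _ _))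
    (CylinderSmooth.sum fun a _ => h1 _ _ _)
    (add ((hT i j).rotDeriv k) (CylinderSmooth.sum fun a _ => h1 _ _ _)
      ((h i j).rotDeriv hw (hT i j) k) (sum (fun a => h1 _ _ _) fun a => h2 _ _ _))
    (sum (fun a => h1 _ _ _) fun a => h2 _ _ _)

theorem GradBound.contract {S : Set ℝ} {w w₁ w₂ : ℝ → ℝ} {n : ℕ} (hw : ∀ u, w₁ u * w₂ u ≤ w u)
    (hw₁ : ∀ u, 0 ≤ w₁ u) (hw₂ : ∀ u, 0 ≤ w₂ u) {A B : ℝ → S2 → Fin 3 → Fin 3 → ℝ}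
    (hA : ∀ i j, CylinderSmooth (fun u x => A u x i j))
    (hB : ∀ i j, CylinderSmooth (fun u x => B u x i j))
    (h : ∀ i j, GradBound S w₁ n (fun u x => A u x i j))
    (h' : ∀ i j, GradBound S w₂ n (fun u x => B u x i j)) :
    GradBound S w n (fun u x => contract (A u x) (B u x)) :=
  sum (fun i => CylinderSmooth.sum fun j _ => (hA i j).mul (hB i j)) fun i =>
    sum (fun j => (hA i j).mul (hB i j)) fun j =>
      mul hw hw₁ hw₂ (hA i j) (hB i j) (h i j) (h' i j)

theorem decay_mul_decay_le {ε : ℝ} (hε : 0 < ε) (u : ℝ) : decay ε u * decay ε u ≤ decay ε u :=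
  mul_le_of_le_one_left (decay_pos _ _).le (decay_le_one hε u)

theorem CylinderSmooth.hasDerivAt_div2 {T : ℝ → S2 → Fin 3 → Fin 3 → ℝ}
    (hT : ∀ i j, CylinderSmooth (fun u x => T u x i j)) (u : ℝ) (x : S2) (j : Fin 3) :
    HasDerivAt (fun t => _root_.div2 (T t) x j)
      (_root_.div2 (fun z i j => deriv (fun t => T t z i j) u) x j) u := by
  simp only [div2_eq]
  exact HasDerivAt.fun_sum fun c _ =>
    (HasDerivAt.fun_sum fun i _ => (hT i c).hasDerivAt_grad u x i).const_mul _

theorem IsSTT.dt {T : ℝ → S2 → Fin 3 → Fin 3 → ℝ}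
    (hT : ∀ i j, CylinderSmooth (fun u x => T u x i j)) (h : ∀ u, IsSTT (T u)) (u : ℝ) :
    IsSTT (fun x i j => deriv (fun t => T t x i j) u) := by
  refine ⟨fun i j => (hT i j).dt.slice u, fun x i => ?_, fun x i j => ?_, fun x => ?_⟩
  · have h1 : HasDerivAt (fun t => ∑ j, T t x i j * x.1 j)
        (∑ j, deriv (fun t => T t x i j) u * x.1 j) u :=
      HasDerivAt.fun_sum fun j _ => ((hT i j).hasDerivAt u x).mul_const _
    simp only [(h _).tangent] at h1
    exact h1.unique (hasDerivAt_const u 0)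
  · simp only [(h _).symm x i j]
  · have h1 : HasDerivAt (fun t => ∑ i, T t x i i) (∑ i, deriv (fun t => T t x i i) u) u :=
      HasDerivAt.fun_sum fun j _ => (hT j j).hasDerivAt u x
    simp only [(h _).trace] at h1
    exact h1.unique (hasDerivAt_const u 0)

/-! ### Regularity of vacuum data and the evolution of the angular momentum -/

namespace NullInfinityData
variable {D : NullInfinityData} {ε : ℝ}

namespace IsVacuum

theorem smooth_news (hD : D.IsVacuum) (i j : Fin 3) : CylinderSmooth (fun u x => D.news u x i j) :=
  (hD.smooth_C i j).dt

theorem hasDerivAt_C (hD : D.IsVacuum) (u : ℝ) (x : S2) (i j : Fin 3) :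
    HasDerivAt (fun t => D.C t x i j) (D.news u x i j) u := (hD.smooth_C i j).hasDerivAt u x

theorem isSTT_C (hD : D.IsVacuum) (u : ℝ) : IsSTT (D.C u) :=
  ⟨fun i j => (hD.smooth_C i j).slice u, hD.tangent_C u, hD.symm_C u, hD.trace_C u⟩

theorem isSTT_news (hD : D.IsVacuum) (u : ℝ) : IsSTT (D.news u) :=
  IsSTT.dt hD.smooth_C hD.isSTT_C u

theorem hasDerivAt_div2_C (hD : D.IsVacuum) (u : ℝ) (x : S2) (j : Fin 3) :
    HasDerivAt (fun t => div2 (D.C t) x j) (div2 (D.news u) x j) u :=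
  CylinderSmooth.hasDerivAt_div2 hD.smooth_C u x j

theorem smooth_massRate (hD : D.IsVacuum) : CylinderSmooth D.massRate :=
  ((CylinderSmooth.const _).mul (CylinderSmooth.contract hD.smooth_news hD.smooth_news)).add
    ((CylinderSmooth.const _).mul (CylinderSmooth.div1 fun i =>
      CylinderSmooth.div2 hD.smooth_news i))

end IsVacuum

/-- The angular momentum evolution is smooth. -/
theorem smooth_angularRate (hm : CylinderSmooth D.m)
    (hC : ∀ i j, CylinderSmooth (fun u x => D.C u x i j)) (a : Fin 3) :
    CylinderSmooth (fun u x => D.angularRate u x a) := by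
  have hn : ∀ i j, CylinderSmooth (fun u x => D.news u x i j) := fun i j => (hC i j).dt
  have hc : ∀ b a, CylinderSmooth (fun u x => D.curlShear u x b a) := fun b a =>
    (CylinderSmooth.cov1 (fun i => CylinderSmooth.div2 hC i) b a).sub
      (CylinderSmooth.cov1 (fun i => CylinderSmooth.div2 hC i) a b)
  have k : ∀ c : ℝ, CylinderSmooth (fun _ _ => c) := CylinderSmooth.const
  have h4 : CylinderSmooth fun u x => div2 (fun z b c => ∑ d, D.C u z b d * D.news u z d c) x a :=
    CylinderSmooth.div2 (T := fun u z b c => ∑ d, D.C u z b d * D.news u z d c)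
      (fun b c => CylinderSmooth.sum fun d _ => (hC b d).mul (hn d c)) a
  exact ((((hm.grad a).sub ((k _).mul (CylinderSmooth.div2 hc a))).add
    ((k _).mul ((CylinderSmooth.contract hC hn).grad a))).sub ((k _).mul h4)).add
    ((k _).mul (CylinderSmooth.sum fun b _ => (hC a b).mul (CylinderSmooth.div2 hn b)))

namespace IsVacuum

/-- The evolution of the classical angular momentum. -/
theorem hasDerivAt_angularMomentum (hD : D.IsVacuum) (k : Fin 3) (u : ℝ) :
    HasDerivAt (D.angularMomentum k)
      (-(1 / 4) * sphereIntegral (fun x => contract (D.news u x) (lieRot k (D.C u) x))) u := by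
  have hr := smooth_angularRate hD.smooth_m hD.smooth_C
  have hd := CylinderSmooth.div2 hD.smooth_C
  have hd' := CylinderSmooth.div2 hD.smooth_news
  rw [← sphereIntegral_angular_rate (hD.isSTT_C u) (hD.isSTT_news u) (hD.smooth_m.slice u) k]
  refine hasDerivAt_sphereIntegral
    (F := fun u x => ∑ a, rotField k x a *
      (D.N u x a - (1 / 4) * ∑ d, D.C u x a d * div2 (D.C u) x d))
    (F' := fun u x => ∑ a, rotField k x a * (D.angularRate u x a
        - (1 / 4) * ∑ d, (D.news u x a d * div2 (D.C u) x d + D.C u x a d * div2 (D.news u) x d)))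
    (fun t => ?_) ?_ (fun t x => ?_) u
  · refine (CylinderSmooth.slice (F := fun u x => ∑ a, rotField k x a *
      (D.N u x a - (1 / 4) * ∑ d, D.C u x a d * div2 (D.C u) x d)) ?_ t).continuous
    exact CylinderSmooth.sum fun a _ => (CylinderSmooth.static (by fun_prop)).mul
      ((hD.smooth_N a).sub ((CylinderSmooth.const _).mul (CylinderSmooth.sum fun d _ =>
        (hD.smooth_C a d).mul (hd d))))
  · refine CylinderSmooth.continuous (F := fun u x => ∑ a, rotField k x a * (D.angularRate u x a
      - (1 / 4) * ∑ d, (D.news u x a d * div2 (D.C u) x d + D.C u x a d * div2 (D.news u) x d))) ?_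
    exact CylinderSmooth.sum fun a _ => (CylinderSmooth.static (by fun_prop)).mul
      ((hr a).sub ((CylinderSmooth.const _).mul (CylinderSmooth.sum fun d _ =>
        ((hD.smooth_news a d).mul (hd d)).add ((hD.smooth_C a d).mul (hd' d)))))
  · exact HasDerivAt.fun_sum fun a _ => ((hD.evol_N t x a).sub ((HasDerivAt.fun_sum fun d _ =>
      (hD.hasDerivAt_C t x a d).mul (hD.hasDerivAt_div2_C t x d)).const_mul _)).const_mul _

/-! ### Consequences of the decay of the news -/

/-- The asymptotic hypothesis controls `|u| ≥ R` and compactness controls `|u| ≤ R`; together they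
give one global integrable weight. -/
theorem gradBound_news (hD : D.IsVacuum) (hε : 0 < ε) (hN : D.NewsDecay ε) (i j : Fin 3) :
    GradBound Set.univ (decay ε) 3 (fun u x => D.news u x i j) := by
  obtain ⟨K, R, hR, hK⟩ := hN
  have hp : ∀ u, 0 ≤ decay ε u := fun u => (decay_pos ε u).le
  have h1 : GradBound (Set.Icc (-R) R) (decay ε) 3 (fun u x => D.news u x i j) :=
    GradBound.of_isCompact isCompact_Icc (continuous_decay ε) (decay_pos ε) (hD.smooth_news i j)
  have h2 : GradBound {u | R ≤ |u|} (decay ε) 3 (fun u x => D.news u x i j) := by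
    refine GradBound.of_iteratedFDeriv (fun u => (hD.smooth_news i j).slice u)
      ⟨|K| * (1 + R⁻¹) ^ (1 + ε), fun u hu x m hm => (hK u hu x i j m hm).trans ?_⟩
    calc K * |u| ^ (-1 - ε) ≤ |K| * |u| ^ (-1 - ε) :=
          mul_le_mul_of_nonneg_right (le_abs_self K) (Real.rpow_nonneg (abs_nonneg u) _)
      _ ≤ |K| * ((1 + R⁻¹) ^ (1 + ε) * decay ε u) :=
          mul_le_mul_of_nonneg_left (rpow_le_decay hε hR hu) (abs_nonneg K)
      _ = _ := by ring
  have h3 : Set.Icc (-R) R ∪ {u | R ≤ |u|} = Set.univ := by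
    refine Set.eq_univ_of_forall fun u => ?_
    rcases le_total R |u| with h | h
    · exact Or.inr h
    · exact Or.inl (abs_le.1 h)
  rw [← h3]
  exact h1.union hp h2

/-- The double divergence of the news uses two of the three controlled derivatives. The one left
over is what makes `m(±)` of class `C¹`. -/
theorem gradBound_massRate (hD : D.IsVacuum) (hε : 0 < ε) (hN : D.NewsDecay ε) :
    GradBound Set.univ (decay ε) 1 D.massRate := by
  have hp : ∀ u, 0 ≤ decay ε u := fun u => (decay_pos ε u).le
  have hn := hD.gradBound_news hε hN
  have hs := hD.smooth_news
  have s1 := CylinderSmooth.contract hs hs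
  have s2 := CylinderSmooth.div1 (CylinderSmooth.div2 hs)
  exact GradBound.add ((CylinderSmooth.const _).mul s1) ((CylinderSmooth.const _).mul s2)
    (GradBound.static_mul hp (by fun_prop) s1 (GradBound.contract (decay_mul_decay_le hε) hp hp
      hs hs (fun i j => (hn i j).pred.pred) fun i j => (hn i j).pred.pred))
    (GradBound.static_mul hp (by fun_prop) s2 (GradBound.div1 (CylinderSmooth.div2 hs)
      (GradBound.div2 hp hs hn)))

theorem gradBound_C (hD : D.IsVacuum) (hε : 0 < ε) (hN : D.NewsDecay ε) (i j : Fin 3) :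
    GradBound Set.univ (fun _ => 1) 3 (fun u x => D.C u x i j) :=
  GradBound.of_deriv hε (hD.smooth_C i j) (hD.gradBound_news hε hN i j)

end IsVacuum
end NullInfinityData

end

noncomputable section

/-! ### Lie derivatives of Hessians -/

theorem rotDeriv_add {f g : S2 → ℝ} (hf : SphereContDiff ∞ f) (hg : SphereContDiff ∞ g)
    (k : Fin 3) (x : S2) :
    rotDeriv k (fun z => f z + g z) x = rotDeriv k f x + rotDeriv k g x := by
  simp only [rotDeriv, grad_add hf hg, mul_add, Finset.sum_add_distrib]

theorem rotDeriv_sub {f g : S2 → ℝ} (hf : SphereContDiff ∞ f) (hg : SphereContDiff ∞ g)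
    (k : Fin 3) (x : S2) :
    rotDeriv k (fun z => f z - g z) x = rotDeriv k f x - rotDeriv k g x := by
  simp only [rotDeriv, grad_sub hf hg, mul_sub, Finset.sum_sub_distrib]

theorem rotDeriv_const_mul (c : ℝ) (f : S2 → ℝ) (k : Fin 3) (x : S2) :
    rotDeriv k (fun z => c * f z) x = c * rotDeriv k f x := by
  simp only [rotDeriv, grad_const_mul, Finset.mul_sum]
  exact Finset.sum_congr rfl fun _ _ => by ring

theorem rotDeriv_const (c : ℝ) (k : Fin 3) (x : S2) : rotDeriv k (fun _ => c) x = 0 := by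
  simp [rotDeriv, grad_const]

theorem rotDeriv_coe (k j : Fin 3) (x : S2) :
    rotDeriv k (fun z => z.1 j) x = ∑ c, eps3 j k c * x.1 c := rotDeriv_coord k j x

/-- The flow of `Y` consists of isometries, so its Lie derivative commutes with covariant
differentiation. -/
theorem lieRot_hess {f : S2 → ℝ} (hf : SphereContDiff ∞ f) (k : Fin 3) (x : S2) (i j : Fin 3) :
    lieRot k (hess f) x i j = hess (rotDeriv k f) x i j := by
  have h1 : rotDeriv k (fun z => grad f z j)
      = fun z => grad (rotDeriv k f) z j - ∑ a, eps3 a k j * grad f z a :=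
    funext fun z => rotDeriv_grad hf k j z
  have h2 : rotDeriv k (fun z => grad (fun z => grad f z j) z i) x
      = grad (fun z => grad (rotDeriv k f) z j) x i
        - (∑ a, eps3 a k j * grad (fun z => grad f z a) x i)
        - ∑ a, eps3 a k i * grad (fun z => grad f z j) x a := by
    rw [rotDeriv_grad (by fun_prop), h1, grad_sub (by fun_prop) (by fun_prop),
      grad_sum (fun a => by fun_prop)]
    simp only [grad_const_mul]
  have h3 : rotDeriv k (fun z => z.1 j * grad f z i) x
      = x.1 j * (grad (rotDeriv k f) x i - ∑ a, eps3 a k i * grad f x a)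
        + (∑ c, eps3 j k c * x.1 c) * grad f x i := by
    rw [rotDeriv_mul (by fun_prop) (SphereContDiff.smooth_one (by fun_prop)), rotDeriv_coe,
      rotDeriv_grad hf]
  unfold lieRot
  simp only [hess_eq hf, hess_eq (hf.rotDeriv k)]
  rw [rotDeriv_add (by fun_prop) (by fun_prop), h2, h3]
  simp only [eps3_swap _ k j, Fin.sum_univ_three]
  ring

theorem lieRot_roundMetric (k : Fin 3) (x : S2) (i j : Fin 3) :
    lieRot k roundMetric x i j = 0 := by
  have h1 : rotDeriv k (fun z => z.1 i * z.1 j) x = x.1 i * (∑ c, eps3 j k c * x.1 c)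
      + (∑ c, eps3 i k c * x.1 c) * x.1 j := by
    rw [rotDeriv_mul (by fun_prop) (by fun_prop), rotDeriv_coe, rotDeriv_coe]
  unfold lieRot
  simp only [roundMetric]
  rw [rotDeriv_sub (by fun_prop) (by fun_prop), h1, rotDeriv_const]
  fin_cases i <;> fin_cases j <;> fin_cases k <;> simp [Fin.sum_univ_three, eps3, kron] <;> ring

/-! ### Pairing the news with Hessians -/

section Contract
variable {N : S2 → Fin 3 → Fin 3 → ℝ}

theorem IsSTT.contract_roundMetric (hN : IsSTT N) (x : S2) : contract (N x) (roundMetric x) = 0 := by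
  have h1 := hN.trace x
  have h2 := hN.tangent x
  simp only [contract, roundMetric, kron, Fin.sum_univ_three] at h1 h2 ⊢
  simp
  linear_combination h1 - x.1 0 * h2 0 - x.1 1 * h2 1 - x.1 2 * h2 2

theorem IsSTT.contract_hess (hN : IsSTT N) {f : S2 → ℝ} (hf : SphereContDiff ∞ f) (x : S2) :
    contract (N x) (hess f x) = ∑ i, ∑ j, grad (fun z => grad f z j) x i * N x i j := by
  have h2 := hN.tangent x
  simp only [contract, hess_eq hf, Fin.sum_univ_three] at h2 ⊢
  linear_combination grad f x 0 * h2 0 + grad f x 1 * h2 1 + grad f x 2 * h2 2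

theorem sphereIntegral_grad_mul {f : S2 → ℝ} (hf : SphereContDiff ∞ f) {w : S2 → Fin 3 → ℝ}
    (hw : ∀ i, SphereContDiff ∞ (fun x => w x i)) (ht : ∀ x, ∑ i, x.1 i * w x i = 0) :
    sphereIntegral (fun x => ∑ i, grad f x i * w x i) = -sphereIntegral (fun x => f x * div1 w x) := by
  have h1 := sphereIntegral_div (w := fun i x => f x * w x i)
    (fun i => SphereContDiff.smooth_one (by fun_prop)) (fun x => by
      rw [← mul_zero (f x), ← ht x, Finset.mul_sum]
      exact Finset.sum_congr rfl fun i _ => by ring)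
  have h2 : (fun x => ∑ i, grad (fun x => f x * w x i) x i)
      = fun x => f x * div1 w x + ∑ i, grad f x i * w x i := by
    funext x
    simp only [grad_mul hf (hw _), Finset.sum_add_distrib, div1_eq, Finset.mul_sum]
  rw [h2, sphereIntegral_add (SphereContDiff.continuous (n := ∞) (by fun_prop))
    (SphereContDiff.continuous (n := ∞) (by fun_prop))] at h1
  linarith

theorem IsSTT.sphereIntegral_contract_hess (hN : IsSTT N) {f : S2 → ℝ} (hf : SphereContDiff ∞ f) :
    sphereIntegral (fun x => contract (N x) (hess f x))
      = sphereIntegral (fun x => f x * div1 (div2 N) x) := by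
  have hs := hN.smooth
  have h1 := sphereIntegral_mul_div2 (v := fun a x => grad f x a) (fun a => hf.grad a)
    (fun x => sum_coord_mul_grad f x) hs hN.tangent_left
  rw [sphereIntegral_grad_mul hf (fun i => by fun_prop) (sum_coord_mul_div2 N)] at h1
  simp only [hN.contract_hess hf]
  linarith

/-- The Lie derivative of the change of the shear under a supertranslation. -/
theorem IsSTT.contract_lieRot_shear (hN : IsSTT N) {f : S2 → ℝ} (hf : SphereContDiff ∞ f)
    (k : Fin 3) (x : S2) :
    contract (N x) (lieRot k (fun z i j => 2 * hess f z i j - lap f z * roundMetric z i j) x)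
      = 2 * contract (N x) (hess (rotDeriv k f) x) := by
  have h1 : ∀ i j, lieRot k (fun z i j => 2 * hess f z i j - lap f z * roundMetric z i j) x i j
      = 2 * hess (rotDeriv k f) x i j - rotDeriv k (lap f) x * roundMetric x i j := by
    intro i j
    rw [← lieRot_hess hf]
    have h2 := lieRot_roundMetric k x i j
    unfold lieRot at h2 ⊢
    rw [rotDeriv_sub (by fun_prop) (by fun_prop), rotDeriv_const_mul,
      rotDeriv_mul (SphereContDiff.smooth_one (by fun_prop))
        (SphereContDiff.smooth_one (by fun_prop))]
    simp only [Fin.sum_univ_three] at h2 ⊢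
    linear_combination -lap f x * h2
  have h3 := hN.contract_roundMetric x
  simp only [contract, h1, Fin.sum_univ_three] at h3 ⊢
  linear_combination -rotDeriv k (lap f) x * h3

end Contract

namespace NullInfinityData
variable {D D' : NullInfinityData} {ε : ℝ} {f : S2 → ℝ}

/-! ### Limits of the mass aspect -/

/-- The rate of `m` has integrable `C¹` bounds, so its integrals over the two half-lines converge
and are `C¹` in the direction. -/
theorem IsVacuum.exists_mass_limits (hD : D.IsVacuum) (hε : 0 < ε) (hN : D.NewsDecay ε) :
    ∃ mp mm : S2 → ℝ, SphereContDiff 1 mp ∧ SphereContDiff 1 mm ∧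
      (∀ x, Tendsto (fun u => D.m u x) atTop (𝓝 (mp x))) ∧
      (∀ x, Tendsto (fun u => D.m u x) atBot (𝓝 (mm x))) ∧
      ∀ x, mp x - mm x = ∫ u, D.massRate u x := by
  have h := hD.gradBound_massRate hε hN
  have hs := hD.smooth_massRate
  obtain ⟨K, hK⟩ := h.bound
  have h0 := (hD.smooth_m.slice 0).smooth_one
  have ht := fun x => tendsto_of_decay hε (hs.continuous_left x) (fun u => hK u trivial x)
    (fun u => hD.evol_m u x)
  refine ⟨_, _, h0.add (h.sphereContDiff_integral hε hs (Set.Ioi 0)),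
    h0.sub (h.sphereContDiff_integral hε hs (Set.Iic 0)), fun x => (ht x).1, fun x => (ht x).2,
    fun x => ?_⟩
  have hi := integrable_of_decay hε (hs.continuous_left x) fun u => hK u trivial x
  rw [← intervalIntegral.integral_Iic_add_Ioi (b := 0) hi.integrableOn hi.integrableOn]
  ring

/-! ### The flux of the angular momentum under supertranslations -/

theorem IsSupertranslate.news_eq (h : D.IsSupertranslate f D') (u : ℝ)
    (x : S2) (i j : Fin 3) : D'.news u x i j = D.news (u + f x) x i j := by
  unfold news
  simp only [h.shear, deriv_add_const, deriv_sub_const]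
  exact deriv_comp_add_const (fun t => D.C t x i j) (f x) u

/-- The density of the flux of the supertranslated angular momentum. -/
def fluxDensity (D : NullInfinityData) (f : S2 → ℝ) (k : Fin 3) (u : ℝ) (x : S2) : ℝ :=
  contract (D.news u x) (lieRot k (D.C u) x)
    + rotDeriv k f x * contract (D.news u x) (D.news u x)
    - 2 * contract (D.news u x) (hess (rotDeriv k f) x)

/-- The chain rule for `x ↦ C(u + f(x), x)` contributes `N · Y f`, and the static terms contribute
`-2 Hess (Y f)` up to a pure trace. All terms are evaluated on the same cut `u + f`. -/
theorem IsSupertranslate.contract_lieRot (hD : D.IsVacuum) (hf : SphereContDiff ∞ f)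
    (h : D.IsSupertranslate f D') (k : Fin 3) (u : ℝ) (x : S2) :
    contract (D'.news u x) (lieRot k (D'.C u) x) = D.fluxDensity f k (u + f x) x := by
  have h1 : ∀ i j, lieRot k (D'.C u) x i j = lieRot k (D.C (u + f x)) x i j
      + D.news (u + f x) x i j * rotDeriv k f x
      - lieRot k (fun z i j => 2 * hess f z i j - lap f z * roundMetric z i j) x i j := by
    intro i j
    have h2 : ∀ z i j, D'.C u z i j = D.C (u + f z) z i j
        - (2 * hess f z i j - lap f z * roundMetric z i j) := fun z i j => by
      rw [h.shear]; ring
    have h3 : rotDeriv k (fun z => D.C (u + f z) z i j) x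
        = rotDeriv k (fun z => D.C (u + f x) z i j) x
          + D.news (u + f x) x i j * rotDeriv k f x := by
      simp only [rotDeriv, (hD.smooth_C i j).grad_shift hf, mul_add, Finset.sum_add_distrib,
        Finset.mul_sum]
      congr 1
      exact Finset.sum_congr rfl fun a _ => by unfold news; ring
    unfold lieRot
    simp only [h2]
    rw [rotDeriv_sub (((hD.smooth_C i j).shift hf).slice u) (by fun_prop), h3]
    simp only [mul_sub, Finset.sum_sub_distrib]
    ring
  have h4 := (hD.isSTT_news (u + f x)).contract_lieRot_shear hf k x
  have h5 : D'.news u x = D.news (u + f x) x := by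
    funext i j; exact h.news_eq u x i j
  unfold fluxDensity
  rw [h5, ← h4]
  simp only [contract, h1, Fin.sum_univ_three]
  ring

theorem IsVacuum.smooth_fluxDensity (hD : D.IsVacuum) (hf : SphereContDiff ∞ f) (k : Fin 3) :
    CylinderSmooth (D.fluxDensity f k) := by
  have hn := hD.smooth_news
  exact ((CylinderSmooth.contract hn (CylinderSmooth.lieRot hD.smooth_C k)).add
    ((CylinderSmooth.static (by fun_prop)).mul (CylinderSmooth.contract hn hn))).sub
    ((CylinderSmooth.const _).mul (CylinderSmooth.contract hn
      (T := fun _ x => hess (rotDeriv k f) x) fun i j => CylinderSmooth.static (by fun_prop)))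

theorem IsVacuum.bound_fluxDensity (hD : D.IsVacuum) (hε : 0 < ε) (hN : D.NewsDecay ε)
    (hf : SphereContDiff ∞ f) (k : Fin 3) :
    ∃ K, ∀ u x, |D.fluxDensity f k u x| ≤ K * decay ε u := by
  have hn := hD.smooth_news
  have hp : ∀ u, 0 ≤ decay ε u := fun u => (decay_pos ε u).le
  have h1 : ∀ _ : ℝ, (0 : ℝ) ≤ 1 := fun _ => zero_le_one
  have b := fun i j => (hD.gradBound_news hε hN i j).pred.pred.pred
  have s1 := CylinderSmooth.contract hn (CylinderSmooth.lieRot hD.smooth_C k)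
  have s2 := CylinderSmooth.contract hn hn
  have hh : ∀ i j, CylinderSmooth fun (_ : ℝ) x => hess (rotDeriv k f) x i j :=
    fun i j => CylinderSmooth.static (by fun_prop)
  have s3 := CylinderSmooth.contract hn hh
  have b1 := GradBound.contract (w := decay ε) (w₂ := fun _ => 1) (by simp) hp h1 hn
    (CylinderSmooth.lieRot hD.smooth_C k) b
    (GradBound.lieRot h1 hD.smooth_C (fun i j => (hD.gradBound_C hε hN i j).pred.pred) k)
  have b2 := GradBound.contract (decay_mul_decay_le hε) hp hp hn hn b b
  have b3 := GradBound.contract (w := decay ε) (w₂ := fun _ => 1) (by simp) hp h1 hn hh b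
    fun i j => GradBound.static (by fun_prop)
  obtain ⟨K1, hK1⟩ := b1.bound
  obtain ⟨K2, hK2⟩ := (b2.static_mul hp (f := rotDeriv k f) (by fun_prop) s2).bound
  obtain ⟨K3, hK3⟩ := b3.bound
  refine ⟨K1 + K2 + 2 * K3, fun u x => ?_⟩
  have e1 := hK1 u trivial x
  have e2 := hK2 u trivial x
  have e3 := hK3 u trivial x
  unfold fluxDensity
  rw [abs_le] at *
  constructor <;> linarith

theorem IsVacuum.hasTotalFlux (hD : D.IsVacuum) (hε : 0 < ε) (hN : D.NewsDecay ε) (k : Fin 3) :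
    HasTotalFlux (D.angularMomentum k)
      (∫ u, -(1 / 4) * sphereIntegral (D.fluxDensity (fun _ => 0) k u)) := by
  have h0 : SphereContDiff ∞ (fun _ : S2 => (0 : ℝ)) := by fun_prop
  -- The original data are the case `f = 0`; writing their flux with the same density makes the two
  -- fluxes directly comparable.
  have h1 : ∀ u, (fun x => contract (D.news u x) (lieRot k (D.C u) x))
      = D.fluxDensity (fun _ => 0) k u := by
    intro u
    funext x
    have h2 : rotDeriv k (fun _ : S2 => (0 : ℝ)) = fun _ => 0 := funext (rotDeriv_const 0 k)
    have h3 : ∀ i j, hess (fun _ : S2 => (0 : ℝ)) x i j = 0 := fun i j => by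
      rw [hess_eq h0]; simp [grad_const]
    simp [fluxDensity, h2, contract, h3]
  obtain ⟨K, hK⟩ := hD.bound_fluxDensity hε hN h0 k
  have hs := hD.smooth_fluxDensity h0 k
  refine hasTotalFlux_of_decay hε (K := 1 / 4 * (sphereArea * K)) ?_ (fun u => ?_) fun u => ?_
  · exact continuous_const.mul (continuous_iff_continuousAt.2 fun u =>
      (hs.hasDerivAt_sphereIntegral u).continuousAt)
  · rw [abs_mul, mul_assoc, mul_assoc]
    exact mul_le_mul (by norm_num) (abs_sphereIntegral_le (hK u)) (abs_nonneg _) (by norm_num)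
  · rw [← h1]
    exact hD.hasDerivAt_angularMomentum k u

theorem IsSupertranslate.hasTotalFlux (hD : D.IsVacuum) (hε : 0 < ε) (hN : D.NewsDecay ε)
    (hf : SphereContDiff ∞ f) (h : D.IsSupertranslate f D') (k : Fin 3) :
    HasTotalFlux (D'.angularMomentum k)
      (∫ u, -(1 / 4) * sphereIntegral (D.fluxDensity f k u)) := by
  obtain ⟨K, hK⟩ := hD.bound_fluxDensity hε hN hf k
  have hs := hD.smooth_fluxDensity hf k
  have hs' := hs.shift hf
  obtain ⟨M, hM⟩ := isCompact_univ.exists_bound_of_continuousOn hf.continuous.continuousOn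
  have hK' : ∀ u x, |D.fluxDensity f k (u + f x) x|
      ≤ (|K| * (1 + M) ^ (1 + ε)) * decay ε u := by
    intro u x
    refine (hK _ _).trans ?_
    have h1 := decay_add_le hε (hM x trivial) u
    calc K * decay ε (u + f x) ≤ |K| * decay ε (u + f x) :=
          mul_le_mul_of_nonneg_right (le_abs_self K) (decay_pos _ _).le
      _ ≤ |K| * ((1 + M) ^ (1 + ε) * decay ε u) := mul_le_mul_of_nonneg_left h1 (abs_nonneg K)
      _ = _ := by ring
  -- The shift by `f` disappears from the total flux by `integral_sphereIntegral_shift`, used once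
  -- for `f` and once for the zero shift.
  have e : (∫ u, -(1 / 4) * sphereIntegral (D.fluxDensity f k u))
      = ∫ u, -(1 / 4) * sphereIntegral (fun x => D.fluxDensity f k (u + f x) x) := by
    have e1 := integral_sphereIntegral_shift hε hs.continuous hK hf.continuous
    have e2 := integral_sphereIntegral_shift hε hs.continuous hK (continuous_const (y := (0 : ℝ)))
    simp only [add_zero] at e2
    rw [integral_const_mul, integral_const_mul, e1, e2]
  rw [e]
  refine hasTotalFlux_of_decay hε (K := 1 / 4 * (sphereArea * (|K| * (1 + M) ^ (1 + ε))))
    ?_ (fun u => ?_) fun u => ?_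
  · exact continuous_const.mul (continuous_iff_continuousAt.2 fun u =>
      (hs'.hasDerivAt_sphereIntegral u).continuousAt)
  · rw [abs_mul, mul_assoc, mul_assoc]
    exact mul_le_mul (by norm_num) (abs_sphereIntegral_le (hK' u)) (abs_nonneg _) (by norm_num)
  · simp only [← h.contract_lieRot hD hf k]
    exact h.vacuum.hasDerivAt_angularMomentum k u

/-- The term `N · L_Y C` cancels. Two integrations by parts turn `N · Hess (Y f)` into `(Y f) ∇∇N`,
and what is left is `2 Y f` times the mass loss rate; no derivative falls on `m`. -/
theorem IsVacuum.flux_sub (hD : D.IsVacuum) (hε : 0 < ε) (hN : D.NewsDecay ε)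
    (hf : SphereContDiff ∞ f) (k : Fin 3) :
    (∫ u, -(1 / 4) * sphereIntegral (D.fluxDensity f k u))
        - ∫ u, -(1 / 4) * sphereIntegral (D.fluxDensity (fun _ => 0) k u)
      = sphereIntegral (fun x => 2 * rotDeriv k f x * ∫ u, D.massRate u x) := by
  have h0 : SphereContDiff ∞ (fun _ : S2 => (0 : ℝ)) := by fun_prop
  have hL : SphereContDiff ∞ (rotDeriv k f) := by fun_prop
  have hsm := hD.smooth_massRate
  have int : ∀ {g : S2 → ℝ}, SphereContDiff ∞ g →
      Integrable fun u => -(1 / 4) * sphereIntegral (D.fluxDensity g k u) := by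
    intro g hg
    obtain ⟨K, hK⟩ := hD.bound_fluxDensity hε hN hg k
    refine Integrable.const_mul ?_ _
    refine integrable_of_decay hε (K := sphereArea * K) ?_ fun u => ?_
    · exact continuous_iff_continuousAt.2 fun u =>
        ((hD.smooth_fluxDensity hg k).hasDerivAt_sphereIntegral u).continuousAt
    · rw [mul_assoc]
      exact abs_sphereIntegral_le (hK u)
  rw [← integral_sub (int hf) (int h0)]
  have e1 : ∀ u, -(1 / 4) * sphereIntegral (D.fluxDensity f k u)
      - -(1 / 4) * sphereIntegral (D.fluxDensity (fun _ => 0) k u)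
      = sphereIntegral (fun x => 2 * rotDeriv k f x * D.massRate u x) := by
    intro u
    have hn := (hD.isSTT_news u).smooth
    have c1 := ((hD.smooth_fluxDensity hf k).slice u).continuous
    have c2 := ((hD.smooth_fluxDensity h0 k).slice u).continuous
    have c3 : Continuous fun x => contract (D.news u x) (hess (rotDeriv k f) x) :=
      SphereContDiff.continuous (n := ∞) (by fun_prop)
    have c4 : Continuous fun x => rotDeriv k f x * div1 (div2 (D.news u)) x :=
      SphereContDiff.continuous (n := ∞) (by fun_prop)
    have c5 : Continuous fun x => rotDeriv k f x * contract (D.news u x) (D.news u x) :=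
      SphereContDiff.continuous (n := ∞) (by fun_prop)
    have h6 : ∀ x, D.fluxDensity f k u x - D.fluxDensity (fun _ => 0) k u x
        = rotDeriv k f x * contract (D.news u x) (D.news u x)
          - 2 * contract (D.news u x) (hess (rotDeriv k f) x) := by
      intro x
      have h2 : rotDeriv k (fun _ : S2 => (0 : ℝ)) = fun _ => 0 := funext (rotDeriv_const 0 k)
      have h3 : ∀ i j, hess (fun _ : S2 => (0 : ℝ)) x i j = 0 := fun i j => by
        rw [hess_eq h0]; simp [grad_const]
      have h4 : contract (D.news u x) (hess (fun _ : S2 => (0 : ℝ)) x) = 0 := by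
        simp [contract, h3]
      simp only [fluxDensity, h2, h4]
      ring
    rw [← mul_sub, ← sphereIntegral_sub c1 c2]
    simp only [h6]
    rw [sphereIntegral_sub c5 (by fun_prop), sphereIntegral_const_mul,
      (hD.isSTT_news u).sphereIntegral_contract_hess hL]
    have h7 : (fun x => 2 * rotDeriv k f x * D.massRate u x)
        = fun x => -(1 / 4) * (rotDeriv k f x * contract (D.news u x) (D.news u x))
          + (1 / 2) * (rotDeriv k f x * div1 (div2 (D.news u)) x) := by
      funext x
      unfold massRate
      ring
    rw [h7, sphereIntegral_add (by fun_prop) (by fun_prop), sphereIntegral_const_mul,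
      sphereIntegral_const_mul]
    ring
  simp only [e1]
  have hq : CylinderSmooth fun u x => 2 * rotDeriv k f x * D.massRate u x :=
    (CylinderSmooth.static (by fun_prop)).mul hsm
  obtain ⟨K, hK⟩ := ((hD.gradBound_massRate hε hN).static_mul (fun u => (decay_pos ε u).le)
    (f := fun x => 2 * rotDeriv k f x) (by fun_prop) hsm).bound
  have e2 := integral_sphereIntegral_shift hε hq.continuous (fun u x => hK u trivial x)
    (continuous_const (y := (0 : ℝ)))
  simp only [add_zero] at e2
  rw [e2]
  congr 1
  funext x
  exact integral_const_mul _ _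

end NullInfinityData

end

noncomputable section

/-! ### Supertranslated data -/

theorem sum_hess_mul_coord {f : S2 → ℝ} (hf : SphereContDiff ∞ f) (x : S2) (i : Fin 3) :
    ∑ j, hess f x i j * x.1 j = 0 := by
  have h1 := sum_coord_mul_grad_grad hf x i
  have h2 := S2.sum_sq x
  simp only [hess_eq hf, Fin.sum_univ_three] at h1 h2 ⊢
  linear_combination h1 + grad f x i * h2

theorem hess_symm {f : S2 → ℝ} (hf : SphereContDiff ∞ f) (x : S2) (i j : Fin 3) :
    hess f x i j = hess f x j i := by
  rw [hess_eq hf, hess_eq hf, grad_grad_comm hf x i j]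
  ring

theorem sum_hess {f : S2 → ℝ} (hf : SphereContDiff ∞ f) (x : S2) : ∑ i, hess f x i i = lap f x := by
  have h1 := sum_coord_mul_grad f x
  simp only [hess_eq hf, lap_eq, Fin.sum_univ_three] at h1 ⊢
  linear_combination h1

theorem sum_roundMetric (x : S2) : ∑ i, roundMetric x i i = 2 := by
  have h1 := S2.sum_sq x
  simp only [roundMetric, kron, Fin.sum_univ_three] at h1 ⊢
  simp
  linear_combination -h1

/-! ### Divergences of tensors evaluated on the cut `u + f` -/

section Shift
variable {T : ℝ → S2 → Fin 3 → Fin 3 → ℝ} {f : S2 → ℝ}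

theorem div2_shift (hT : ∀ i j, CylinderSmooth (fun u x => T u x i j)) (h : ∀ u, IsSTT (T u))
    (hf : SphereContDiff ∞ f) (u : ℝ) (x : S2) (j : Fin 3) :
    div2 (fun z => T (u + f z) z) x j = div2 (T (u + f x)) x j
      + ∑ i, deriv (fun t => T t x i j) (u + f x) * grad f x i := by
  have h1 : ∑ i, x.1 i * ∑ a, deriv (fun t => T t x a i) (u + f x) * grad f x a = 0 := by
    have := (IsSTT.dt hT h (u + f x)).tangent x
    simp only [Fin.sum_univ_three] at this ⊢
    linear_combination grad f x 0 * this 0 + grad f x 1 * this 1 + grad f x 2 * this 2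
  rw [← sum_roundMetric_mul h1 j, div2_eq, div2_eq, ← Finset.sum_add_distrib]
  refine Finset.sum_congr rfl fun c _ => ?_
  simp only [(hT _ c).grad_shift hf, Finset.sum_add_distrib, mul_add]

/-- Each divergence of `x ↦ T(u + f(x), x)` also differentiates in time. The two mixed terms
coincide by symmetry of `T`, hence the factor 2. Applied to the news, the correction is four times
the `u`-derivative of the extra terms in the transformed mass aspect. -/
theorem div1_div2_shift (hT : ∀ i j, CylinderSmooth (fun u x => T u x i j))
    (h : ∀ u, IsSTT (T u)) (hf : SphereContDiff ∞ f) (u : ℝ) (x : S2) :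
    div1 (div2 (fun z => T (u + f z) z)) x = div1 (div2 (T (u + f x))) x
      + 2 * ∑ d, div2 (fun z i j => deriv (fun t => T t z i j) (u + f x)) x d * grad f x d
      + (∑ b, ∑ d, deriv (fun s => deriv (fun t => T t x b d) s) (u + f x)
          * grad f x b * grad f x d)
      + contract (fun i j => deriv (fun t => T t x i j) (u + f x)) (hess f x) := by
  have hd := IsSTT.dt hT h (u + f x)
  have h1 : div2 (fun z => T (u + f z) z) = fun z j => div2 (T (u + f z)) z j
      + ∑ i, deriv (fun t => T t z i j) (u + f z) * grad f z i :=
    funext fun z => funext fun j => div2_shift hT h hf u z j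
  have s1 : ∀ j, SphereContDiff ∞ fun z => div2 (T (u + f z)) z j := fun j =>
    ((CylinderSmooth.div2 hT j).shift hf).slice u
  have s2 : ∀ i j, SphereContDiff ∞ fun z => deriv (fun t => T t z i j) (u + f z) := fun i j =>
    ((hT i j).dt.shift hf).slice u
  have h2 : ∀ j, grad (fun z => div2 (fun z => T (u + f z) z) z j) x j
      = grad (fun z => div2 (T (u + f x)) z j) x j
        + div2 (fun z i j => deriv (fun t => T t z i j) (u + f x)) x j * grad f x j
        + ∑ i, (deriv (fun t => T t x i j) (u + f x) * grad (fun z => grad f z i) x j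
          + (grad (fun z => deriv (fun t => T t z i j) (u + f x)) x j
          + deriv (fun s => deriv (fun t => T t x i j) s) (u + f x) * grad f x j)
            * grad f x i) := by
    intro j
    rw [h1, grad_add (s1 j) (by fun_prop), (CylinderSmooth.div2 hT j).grad_shift hf,
      (CylinderSmooth.hasDerivAt_div2 hT (u + f x) x j).deriv, grad_sum (fun i => by fun_prop)]
    congr 1
    refine Finset.sum_congr rfl fun i _ => ?_
    rw [grad_mul (s2 i j) (hf.grad i), (hT i j).dt.grad_shift hf]
  have h3 : ∑ d, div2 (fun z i j => deriv (fun t => T t z i j) (u + f x)) x d * grad f x d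
      = ∑ j, ∑ i, grad (fun z => deriv (fun t => T t z i j) (u + f x)) x j * grad f x i := by
    have h4 := sum_mul_div2 (x := x) (v := grad f x) (sum_coord_mul_grad f x)
      (fun z i j => deriv (fun t => T t z i j) (u + f x))
    simp only [mul_comm (div2 _ _ _)]
    rw [h4, Finset.sum_comm]
    refine Finset.sum_congr rfl fun c _ => ?_
    rw [Finset.mul_sum]
    refine Finset.sum_congr rfl fun i _ => ?_
    simp only [hd.symm _ i c]
    ring
  have h5 := hd.contract_hess hf x
  have h6 : ∀ i j, deriv (fun s => deriv (fun t => T t x i j) s) (u + f x)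
      = deriv (fun s => deriv (fun t => T t x j i) s) (u + f x) := fun i j => by
    simp only [(h _).symm x i j]
  have h7 : ∀ i j, deriv (fun t => T t x i j) (u + f x)
      = deriv (fun t => T t x j i) (u + f x) := fun i j => by
    simp only [(h _).symm x i j]
  rw [h5, div1_eq, div1_eq, Finset.sum_congr rfl fun j _ => h2 j, two_mul]
  nth_rw 2 [h3]
  have h8 : ∑ i, ∑ j, grad (fun z => grad f z j) x i * deriv (fun t => T t x i j) (u + f x)
      = ∑ j, ∑ i, deriv (fun t => T t x i j) (u + f x) * grad (fun z => grad f z i) x j :=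
    Finset.sum_congr rfl fun j _ => Finset.sum_congr rfl fun i _ => by rw [h7 j i]; ring
  have h9 : ∑ b, ∑ d, deriv (fun s => deriv (fun t => T t x b d) s) (u + f x)
          * grad f x b * grad f x d
      = ∑ j, ∑ i, deriv (fun s => deriv (fun t => T t x i j) s) (u + f x) * grad f x j
            * grad f x i :=
    Finset.sum_congr rfl fun j _ => Finset.sum_congr rfl fun i _ => by rw [h6 j i]
  rw [h8, h9]
  simp only [Finset.sum_add_distrib, add_mul]
  ring

end Shift

namespace NullInfinityData
variable {D : NullInfinityData} {f : S2 → ℝ}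

theorem sum_angularRate_mul_coord
    (hC : ∀ u x i, ∑ j, D.C u x i j * x.1 j = 0) (hs : ∀ u x i j, D.C u x i j = D.C u x j i)
    (u : ℝ) (x : S2) : ∑ a, D.angularRate u x a * x.1 a = 0 := by
  have h1 := sum_coord_mul_grad (D.m u) x
  have h2 := sum_coord_mul_div2 (D.curlShear u) x
  have h3 := sum_coord_mul_grad (fun z => contract (D.C u z) (D.news u z)) x
  have h4 := sum_coord_mul_div2 (fun z b c => ∑ d, D.C u z b d * D.news u z d c) x
  have h5 : ∑ a, x.1 a * ∑ b, D.C u x a b * div2 (D.news u) x b = 0 := by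
    have h := hC u x
    have h01 := hs u x 0 1
    have h02 := hs u x 0 2
    have h12 := hs u x 1 2
    simp only [Fin.sum_univ_three] at h ⊢
    set v := div2 (D.news u) x
    linear_combination v 0 * h 0 + v 1 * h 1 + v 2 * h 2 + (x.1 0 * v 1 - x.1 1 * v 0) * h01
      + (x.1 0 * v 2 - x.1 2 * v 0) * h02 + (x.1 1 * v 2 - x.1 2 * v 1) * h12
  have h6 : ∑ a, D.angularRate u x a * x.1 a = (∑ a, x.1 a * grad (D.m u) x a)
      - (1 / 4) * (∑ a, x.1 a * div2 (D.curlShear u) x a)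
      + (1 / 4) * (∑ a, x.1 a * grad (fun z => contract (D.C u z) (D.news u z)) x a)
      - (1 / 4) * (∑ a, x.1 a * div2 (fun z b c => ∑ d, D.C u z b d * D.news u z d c) x a)
      + (1 / 2) * ∑ a, x.1 a * ∑ b, D.C u x a b * div2 (D.news u) x b := by
    simp only [Finset.mul_sum (Finset.univ) (fun a => x.1 a * _), ← Finset.sum_add_distrib,
      ← Finset.sum_sub_distrib]
    refine Finset.sum_congr rfl fun a _ => ?_
    unfold angularRate
    ring
  rw [h6, h1, h2, h3, h4, h5]
  ring

/-- The data without angular momentum aspect in supertranslated coordinates. -/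
def supertranslateAux (D : NullInfinityData) (f : S2 → ℝ) : NullInfinityData where
  m u x := D.m (u + f x) x
    + (1 / 2) * ∑ d, div2 (D.news (u + f x)) x d * grad f x d
    + (1 / 4) * ∑ b, ∑ d, deriv (fun t => D.news t x b d) (u + f x) * grad f x b * grad f x d
    + (1 / 4) * contract (D.news (u + f x) x) (hess f x)
  N _ _ _ := 0
  C u x i j := D.C (u + f x) x i j - 2 * hess f x i j + lap f x * roundMetric x i j

/-- The data in supertranslated coordinates. -/
def supertranslate (D : NullInfinityData) (f : S2 → ℝ) : NullInfinityData where
  m := (D.supertranslateAux f).m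
  -- The solution of the evolution equation with value zero at `u = 0`; any other initial value
  -- would give the same flux.
  N u x a := ∫ t in (0 : ℝ)..u, (D.supertranslateAux f).angularRate t x a
  C := (D.supertranslateAux f).C

theorem IsVacuum.isSupertranslate (hD : D.IsVacuum) (hf : SphereContDiff ∞ f) :
    D.IsSupertranslate f (D.supertranslate f) := by
  have hn := hD.smooth_news
  have k : ∀ c : ℝ, CylinderSmooth (fun _ _ => c) := CylinderSmooth.const
  have sC : ∀ i j, CylinderSmooth fun u x => (D.supertranslate f).C u x i j := fun i j =>
    (((hD.smooth_C i j).shift hf).sub (CylinderSmooth.static (f := fun x => 2 * hess f x i j)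
      (by fun_prop))).add (CylinderSmooth.static (f := fun x => lap f x * roundMetric x i j)
      (by fun_prop))
  have sm : CylinderSmooth (D.supertranslate f).m := by
    refine ((hD.smooth_m.shift hf).add ((k _).mul (CylinderSmooth.sum fun d _ => ?_))).add
      ((k _).mul (CylinderSmooth.sum fun b _ => CylinderSmooth.sum fun d _ => ?_)) |>.add
      ((k _).mul (CylinderSmooth.sum fun i _ => CylinderSmooth.sum fun j _ => ?_))
    · exact ((CylinderSmooth.div2 hn d).shift hf).mul (CylinderSmooth.static (by fun_prop))
    · exact (((hn b d).dt.shift hf).mul (CylinderSmooth.static (by fun_prop))).mul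
        (CylinderSmooth.static (by fun_prop))
    · exact ((hn i j).shift hf).mul (CylinderSmooth.static (by fun_prop))
  have tC : ∀ u x i, ∑ j, (D.supertranslate f).C u x i j * x.1 j = 0 := by
    intro u x i
    have h1 := hD.tangent_C (u + f x) x i
    have h2 := sum_hess_mul_coord hf x i
    have h3 := sum_roundMetric_mul_coord x i
    simp only [supertranslate, supertranslateAux, Fin.sum_univ_three] at h1 h2 h3 ⊢
    linear_combination h1 - 2 * h2 + lap f x * h3
  have yC : ∀ u x i j, (D.supertranslate f).C u x i j = (D.supertranslate f).C u x j i := by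
    intro u x i j
    simp only [supertranslate, supertranslateAux]
    rw [hD.symm_C, hess_symm hf, roundMetric_comm]
  have hnews : ∀ u x, (D.supertranslate f).news u x = D.news (u + f x) x := by
    intro u x
    funext i j
    simp only [news, supertranslate, supertranslateAux, deriv_add_const, deriv_sub_const]
    exact deriv_comp_add_const (fun t => D.C t x i j) (f x) u
  have sr : ∀ a, CylinderSmooth fun u x => (D.supertranslateAux f).angularRate u x a := fun a =>
    smooth_angularRate (D := D.supertranslateAux f) sm sC a
  refine ⟨⟨sm, fun a => (sr a).primitive, sC, fun u x => ?_, tC, yC, fun u x => ?_, fun u x => ?_,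
    fun u x a => (sr a).hasDerivAt_primitive u x⟩, fun _ _ _ _ => rfl, fun _ _ => rfl⟩
  -- The rate is tangential at all times, so its time integral starting from zero is tangential too.
  · have h1 : ∀ a, (D.supertranslate f).N u x a * x.1 a
        = ∫ t in (0 : ℝ)..u, (D.supertranslateAux f).angularRate t x a * x.1 a := fun a =>
      (intervalIntegral.integral_mul_const _ _).symm
    have hc : ∀ a, Continuous fun t => (D.supertranslateAux f).angularRate t x a * x.1 a :=
      fun a => ((sr a).continuous_left x).mul continuous_const
    simp only [h1]
    rw [← intervalIntegral.integral_finsetSum fun a _ => (hc a).intervalIntegrable _ _]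
    simp only [sum_angularRate_mul_coord (D := D.supertranslateAux f) tC yC,
      intervalIntegral.integral_zero]
  · have h1 := hD.trace_C (u + f x) x
    have h2 := sum_hess hf x
    have h3 := sum_roundMetric x
    simp only [supertranslate, supertranslateAux, Fin.sum_univ_three] at h1 h2 h3 ⊢
    linear_combination h1 - 2 * h2 + lap f x * h3
  · have hu : HasDerivAt (fun t : ℝ => t + f x) 1 u := (hasDerivAt_id u).add_const _
    have sh : ∀ {g : ℝ → ℝ} {g' : ℝ}, HasDerivAt g g' (u + f x) →
        HasDerivAt (fun t => g (t + f x)) g' u := fun {g g'} hg => hg.comp_add_const u (f x)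
    have e1 := sh (hD.evol_m (u + f x) x)
    have e2 : HasDerivAt (fun t => ∑ d, div2 (D.news (t + f x)) x d * grad f x d)
        (∑ d, div2 (fun z i j => deriv (fun t => D.news t z i j) (u + f x)) x d * grad f x d) u :=
      HasDerivAt.fun_sum fun d _ =>
        (sh (CylinderSmooth.hasDerivAt_div2 hn (u + f x) x d)).mul_const _
    have e3 : HasDerivAt (fun t => ∑ b, ∑ d, deriv (fun t => D.news t x b d) (t + f x)
          * grad f x b * grad f x d)
        (∑ b, ∑ d, deriv (fun s => deriv (fun t => D.news t x b d) s) (u + f x)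
          * grad f x b * grad f x d) u :=
      HasDerivAt.fun_sum fun b _ => HasDerivAt.fun_sum fun d _ =>
        ((sh ((hn b d).dt.hasDerivAt (u + f x) x)).mul_const _).mul_const _
    have e4 : HasDerivAt (fun t => contract (D.news (t + f x) x) (hess f x))
        (contract (fun i j => deriv (fun t => D.news t x i j) (u + f x)) (hess f x)) u :=
      HasDerivAt.fun_sum fun b _ => HasDerivAt.fun_sum fun d _ =>
        (sh ((hn b d).hasDerivAt (u + f x) x)).mul_const _
    -- The quadratic news term is just shifted. The double divergence of the shifted news generates
    -- precisely the derivatives of the three correction terms in the mass aspect.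
    refine (((e1.add (e2.const_mul _)).add (e3.const_mul _)).add (e4.const_mul _)).congr_deriv ?_
    have h1 : (D.supertranslate f).news u = fun z => D.news (u + f z) z := funext fun z => hnews u z
    unfold massRate
    rw [h1, div1_div2_shift hn hD.isSTT_news hf]
    ring

end NullInfinityData

end

noncomputable section

/-! ### Supertranslation invariance of the total flux -/

theorem HasTotalFlux.unique {J : ℝ → ℝ} {Φ Φ' : ℝ} (h : HasTotalFlux J Φ) (h' : HasTotalFlux J Φ') :
    Φ = Φ' := by
  obtain ⟨a, b, h1, h2, rfl⟩ := h
  obtain ⟨a', b', h3, h4, rfl⟩ := h'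
  rw [tendsto_nhds_unique h1 h3, tendsto_nhds_unique h2 h4]

namespace NullInfinityData
variable {D D' : NullInfinityData} {ε : ℝ} {h : S2 → ℝ}

/-- The change of the total flux under a supertranslation. -/
theorem IsVacuum.exists_flux (hD : D.IsVacuum) (hε : 0 < ε) (hN : D.NewsDecay ε)
    (hh : ∀ x, h x = ∫ u, D.massRate u x) {f : S2 → ℝ} (hf : SphereContDiff ∞ f)
    (hS : D.IsSupertranslate f D') (k : Fin 3) :
    ∃ Φ Φ' : ℝ, HasTotalFlux (D.angularMomentum k) Φ ∧ HasTotalFlux (D'.angularMomentum k) Φ' ∧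
      Φ' - Φ = 2 * sphereIntegral (fun x => h x * rotDeriv k f x) := by
  refine ⟨_, _, hD.hasTotalFlux hε hN k, hS.hasTotalFlux hD hε hN hf k, ?_⟩
  rw [hD.flux_sub hε hN hf, ← sphereIntegral_const_mul]
  congr 1
  funext x
  rw [hh]
  ring

theorem IsVacuum.hasTotalFlux_linearMomentum (hD : D.IsVacuum) (hε : 0 < ε) (hN : D.NewsDecay ε)
    (hh : ∀ x, h x = ∫ u, D.massRate u x) (j : Fin 3) :
    HasTotalFlux (D.linearMomentum j) (2 * sphereIntegral (fun x => h x * coordFn j x)) := by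
  have hs := hD.smooth_massRate
  have sc : CylinderSmooth fun _ x => coordFn j x := CylinderSmooth.static (by fun_prop)
  have k : ∀ c : ℝ, CylinderSmooth (fun _ _ => c) := CylinderSmooth.const
  have hq : CylinderSmooth fun u x => 2 * D.massRate u x * coordFn j x := ((k 2).mul hs).mul sc
  obtain ⟨K, hK⟩ := ((hD.gradBound_massRate hε hN).static_mul (fun u => (decay_pos ε u).le)
    (f := fun x => 2 * coordFn j x) (by fun_prop) hs).bound
  have hK' : ∀ u x, |2 * D.massRate u x * coordFn j x| ≤ K * decay ε u := fun u x => by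
    have := hK u trivial x
    rwa [mul_right_comm] at this
  have e := integral_sphereIntegral_shift hε hq.continuous hK' (continuous_const (y := (0 : ℝ)))
  simp only [add_zero] at e
  have e' : 2 * sphereIntegral (fun x => h x * coordFn j x)
      = ∫ u, sphereIntegral (fun x => 2 * D.massRate u x * coordFn j x) := by
    rw [e, ← sphereIntegral_const_mul]
    congr 1
    funext x
    rw [hh, integral_mul_const, integral_const_mul]
    ring
  rw [e']
  refine hasTotalFlux_of_decay hε (K := sphereArea * K) ?_ (fun u => ?_) fun u => ?_
  · exact continuous_iff_continuousAt.2 fun u => (hq.hasDerivAt_sphereIntegral u).continuousAt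
  · rw [mul_assoc]
    exact abs_sphereIntegral_le (hK' u)
  · exact hasDerivAt_sphereIntegral (F := fun u x => 2 * D.m u x * coordFn j x)
      (fun t => (CylinderSmooth.slice (((k 2).mul hD.smooth_m).mul sc) t).continuous)
      hq.continuous (fun t x => ((hD.evol_m t x).const_mul _).mul_const _) u

/-- The total flux is supertranslation invariant if and only if the mass aspect changes only in
the modes `ℓ ≤ 1`. -/
theorem IsVacuum.fluxSupertranslationInvariant_iff (hD : D.IsVacuum) (hε : 0 < ε)
    (hN : D.NewsDecay ε) (h1 : SphereContDiff 1 h) (hh : ∀ x, h x = ∫ u, D.massRate u x) :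
    D.FluxSupertranslationInvariant ↔ SupportedLeOne h := by
  constructor
  · rintro ⟨H, -⟩
    refine supportedLeOne_of_forall h1 fun k f hf hf2 => ?_
    have hS := hD.isSupertranslate hf
    obtain ⟨Φ, e1, e2⟩ := H f _ hf hf2 hS k
    obtain ⟨Φ₁, Φ₂, e3, e4, e5⟩ := hD.exists_flux hε hN hh hf hS k
    -- Invariance makes the change of flux zero; antisymmetry of the rotation moves it from `f` to
    -- `h`, the form needed for `supportedLeOne_of_forall`.
    rw [← e1.unique e3, ← e2.unique e4, sphereIntegral_mul_rotDeriv h1 hf.smooth_one] at e5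
    linarith
  · rintro ⟨f₀, f₁, m0, m1, e⟩
    refine ⟨fun f D' hf hf2 hS k => ?_, fun α₀ α D' hS k => ?_⟩
    · obtain ⟨Φ, Φ', e3, e4, e5⟩ := hD.exists_flux hε hN hh hf hS k
      have e6 : Φ' = Φ := by
        have s0 := m0.1
        have s1 := m1.1
        -- Rotations preserve the modes 0 and 1, so `Y_k h` is again supported there and is
        -- orthogonal to `f`.
        have e7 : (fun x => f x * rotDeriv k h x)
            = fun x => f x * rotDeriv k f₀ x + f x * rotDeriv k f₁ x := by
          funext x
          rw [funext e, rotDeriv_add m0.1 m1.1, mul_add]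
        rw [sphereIntegral_mul_rotDeriv h1 hf.smooth_one, e7,
          sphereIntegral_add (SphereContDiff.continuous (n := ∞) (by fun_prop))
            (SphereContDiff.continuous (n := ∞) (by fun_prop)),
          hf2 0 (by norm_num) _ (m0.rotDeriv k), hf2 1 le_rfl _ (m1.rotDeriv k)] at e5
        linarith
      exact ⟨Φ, e3, e6 ▸ e4⟩
    · have hf : SphereContDiff ∞ fun x => α₀ + ∑ i, α i * coordFn i x := by fun_prop
      obtain ⟨Φ, Φ', e3, e4, e5⟩ := hD.exists_flux hε hN hh hf hS k
      refine ⟨Φ, Φ', _, e3, e4, fun j => hD.hasTotalFlux_linearMomentum hε hN hh j, ?_⟩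
      -- A rotation maps coordinates to coordinates and kills constants, so the change of flux is a
      -- combination of dipole moments of `h`; twice these moments are the changes of linear
      -- momentum.
      have e6 : (fun x => h x * rotDeriv k (fun x => α₀ + ∑ i, α i * coordFn i x) x)
          = fun x => ∑ i, ∑ j, α i * eps3 i k j * (h x * coordFn j x) := by
        funext x
        rw [rotDeriv_add (by fun_prop) (by fun_prop), rotDeriv_const,
          rotDeriv_sum fun i => by fun_prop]
        simp only [rotDeriv_const_mul, rotDeriv_coord, zero_add, Finset.mul_sum]
        exact Finset.sum_congr rfl fun i _ => Finset.sum_congr rfl fun j _ => by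
          unfold coordFn; ring
      have hc : ∀ j, Continuous fun x => h x * coordFn j x := fun j =>
        SphereContDiff.continuous (n := 1) (by fun_prop)
      rw [e5, e6, sphereIntegral_sum fun i _ => by fun_prop, Finset.mul_sum]
      refine Finset.sum_congr rfl fun i _ => ?_
      rw [sphereIntegral_sum fun j _ => by fun_prop, Finset.mul_sum]
      refine Finset.sum_congr rfl fun j _ => ?_
      rw [sphereIntegral_const_mul]
      ring

end NullInfinityData

end

noncomputable section

/-! ### The curvature in terms of derivatives of the metric -/

section SecondDeriv
variable {E : Type*} [NormedAddCommGroup E] [NormedSpace ℝ E] {F : E → ℝ} {p : E}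

/-- The second derivative as a bilinear form. -/
def secondDeriv (F : E → ℝ) (p v w : E) : ℝ := fderiv ℝ (fderiv ℝ F) p v w

theorem differentiableAt_fderiv (hF : ContDiffAt ℝ 2 F p) : DifferentiableAt ℝ (fderiv ℝ F) p :=
  (hF.fderiv_right (m := 1) (by norm_num)).differentiableAt one_ne_zero

theorem hasFDerivAt_fderiv_apply (hF : ContDiffAt ℝ 2 F p) (v : E) :
    HasFDerivAt (fun q => fderiv ℝ F q v)
      ((ContinuousLinearMap.apply ℝ ℝ v).comp (fderiv ℝ (fderiv ℝ F) p)) p :=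
  (ContinuousLinearMap.apply ℝ ℝ v).hasFDerivAt.comp p (differentiableAt_fderiv hF).hasFDerivAt

theorem fderiv_fderiv_apply (hF : ContDiffAt ℝ 2 F p) (v w : E) :
    fderiv ℝ (fun q => fderiv ℝ F q v) p w = secondDeriv F p w v := by
  rw [(hasFDerivAt_fderiv_apply hF v).fderiv]
  rfl

theorem secondDeriv_comm (hF : ContDiffAt ℝ 2 F p) (v w : E) :
    secondDeriv F p v w = secondDeriv F p w v :=
  (hF.isSymmSndFDerivAt (by simp)) v w

end SecondDeriv

section Partial
variable {F : (Fin 4 → ℝ) → ℝ} {p : Fin 4 → ℝ}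

theorem fderiv_eq_sum (F : (Fin 4 → ℝ) → ℝ) (p v : Fin 4 → ℝ) :
    fderiv ℝ F p v = ∑ a, v a * partial4 a F p := by
  conv_lhs => rw [pi_eq_sum_univ' v, map_sum]
  refine Finset.sum_congr rfl fun a _ => ?_
  rw [map_smul, smul_eq_mul]
  rfl

theorem secondDeriv_eq_sum (F : (Fin 4 → ℝ) → ℝ) (p v w : Fin 4 → ℝ) :
    secondDeriv F p v w
      = ∑ a, ∑ b, v a * w b * secondDeriv F p (Pi.single a 1) (Pi.single b 1) := by
  unfold secondDeriv
  conv_lhs => rw [pi_eq_sum_univ' v, map_sum, sum_apply]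
  refine Finset.sum_congr rfl fun a _ => ?_
  conv_lhs => rw [pi_eq_sum_univ' w, map_sum]
  refine Finset.sum_congr rfl fun b _ => ?_
  rw [map_smul, map_smul, smul_apply, smul_eq_mul, smul_eq_mul]
  ring

end Partial

/-- The component `g(v, w)` of a metric. -/
def metricPair (g : (Fin 4 → ℝ) → Matrix (Fin 4) (Fin 4) ℝ) (v w : Fin 4 → ℝ) (q : Fin 4 → ℝ) : ℝ :=
  ∑ a, ∑ b, v a * w b * g q a b

/-- The Christoffel symbols with lowered index, `g(D_v w, z)` for constant `v` and `w`. -/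
def christoffelLow (g : (Fin 4 → ℝ) → Matrix (Fin 4) (Fin 4) ℝ) (z v w : Fin 4 → ℝ)
    (p : Fin 4 → ℝ) : ℝ :=
  (1 / 2) * (fderiv ℝ (metricPair g z w) p v + fderiv ℝ (metricPair g z v) p w
    - fderiv ℝ (metricPair g v w) p z)

section Riemann
variable {g : (Fin 4 → ℝ) → Matrix (Fin 4) (Fin 4) ℝ} {p : Fin 4 → ℝ}

theorem contDiffAt_det {n : ℕ} {M : (Fin 4 → ℝ) → Matrix (Fin n) (Fin n) ℝ}
    (hM : ∀ a b, ContDiffAt ℝ 2 (fun q => M q a b) p) : ContDiffAt ℝ 2 (fun q => (M q).det) p := by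
  simp only [Matrix.det_apply]
  refine ContDiffAt.sum fun σ _ => ContDiffAt.const_smul _ ?_
  exact contDiffAt_prod fun i _ => hM _ _

theorem contDiffAt_matrix_inv (hg : ∀ a b, ContDiffAt ℝ 2 (fun q => g q a b) p) (hdet : (g p).det ≠ 0)
    (a b : Fin 4) : ContDiffAt ℝ 2 (fun q => (g q)⁻¹ a b) p := by
  have h1 : (fun q => (g q)⁻¹ a b) = fun q => ((g q).det)⁻¹ * (g q).adjugate a b := by
    funext q
    rw [Matrix.inv_def, Matrix.smul_apply, Ring.inverse_eq_inv', smul_eq_mul]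
  rw [h1]
  refine ((contDiffAt_det hg).inv hdet).mul ?_
  simp only [Matrix.adjugate_apply]
  refine contDiffAt_det fun c d => ?_
  by_cases hc : c = b
  · subst hc; simp only [Matrix.updateRow_self]; exact contDiffAt_const
  · simp only [Matrix.updateRow_ne hc]; exact hg c d

theorem metricPair_single (a b : Fin 4) :
    metricPair g (Pi.single a 1) (Pi.single b 1) = fun q => g q a b := by
  funext q
  simp [metricPair, Pi.single_apply]

theorem contDiffAt_metricPair (hg : ∀ a b, ContDiffAt ℝ 2 (fun q => g q a b) p)
    (v w : Fin 4 → ℝ) : ContDiffAt ℝ 2 (metricPair g v w) p :=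
  ContDiffAt.sum fun a _ => ContDiffAt.sum fun b _ => contDiffAt_const.mul (hg a b)

theorem fderiv_metricPair (hg : ∀ a b, ContDiffAt ℝ 2 (fun q => g q a b) p) (v w z : Fin 4 → ℝ) :
    fderiv ℝ (metricPair g v w) p z
      = ∑ a, ∑ b, v a * w b * fderiv ℝ (fun q => g q a b) p z := by
  have h : HasFDerivAt (metricPair g v w)
      (∑ a, ∑ b, (v a * w b) • fderiv ℝ (fun q => g q a b) p) p :=
    HasFDerivAt.fun_sum fun a _ => HasFDerivAt.fun_sum fun b _ =>
      (((hg a b).differentiableAt (by norm_num)).hasFDerivAt.const_mul _)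
  rw [h.fderiv]
  simp

theorem secondDeriv_metricPair (hg : ∀ a b, ContDiffAt ℝ 2 (fun q => g q a b) p)
    (v w y z : Fin 4 → ℝ) :
    secondDeriv (metricPair g v w) p y z
      = ∑ a, ∑ b, v a * w b * secondDeriv (fun q => g q a b) p y z := by
  have h1 : fderiv ℝ (metricPair g v w) =ᶠ[𝓝 p]
      fun q => ∑ a, ∑ b, (v a * w b) • fderiv ℝ (fun q => g q a b) q := by
    have h2 : ∀ᶠ q in 𝓝 p, ∀ a b, ContDiffAt ℝ 2 (fun q => g q a b) q :=
      eventually_all.2 fun a => eventually_all.2 fun b => (hg a b).eventually (by simp)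
    filter_upwards [h2] with q hq
    ext z
    rw [fderiv_metricPair hq]
    simp
  have h : HasFDerivAt (fun q => ∑ a, ∑ b, (v a * w b) • fderiv ℝ (fun q => g q a b) q)
      (∑ a, ∑ b, (v a * w b) • fderiv ℝ (fderiv ℝ (fun q => g q a b)) p) p :=
    HasFDerivAt.fun_sum fun a _ => HasFDerivAt.fun_sum fun b _ =>
      ((differentiableAt_fderiv (hg a b)).hasFDerivAt.fun_const_smul _)
  unfold secondDeriv
  rw [h1.fderiv_eq, h.fderiv]
  simp

theorem christoffel_eq (a b c : Fin 4) (q : Fin 4 → ℝ) :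
    christoffel g a b c q = ∑ d, (g q)⁻¹ a d *
      christoffelLow g (Pi.single d 1) (Pi.single b 1) (Pi.single c 1) q := by
  simp only [christoffel, christoffelLow, metricPair_single, partial4, Finset.mul_sum]
  exact Finset.sum_congr rfl fun d _ => by ring

theorem sum_mul_christoffel {q : Fin 4 → ℝ} (hdet : (g q).det ≠ 0) (e b c : Fin 4) :
    ∑ d, g q e d * christoffel g d b c q
      = christoffelLow g (Pi.single e 1) (Pi.single b 1) (Pi.single c 1) q := by
  have h1 : g q * (g q)⁻¹ = 1 := Matrix.mul_nonsing_inv _ (Ne.isUnit hdet)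
  simp only [christoffel_eq, Finset.mul_sum]
  rw [Finset.sum_comm]
  have h2 : ∀ f, ∑ d, g q e d * (g q)⁻¹ d f = (1 : Matrix (Fin 4) (Fin 4) ℝ) e f := fun f => by
    rw [← h1, Matrix.mul_apply]
  simp only [← mul_assoc, ← Finset.sum_mul, h2, Matrix.one_apply]
  simp

theorem differentiableAt_christoffelLow (hg : ∀ a b, ContDiffAt ℝ 2 (fun q => g q a b) p)
    (z v w : Fin 4 → ℝ) : DifferentiableAt ℝ (christoffelLow g z v w) p := by
  have h := fun v w z => (hasFDerivAt_fderiv_apply (contDiffAt_metricPair hg v w) z).differentiableAt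
  exact (((h z w v).add (h z v w)).sub (h v w z)).const_mul _

theorem differentiableAt_christoffel (hg : ∀ a b, ContDiffAt ℝ 2 (fun q => g q a b) p)
    (hdet : (g p).det ≠ 0) (a b c : Fin 4) : DifferentiableAt ℝ (christoffel g a b c) p := by
  rw [funext (christoffel_eq (g := g) a b c)]
  exact DifferentiableAt.fun_sum fun d _ =>
    ((contDiffAt_matrix_inv hg hdet a d).differentiableAt (by norm_num)).mul
      (differentiableAt_christoffelLow hg _ _ _)

theorem partial4_christoffelLow (hg : ∀ a b, ContDiffAt ℝ 2 (fun q => g q a b) p) (a : Fin 4)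
    (z v w : Fin 4 → ℝ) :
    partial4 a (christoffelLow g z v w) p
      = (1 / 2) * (secondDeriv (metricPair g z w) p (Pi.single a 1) v
        + secondDeriv (metricPair g z v) p (Pi.single a 1) w
        - secondDeriv (metricPair g v w) p (Pi.single a 1) z) := by
  have h := fun v w z => hasFDerivAt_fderiv_apply (contDiffAt_metricPair hg v w) z
  have h2 := (((h z w v).add (h z v w)).sub (h v w z)).const_mul (1 / 2 : ℝ)
  have h3 : HasFDerivAt (christoffelLow g z v w) _ p := h2
  unfold partial4
  rw [h3.fderiv]
  rfl

/-- Differentiating the product `g Γ = Γ_low` isolates the lowered derivative of `Γ` without ever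
differentiating the inverse metric. -/
theorem sum_mul_partial4_christoffel (hg : ∀ a b, ContDiffAt ℝ 2 (fun q => g q a b) p)
    (hdet : (g p).det ≠ 0) (a b c e : Fin 4) :
    ∑ d, g p e d * partial4 a (christoffel g d b c) p
      = partial4 a (christoffelLow g (Pi.single e 1) (Pi.single b 1) (Pi.single c 1)) p
        - ∑ d, partial4 a (fun q => g q e d) p * christoffel g d b c p := by
  have hdet' : ∀ᶠ q in 𝓝 p, (g q).det ≠ 0 :=
    (contDiffAt_det hg).continuousAt.eventually_ne hdet
  have h1 : (fun q => ∑ d, g q e d * christoffel g d b c q) =ᶠ[𝓝 p]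
      christoffelLow g (Pi.single e 1) (Pi.single b 1) (Pi.single c 1) := by
    filter_upwards [hdet'] with q hq
    exact sum_mul_christoffel hq e b c
  have h2 : HasFDerivAt (fun q => ∑ d, g q e d * christoffel g d b c q)
      (∑ d, (g p e d • fderiv ℝ (christoffel g d b c) p
        + christoffel g d b c p • fderiv ℝ (fun q => g q e d) p)) p :=
    HasFDerivAt.fun_sum fun d _ => ((hg e d).differentiableAt (by norm_num)).hasFDerivAt.mul
      (differentiableAt_christoffel hg hdet d b c).hasFDerivAt
  unfold partial4
  rw [← h1.fderiv_eq, h2.fderiv, sum_apply, ← Finset.sum_sub_distrib]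
  refine Finset.sum_congr rfl fun d _ => ?_
  simp
  ring

/-- Compatibility of the connection with the metric, in coordinates. -/
theorem christoffelLow_add (hs : ∀ q a b, g q a b = g q b a) (a d e : Fin 4) (q : Fin 4 → ℝ) :
    christoffelLow g (Pi.single e 1) (Pi.single a 1) (Pi.single d 1) q
      + christoffelLow g (Pi.single d 1) (Pi.single a 1) (Pi.single e 1) q
      = partial4 a (fun q => g q e d) q := by
  simp only [christoffelLow, metricPair_single, partial4, hs _ d e, hs _ a e, hs _ d a]
  ring

/-- The curvature tensor with all indices lowered. -/
theorem sum_mul_riemannUp (hg : ∀ a b, ContDiffAt ℝ 2 (fun q => g q a b) p)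
    (hs : ∀ q a b, g q a b = g q b a) (hdet : (g p).det ≠ 0) (a b c e : Fin 4) :
    ∑ d, g p d e * riemannUp g d a b c p
      = partial4 a (christoffelLow g (Pi.single e 1) (Pi.single b 1) (Pi.single c 1)) p
        - partial4 b (christoffelLow g (Pi.single e 1) (Pi.single a 1) (Pi.single c 1)) p
        - (∑ d, christoffelLow g (Pi.single d 1) (Pi.single a 1) (Pi.single e 1) p
            * christoffel g d b c p)
        + ∑ d, christoffelLow g (Pi.single d 1) (Pi.single b 1) (Pi.single e 1) p
            * christoffel g d a c p := by
  have h1 := sum_mul_partial4_christoffel hg hdet a b c e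
  have h2 := sum_mul_partial4_christoffel hg hdet b a c e
  simp only [← christoffelLow_add hs, add_mul, Finset.sum_add_distrib] at h1 h2
  have h3 : ∀ a b, ∑ d, g p e d * ∑ f, christoffel g d a f p * christoffel g f b c p
      = ∑ f, christoffelLow g (Pi.single e 1) (Pi.single a 1) (Pi.single f 1) p
        * christoffel g f b c p := by
    intro a b
    simp only [Finset.mul_sum]
    rw [Finset.sum_comm]
    refine Finset.sum_congr rfl fun f _ => ?_
    rw [← sum_mul_christoffel hdet, Finset.sum_mul]
    exact Finset.sum_congr rfl fun d _ => by ring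
  have h4 : ∑ d, g p d e * riemannUp g d a b c p
      = (∑ d, g p e d * partial4 a (christoffel g d b c) p)
        - (∑ d, g p e d * partial4 b (christoffel g d a c) p)
        + (∑ d, g p e d * ∑ f, christoffel g d a f p * christoffel g f b c p)
        - ∑ d, g p e d * ∑ f, christoffel g d b f p * christoffel g f a c p := by
    rw [← Finset.sum_sub_distrib, ← Finset.sum_add_distrib, ← Finset.sum_sub_distrib]
    refine Finset.sum_congr rfl fun d _ => ?_
    unfold riemannUp
    rw [hs p d e, Finset.sum_sub_distrib]
    ring
  rw [h4, h1, h2, h3, h3]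
  ring

theorem christoffelLow_eq_sum (hg : ∀ a b, ContDiffAt ℝ 2 (fun q => g q a b) p) (d : Fin 4)
    (v w : Fin 4 → ℝ) :
    christoffelLow g (Pi.single d 1) v w p = ∑ b, ∑ c, v b * w c *
      christoffelLow g (Pi.single d 1) (Pi.single b 1) (Pi.single c 1) p := by
  have h1 : ∀ w v, fderiv ℝ (metricPair g (Pi.single d 1) w) p v
      = ∑ b, ∑ c, v b * w c * partial4 b (fun q => g q d c) p := by
    intro w v
    rw [fderiv_metricPair hg]
    simp only [fderiv_eq_sum _ _ v]
    rw [Finset.sum_eq_single d (by intro a _ ha; simp [ha]) (by simp)]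
    simp only [Finset.mul_sum, Pi.single_eq_same]
    rw [Finset.sum_comm]
    exact Finset.sum_congr rfl fun b _ => Finset.sum_congr rfl fun c _ => by ring
  have h2 : fderiv ℝ (metricPair g v w) p (Pi.single d 1)
      = ∑ b, ∑ c, v b * w c * partial4 d (fun q => g q b c) p := fderiv_metricPair hg _ _ _
  simp only [christoffelLow, h1 _ v, h1 _ w, h2, metricPair_single]
  rw [Finset.sum_comm (f := fun b c => w b * v c * partial4 b (fun q => g q d c) p), ← Finset.sum_add_distrib,
    ← Finset.sum_sub_distrib, Finset.mul_sum]
  refine Finset.sum_congr rfl fun b _ => ?_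
  rw [← Finset.sum_add_distrib, ← Finset.sum_sub_distrib, Finset.mul_sum]
  refine Finset.sum_congr rfl fun c _ => ?_
  unfold partial4
  ring

section Sums
variable {ι : Type*} [Fintype ι]

theorem sum_swap_left (f : ι → ι → ι → ι → ℝ) :
    ∑ a, ∑ b, ∑ c, ∑ d, f a b c d = ∑ a, ∑ b, ∑ c, ∑ d, f b a c d := Finset.sum_comm

theorem sum_swap_mid (f : ι → ι → ι → ι → ℝ) :
    ∑ a, ∑ b, ∑ c, ∑ d, f a b c d = ∑ a, ∑ b, ∑ c, ∑ d, f a c b d :=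
  Finset.sum_congr rfl fun _ _ => Finset.sum_comm

theorem sum_swap_right (f : ι → ι → ι → ι → ℝ) :
    ∑ a, ∑ b, ∑ c, ∑ d, f a b c d = ∑ a, ∑ b, ∑ c, ∑ d, f a b d c :=
  Finset.sum_congr rfl fun _ _ => Finset.sum_congr rfl fun _ _ => Finset.sum_comm

theorem sum_sum_sum_sum_congr {f g : ι → ι → ι → ι → ℝ} (h : ∀ a b c d, f a b c d = g a b c d) :
    ∑ a, ∑ b, ∑ c, ∑ d, f a b c d = ∑ a, ∑ b, ∑ c, ∑ d, g a b c d := by simp only [h]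

theorem sum_mul_sum_sum (A B : ι → ι → ℝ) :
    (∑ a, ∑ b, A a b) * ∑ c, ∑ d, B c d = ∑ a, ∑ b, ∑ c, ∑ d, A a b * B c d := by
  rw [Finset.sum_mul]
  refine Finset.sum_congr rfl fun a _ => ?_
  rw [Finset.sum_mul]
  refine Finset.sum_congr rfl fun b _ => ?_
  simp only [Finset.mul_sum]

end Sums

/-- The sectional curvature component `R(X, Y, X, Y)`. -/
theorem riemann_eq (hg : ∀ a b, ContDiffAt ℝ 2 (fun q => g q a b) p)
    (hs : ∀ q a b, g q a b = g q b a) (hdet : (g p).det ≠ 0) (X Y : Fin 4 → ℝ) :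
    riemann g p X Y X Y = secondDeriv (metricPair g X Y) p X Y
      - (1 / 2) * secondDeriv (metricPair g Y Y) p X X
      - (1 / 2) * secondDeriv (metricPair g X X) p Y Y
      - (∑ d, ∑ f, (g p)⁻¹ d f * (christoffelLow g (Pi.single d 1) X X p
        * christoffelLow g (Pi.single f 1) Y Y p))
      + ∑ d, ∑ f, (g p)⁻¹ d f * (christoffelLow g (Pi.single d 1) Y X p
        * christoffelLow g (Pi.single f 1) X Y p) := by
  set e : Fin 4 → Fin 4 → ℝ := fun a => Pi.single a 1 with he
  -- `H a b c d` stands for `∂_a ∂_b g_{cd}`. Contraction with constant vectors turns sums of `H`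
  -- into second derivatives of `metricPair`; `t1` to `t4` below contract the four terms of the
  -- lowered curvature.
  set H : Fin 4 → Fin 4 → Fin 4 → Fin 4 → ℝ :=
    fun a b c d => secondDeriv (fun q => g q c d) p (e a) (e b) with hH
  have sd : ∀ v w y z, secondDeriv (metricPair g v w) p y z
      = ∑ c, ∑ d, ∑ a, ∑ b, v c * w d * (y a * z b) * H a b c d := by
    intro v w y z
    rw [secondDeriv_metricPair hg]
    refine Finset.sum_congr rfl fun c _ => Finset.sum_congr rfl fun d _ => ?_
    rw [secondDeriv_eq_sum, Finset.mul_sum]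
    refine Finset.sum_congr rfl fun a _ => ?_
    rw [Finset.mul_sum]
    exact Finset.sum_congr rfl fun b _ => by ring
  have hp : ∀ a d b c, partial4 a (christoffelLow g (e d) (e b) (e c)) p
      = (1 / 2) * (H a b d c + H a c d b - H a d b c) := by
    intro a d b c
    rw [partial4_christoffelLow hg]
    simp only [he, metricPair_single, hH]
  have up : ∀ v w d, ∑ b, ∑ c, v b * w c * christoffel g d b c p
      = ∑ f, (g p)⁻¹ d f * christoffelLow g (e f) v w p := by
    intro v w d
    simp only [he, christoffelLow_eq_sum hg _ v w, christoffel_eq, Finset.mul_sum]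
    rw [Finset.sum_comm (s := Finset.univ) (t := Finset.univ) (f := fun f b => ∑ c, (g p)⁻¹ d f *
      (v b * w c * christoffelLow g (Pi.single f 1) (Pi.single b 1) (Pi.single c 1) p))]
    have : ∀ b, ∑ c, ∑ f, v b * w c * ((g p)⁻¹ d f
        * christoffelLow g (Pi.single f 1) (Pi.single b 1) (Pi.single c 1) p)
        = ∑ f, ∑ c, (g p)⁻¹ d f * (v b * w c *
          christoffelLow g (Pi.single f 1) (Pi.single b 1) (Pi.single c 1) p) := fun b => by
      rw [Finset.sum_comm]
      exact Finset.sum_congr rfl fun f _ => Finset.sum_congr rfl fun c _ => by ring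
    exact Finset.sum_congr rfl fun b _ => this b
  have r1 : riemann g p X Y X Y = ∑ a, ∑ b, ∑ c, ∑ k, X a * Y b * Y c * X k *
      ∑ d, g p d k * riemannUp g d a b c p := by
    unfold riemann
    refine Finset.sum_congr rfl fun a _ => Finset.sum_congr rfl fun b _ =>
      Finset.sum_congr rfl fun c _ => ?_
    rw [Finset.sum_comm]
    refine Finset.sum_congr rfl fun k _ => ?_
    rw [Finset.mul_sum]
    exact Finset.sum_congr rfl fun d _ => by ring
  have t1 : ∑ a, ∑ b, ∑ c, ∑ k, X a * Y b * Y c * X k *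
      partial4 a (christoffelLow g (e k) (e b) (e c)) p
      = secondDeriv (metricPair g X Y) p X Y
        - (1 / 2) * secondDeriv (metricPair g Y Y) p X X := by
    have a1 : ∑ a, ∑ b, ∑ c, ∑ k, X a * Y b * Y c * X k * H a b k c
        = secondDeriv (metricPair g X Y) p X Y := by
      rw [sd, sum_swap_mid, sum_swap_left, sum_swap_right, sum_swap_mid, sum_swap_left]
      exact sum_sum_sum_sum_congr fun _ _ _ _ => by ring
    have a2 : ∑ a, ∑ b, ∑ c, ∑ k, X a * Y b * Y c * X k * H a c k b
        = secondDeriv (metricPair g X Y) p X Y := by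
      rw [← a1, sum_swap_mid]
      exact sum_sum_sum_sum_congr fun _ _ _ _ => by ring
    have a3 : ∑ a, ∑ b, ∑ c, ∑ k, X a * Y b * Y c * X k * H a k b c
        = secondDeriv (metricPair g Y Y) p X X := by
      rw [sd, sum_swap_left, sum_swap_mid]
      exact sum_sum_sum_sum_congr fun _ _ _ _ => by ring
    have a4 : ∀ a b c k, X a * Y b * Y c * X k *
        partial4 a (christoffelLow g (e k) (e b) (e c)) p
        = (1 / 2) * (X a * Y b * Y c * X k * H a b k c)
          + (1 / 2) * (X a * Y b * Y c * X k * H a c k b)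
          - (1 / 2) * (X a * Y b * Y c * X k * H a k b c) := fun a b c k => by
      rw [hp]; ring
    simp only [a4, Finset.sum_sub_distrib, Finset.sum_add_distrib, ← Finset.mul_sum, a1, a2, a3]
    ring
  have t2 : ∑ a, ∑ b, ∑ c, ∑ k, X a * Y b * Y c * X k *
      partial4 b (christoffelLow g (e k) (e a) (e c)) p
      = (1 / 2) * secondDeriv (metricPair g X X) p Y Y := by
    have a1 : ∑ a, ∑ b, ∑ c, ∑ k, X a * Y b * Y c * X k * H b a k c
        = ∑ a, ∑ b, ∑ c, ∑ k, X a * Y b * Y c * X k * H b k a c := by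
      rw [sum_swap_left, sum_swap_mid, sum_swap_right, sum_swap_mid, sum_swap_left]
      exact sum_sum_sum_sum_congr fun _ _ _ _ => by ring
    have a2 : ∑ a, ∑ b, ∑ c, ∑ k, X a * Y b * Y c * X k * H b c k a
        = secondDeriv (metricPair g X X) p Y Y := by
      rw [sd, sum_swap_right, sum_swap_mid, sum_swap_left]
      exact sum_sum_sum_sum_congr fun _ _ _ _ => by ring
    have a4 : ∀ a b c k, X a * Y b * Y c * X k *
        partial4 b (christoffelLow g (e k) (e a) (e c)) p
        = (1 / 2) * (X a * Y b * Y c * X k * H b a k c)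
          + (1 / 2) * (X a * Y b * Y c * X k * H b c k a)
          - (1 / 2) * (X a * Y b * Y c * X k * H b k a c) := fun a b c k => by
      rw [hp]; ring
    simp only [a4, Finset.sum_sub_distrib, Finset.sum_add_distrib, ← Finset.mul_sum, a1, a2]
    ring
  have out : ∀ (F : Fin 4 → Fin 4 → Fin 4 → Fin 4 → ℝ) (G : Fin 4 → Fin 4 → Fin 4 → Fin 4 →
      Fin 4 → ℝ), ∑ a, ∑ b, ∑ c, ∑ k, F a b c k * ∑ d, G a b c k d
        = ∑ d, ∑ a, ∑ b, ∑ c, ∑ k, F a b c k * G a b c k d := by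
    intro F G
    simp only [Finset.mul_sum]
    symm
    rw [Finset.sum_comm]
    refine Finset.sum_congr rfl fun a _ => ?_
    rw [Finset.sum_comm]
    refine Finset.sum_congr rfl fun b _ => ?_
    rw [Finset.sum_comm]
    exact Finset.sum_congr rfl fun c _ => Finset.sum_comm
  have t3 : ∑ a, ∑ b, ∑ c, ∑ k, X a * Y b * Y c * X k *
      ∑ d, christoffelLow g (e d) (e a) (e k) p * christoffel g d b c p
      = ∑ d, ∑ f, (g p)⁻¹ d f * (christoffelLow g (e d) X X p
        * christoffelLow g (e f) Y Y p) := by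
    have a1 : ∀ d, ∑ f, (g p)⁻¹ d f * (christoffelLow g (e d) X X p
        * christoffelLow g (e f) Y Y p)
        = (∑ a, ∑ k, X a * X k * christoffelLow g (e d) (e a) (e k) p)
          * ∑ b, ∑ c, Y b * Y c * christoffel g d b c p := by
      intro d
      rw [up, ← christoffelLow_eq_sum hg, Finset.mul_sum]
      exact Finset.sum_congr rfl fun f _ => by ring
    rw [out]
    refine Finset.sum_congr rfl fun d _ => ?_
    rw [a1, sum_mul_sum_sum, sum_swap_right, sum_swap_mid]
    exact sum_sum_sum_sum_congr fun _ _ _ _ => by ring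
  have t4 : ∑ a, ∑ b, ∑ c, ∑ k, X a * Y b * Y c * X k *
      ∑ d, christoffelLow g (e d) (e b) (e k) p * christoffel g d a c p
      = ∑ d, ∑ f, (g p)⁻¹ d f * (christoffelLow g (e d) Y X p
        * christoffelLow g (e f) X Y p) := by
    have a1 : ∀ d, ∑ f, (g p)⁻¹ d f * (christoffelLow g (e d) Y X p
        * christoffelLow g (e f) X Y p)
        = (∑ b, ∑ k, Y b * X k * christoffelLow g (e d) (e b) (e k) p)
          * ∑ a, ∑ c, X a * Y c * christoffel g d a c p := by
      intro d
      rw [up, ← christoffelLow_eq_sum hg, Finset.mul_sum]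
      exact Finset.sum_congr rfl fun f _ => by ring
    rw [out]
    refine Finset.sum_congr rfl fun d _ => ?_
    rw [a1, sum_mul_sum_sum, sum_swap_left, sum_swap_right, sum_swap_mid]
    exact sum_sum_sum_sum_congr fun _ _ _ _ => by ring
  have h := fun a b c k => sum_mul_riemannUp hg hs hdet a b c k
  rw [r1]
  simp only [h, mul_add, mul_sub, Finset.sum_sub_distrib, Finset.sum_add_distrib]
  simp only [he] at t1 t2 t3 t4
  rw [t1, t2, t3, t4]

end Riemann

end

noncomputable section

/-! ### Orders of decay of two-jets along a ray -/

section Calculus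
variable {E : Type*} [NormedAddCommGroup E] [NormedSpace ℝ E] {F G : E → ℝ} {p : E}

theorem eventually_differentiableAt (hF : ContDiffAt ℝ 2 F p) :
    ∀ᶠ q in 𝓝 p, DifferentiableAt ℝ F q :=
  (hF.eventually (by simp)).mono fun _ h => h.differentiableAt (by norm_num)

theorem secondDeriv_add (hF : ContDiffAt ℝ 2 F p) (hG : ContDiffAt ℝ 2 G p) (v w : E) :
    secondDeriv (fun q => F q + G q) p v w = secondDeriv F p v w + secondDeriv G p v w := by
  have h : fderiv ℝ (fun q => F q + G q) =ᶠ[𝓝 p] fun q => fderiv ℝ F q + fderiv ℝ G q := by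
    filter_upwards [eventually_differentiableAt hF, eventually_differentiableAt hG] with q h1 h2
    exact fderiv_fun_add h1 h2
  unfold secondDeriv
  rw [h.fderiv_eq, fderiv_fun_add (differentiableAt_fderiv hF) (differentiableAt_fderiv hG)]
  rfl

theorem secondDeriv_mul (hF : ContDiffAt ℝ 2 F p) (hG : ContDiffAt ℝ 2 G p) (v w : E) :
    secondDeriv (fun q => F q * G q) p v w
      = F p * secondDeriv G p v w + fderiv ℝ F p v * fderiv ℝ G p w
        + (G p * secondDeriv F p v w + fderiv ℝ G p v * fderiv ℝ F p w) := by
  have h : fderiv ℝ (fun q => F q * G q) =ᶠ[𝓝 p]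
      fun q => F q • fderiv ℝ G q + G q • fderiv ℝ F q := by
    filter_upwards [eventually_differentiableAt hF, eventually_differentiableAt hG] with q h1 h2
    exact fderiv_fun_mul h1 h2
  have hF1 := (hF.differentiableAt (by norm_num)).hasFDerivAt
  have hG1 := (hG.differentiableAt (by norm_num)).hasFDerivAt
  have hF2 := (differentiableAt_fderiv hF).hasFDerivAt
  have hG2 := (differentiableAt_fderiv hG).hasFDerivAt
  unfold secondDeriv
  rw [h.fderiv_eq, ((hF1.fun_smul hG2).fun_add (hG1.fun_smul hF2)).fderiv]
  simp

theorem secondDeriv_const (c : ℝ) (v w : E) : secondDeriv (fun _ : E => c) p v w = 0 := by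
  have h : fderiv ℝ (fun _ : E => c) = fun _ => 0 := by
    funext q; simp
  simp [secondDeriv, h]

theorem secondDeriv_congr (h : F =ᶠ[𝓝 p] G) (v w : E) :
    secondDeriv F p v w = secondDeriv G p v w := by
  unfold secondDeriv
  rw [h.fderiv.fderiv_eq]

end Calculus

theorem isBigO_zpow {a b : ℤ} (h : b ≤ a) :
    (fun r : ℝ => r ^ (-a)) =O[atTop] fun r : ℝ => r ^ (-b) := by
  refine Asymptotics.IsBigO.of_bound 1 ?_
  filter_upwards [eventually_ge_atTop 1] with r hr
  rw [one_mul, Real.norm_of_nonneg (by positivity), Real.norm_of_nonneg (by positivity)]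
  exact zpow_le_zpow_right₀ hr (by omega)

theorem isBigO_mul_zpow {f g : ℝ → ℝ} {a b c : ℤ} (hf : f =O[atTop] fun r : ℝ => r ^ (-a))
    (hg : g =O[atTop] fun r : ℝ => r ^ (-b)) (h : c ≤ a + b) :
    (fun r => f r * g r) =O[atTop] fun r : ℝ => r ^ (-c) := by
  refine (hf.mul hg).trans ?_
  have h1 : (fun r : ℝ => r ^ (-a) * r ^ (-b)) =ᶠ[atTop] fun r : ℝ => r ^ (-(a + b)) := by
    filter_upwards [eventually_gt_atTop 0] with r hr
    rw [← zpow_add₀ hr.ne', neg_add]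
  exact h1.isBigO.trans (isBigO_zpow h)

/-- Along the points `p r`, the function `F r` is `O(r ^ (-k))` together with its derivatives of
order at most two in the directions `X` and `Y`, each derivative in the direction `Y` gaining a
factor `r⁻¹`; all its first derivatives are `O(r ^ (-l))`. -/
structure JetO (p X : ℝ → Fin 4 → ℝ) (Y : Fin 4 → ℝ) (k l : ℤ) (F : ℝ → (Fin 4 → ℝ) → ℝ) :
    Prop where
  smooth : ∀ᶠ r in atTop, ContDiffAt ℝ 2 (F r) (p r)
  val : (fun r => F r (p r)) =O[atTop] fun r : ℝ => r ^ (-k)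
  dX : (fun r => fderiv ℝ (F r) (p r) (X r)) =O[atTop] fun r : ℝ => r ^ (-k)
  dY : (fun r => fderiv ℝ (F r) (p r) Y) =O[atTop] fun r : ℝ => r ^ (-(k + 1))
  dXX : (fun r => secondDeriv (F r) (p r) (X r) (X r)) =O[atTop] fun r : ℝ => r ^ (-k)
  dXY : (fun r => secondDeriv (F r) (p r) (X r) Y) =O[atTop] fun r : ℝ => r ^ (-(k + 1))
  dYY : (fun r => secondDeriv (F r) (p r) Y Y) =O[atTop] fun r : ℝ => r ^ (-(k + 2))
  dAll : ∀ a, (fun r => fderiv ℝ (F r) (p r) (Pi.single a 1)) =O[atTop] fun r : ℝ => r ^ (-l)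

namespace JetO
variable {p X : ℝ → Fin 4 → ℝ} {Y : Fin 4 → ℝ} {k l k' l' m n : ℤ} {F G : ℝ → (Fin 4 → ℝ) → ℝ}

theorem congr (hF : JetO p X Y k l F) (h : ∀ᶠ r in atTop, G r =ᶠ[𝓝 (p r)] F r) :
    JetO p X Y k l G := by
  have e1 : ∀ v : ℝ → Fin 4 → ℝ, (fun r => fderiv ℝ (G r) (p r) (v r)) =ᶠ[atTop]
      fun r => fderiv ℝ (F r) (p r) (v r) := fun v => h.mono fun r hr => by
    simp only [hr.fderiv_eq]
  have e2 : ∀ v w : ℝ → Fin 4 → ℝ, (fun r => secondDeriv (G r) (p r) (v r) (w r)) =ᶠ[atTop]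
      fun r => secondDeriv (F r) (p r) (v r) (w r) := fun v w => h.mono fun r hr =>
    secondDeriv_congr hr _ _
  refine ⟨?_, ?_, (e1 _).trans_isBigO hF.dX, (e1 _).trans_isBigO hF.dY,
    (e2 _ _).trans_isBigO hF.dXX, (e2 _ _).trans_isBigO hF.dXY, (e2 _ _).trans_isBigO hF.dYY,
    fun a => (e1 _).trans_isBigO (hF.dAll a)⟩
  · filter_upwards [h, hF.smooth] with r h1 h2
    exact h2.congr_of_eventuallyEq h1
  · refine EventuallyEq.trans_isBigO ?_ hF.val
    exact h.mono fun r hr => hr.eq_of_nhds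

theorem mono (hF : JetO p X Y k l F) (hk : m ≤ k) (hl : n ≤ l) : JetO p X Y m n F :=
  ⟨hF.smooth, hF.val.trans (isBigO_zpow hk), hF.dX.trans (isBigO_zpow hk),
    hF.dY.trans (isBigO_zpow (by omega)), hF.dXX.trans (isBigO_zpow hk),
    hF.dXY.trans (isBigO_zpow (by omega)), hF.dYY.trans (isBigO_zpow (by omega)),
    fun a => (hF.dAll a).trans (isBigO_zpow hl)⟩

theorem const {c : ℝ → ℝ} (hc : c =O[atTop] fun r : ℝ => r ^ (-k)) :
    JetO p X Y k l (fun r _ => c r) := by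
  refine ⟨Eventually.of_forall fun r => contDiffAt_const, hc, ?_, ?_, ?_, ?_, ?_, fun a => ?_⟩
  all_goals
    simp only [secondDeriv_const, fderiv_fun_const, Pi.zero_apply, zero_apply]
    exact Asymptotics.isBigO_zero _ _

theorem add (hF : JetO p X Y k l F) (hG : JetO p X Y k l G) :
    JetO p X Y k l (fun r q => F r q + G r q) := by
  have h := hF.smooth.and hG.smooth
  have e1 : ∀ v : ℝ → Fin 4 → ℝ, (fun r => fderiv ℝ (fun q => F r q + G r q) (p r) (v r)) =ᶠ[atTop]
      fun r => fderiv ℝ (F r) (p r) (v r) + fderiv ℝ (G r) (p r) (v r) := fun v =>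
    h.mono fun r hr => by
      simp only [fderiv_fun_add (hr.1.differentiableAt (by norm_num))
        (hr.2.differentiableAt (by norm_num)), add_apply]
  have e2 : ∀ v w : ℝ → Fin 4 → ℝ,
      (fun r => secondDeriv (fun q => F r q + G r q) (p r) (v r) (w r)) =ᶠ[atTop]
      fun r => secondDeriv (F r) (p r) (v r) (w r) + secondDeriv (G r) (p r) (v r) (w r) :=
    fun v w => h.mono fun r hr => secondDeriv_add hr.1 hr.2 _ _
  exact ⟨h.mono fun r hr => hr.1.add hr.2, hF.val.add hG.val,
    (e1 _).trans_isBigO (hF.dX.add hG.dX), (e1 _).trans_isBigO (hF.dY.add hG.dY),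
    (e2 _ _).trans_isBigO (hF.dXX.add hG.dXX), (e2 _ _).trans_isBigO (hF.dXY.add hG.dXY),
    (e2 _ _).trans_isBigO (hF.dYY.add hG.dYY),
    fun a => (e1 _).trans_isBigO ((hF.dAll a).add (hG.dAll a))⟩

/-- Orders add under products by the Leibniz rule. The general gradient carries its own order `l`,
since directions other than `X` and `Y` may decay more slowly. -/
theorem mul (hF : JetO p X Y k l F) (hG : JetO p X Y k' l' G) (hm : m ≤ k + k') (hn : n ≤ k + l')
    (hn' : n ≤ l + k') : JetO p X Y m n (fun r q => F r q * G r q) := by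
  have h := hF.smooth.and hG.smooth
  have e1 : ∀ v : ℝ → Fin 4 → ℝ, (fun r => fderiv ℝ (fun q => F r q * G r q) (p r) (v r)) =ᶠ[atTop]
      fun r => F r (p r) * fderiv ℝ (G r) (p r) (v r) + G r (p r) * fderiv ℝ (F r) (p r) (v r) :=
    fun v => h.mono fun r hr => by
      simp only [fderiv_fun_mul (hr.1.differentiableAt (by norm_num))
        (hr.2.differentiableAt (by norm_num)), add_apply, smul_apply, smul_eq_mul]
  have e2 : ∀ v w : ℝ → Fin 4 → ℝ,
      (fun r => secondDeriv (fun q => F r q * G r q) (p r) (v r) (w r)) =ᶠ[atTop]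
      fun r => F r (p r) * secondDeriv (G r) (p r) (v r) (w r)
        + fderiv ℝ (F r) (p r) (v r) * fderiv ℝ (G r) (p r) (w r)
        + (G r (p r) * secondDeriv (F r) (p r) (v r) (w r)
        + fderiv ℝ (G r) (p r) (v r) * fderiv ℝ (F r) (p r) (w r)) :=
    fun v w => h.mono fun r hr => secondDeriv_mul hr.1 hr.2 _ _
  refine ⟨h.mono fun r hr => hr.1.mul hr.2, isBigO_mul_zpow hF.val hG.val hm,
    (e1 _).trans_isBigO ?_, (e1 _).trans_isBigO ?_, (e2 _ _).trans_isBigO ?_,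
    (e2 _ _).trans_isBigO ?_, (e2 _ _).trans_isBigO ?_, fun a => (e1 _).trans_isBigO ?_⟩
  · exact (isBigO_mul_zpow hF.val hG.dX (by omega)).add (isBigO_mul_zpow hG.val hF.dX (by omega))
  · exact (isBigO_mul_zpow hF.val hG.dY (by omega)).add (isBigO_mul_zpow hG.val hF.dY (by omega))
  · exact ((isBigO_mul_zpow hF.val hG.dXX (by omega)).add
      (isBigO_mul_zpow hF.dX hG.dX (by omega))).add
      ((isBigO_mul_zpow hG.val hF.dXX (by omega)).add (isBigO_mul_zpow hG.dX hF.dX (by omega)))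
  · exact ((isBigO_mul_zpow hF.val hG.dXY (by omega)).add
      (isBigO_mul_zpow hF.dX hG.dY (by omega))).add
      ((isBigO_mul_zpow hG.val hF.dXY (by omega)).add (isBigO_mul_zpow hG.dX hF.dY (by omega)))
  · exact ((isBigO_mul_zpow hF.val hG.dYY (by omega)).add
      (isBigO_mul_zpow hF.dY hG.dY (by omega))).add
      ((isBigO_mul_zpow hG.val hF.dYY (by omega)).add (isBigO_mul_zpow hG.dY hF.dY (by omega)))
  · exact (isBigO_mul_zpow hF.val (hG.dAll a) hn).add (isBigO_mul_zpow hG.val (hF.dAll a) (by omega))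

theorem const_mul {c : ℝ → ℝ} (hc : c =O[atTop] fun r : ℝ => r ^ (-(0 : ℤ)))
    (hF : JetO p X Y k l F) : JetO p X Y k l (fun r q => c r * F r q) :=
  mul (l := l - k) (const hc) hF (by omega) (by omega) (by omega)

theorem sum {ι : Type*} {s : Finset ι} {F : ι → ℝ → (Fin 4 → ℝ) → ℝ}
    (h : ∀ i, JetO p X Y k l (F i)) : JetO p X Y k l (fun r q => ∑ i ∈ s, F i r q) := by
  classical
  induction s using Finset.induction_on with
  | empty => simpa using const (Asymptotics.isBigO_zero _ _)
  | insert a s ha ih =>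
    simp only [Finset.sum_insert ha]
    exact (h a).add ih

end JetO

end

noncomputable section

/-! ### Orders of vanishing at null infinity -/

/-- The derivative with respect to the inverse radius. -/
def derivS (Ψ : ℝ × ℝ × E3 → ℝ) (P : ℝ × ℝ × E3) : ℝ := fderiv ℝ Ψ P (0, 1, 0)

/-- `Ψ(u, s, z)` vanishes to order `k` at `s = 0`, for `(u, z)` near a given point. -/
def VanishesTo (u : ℝ) (z : E3) (k : ℕ) (Ψ : ℝ × ℝ × E3 → ℝ) : Prop :=
  ∀ j < k, ∀ᶠ q : ℝ × E3 in 𝓝 (u, z), derivS^[j] Ψ (q.1, 0, q.2) = 0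

section Vanishing
variable {u : ℝ} {z : E3} {k : ℕ} {Ψ Φ : ℝ × ℝ × E3 → ℝ}

theorem contDiffAt_derivS {P : ℝ × ℝ × E3} {k : ℕ} (h : ContDiffAt ℝ (k + 1 : ℕ) Ψ P) :
    ContDiffAt ℝ k (derivS Ψ) P :=
  (h.fderiv_right (m := k) (by norm_cast)).clm_apply contDiffAt_const

theorem hasDerivAt_slice {s : ℝ} (h : DifferentiableAt ℝ Ψ (u, s, z)) :
    HasDerivAt (fun s => Ψ (u, s, z)) (derivS Ψ (u, s, z)) s := by
  have h1 : HasDerivAt (fun s : ℝ => ((u, s, z) : ℝ × ℝ × E3)) (0, 1, 0) s :=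
    (hasDerivAt_const s u).prodMk ((hasDerivAt_id s).prodMk (hasDerivAt_const s z))
  exact h.hasFDerivAt.comp_hasDerivAt s h1

theorem continuous_slice (u : ℝ) (z : E3) :
    Continuous fun s : ℝ => ((u, s, z) : ℝ × ℝ × E3) := by fun_prop

/-- Taylor expansion in the inverse radius of a function that vanishes to order `k`. -/
theorem isLittleO_slice (hΨ : ContDiffAt ℝ k Ψ (u, 0, z))
    (h : ∀ j < k, derivS^[j] Ψ (u, 0, z) = 0) :
    (fun s => Ψ (u, s, z) - derivS^[k] Ψ (u, 0, z) / k.factorial * s ^ k)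
      =o[𝓝 0] fun s : ℝ => s ^ k := by
  induction k generalizing Ψ with
  | zero =>
    simp only [pow_zero, mul_one, Nat.factorial_zero, Nat.cast_one, div_one,
      Function.iterate_zero, id, Asymptotics.isLittleO_one_iff]
    have := (hΨ.continuousAt.comp (f := fun s : ℝ => ((u, s, z) : ℝ × ℝ × E3))
      (continuous_slice u z).continuousAt).tendsto.sub_const (Ψ (u, 0, z))
    simpa using this
  | succ k ih =>
    set c := derivS^[k + 1] Ψ (u, 0, z) with hc
    have h0 : Ψ (u, 0, z) = 0 := h 0 (Nat.succ_pos k)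
    have h1 := ih (contDiffAt_derivS hΨ) fun j hj => h (j + 1) (by omega)
    rw [Asymptotics.isLittleO_iff] at h1 ⊢
    intro ε hε
    have h2 : ∀ᶠ s in 𝓝 (0 : ℝ), HasDerivAt
        (fun s => Ψ (u, s, z) - c / (k + 1).factorial * s ^ (k + 1))
        (derivS Ψ (u, s, z) - c / k.factorial * s ^ k) s := by
      have h3 : ∀ᶠ P in 𝓝 ((u, 0, z) : ℝ × ℝ × E3), ContDiffAt ℝ (k + 1 : ℕ) Ψ P :=
        hΨ.eventually (by simp)
      filter_upwards [(continuous_slice u z).continuousAt.eventually h3] with s hs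
      refine ((hasDerivAt_slice (hs.differentiableAt (by simp))).sub
        ((hasDerivAt_pow (k + 1) s).const_mul _)).congr_deriv ?_
      rw [Nat.factorial_succ]
      push_cast
      have : (k.factorial : ℝ) ≠ 0 := by positivity
      field_simp
    obtain ⟨δ, hδ, hball⟩ := Metric.eventually_nhds_iff_ball.1 ((h1 hε).and h2)
    filter_upwards [Metric.ball_mem_nhds (0 : ℝ) hδ] with s hs
    have hsub : ∀ t ∈ Set.uIcc 0 s, t ∈ Metric.ball (0 : ℝ) δ ∧ |t| ≤ |s| := by
      intro t ht
      have ht' : |t| ≤ |s| := by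
        have := Set.abs_sub_left_of_mem_uIcc ht
        simpa using this
      refine ⟨?_, ht'⟩
      rw [Metric.mem_ball, dist_zero_right, Real.norm_eq_abs] at hs ⊢
      exact ht'.trans_lt hs
    -- The mean value inequality on the segment from `0` to `s` integrates the estimate for the
    -- derivative, gaining one power of `s`.
    have := (convex_uIcc (0 : ℝ) s).norm_image_sub_le_of_norm_hasDerivWithin_le
      (f := fun s => Ψ (u, s, z) - c / (k + 1).factorial * s ^ (k + 1))
      (f' := fun s => derivS Ψ (u, s, z) - c / k.factorial * s ^ k) (C := ε * |s| ^ k)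
      (fun t ht => (hball t (hsub t ht).1).2.hasDerivWithinAt) (fun t ht => ?_)
      Set.left_mem_uIcc Set.right_mem_uIcc
    · simpa [h0, pow_succ, mul_assoc] using this
    · refine (hball t (hsub t ht).1).1.trans ?_
      rw [norm_pow, Real.norm_eq_abs]
      exact mul_le_mul_of_nonneg_left (pow_le_pow_left₀ (abs_nonneg t) (hsub t ht).2 k) hε.le

theorem VanishesTo.isBigO (h : VanishesTo u z k Ψ) (hΨ : ContDiffAt ℝ k Ψ (u, 0, z)) :
    (fun s => Ψ (u, s, z)) =O[𝓝 0] fun s : ℝ => s ^ k := by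
  have h1 := isLittleO_slice hΨ fun j hj => (h j hj).self_of_nhds
  have h2 := h1.isBigO.add (Asymptotics.isBigO_const_mul_self
    (derivS^[k] Ψ (u, 0, z) / k.factorial) (fun s : ℝ => s ^ k) (𝓝 0))
  simpa using h2

/-- For a smooth function, one-sided pointwise bounds near each point force the Taylor coefficients
to vanish, one after another. Expansions assumed pointwise, without uniformity or derivatives,
thereby become differentiable expansions. -/
theorem VanishesTo.of_isBigO (hΨ : ContDiffAt ℝ k Ψ (u, 0, z))
    (h : ∀ᶠ q : ℝ × E3 in 𝓝 (u, z),
      (fun s => Ψ (q.1, s, q.2)) =O[𝓝[>] 0] fun s : ℝ => s ^ k) : VanishesTo u z k Ψ := by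
  intro j
  induction j using Nat.strong_induction_on with
  | _ j ih =>
    intro hj
    have h1 : ∀ᶠ q : ℝ × E3 in 𝓝 (u, z), ∀ i < j, derivS^[i] Ψ (q.1, 0, q.2) = 0 := by
      have : ∀ i ∈ Finset.range j, ∀ᶠ q : ℝ × E3 in 𝓝 (u, z),
          derivS^[i] Ψ (q.1, 0, q.2) = 0 := fun i hi =>
        ih i (Finset.mem_range.1 hi) ((Finset.mem_range.1 hi).trans hj)
      have h2 := (Finset.eventually_all _).2 this
      filter_upwards [h2] with q hq i hi
      exact hq i (Finset.mem_range.2 hi)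
    have h2 : ∀ᶠ q : ℝ × E3 in 𝓝 (u, z), ContDiffAt ℝ k Ψ (q.1, 0, q.2) := by
      have hc : ContinuousAt (fun q : ℝ × E3 => ((q.1, 0, q.2) : ℝ × ℝ × E3)) (u, z) := by fun_prop
      exact hc.eventually (hΨ.eventually (by simp))
    filter_upwards [h, h1, h2] with q h3 h4 h5
    have h6 := (isLittleO_slice (h5.of_le (by exact_mod_cast hj.le)) h4).mono
      (nhdsWithin_le_nhds (s := Set.Ioi 0))
    set c := derivS^[j] Ψ (q.1, 0, q.2) with hc
    have h7 : (fun s : ℝ => s ^ k) =o[𝓝[>] 0] fun s : ℝ => s ^ j :=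
      (Asymptotics.isLittleO_pow_pow hj).mono nhdsWithin_le_nhds
    have h8 := ((h3.trans_isLittleO h7).sub h6)
    simp only [sub_sub_cancel] at h8
    -- The first possibly nonzero Taylor term `c s^j / j!` would have to be `o(s^j)`, so its
    -- coefficient is zero.
    have h9 : (fun _ : ℝ => c / j.factorial) =o[𝓝[>] 0] fun _ : ℝ => (1 : ℝ) := by
      have h10 := h8.mul_isBigO (Asymptotics.isBigO_refl (fun s : ℝ => (s ^ j)⁻¹) (𝓝[>] 0))
      refine (h10.congr' ?_ ?_)
      · filter_upwards [self_mem_nhdsWithin] with s hs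
        have : s ^ j ≠ 0 := pow_ne_zero _ (Set.mem_Ioi.1 hs).ne'
        field_simp
      · filter_upwards [self_mem_nhdsWithin] with s hs
        have : s ^ j ≠ 0 := pow_ne_zero _ (Set.mem_Ioi.1 hs).ne'
        field_simp
    rw [Asymptotics.isLittleO_one_iff] at h9
    have h10 := tendsto_nhds_unique h9 tendsto_const_nhds
    have : (j.factorial : ℝ) ≠ 0 := by positivity
    field_simp at h10
    exact h10.symm.trans (zero_mul _)

theorem VanishesTo.congr (h : VanishesTo u z k Ψ) (he : Φ =ᶠ[𝓝 (u, 0, z)] Ψ) :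
    VanishesTo u z k Φ := by
  intro j hj
  have h1 : derivS^[j] Φ =ᶠ[𝓝 (u, 0, z)] derivS^[j] Ψ := by
    clear hj h
    induction j generalizing Φ Ψ with
    | zero => exact he
    | succ j ih =>
      refine ih ?_
      filter_upwards [he.fderiv (𝕜 := ℝ)] with P hP
      rw [derivS, derivS, hP]
  have hc : ContinuousAt (fun q : ℝ × E3 => ((q.1, 0, q.2) : ℝ × ℝ × E3)) (u, z) := by fun_prop
  filter_upwards [h j hj, hc.eventually h1] with q h2 h3
  rw [h3, h2]

/-- Derivatives tangential to null infinity preserve the order of vanishing. -/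
theorem VanishesTo.fderiv (h : VanishesTo u z k Ψ) (hΨ : ContDiffAt ℝ (k + 1 : ℕ) Ψ (u, 0, z))
    (a : ℝ) (b : E3) : VanishesTo u z k (fun P => fderiv ℝ Ψ P (a, 0, b)) := by
  induction k generalizing Ψ with
  | zero => intro j hj; omega
  | succ k ih =>
    have hc : Continuous (fun q : ℝ × E3 => ((q.1, 0, q.2) : ℝ × ℝ × E3)) := by fun_prop
    have hnear : ∀ᶠ P in 𝓝 ((u, 0, z) : ℝ × ℝ × E3), ContDiffAt ℝ (k + 2 : ℕ) Ψ P :=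
      hΨ.eventually (by simp)
    intro j hj
    rcases j with _ | j
    · filter_upwards [(h 0 (Nat.succ_pos k)).eventually_nhds,
        hc.continuousAt.eventually hnear] with q h1 h2
      have h3 : HasFDerivAt (fun q : ℝ × E3 => ((q.1, 0, q.2) : ℝ × ℝ × E3))
          ((ContinuousLinearMap.fst ℝ ℝ E3).prod
            ((0 : ℝ × E3 →L[ℝ] ℝ).prod (ContinuousLinearMap.snd ℝ ℝ E3))) q :=
        ContinuousLinearMap.hasFDerivAt ((ContinuousLinearMap.fst ℝ ℝ E3).prod
          ((0 : ℝ × E3 →L[ℝ] ℝ).prod (ContinuousLinearMap.snd ℝ ℝ E3)))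
      have h4 := HasFDerivAt.comp (𝕜 := ℝ) q (h2.differentiableAt (by simp)).hasFDerivAt h3
      have h5 : HasFDerivAt (Ψ ∘ fun q : ℝ × E3 => ((q.1, 0, q.2) : ℝ × ℝ × E3))
          (0 : ℝ × E3 →L[ℝ] ℝ) q :=
        (hasFDerivAt_const (0 : ℝ) q).congr_of_eventuallyEq h1
      have h6 := congrArg (fun L : ℝ × E3 →L[ℝ] ℝ => L (a, b)) (h4.unique h5)
      simpa using h6
    -- For higher Taylor coefficients the tangential derivative is commuted past `derivS` by
    -- symmetry of the second derivative, and induction applies to `derivS Ψ`.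
    · have h1 : VanishesTo u z k (derivS Ψ) := fun i hi => h (i + 1) (by omega)
      have h2 := ih h1 (contDiffAt_derivS hΨ)
      refine h2.congr ?_ j (by omega)
      filter_upwards [hnear] with P hP
      have hP2 : ContDiffAt ℝ 2 Ψ P := hP.of_le (by exact_mod_cast (by omega : 2 ≤ k + 2))
      change fderiv ℝ (fun P => fderiv ℝ Ψ P (a, 0, b)) P (0, 1, 0)
        = fderiv ℝ (fun P => fderiv ℝ Ψ P (0, 1, 0)) P (a, 0, b)
      rw [fderiv_fderiv_apply hP2, fderiv_fderiv_apply hP2, secondDeriv_comm hP2]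

end Vanishing

end

noncomputable section

/-! ### Functions smooth up to null infinity -/

section Affine
variable {E E' : Type*} [NormedAddCommGroup E] [NormedSpace ℝ E] [NormedAddCommGroup E']
  [NormedSpace ℝ E'] {Ψ : E' → ℝ} (A : E →L[ℝ] E') (c : E') {p : E}

theorem hasFDerivAt_affine (p : E) : HasFDerivAt (fun q => c + A q) A p :=
  A.hasFDerivAt.const_add c

theorem contDiffAt_comp_affine {n : WithTop ℕ∞} (h : ContDiffAt ℝ n Ψ (c + A p)) :
    ContDiffAt ℝ n (fun q => Ψ (c + A q)) p :=
  h.comp p (contDiffAt_const.add A.contDiff.contDiffAt)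

theorem fderiv_comp_affine (h : DifferentiableAt ℝ Ψ (c + A p)) :
    fderiv ℝ (fun q => Ψ (c + A q)) p = (fderiv ℝ Ψ (c + A p)).comp A :=
  (h.hasFDerivAt.comp p (hasFDerivAt_affine A c p)).fderiv

theorem secondDeriv_comp_affine (h : ContDiffAt ℝ 2 Ψ (c + A p)) (v w : E) :
    secondDeriv (fun q => Ψ (c + A q)) p v w = secondDeriv Ψ (c + A p) (A v) (A w) := by
  have h1 : (fun q => fderiv ℝ (fun q => Ψ (c + A q)) q w)
      =ᶠ[𝓝 p] fun q => fderiv ℝ Ψ (c + A q) (A w) := by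
    have h2 : ContinuousAt (fun q => c + A q) p := by fun_prop
    filter_upwards [h2.eventually (eventually_differentiableAt h)] with q hq
    rw [fderiv_comp_affine A c hq]
    rfl
  rw [← fderiv_fderiv_apply (contDiffAt_comp_affine A c h), h1.fderiv_eq,
    ← fderiv_fderiv_apply h]
  have h3 := (hasFDerivAt_fderiv_apply h (A w)).comp p (hasFDerivAt_affine A c p)
  have h4 : HasFDerivAt (fun q => fderiv ℝ Ψ (c + A q) (A w)) _ p := h3
  rw [h4.fderiv, (hasFDerivAt_fderiv_apply h (A w)).fderiv]
  rfl

end Affine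

open BondiSachsMetric

/-- The spatial part as a continuous linear map. -/
def spatialL : (Fin 4 → ℝ) →L[ℝ] E3 :=
  LinearMap.toContinuousLinearMap
    { toFun := spatial
      map_add' := fun _ _ => rfl
      map_smul' := fun _ _ => rfl }

theorem spatialL_apply (q : Fin 4 → ℝ) : spatialL q = spatial q := rfl

/-- The linear map `(u, y) ↦ (u, 0, s y)`. -/
def scaleL (s : ℝ) : (Fin 4 → ℝ) →L[ℝ] ℝ × ℝ × E3 :=
  (ContinuousLinearMap.proj 0).prod ((0 : (Fin 4 → ℝ) →L[ℝ] ℝ).prod (s • spatialL))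

theorem scaleL_apply (s : ℝ) (q : Fin 4 → ℝ) : scaleL s q = (q 0, 0, s • spatial q) := rfl

/-- The function `Ψ(u, s, z)` in the rescaled coordinates `z = y / r`, `s = 1 / r`. -/
def rescale (Ψ : ℝ × ℝ × E3 → ℝ) (r : ℝ) (q : Fin 4 → ℝ) : ℝ := Ψ (q 0, r⁻¹, r⁻¹ • spatial q)

/-- With `r` a fixed parameter the rescaling is affine and keeps `s = 1/r` constant. Derivatives in
`q` thus never differentiate in `s`, and each spatial one gains a factor `1/r`. -/
theorem rescale_eq (Ψ : ℝ × ℝ × E3 → ℝ) (r : ℝ) :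
    rescale Ψ r = fun q => Ψ ((0, r⁻¹, 0) + scaleL r⁻¹ q) := by
  funext q
  simp [rescale, scaleL_apply]

theorem spatial_point (u r : ℝ) (x : S2) : spatial (point u r x) = r • x.1 := by
  ext i
  simp [spatial, point]

theorem rescale_point {r : ℝ} (hr : r ≠ 0) (u : ℝ) (x : S2) :
    ((0, r⁻¹, 0) : ℝ × ℝ × E3) + scaleL r⁻¹ (point u r x) = (u, r⁻¹, x.1) := by
  rw [scaleL_apply, spatial_point, smul_smul, inv_mul_cancel₀ hr, one_smul]
  simp [point]

/-- The coefficients of a vector in rescaled coordinates. -/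
def scaledVec (r : ℝ) (v : Fin 4 → ℝ) : Fin 4 → ℝ := Fin.cons (v 0) fun i => r⁻¹ * v i.succ

theorem scaleL_eq_sum (r : ℝ) (v : Fin 4 → ℝ) :
    scaleL r⁻¹ v = ∑ a, scaledVec r v a • scaleL 1 (Pi.single a 1) := by
  have h1 : scaleL r⁻¹ v = scaleL 1 (scaledVec r v) := by
    rw [scaleL_apply, scaleL_apply, one_smul]
    congr 2
  rw [h1]
  conv_lhs => rw [pi_eq_sum_univ' (scaledVec r v), map_sum]
  simp only [map_smul]

theorem isBigO_scaledVec {X : ℝ → Fin 4 → ℝ}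
    (hX : ∀ a, (fun r => X r a) =O[atTop] fun r : ℝ => r ^ (-(0 : ℤ))) (a : Fin 4) :
    (fun r => scaledVec r (X r) a) =O[atTop] fun r : ℝ => r ^ (-(0 : ℤ)) := by
  refine Fin.cases (hX 0) (fun i => ?_) a
  have h : (fun r : ℝ => r⁻¹) =O[atTop] fun r : ℝ => r ^ (-(1 : ℤ)) := by
    simpa using Asymptotics.isBigO_refl _ _
  exact isBigO_mul_zpow h (hX i.succ) (by norm_num)

section Rescale
variable {u : ℝ} {x : S2} {k : ℕ} {Ψ : ℝ × ℝ × E3 → ℝ}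

theorem tendsto_slice (u : ℝ) (x : S2) :
    Tendsto (fun r : ℝ => ((u, r⁻¹, x.1) : ℝ × ℝ × E3)) atTop (𝓝 (u, 0, x.1)) :=
  ((continuous_slice u x.1).tendsto 0).comp tendsto_inv_atTop_zero

theorem VanishesTo.isBigO_atTop (h : VanishesTo u x.1 k Ψ) (hΨ : ContDiffAt ℝ k Ψ (u, 0, x.1)) :
    (fun r : ℝ => Ψ (u, r⁻¹, x.1)) =O[atTop] fun r : ℝ => r ^ (-(k : ℤ)) := by
  have h1 := (h.isBigO hΨ).comp_tendsto tendsto_inv_atTop_zero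
  refine h1.congr_right fun r => ?_
  simp

theorem smooth_fderiv_apply {P : ℝ × ℝ × E3} (h : ContDiffAt ℝ ∞ Ψ P) (a : ℝ × ℝ × E3) :
    ContDiffAt ℝ ∞ (fun P => fderiv ℝ Ψ P a) P :=
  (h.fderiv_right (m := ∞) (by simp)).clm_apply contDiffAt_const

theorem VanishesTo.fderiv_smooth (h : VanishesTo u x.1 k Ψ) (hΨ : ContDiffAt ℝ ∞ Ψ (u, 0, x.1))
    (v : Fin 4 → ℝ) : VanishesTo u x.1 k (fun P => _root_.fderiv ℝ Ψ P (scaleL 1 v)) :=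
  h.fderiv (hΨ.of_le (WithTop.coe_le_coe.2 le_top)) _ _

theorem isBigO_rescale (hΨ : ContDiffAt ℝ ∞ Ψ (u, 0, x.1)) (h : VanishesTo u x.1 k Ψ) :
    (fun r : ℝ => Ψ (u, r⁻¹, x.1)) =O[atTop] fun r : ℝ => r ^ (-(k : ℤ)) :=
  h.isBigO_atTop (hΨ.of_le (WithTop.coe_le_coe.2 le_top))

/-- By the chain rule only derivatives tangential to null infinity occur. They preserve the order of
vanishing `k`, and the decay of the scaled components of `v` adds to it. -/
theorem isBigO_fderiv_rescale (hΨ : ContDiffAt ℝ ∞ Ψ (u, 0, x.1)) (h : VanishesTo u x.1 k Ψ)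
    {m n : ℤ} {v : ℝ → Fin 4 → ℝ}
    (hv : ∀ a, (fun r => scaledVec r (v r) a) =O[atTop] fun r : ℝ => r ^ (-m)) (hn : n ≤ m + k) :
    (fun r => fderiv ℝ (rescale Ψ r) (point u r x) (v r)) =O[atTop] fun r : ℝ => r ^ (-n) := by
  have h1 : ∀ᶠ r : ℝ in atTop, DifferentiableAt ℝ Ψ (u, r⁻¹, x.1) :=
    (tendsto_slice u x).eventually (eventually_differentiableAt (hΨ.of_le two_le_smooth))
  have h2 : (fun r => fderiv ℝ (rescale Ψ r) (point u r x) (v r)) =ᶠ[atTop]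
      fun r => ∑ a, scaledVec r (v r) a * fderiv ℝ Ψ (u, r⁻¹, x.1) (scaleL 1 (Pi.single a 1)) := by
    filter_upwards [h1, eventually_ne_atTop 0] with r hr hr0
    rw [rescale_eq, fderiv_comp_affine _ _ (by rwa [rescale_point hr0]), rescale_point hr0]
    simp [scaleL_eq_sum]
  refine h2.trans_isBigO (Asymptotics.IsBigO.fun_sum fun a _ => isBigO_mul_zpow (hv a) ?_ hn)
  exact isBigO_rescale (smooth_fderiv_apply hΨ _) (h.fderiv_smooth hΨ _)

theorem isBigO_secondDeriv_rescale (hΨ : ContDiffAt ℝ ∞ Ψ (u, 0, x.1)) (h : VanishesTo u x.1 k Ψ)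
    {m m' n : ℤ} {v w : ℝ → Fin 4 → ℝ}
    (hv : ∀ a, (fun r => scaledVec r (v r) a) =O[atTop] fun r : ℝ => r ^ (-m))
    (hw : ∀ a, (fun r => scaledVec r (w r) a) =O[atTop] fun r : ℝ => r ^ (-m'))
    (hn : n ≤ m + m' + k) :
    (fun r => secondDeriv (rescale Ψ r) (point u r x) (v r) (w r))
      =O[atTop] fun r : ℝ => r ^ (-n) := by
  have h1 : ∀ᶠ r : ℝ in atTop, ContDiffAt ℝ 2 Ψ (u, r⁻¹, x.1) :=
    (tendsto_slice u x).eventually ((hΨ.of_le two_le_smooth).eventually (by simp))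
  have h2 : (fun r => secondDeriv (rescale Ψ r) (point u r x) (v r) (w r)) =ᶠ[atTop]
      fun r => ∑ a, scaledVec r (v r) a * ∑ b, scaledVec r (w r) b *
        fderiv ℝ (fun P => fderiv ℝ Ψ P (scaleL 1 (Pi.single b 1))) (u, r⁻¹, x.1)
          (scaleL 1 (Pi.single a 1)) := by
    filter_upwards [h1, eventually_ne_atTop 0] with r hr hr0
    rw [rescale_eq, secondDeriv_comp_affine _ _ (by rwa [rescale_point hr0]), rescale_point hr0,
      scaleL_eq_sum, scaleL_eq_sum]
    simp only [fderiv_fderiv_apply hr]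
    simp only [secondDeriv, map_sum, map_smul, smul_eq_mul, sum_apply, smul_apply]
    simp only [Finset.mul_sum, mul_left_comm]
    exact Finset.sum_comm
  refine h2.trans_isBigO (Asymptotics.IsBigO.fun_sum fun a _ => isBigO_mul_zpow (hv a)
    (Asymptotics.IsBigO.fun_sum fun b _ => isBigO_mul_zpow (hw b) ?_ (le_refl (m' + (k : ℤ)))) (by omega))
  exact isBigO_rescale (smooth_fderiv_apply (smooth_fderiv_apply hΨ _) _)
    ((h.fderiv_smooth hΨ _).fderiv_smooth (smooth_fderiv_apply hΨ _) _)

/-- A function that is smooth up to null infinity and vanishes there to order `k`. -/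
theorem jetO_rescale {X : ℝ → Fin 4 → ℝ} (hΨ : ContDiffAt ℝ ∞ Ψ (u, 0, x.1))
    (h : VanishesTo u x.1 k Ψ) (hX : ∀ a, (fun r => X r a) =O[atTop] fun r : ℝ => r ^ (-(0 : ℤ))) :
    JetO (fun r => point u r x) X (nullL x) k k (rescale Ψ) := by
  have hX' : ∀ a, (fun r => scaledVec r (X r) a) =O[atTop] fun r : ℝ => r ^ (-(0 : ℤ)) :=
    isBigO_scaledVec hX
  -- The radial vector has no `u` component, so all its scaled components carry the factor `1/r`;
  -- this is the gain per radial derivative.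
  have hY : ∀ a, (fun r => scaledVec r (nullL x) a) =O[atTop] fun r : ℝ => r ^ (-(1 : ℤ)) := by
    intro a
    refine Fin.cases ?_ (fun i => ?_) a
    · simpa [scaledVec, nullL] using Asymptotics.isBigO_zero _ _
    · simp only [scaledVec, nullL, Fin.cons_succ, zpow_neg_one, mul_comm _ (x.1 i)]
      exact Asymptotics.isBigO_const_mul_self _ _ _
  refine ⟨?_, ?_, isBigO_fderiv_rescale hΨ h hX' (by omega),
    isBigO_fderiv_rescale hΨ h hY (by omega), isBigO_secondDeriv_rescale hΨ h hX' hX' (by omega),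
    isBigO_secondDeriv_rescale hΨ h hX' hY (by omega),
    isBigO_secondDeriv_rescale hΨ h hY hY (by omega), fun a =>
    isBigO_fderiv_rescale hΨ h (v := fun _ => Pi.single a 1) (m := 0) (isBigO_scaledVec fun b => ?_)
      (by omega)⟩
  · filter_upwards [(tendsto_slice u x).eventually ((hΨ.of_le two_le_smooth).eventually (by simp)),
      eventually_ne_atTop 0] with r hr hr0
    rw [rescale_eq]
    exact contDiffAt_comp_affine _ _ (by rwa [rescale_point hr0])
  · refine EventuallyEq.trans_isBigO ?_ (isBigO_rescale hΨ h)
    filter_upwards [eventually_ne_atTop 0] with r hr0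
    rw [rescale_eq]
    exact congrArg Ψ (rescale_point hr0 u x)
  · simpa using Asymptotics.isBigO_const_const (Pi.single (M := fun _ => ℝ) a 1 b) (one_ne_zero (α := ℝ)) atTop

end Rescale

end

noncomputable section

/-! ### Coefficient functions near null infinity -/

open BondiSachsMetric

/-- A coefficient `H(u, 1/r, x)` as a function of `(u, y)`, `y = r x`. -/
def coef (H : ℝ → ℝ → S2 → ℝ) (q : Fin 4 → ℝ) : ℝ := H (q 0) ‖spatial q‖⁻¹ (dir (spatial q))

/-- The extension of `H` to a function of `(u, s, z)` that is homogeneous in `(s, z)`. -/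
def homogExt (H : ℝ → ℝ → S2 → ℝ) (P : ℝ × ℝ × E3) : ℝ :=
  radialExt (H P.1 (P.2.1 * ‖P.2.2‖⁻¹)) P.2.2

/-- The coefficient `H(u, s, x)` is smooth near null infinity at `(u, x)`. -/
def SmoothAtScri (H : ℝ → ℝ → S2 → ℝ) (u : ℝ) (x : S2) : Prop :=
  ContDiffAt ℝ ∞ (fun p : ℝ × ℝ × E3 => radialExt (H p.1 p.2.1) p.2.2) (u, 0, x.1)

section Coef
variable {H : ℝ → ℝ → S2 → ℝ} {u : ℝ} {x : S2} {k : ℕ}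

/-- `homogExt H` is invariant under a common positive scaling of `(s, z)`, so the coefficient can be
read with `s` frozen at `1/r` for any chosen `r`, in particular that of the base point. -/
theorem coef_eq_rescale {r : ℝ} (hr : 0 < r) : coef H = rescale (homogExt H) r := by
  funext q
  have h1 : r⁻¹ * ‖r⁻¹ • spatial q‖⁻¹ = ‖spatial q‖⁻¹ := by
    rw [norm_smul, Real.norm_of_nonneg (inv_nonneg.2 hr.le), mul_inv, inv_inv, ← mul_assoc,
      inv_mul_cancel₀ hr.ne', one_mul]
  simp only [coef, rescale, homogExt, radialExt, h1, dir_smul (inv_pos.2 hr)]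

theorem coef_point {r : ℝ} (hr : 0 < r) : coef H (point u r x) = H u r⁻¹ x := by
  simp only [coef, spatial_point, norm_smul, dir_smul hr, dir_coe, S2.norm_coe, mul_one,
    Real.norm_of_nonneg hr.le]
  rfl

theorem SmoothAtScri.homogExt (h : SmoothAtScri H u x) :
    ContDiffAt ℝ ∞ (homogExt H) (u, 0, x.1) := by
  have h1 : ContDiffAt ℝ ∞ (fun P : ℝ × ℝ × E3 => (P.1, P.2.1 * ‖P.2.2‖⁻¹, P.2.2)) (u, 0, x.1) := by
    have h2 : ContDiffAt ℝ ∞ (fun P : ℝ × ℝ × E3 => ‖P.2.2‖⁻¹) (u, 0, x.1) :=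
      ((contDiffAt_norm ℝ (S2.coe_ne_zero x)).comp (u, 0, x.1)
        (contDiffAt_snd.comp _ contDiffAt_snd)).inv (by simp)
    exact contDiffAt_fst.prodMk (((contDiffAt_fst.comp _ contDiffAt_snd).mul h2).prodMk
      (contDiffAt_snd.comp _ contDiffAt_snd))
  refine ContDiffAt.comp (g := fun p : ℝ × ℝ × E3 => radialExt (H p.1 p.2.1) p.2.2)
    (u, 0, x.1) ?_ h1
  simpa [SmoothAtScri] using h

/-- Along each ray `s` is `1/r` up to the positive factor `‖z‖`, so the expansions assumed at all
`(u', x')` bound the extension near every nearby point of null infinity. -/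
theorem vanishesTo_homogExt (h : SmoothAtScri H u x)
    (hO : ∀ u' x', (fun r => H u' r⁻¹ x') =O[atTop] fun r : ℝ => r ^ (-(k : ℤ))) :
    VanishesTo u x.1 k (homogExt H) := by
  refine VanishesTo.of_isBigO (h.homogExt.of_le (WithTop.coe_le_coe.2 le_top)) ?_
  have h1 : ∀ᶠ q : ℝ × E3 in 𝓝 (u, x.1), q.2 ≠ 0 :=
    continuousAt_snd.eventually_ne (S2.coe_ne_zero x)
  filter_upwards [h1] with q hq
  have hq' : 0 < ‖q.2‖ := norm_pos_iff.2 hq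
  have h2 : Tendsto (fun s : ℝ => s⁻¹ * ‖q.2‖) (𝓝[>] 0) atTop :=
    tendsto_inv_nhdsGT_zero.atTop_mul_const hq'
  have h3 := (hO q.1 (dir q.2)).comp_tendsto h2
  have h4 : (fun s => homogExt H (q.1, s, q.2))
      = (fun r => H q.1 r⁻¹ (dir q.2)) ∘ fun s : ℝ => s⁻¹ * ‖q.2‖ := by
    funext s
    simp [homogExt, radialExt, mul_comm]
  rw [h4]
  refine h3.trans ?_
  have h5 : ((fun r : ℝ => r ^ (-(k : ℤ))) ∘ fun s : ℝ => s⁻¹ * ‖q.2‖)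
      = fun s : ℝ => (‖q.2‖ ^ k)⁻¹ * s ^ k := by
    funext s
    simp only [Function.comp, zpow_neg, zpow_natCast, mul_pow, mul_inv, inv_pow, inv_inv]
    ring
  rw [h5]
  exact Asymptotics.isBigO_const_mul_self _ _ _

theorem jetO_coef {X : ℝ → Fin 4 → ℝ} (h : SmoothAtScri H u x)
    (hO : ∀ u' x', (fun r => H u' r⁻¹ x') =O[atTop] fun r : ℝ => r ^ (-(k : ℤ)))
    (hX : ∀ a, (fun r => X r a) =O[atTop] fun r : ℝ => r ^ (-(0 : ℤ))) :
    JetO (fun r => point u r x) X (nullL x) k k (fun _ => coef H) := by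
  refine (jetO_rescale h.homogExt (vanishesTo_homogExt h hO) hX).congr ?_
  filter_upwards [eventually_gt_atTop 0] with r hr
  rw [coef_eq_rescale hr]

theorem SmoothAtScri.contDiffAt_coef (h : SmoothAtScri H u x) :
    ∀ᶠ r in atTop, ContDiffAt ℝ 2 (coef H) (point u r x) := by
  filter_upwards [(tendsto_slice u x).eventually
    ((h.homogExt.of_le two_le_smooth).eventually (by simp)), eventually_gt_atTop 0] with r hr hr0
  rw [coef_eq_rescale hr0, rescale_eq]
  exact contDiffAt_comp_affine _ _ (by rwa [rescale_point hr0.ne'])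

theorem SmoothAtScri.secondDeriv_coef (h : SmoothAtScri H u x)
    (hO : ∀ u' x', (fun r => H u' r⁻¹ x') =O[atTop] fun r : ℝ => r ^ (-(k : ℤ)))
    {m m' n : ℤ} {v w : ℝ → Fin 4 → ℝ}
    (hv : ∀ a, (fun r => scaledVec r (v r) a) =O[atTop] fun r : ℝ => r ^ (-m))
    (hw : ∀ a, (fun r => scaledVec r (w r) a) =O[atTop] fun r : ℝ => r ^ (-m'))
    (hn : n ≤ m + m' + k) :
    (fun r => secondDeriv (coef H) (point u r x) (v r) (w r)) =O[atTop] fun r : ℝ => r ^ (-n) := by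
  refine EventuallyEq.trans_isBigO ?_
    (isBigO_secondDeriv_rescale h.homogExt (vanishesTo_homogExt h hO) hv hw hn)
  filter_upwards [eventually_gt_atTop 0] with r hr
  rw [coef_eq_rescale hr]

theorem SmoothAtScri.mul {H' : ℝ → ℝ → S2 → ℝ} (h : SmoothAtScri H u x) (h' : SmoothAtScri H' u x) :
    SmoothAtScri (fun u s x => H u s x * H' u s x) u x := ContDiffAt.mul h h'

theorem smoothAtScri_s : SmoothAtScri (fun _ s _ => s) u x :=
  contDiffAt_fst.comp (u, 0, x.1) contDiffAt_snd

theorem smoothAtScri_coord (i : Fin 3) : SmoothAtScri (fun _ _ x => x.1 i) u x :=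
  ContDiffAt.comp (g := fun z : E3 => (dir z).1 i) (f := fun P : ℝ × ℝ × E3 => P.2.2) (u, 0, x.1)
    (contDiffAt_euclidean.1 (contDiffAt_dir (S2.coe_ne_zero x)) i)
    (contDiffAt_snd.comp (u, 0, x.1) contDiffAt_snd)

theorem CylinderSmooth.smoothAtScri {F : ℝ → S2 → ℝ} (hF : CylinderSmooth F) :
    SmoothAtScri (fun u _ x => F u x) u x :=
  (hF.contDiffAt u (S2.coe_ne_zero x)).comp (f := fun p : ℝ × ℝ × E3 => (p.1, p.2.2)) (u, 0, x.1)
    (contDiffAt_fst.prodMk (contDiffAt_snd.comp _ contDiffAt_snd))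

end Coef

/-! ### Derivatives along coordinate lines and radial rays -/

section Ray
variable {F : (Fin 4 → ℝ) → ℝ} {φ : ℝ → ℝ} {c : ℝ} {p v : Fin 4 → ℝ} {u r : ℝ} {x : S2}

theorem fderiv_eq_of_line (hF : DifferentiableAt ℝ F p)
    (hφ : (fun t : ℝ => F (p + t • v)) =ᶠ[𝓝 0] φ) (h : HasDerivAt φ c 0) : fderiv ℝ F p v = c := by
  have h1 : HasDerivAt (fun t : ℝ => p + t • v) v 0 := by
    simpa using ((hasDerivAt_id (0 : ℝ)).smul_const v).const_add p
  have h2 : HasFDerivAt F (fderiv ℝ F p) (p + (0 : ℝ) • v) := by simpa using hF.hasFDerivAt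
  exact (h2.comp_hasDerivAt (0 : ℝ) h1).unique (h.congr_of_eventuallyEq hφ)

theorem point_add_single (t : ℝ) : point u r x + t • Pi.single 0 1 = point (u + t) r x := by
  funext a
  refine Fin.cases ?_ (fun i => ?_) a <;> simp [point]

theorem point_add_nullL (t : ℝ) : point u r x + t • nullL x = point u (r + t) x := by
  funext a
  refine Fin.cases ?_ (fun i => ?_) a
  · simp [point, nullL]
  · simp [point, nullL, add_mul]

theorem continuous_point (u : ℝ) (x : S2) : Continuous fun r => point u r x := by
  refine continuous_pi fun a => ?_
  refine Fin.cases ?_ (fun i => ?_) a <;> simp only [point, Fin.cons_zero, Fin.cons_succ] <;> fun_prop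

/-- The second derivative in the radial direction of the derivative along a fixed vector. -/
theorem secondDeriv_nullL (hF : ContDiffAt ℝ 2 F (point u r x))
    (hφ : ∀ᶠ ρ in 𝓝 r, fderiv ℝ F (point u ρ x) v = φ ρ) (h : HasDerivAt φ c r) :
    secondDeriv F (point u r x) v (nullL x) = c := by
  rw [secondDeriv_comm hF, ← fderiv_fderiv_apply hF]
  have ht : Tendsto (fun t : ℝ => r + t) (𝓝 0) (𝓝 r) := by
    have h1 : Continuous fun t : ℝ => r + t := by fun_prop
    simpa using h1.tendsto 0
  refine fderiv_eq_of_line (φ := fun t => φ (r + t)) (hasFDerivAt_fderiv_apply hF v).differentiableAt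
    ?_ ?_
  · filter_upwards [ht.eventually hφ] with t h1
    rw [point_add_nullL, h1]
  · have h2 : HasDerivAt φ c (r + 0) := by simpa using h
    simpa using h2.comp_const_add r 0

theorem eventually_differentiableAt_point (hF : ContDiffAt ℝ 2 F (point u r x)) :
    ∀ᶠ ρ in 𝓝 r, DifferentiableAt ℝ F (point u ρ x) :=
  (continuous_point u x).continuousAt.eventually (eventually_differentiableAt hF)

end Ray

end

noncomputable section

/-! ### Jets of the coefficients of a Bondi-Sachs metric -/

open BondiSachsMetric

theorem isBigO_inv_zpow : (fun r : ℝ => r⁻¹) =O[atTop] fun r : ℝ => r ^ (-(1 : ℤ)) := by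
  simpa using Asymptotics.isBigO_refl _ _

theorem isBigO_inv_pow (k : ℕ) : (fun r : ℝ => (r ^ k)⁻¹) =O[atTop] fun r : ℝ => r ^ (-(k : ℤ)) := by
  simpa using Asymptotics.isBigO_refl _ _

theorem isBigO_of_tendsto {f : ℝ → ℝ} {c : ℝ} (h : Tendsto f atTop (𝓝 c)) :
    f =O[atTop] fun r : ℝ => r ^ (-(0 : ℤ)) := by
  simpa using h.isBigO_one ℝ

theorem isBigO_const_zpow (c : ℝ) : (fun _ : ℝ => c) =O[atTop] fun r : ℝ => r ^ (-(0 : ℤ)) :=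
  isBigO_of_tendsto tendsto_const_nhds

theorem tendsto_of_isBigO {f : ℝ → ℝ} {k : ℤ} (hk : 1 ≤ k)
    (h : f =O[atTop] fun r : ℝ => r ^ (-k)) : Tendsto f atTop (𝓝 0) := by
  have h1 := (h.trans (isBigO_zpow hk)).trans_tendsto (by
    simpa using (tendsto_inv_atTop_zero (𝕜 := ℝ)))
  exact h1

/-! #### The direction of the position vector -/

section Dir
variable {u r : ℝ} {x : S2} {p : Fin 4 → ℝ} (i : Fin 3)

/-- The component `y_i / |y|`. -/
def dirCoef (i : Fin 3) : (Fin 4 → ℝ) → ℝ := coef fun _ _ z => z.1 i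

theorem dirCoef_eq : dirCoef i = fun q => radialExt (fun z : S2 => z.1 i) (0 + spatialL q) := by
  funext q
  simp [dirCoef, coef, radialExt, spatialL_apply]

theorem dirCoef_point (hr : 0 < r) : dirCoef i (point u r x) = x.1 i := coef_point hr

theorem contDiffAt_radialExt_coord (hr : 0 < r) :
    ContDiffAt ℝ 2 (radialExt fun z : S2 => z.1 i) (0 + spatialL (point u r x)) := by
  have h : spatialL (point u r x) ≠ 0 := by
    rw [spatialL_apply, spatial_point]
    exact smul_ne_zero hr.ne' (S2.coe_ne_zero x)
  rw [zero_add]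
  exact contDiffAt_euclidean.1 (contDiffAt_dir h) i

theorem contDiffAt_dirCoef (hr : 0 < r) : ContDiffAt ℝ 2 (dirCoef i) (point u r x) := by
  rw [dirCoef_eq]
  exact contDiffAt_comp_affine _ _ (contDiffAt_radialExt_coord i hr)

theorem fderiv_dirCoef (hr : 0 < r) (v : Fin 4 → ℝ) :
    fderiv ℝ (dirCoef i) (point u r x) v = (∑ j, roundMetric x j i * v j.succ) * r⁻¹ := by
  have h : r • x.1 ≠ 0 := smul_ne_zero hr.ne' (S2.coe_ne_zero x)
  rw [dirCoef_eq, fderiv_comp_affine _ _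
    ((contDiffAt_radialExt_coord i hr).differentiableAt (by norm_num)), ContinuousLinearMap.comp_apply,
    zero_add, spatialL_apply, spatial_point, fderiv_radialExt_of_ne_zero h, dir_smul hr, dir_coe,
    norm_smul, S2.norm_coe, Real.norm_of_nonneg hr.le, mul_one, fderiv_radialExt, mul_comm]
  · congr 1
    refine Finset.sum_congr rfl fun j _ => ?_
    rw [grad_coord]
    rfl
  · rw [SDiffAt]
    exact (contDiffAt_euclidean.1 (contDiffAt_dir (n := 2) (S2.coe_ne_zero _)) i).differentiableAt
      (by norm_num)

theorem secondDeriv_dirCoef_nullL (hr : 0 < r) (v : Fin 4 → ℝ) :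
    secondDeriv (dirCoef i) (point u r x) v (nullL x)
      = (∑ j, roundMetric x j i * v j.succ) * -(r ^ 2)⁻¹ := by
  refine secondDeriv_nullL (contDiffAt_dirCoef i hr)
    (φ := fun ρ => (∑ j, roundMetric x j i * v j.succ) * ρ⁻¹) ?_ ((hasDerivAt_inv hr.ne').const_mul _)
  filter_upwards [lt_mem_nhds hr] with ρ hρ
  exact fderiv_dirCoef i hρ v

theorem roundMetric_mul_self (x : S2) : ∑ j, roundMetric x j i * x.1 j = 0 := by
  simpa only [roundMetric_comm x i] using sum_roundMetric_mul_coord x i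

theorem secondDeriv_sub_const (F : (Fin 4 → ℝ) → ℝ) (c : ℝ) (v w : Fin 4 → ℝ) :
    secondDeriv (fun q => F q - c) p v w = secondDeriv F p v w := by
  have h : fderiv ℝ (fun q => F q - c) = fderiv ℝ F := by
    funext q
    exact fderiv_sub_const c
  simp only [secondDeriv, h]

/-- The direction is constant along the ray, so the function and its radial derivatives vanish
there. A general derivative is `O(r⁻¹)`; the vector `X` is tangential to the spheres only up to
`O(r⁻¹)`, which gives its derivative the better order 2. -/
theorem jetO_dir {X : ℝ → Fin 4 → ℝ} {a : ℝ → ℝ} {b : ℝ → Fin 3 → ℝ}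
    (hX : ∀ a, (fun r => X r a) =O[atTop] fun r : ℝ => r ^ (-(0 : ℤ)))
    (hab : ∀ r i, X r i.succ = b r i + a r * x.1 i)
    (hb : ∀ i, (fun r => b r i) =O[atTop] fun r : ℝ => r ^ (-(1 : ℤ))) :
    JetO (fun r => point u r x) X (nullL x) 2 1 (fun _ q => dirCoef i q - x.1 i) := by
  have hpos := eventually_gt_atTop (0 : ℝ)
  have hκ : (fun r => ∑ j, roundMetric x j i * X r j.succ) =O[atTop] fun r : ℝ => r ^ (-(1 : ℤ)) := by
    have h1 : (fun r => ∑ j, roundMetric x j i * X r j.succ)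
        = fun r => ∑ j, roundMetric x j i * b r j := by
      funext r
      simp only [hab, mul_add, Finset.sum_add_distrib]
      have := roundMetric_mul_self i x
      simp only [mul_left_comm _ (a r), ← Finset.mul_sum, this, mul_zero, add_zero]
    rw [h1]
    exact Asymptotics.IsBigO.fun_sum fun j _ => (hb j).const_mul_left _
  have hY : ∑ j, roundMetric x j i * nullL x j.succ = 0 := roundMetric_mul_self i x
  refine ⟨hpos.mono fun r hr => (contDiffAt_dirCoef i hr).sub contDiffAt_const, ?_, ?_, ?_, ?_, ?_,
    ?_, fun c => ?_⟩
  · refine EventuallyEq.trans_isBigO ?_ (Asymptotics.isBigO_zero _ _)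
    filter_upwards [hpos] with r hr
    rw [dirCoef_point i hr, sub_self]
  · refine EventuallyEq.trans_isBigO ?_ (isBigO_mul_zpow hκ isBigO_inv_zpow (by norm_num))
    filter_upwards [hpos] with r hr
    rw [fderiv_sub_const, fderiv_dirCoef i hr]
  · refine EventuallyEq.trans_isBigO ?_ (Asymptotics.isBigO_zero _ _)
    filter_upwards [hpos] with r hr
    rw [fderiv_sub_const, fderiv_dirCoef i hr, hY, zero_mul]
  -- The direction does not depend on `u`, so `X` may be replaced by its spatial part, whose two
  -- scaled copies give `r⁻²`.
  · have hs : ∀ c, (fun r => scaledVec r (Fin.cons 0 fun j => X r j.succ) c) =O[atTop]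
        fun r : ℝ => r ^ (-(1 : ℤ)) := by
      intro c
      refine Fin.cases ?_ (fun j => ?_) c
      · simpa [scaledVec] using Asymptotics.isBigO_zero _ _
      · exact isBigO_mul_zpow isBigO_inv_zpow (hX j.succ) (by norm_num)
    refine EventuallyEq.trans_isBigO ?_ ((smoothAtScri_coord i (u := u) (x := x)).secondDeriv_coef
      (k := 0) (n := 2) (fun _ x' => isBigO_const_zpow _) hs hs (by norm_num))
    filter_upwards [hpos] with r hr
    rw [secondDeriv_sub_const]
    change _ = secondDeriv (dirCoef i) _ _ _
    rw [dirCoef_eq, secondDeriv_comp_affine _ _ (contDiffAt_radialExt_coord i hr),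
      secondDeriv_comp_affine _ _ (contDiffAt_radialExt_coord i hr)]
    rfl
  · refine EventuallyEq.trans_isBigO ?_ (isBigO_mul_zpow hκ (isBigO_inv_pow 2).neg_left (by norm_num))
    filter_upwards [hpos] with r hr
    rw [secondDeriv_sub_const, secondDeriv_dirCoef_nullL i hr]
  · refine EventuallyEq.trans_isBigO ?_ (Asymptotics.isBigO_zero _ _)
    filter_upwards [hpos] with r hr
    rw [secondDeriv_sub_const, secondDeriv_dirCoef_nullL i hr, hY, zero_mul]
  · refine EventuallyEq.trans_isBigO ?_ (isBigO_inv_zpow.const_mul_left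
      (∑ j, roundMetric x j i * (Pi.single c 1 : Fin 4 → ℝ) j.succ))
    filter_upwards [hpos] with r hr
    rw [fderiv_sub_const, fderiv_dirCoef i hr]

end Dir

end

noncomputable section

open BondiSachsMetric

namespace JetO
variable {p X : ℝ → Fin 4 → ℝ} {Y : Fin 4 → ℝ} {k l : ℤ} {F G : ℝ → (Fin 4 → ℝ) → ℝ}

theorem neg (hF : JetO p X Y k l F) : JetO p X Y k l (fun r q => -F r q) := by
  simpa using const_mul (isBigO_const_zpow (-1)) hF

theorem sub (hF : JetO p X Y k l F) (hG : JetO p X Y k l G) :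
    JetO p X Y k l (fun r q => F r q - G r q) := by
  simpa only [sub_eq_add_neg] using hF.add hG.neg

end JetO

/-! #### Decay of the coefficients -/

namespace BondiSachsMetric
variable {G : BondiSachsMetric}

namespace HasNullInfinityData
variable {D : NullInfinityData} (hG : G.HasNullInfinityData D)
include hG

theorem isBigO_U3 (u : ℝ) (x : S2) : (fun r : ℝ => G.U u r⁻¹ x - 1
    + 1 / 16 * contract (D.C u x) (D.C u x) * (r⁻¹ * r⁻¹)) =O[atTop] fun r : ℝ => r ^ (-((3 : ℕ) : ℤ)) := by
  refine ((hG.expand_U u x).trans (isBigO_inv_pow 3)).congr_left fun r => ?_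
  rw [div_eq_mul_inv, mul_inv]
  ring

theorem isBigO_U (u : ℝ) (x : S2) :
    (fun r : ℝ => G.U u r⁻¹ x - 1) =O[atTop] fun r : ℝ => r ^ (-((2 : ℕ) : ℤ)) := by
  have h1 := ((hG.isBigO_U3 u x).trans (isBigO_zpow (b := 2) (by norm_num))).sub
    ((isBigO_inv_pow 2).const_mul_left (1 / 16 * contract (D.C u x) (D.C u x)))
  refine h1.congr_left fun r => ?_
  ring

theorem isBigO_V2 (u : ℝ) (x : S2) : (fun r : ℝ => G.V u r⁻¹ x - 1 + 2 * D.m u x * r⁻¹)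
    =O[atTop] fun r : ℝ => r ^ (-((2 : ℕ) : ℤ)) := by
  have h1 := (((hG.expand_V u x).trans (isBigO_inv_pow 3)).trans
    (isBigO_zpow (b := 2) (by norm_num))).add ((isBigO_inv_pow 2).const_mul_left
      ((1 / 3) * div1 (D.N u) x + (1 / 4) * ∑ b, div2 (D.C u) x b * div2 (D.C u) x b
        + (1 / 16) * contract (D.C u x) (D.C u x)))
  refine h1.congr_left fun r => ?_
  rw [div_eq_mul_inv]
  ring

theorem isBigO_V (u : ℝ) (x : S2) :
    (fun r : ℝ => G.V u r⁻¹ x - 1) =O[atTop] fun r : ℝ => r ^ (-((1 : ℕ) : ℤ)) := by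
  have h1 := ((hG.isBigO_V2 u x).trans (isBigO_zpow (b := 1) (by norm_num))).sub
    (isBigO_inv_zpow.const_mul_left (2 * D.m u x))
  refine h1.congr_left fun r => ?_
  ring

theorem isBigO_W (u : ℝ) (x : S2) (i : Fin 3) :
    (fun r : ℝ => G.W u r⁻¹ x i) =O[atTop] fun r : ℝ => r ^ (-((2 : ℕ) : ℤ)) := by
  have h1 := ((((hG.expand_W u x i).trans (isBigO_inv_pow 4)).trans
    (isBigO_zpow (b := 2) (by norm_num))).add ((isBigO_inv_pow 2).const_mul_left
      (1 / 2 * div2 (D.C u) x i))).add (((isBigO_inv_pow 3).trans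
    (isBigO_zpow (b := 2) (by norm_num))).const_mul_left ((2 / 3) * D.N u x i
          - (1 / 16) * grad (fun z => contract (D.C u z) (D.C u z)) x i
          - (1 / 2) * ∑ b, D.C u x i b * div2 (D.C u) x b))
  refine h1.congr_left fun r => ?_
  rw [mul_inv]
  ring

theorem isBigO_h_sub (u : ℝ) (x : S2) (i j : Fin 3) :
    (fun r : ℝ => G.h u r⁻¹ x i j - roundMetric x i j) =O[atTop]
      fun r : ℝ => r ^ (-((1 : ℕ) : ℤ)) := by
  have h1 := ((((hG.expand_h u x i j).trans (isBigO_inv_pow 3)).trans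
    (isBigO_zpow (b := 1) (by norm_num))).add (isBigO_inv_zpow.const_mul_left (D.C u x i j))).add
    (((isBigO_inv_pow 2).trans (isBigO_zpow (b := 1) (by norm_num))).const_mul_left
      (1 / 4 * contract (D.C u x) (D.C u x) * roundMetric x i j))
  refine h1.congr_left fun r => ?_
  rw [div_eq_mul_inv, div_eq_mul_inv, mul_inv]
  ring

theorem isBigO_h (u : ℝ) (x : S2) (i j : Fin 3) :
    (fun r : ℝ => G.h u r⁻¹ x i j) =O[atTop] fun r : ℝ => r ^ (-((0 : ℕ) : ℤ)) := by
  have h1 := ((hG.isBigO_h_sub u x i j).trans (isBigO_zpow (b := 0) (by norm_num))).add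
    (isBigO_const_zpow (roundMetric x i j))
  refine h1.congr_left fun r => ?_
  ring

theorem tendsto_U (u : ℝ) (x : S2) : Tendsto (fun r : ℝ => G.U u r⁻¹ x) atTop (𝓝 1) := by
  simpa using (tendsto_of_isBigO (by norm_num) (hG.isBigO_U u x)).add_const 1

theorem tendsto_V (u : ℝ) (x : S2) : Tendsto (fun r : ℝ => G.V u r⁻¹ x) atTop (𝓝 1) := by
  simpa using (tendsto_of_isBigO (by norm_num) (hG.isBigO_V u x)).add_const 1

theorem tendsto_h (u : ℝ) (x : S2) (i j : Fin 3) :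
    Tendsto (fun r : ℝ => G.h u r⁻¹ x i j) atTop (𝓝 (roundMetric x i j)) := by
  simpa using (tendsto_of_isBigO (by norm_num) (hG.isBigO_h_sub u x i j)).add_const
    (roundMetric x i j)

theorem isBigO_rW (u : ℝ) (x : S2) (i : Fin 3) :
    (fun r : ℝ => r * G.W u r⁻¹ x i) =O[atTop] fun r : ℝ => r ^ (-(1 : ℤ)) := by
  have h : (fun r : ℝ => r) =O[atTop] fun r : ℝ => r ^ (-(-1 : ℤ)) := by
    simpa using Asymptotics.isBigO_refl _ _
  exact isBigO_mul_zpow h (hG.isBigO_W u x i) (by norm_num)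

theorem tendsto_nullLbar_zero (u : ℝ) (x : S2) :
    Tendsto (fun r => G.nullLbar u r x 0) atTop (𝓝 2) := by
  have h : Tendsto (fun r => 2 / G.U u r⁻¹ x) atTop (𝓝 (2 / 1)) :=
    tendsto_const_nhds.div (hG.tendsto_U u x) one_ne_zero
  simpa [nullLbar] using h

end HasNullInfinityData

/-- The radial component of `L̲`. -/
def radialPart (G : BondiSachsMetric) (u : ℝ) (x : S2) (r : ℝ) : ℝ :=
  -(2 / G.U u r⁻¹ x * (G.V u r⁻¹ x / 2))

/-- The component of `L̲` tangential to the spheres. -/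
def tangentPart (G : BondiSachsMetric) (u : ℝ) (x : S2) (r : ℝ) (i : Fin 3) : ℝ :=
  -(2 / G.U u r⁻¹ x * (r * G.W u r⁻¹ x i))

theorem nullLbar_succ (u : ℝ) (x : S2) (r : ℝ) (i : Fin 3) :
    G.nullLbar u r x i.succ = G.tangentPart u x r i + G.radialPart u x r * x.1 i := by
  simp only [nullLbar, Fin.cons_succ, tangentPart, radialPart]
  ring

theorem sum_tangentPart (u : ℝ) (x : S2) (r : ℝ) : ∑ i, x.1 i * G.tangentPart u x r i = 0 := by
  have h := G.tangent_W u r⁻¹ x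
  simp only [Fin.sum_univ_three, tangentPart] at h ⊢
  linear_combination -(2 / G.U u r⁻¹ x * r) * h

/-- The order of decay along the radial rays, with respect to `L̲` and `L`. -/
abbrev JetScri (G : BondiSachsMetric) (u : ℝ) (x : S2) (k l : ℤ) (F : ℝ → (Fin 4 → ℝ) → ℝ) : Prop :=
  JetO (fun r => point u r x) (fun r => G.nullLbar u r x) (nullL x) k l F

/-- `r W_i` as a function of `(u, y)`. -/
def shift (G : BondiSachsMetric) (i : Fin 3) (q : Fin 4 → ℝ) : ℝ :=
  ‖spatial q‖ * coef (fun u s x => G.W u s x i) q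

namespace HasNullInfinityData
variable {D : NullInfinityData} (hG : G.HasNullInfinityData D) (u : ℝ) (x : S2)
include hG

theorem isBigO_radialPart : (G.radialPart u x) =O[atTop] fun r : ℝ => r ^ (-(0 : ℤ)) :=
  isBigO_of_tendsto (((hG.tendsto_nullLbar_zero u x).mul ((hG.tendsto_V u x).div_const 2)).neg)

theorem isBigO_tangentPart (i : Fin 3) :
    (fun r => G.tangentPart u x r i) =O[atTop] fun r : ℝ => r ^ (-(1 : ℤ)) :=
  (isBigO_mul_zpow (isBigO_of_tendsto (hG.tendsto_nullLbar_zero u x)) (hG.isBigO_rW u x i)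
    (by norm_num)).neg_left

theorem isBigO_nullLbar (a : Fin 4) :
    (fun r => G.nullLbar u r x a) =O[atTop] fun r : ℝ => r ^ (-(0 : ℤ)) := by
  refine Fin.cases (isBigO_of_tendsto (hG.tendsto_nullLbar_zero u x)) (fun i => ?_) a
  simp only [nullLbar_succ]
  refine ((hG.isBigO_tangentPart u x i).trans (isBigO_zpow (by norm_num))).add
    (isBigO_mul_zpow (hG.isBigO_radialPart u x) (isBigO_const_zpow (x.1 i)) (by norm_num))

theorem jet_dir (i : Fin 3) : G.JetScri u x 2 1 (fun _ q => dirCoef i q - x.1 i) :=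
  jetO_dir i (hG.isBigO_nullLbar u x) (nullLbar_succ u x) (hG.isBigO_tangentPart u x)

theorem jet_U : G.JetScri u x 2 2 (fun _ q => coef G.U q - 1) :=
  jetO_coef (H := fun u s x => G.U u s x - 1) (k := 2)
    (ContDiffAt.sub (G.smooth_U u x) contDiffAt_const) hG.isBigO_U (hG.isBigO_nullLbar u x)

theorem jet_V : G.JetScri u x 1 1 (fun _ q => coef G.V q - 1) :=
  jetO_coef (H := fun u s x => G.V u s x - 1) (k := 1)
    (ContDiffAt.sub (G.smooth_V u x) contDiffAt_const) hG.isBigO_V (hG.isBigO_nullLbar u x)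

theorem jet_h (i j : Fin 3) : G.JetScri u x 0 0 (fun _ => coef fun u s x => G.h u s x i j) :=
  jetO_coef (k := 0) (G.smooth_h u x i j) (fun u x => hG.isBigO_h u x i j) (hG.isBigO_nullLbar u x)

theorem jet_shift (i : Fin 3) : G.JetScri u x 1 1 (fun _ => G.shift i) := by
  have h1 : G.JetScri u x 2 2 (fun _ => coef fun u s x => G.W u s x i) :=
    jetO_coef (k := 2) (G.smooth_W u x i) (fun u x => hG.isBigO_W u x i) (hG.isBigO_nullLbar u x)
  -- The factor `‖y‖` is `r` times the rescaled norm of `z`, hence of order -1; multiplied by `W` of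
  -- order 2 it leaves order 1.
  have h2 : G.JetScri u x 0 0 (rescale fun P => ‖P.2.2‖) := by
    refine jetO_rescale (k := 0) ?_ (fun j hj => absurd hj (Nat.not_lt_zero j))
      (hG.isBigO_nullLbar u x)
    exact (contDiffAt_norm ℝ (S2.coe_ne_zero x)).comp (u, 0, x.1)
      (contDiffAt_snd.comp (u, 0, x.1) contDiffAt_snd)
  have h3 : (fun r : ℝ => r) =O[atTop] fun r : ℝ => r ^ (-(-1 : ℤ)) := by
    simpa using Asymptotics.isBigO_refl _ _
  have h4 : G.JetScri u x (-1) (-1) (fun r q => r * rescale (fun P => ‖P.2.2‖) r q) :=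
    JetO.mul (l := -1) (JetO.const h3) h2 (by norm_num) (by norm_num) (by norm_num)
  refine (h4.mul h1 (m := 1) (n := 1) (by norm_num) (by norm_num) (by norm_num)).congr ?_
  filter_upwards [eventually_gt_atTop 0] with r hr
  refine Eventually.of_forall fun q => ?_
  simp only [shift, rescale, norm_smul, norm_inv, Real.norm_of_nonneg hr.le]
  rw [← mul_assoc r, mul_inv_cancel₀ hr.ne', one_mul]

end HasNullInfinityData

end BondiSachsMetric

end

noncomputable section

open BondiSachsMetric

/-! ### Components of a Bondi-Sachs metric -/

namespace BondiSachsMetric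
variable (G : BondiSachsMetric)

theorem metric_symm (q : Fin 4 → ℝ) (a b : Fin 4) : G.metric q a b = G.metric q b a := by
  simp only [metric, Matrix.of_apply]
  congr 1
  · ring
  · congr 1
    rw [Finset.sum_comm]
    refine Finset.sum_congr rfl fun i _ => Finset.sum_congr rfl fun j _ => ?_
    rw [G.symm_h]
    ring

theorem sum_sum_quadratic (v w : Fin 4 → ℝ) (c d : ℝ) (du dr : Fin 4 → ℝ) (h : Fin 3 → Fin 3 → ℝ)
    (θ : Fin 3 → Fin 4 → ℝ) (e : ℝ) :
    ∑ a, ∑ b, v a * w b * (c * du a * du b - d * (du a * dr b + dr a * du b)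
        + e * ∑ i, ∑ j, h i j * (θ i a) * (θ j b))
      = c * (∑ a, v a * du a) * (∑ b, w b * du b)
        - d * ((∑ a, v a * du a) * (∑ b, w b * dr b) + (∑ a, v a * dr a) * (∑ b, w b * du b))
        + e * ∑ i, ∑ j, h i j * (∑ a, v a * θ i a) * (∑ b, w b * θ j b) := by
  simp only [Fin.sum_univ_four, Fin.sum_univ_three]
  ring

/-- The components of a vector `v` along the spheres relative to the frame `∂_u - W^A ∂_A`, up to
an arbitrary multiple `α` of the radial direction. -/
def sphereComp (v : Fin 4 → ℝ) (α : ℝ) (i : Fin 3) (q : Fin 4 → ℝ) : ℝ :=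
  v i.succ - α * dirCoef i q + G.shift i q * v 0

/-- The tensor `h` annihilates the normal, so normal multiples may be added to either argument
freely. This is the freedom `α` in `sphereComp`. -/
theorem sum_sum_tangential {h : Fin 3 → Fin 3 → ℝ} {n : Fin 3 → ℝ} (hn : ∀ i, ∑ j, h i j * n j = 0)
    (hs : ∀ i j, h i j = h j i) (v w : Fin 3 → ℝ) (α β : ℝ) :
    ∑ i, ∑ j, h i j * (v i + α * n i) * (w j + β * n j) = ∑ i, ∑ j, h i j * v i * w j := by
  have h1 : ∀ i, ∑ j, h i j * (v i + α * n i) * (w j + β * n j)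
      = ∑ j, h i j * v i * w j + α * (n i * ∑ j, h i j * w j) := by
    intro i
    have := hn i
    simp only [Fin.sum_univ_three] at this ⊢
    linear_combination (v i + α * n i) * β * this
  have h2 : ∑ i, n i * ∑ j, h i j * w j = 0 := by
    simp only [Finset.mul_sum]
    rw [Finset.sum_comm]
    refine Finset.sum_eq_zero fun j _ => ?_
    have := hn j
    rw [← mul_zero (w j), ← this, Finset.mul_sum]
    refine Finset.sum_congr rfl fun i _ => ?_
    rw [hs i j]
    ring
  rw [Finset.sum_congr rfl fun i _ => h1 i, Finset.sum_add_distrib, ← Finset.mul_sum, h2, mul_zero,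
    add_zero]

/-- The multiples `α`, `β` are chosen later for each vector so that the spherical components are
small near the ray: `1` for `L`, `radialPart` for `L̲`, and `0` for coordinate vectors. -/
theorem metricPair_metric {q : Fin 4 → ℝ} (hq : spatial q ≠ 0) (v w : Fin 4 → ℝ) (α β : ℝ) :
    metricPair G.metric v w q = -(coef G.U q * coef G.V q) * v 0 * w 0
      - coef G.U q * (v 0 * (∑ i, w i.succ * dirCoef i q) + (∑ i, v i.succ * dirCoef i q) * w 0)
      + ∑ i, ∑ j, coef (fun u s x => G.h u s x i j) q * G.sphereComp v α i q
        * G.sphereComp w β j q := by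
  have hr : ‖spatial q‖ ≠ 0 := norm_ne_zero_iff.2 hq
  simp only [metricPair, metric, Matrix.of_apply]
  rw [sum_sum_quadratic]
  have e1 : ∀ v : Fin 4 → ℝ, ∑ a, v a * (Fin.cons 1 (fun _ : Fin 3 => 0) : Fin 4 → ℝ) a = v 0 := by
    intro v
    simp [Fin.sum_univ_succ]
  have e2 : ∀ v : Fin 4 → ℝ, ∑ a, v a * (Fin.cons 0 (fun j : Fin 3 => (dir (spatial q)).1 j) :
      Fin 4 → ℝ) a = ∑ i, v i.succ * dirCoef i q := by
    intro v
    rw [Fin.sum_univ_succ]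
    simp [dirCoef, coef]
  have e3 : ∀ (v : Fin 4 → ℝ) (i : Fin 3), ∑ a, v a * ((Fin.cons 0 (fun j : Fin 3 =>
      ‖spatial q‖⁻¹ * roundMetric (dir (spatial q)) i j) : Fin 4 → ℝ) a
        + G.W (q 0) ‖spatial q‖⁻¹ (dir (spatial q)) i *
          (Fin.cons 1 (fun _ : Fin 3 => 0) : Fin 4 → ℝ) a)
      = ‖spatial q‖⁻¹ * ((v i.succ + G.shift i q * v 0)
        + -(∑ j, v j.succ * dirCoef j q) * dirCoef i q) := by
    intro v i
    rw [Fin.sum_univ_succ]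
    simp only [Fin.cons_zero, Fin.cons_succ, mul_zero, add_zero, zero_add, mul_one, shift,
      dirCoef, coef, roundMetric, kron]
    have : ∑ j : Fin 3, v j.succ * (‖spatial q‖⁻¹ * ((if i = j then 1 else 0)
        - (dir (spatial q)).1 i * (dir (spatial q)).1 j))
        = ‖spatial q‖⁻¹ * (v i.succ - (∑ j, v j.succ * (dir (spatial q)).1 j)
          * (dir (spatial q)).1 i) := by
      fin_cases i <;> simp [Fin.sum_univ_three] <;> ring
    rw [this]
    field_simp
    ring
  have hn : ∀ i, ∑ j, coef (fun u s x => G.h u s x i j) q * dirCoef j q = 0 := fun i =>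
    G.tangent_h _ _ _ i
  have hs : ∀ i j, coef (fun u s x => G.h u s x i j) q = coef (fun u s x => G.h u s x j i) q :=
    fun i j => G.symm_h _ _ _ i j
  simp only [e1, e2, e3]
  have e4 : ∀ i j, G.h (q 0) ‖spatial q‖⁻¹ (dir (spatial q)) i j *
      (‖spatial q‖⁻¹ * ((v i.succ + G.shift i q * v 0)
        + -(∑ j, v j.succ * dirCoef j q) * dirCoef i q)) *
      (‖spatial q‖⁻¹ * ((w j.succ + G.shift j q * w 0)
        + -(∑ j, w j.succ * dirCoef j q) * dirCoef j q)) = ‖spatial q‖⁻¹ ^ 2 *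
      (coef (fun u s x => G.h u s x i j) q * ((v i.succ + G.shift i q * v 0)
        + -(∑ j, v j.succ * dirCoef j q) * dirCoef i q) * ((w j.succ + G.shift j q * w 0)
        + -(∑ j, w j.succ * dirCoef j q) * dirCoef j q)) := by
    intro i j
    simp only [coef]
    ring
  simp only [e4, ← Finset.mul_sum]
  rw [sum_sum_tangential hn hs]
  have e5 : ∀ (v : Fin 4 → ℝ) α i, G.sphereComp v α i q
      = (v i.succ + G.shift i q * v 0) + -α * dirCoef i q := by
    intro v α i
    simp only [sphereComp]
    ring
  simp only [e5]
  rw [sum_sum_tangential hn hs, ← mul_assoc, ← mul_pow, mul_inv_cancel₀ hr, one_pow, one_mul]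
  simp only [coef]

end BondiSachsMetric

end

/-! ### Orders of the metric components in the frozen null frame -/

noncomputable section

open BondiSachsMetric

namespace BondiSachsMetric
variable {G : BondiSachsMetric}

theorem eventually_spatial_ne_zero (u : ℝ) (x : S2) :
    ∀ᶠ r in atTop, ∀ᶠ q in 𝓝 (point u r x), spatial q ≠ 0 := by
  filter_upwards [eventually_gt_atTop 0] with r hr
  have h : spatialL (point u r x) ≠ 0 := by
    rw [spatialL_apply, spatial_point]
    exact smul_ne_zero hr.ne' (S2.coe_ne_zero x)
  exact spatialL.continuous.continuousAt.eventually_ne h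

/-- The radial component of a vector. -/
def radialComp (v q : Fin 4 → ℝ) : ℝ := ∑ i, v i.succ * dirCoef i q

theorem sum_dirCoef_sq (q : Fin 4 → ℝ) : ∑ i, dirCoef i q * dirCoef i q = 1 :=
  S2.sum_sq (dir (spatial q))

namespace HasNullInfinityData
variable {D : NullInfinityData} (hG : G.HasNullInfinityData D) (u : ℝ) (x : S2)
include hG

/-- For unit vectors `n · x - 1 = -1/2 |n - x|²`, which is quadratic in `n - x`, so the order of
`jet_dir` doubles. -/
theorem jet_radialComp_nullL : G.JetScri u x 4 3 (fun _ q => radialComp (nullL x) q - 1) := by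
  have h1 : G.JetScri u x 4 3 (fun _ q => ∑ i, (dirCoef i q - x.1 i) * (dirCoef i q - x.1 i)) :=
    JetO.sum fun i => (hG.jet_dir u x i).mul (hG.jet_dir u x i) (by norm_num) (by norm_num)
      (by norm_num)
  have h2 := JetO.const_mul (isBigO_const_zpow (-(1 / 2))) h1
  refine h2.congr (Eventually.of_forall fun r => Eventually.of_forall fun q => ?_)
  have e1 := sum_dirCoef_sq q
  have e2 := S2.sum_sq x
  simp only [radialComp, nullL, Fin.cons_succ, Fin.sum_univ_three] at e1 e2 ⊢
  linear_combination (1 / 2) * e1 + (1 / 2) * e2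

/-- The deviation is the tangential part of `L̲`, of order 1, paired with `n - x`, plus a multiple
of the quadratic deviation for `L`. -/
theorem jet_radialComp_nullLbar :
    G.JetScri u x 3 2 (fun r q => radialComp (G.nullLbar u r x) q - G.radialPart u x r) := by
  have h1 : G.JetScri u x 3 2 (fun r q => ∑ i, G.tangentPart u x r i * (dirCoef i q - x.1 i)) :=
    JetO.sum fun i => JetO.mul (l := 1) (JetO.const (hG.isBigO_tangentPart u x i))
      (hG.jet_dir u x i) (by norm_num) (by norm_num) (by norm_num)
  have h2 := h1.add (JetO.const_mul (hG.isBigO_radialPart u x)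
    ((hG.jet_radialComp_nullL u x).mono (by norm_num) (by norm_num)))
  refine h2.congr (Eventually.of_forall fun r => Eventually.of_forall fun q => ?_)
  have e1 := sum_tangentPart (G := G) u x r
  simp only [radialComp, nullL, nullLbar_succ, Fin.cons_succ, Fin.sum_univ_three] at e1 ⊢
  linear_combination e1

theorem jet_sphereComp_nullL (i : Fin 3) :
    G.JetScri u x 2 1 (fun _ => G.sphereComp (nullL x) 1 i) := by
  refine (hG.jet_dir u x i).neg.congr
    (Eventually.of_forall fun r => Eventually.of_forall fun q => ?_)
  simp only [sphereComp, nullL, Fin.cons_succ, Fin.cons_zero]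
  ring

theorem jet_sphereComp_nullLbar (i : Fin 3) :
    G.JetScri u x 1 1 (fun r => G.sphereComp (G.nullLbar u r x) (G.radialPart u x r) i) := by
  have h1 := (JetO.const (hG.isBigO_tangentPart u x i)).add ((JetO.const_mul
    (hG.isBigO_radialPart u x).neg_left ((hG.jet_dir u x i).mono (by norm_num) le_rfl)).add
    (JetO.const_mul (hG.isBigO_nullLbar u x 0) (hG.jet_shift u x i)))
  refine h1.congr (Eventually.of_forall fun r => Eventually.of_forall fun q => ?_)
  simp only [sphereComp, nullLbar_succ]
  ring

theorem jet_quadratic {k l k' l' m n : ℤ} {ζ ζ' : Fin 3 → ℝ → (Fin 4 → ℝ) → ℝ}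
    (h : ∀ i, G.JetScri u x k l (ζ i)) (h' : ∀ i, G.JetScri u x k' l' (ζ' i)) (hl : l ≤ k)
    (hm : m ≤ k + k') (hn : n ≤ k + l') (hn' : n ≤ l + k') :
    G.JetScri u x m n (fun r q => ∑ i, ∑ j, coef (fun u s x => G.h u s x i j) q * ζ i r q
      * ζ' j r q) :=
  JetO.sum fun i => JetO.sum fun j => ((hG.jet_h u x i j).mul (h i) (m := k) (n := l) (by omega)
    (by omega) (by omega)).mul (h' j) hm hn hn'

theorem jet_coef_U : G.JetScri u x 0 0 (fun _ q => coef G.U q) := by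
  have h := ((hG.jet_U u x).mono (m := 0) (n := 0) (by norm_num) (by norm_num)).add
    (JetO.const (isBigO_const_zpow 1))
  simpa using h

theorem jet_coef_V : G.JetScri u x 0 0 (fun _ q => coef G.V q) := by
  have h := ((hG.jet_V u x).mono (m := 0) (n := 0) (by norm_num) (by norm_num)).add
    (JetO.const (isBigO_const_zpow 1))
  simpa using h

theorem jet_radialComp_nullLbar' : G.JetScri u x 0 0 (fun r => radialComp (G.nullLbar u r x)) := by
  have h := ((hG.jet_radialComp_nullLbar u x).mono (m := 0) (n := 0) (by norm_num)
    (by norm_num)).add (JetO.const (hG.isBigO_radialPart u x))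
  simpa using h

theorem jet_radialComp_nullL' : G.JetScri u x 0 0 (fun _ => radialComp (nullL x)) := by
  have h := ((hG.jet_radialComp_nullL u x).mono (m := 0) (n := 0) (by norm_num)
    (by norm_num)).add (JetO.const (isBigO_const_zpow 1))
  simpa using h

/-- The constant vector `L` is null only along its own ray; nearby, `g(L, L)` is quadratic in the
deviation of the direction, hence of order 4. -/
theorem jet_metric_LL : G.JetScri u x 4 3 (fun _ => metricPair G.metric (nullL x) (nullL x)) := by
  refine (hG.jet_quadratic u x (hG.jet_sphereComp_nullL u x) (hG.jet_sphereComp_nullL u x)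
    (by norm_num) (m := 4) (n := 3) (by norm_num) (by norm_num) (by norm_num)).congr ?_
  filter_upwards [eventually_spatial_ne_zero u x] with r hr
  filter_upwards [hr] with q hq
  rw [metricPair_metric G hq _ _ 1 1]
  simp [nullL]

/-- The term with `U` must be kept: it has order 2 after subtracting its limit, so a mixed second
derivative of it contributes at `r⁻³`. Everything else has order 3 and contributes `O(r⁻⁴)`. -/
theorem jet_metric_LbarL : G.JetScri u x 3 2 (fun r q =>
    metricPair G.metric (G.nullLbar u r x) (nullL x) q + G.nullLbar u r x 0 * coef G.U q) := by
  have h1 : G.JetScri u x 3 2 _ := hG.jet_quadratic u x (hG.jet_sphereComp_nullLbar u x)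
    (hG.jet_sphereComp_nullL u x) le_rfl (by norm_num) (by norm_num) (by norm_num)
  have h2 : G.JetScri u x 3 2 (fun r q => G.nullLbar u r x 0 * (coef G.U q *
      (radialComp (nullL x) q - 1))) := JetO.const_mul (hG.isBigO_nullLbar u x 0)
    ((hG.jet_coef_U u x).mul ((hG.jet_radialComp_nullL u x).mono (m := 3) (n := 2) (by norm_num)
      (by norm_num)) (by norm_num) (by norm_num) (by norm_num))
  refine (h1.sub h2).congr ?_
  filter_upwards [eventually_spatial_ne_zero u x] with r hr
  filter_upwards [hr] with q hq
  rw [metricPair_metric G hq _ _ (G.radialPart u x r) 1]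
  simp only [nullL, radialComp, Fin.cons_zero, Fin.cons_succ]
  ring

/-- Order 2 for the remainder suffices, because this component enters the curvature through two
radial derivatives. The coefficient `V`, with its `1/r` term, is kept explicitly. -/
theorem jet_metric_LbarLbar : G.JetScri u x 2 2 (fun r q =>
    metricPair G.metric (G.nullLbar u r x) (G.nullLbar u r x) q
      + G.nullLbar u r x 0 * G.nullLbar u r x 0 * coef G.V q
      + 2 * G.nullLbar u r x 0 * G.radialPart u x r) := by
  have hX := hG.isBigO_nullLbar u x 0
  have h1 : G.JetScri u x 2 2 _ := hG.jet_quadratic u x (hG.jet_sphereComp_nullLbar u x)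
    (hG.jet_sphereComp_nullLbar u x) le_rfl (by norm_num) (by norm_num) (by norm_num)
  have h2 : G.JetScri u x 2 2 (fun r q => G.nullLbar u r x 0 * (G.nullLbar u r x 0 *
      ((coef G.U q - 1) * coef G.V q))) := JetO.const_mul hX (JetO.const_mul hX
    ((hG.jet_U u x).mul (hG.jet_coef_V u x) (by norm_num) (by norm_num) (by norm_num)))
  have h3 : G.JetScri u x 2 2 (fun r q => G.nullLbar u r x 0 * ((coef G.U q - 1)
      * radialComp (G.nullLbar u r x) q)) := JetO.const_mul hX
    ((hG.jet_U u x).mul (hG.jet_radialComp_nullLbar' u x) (by norm_num) (by norm_num) (by norm_num))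
  have h4 : G.JetScri u x 2 2 (fun r q => G.nullLbar u r x 0 *
      (radialComp (G.nullLbar u r x) q - G.radialPart u x r)) := JetO.const_mul hX
    ((hG.jet_radialComp_nullLbar u x).mono (by norm_num) (by norm_num))
  refine (((h1.sub h2).sub (h3.add h3)).sub (h4.add h4)).congr ?_
  filter_upwards [eventually_spatial_ne_zero u x] with r hr
  filter_upwards [hr] with q hq
  rw [metricPair_metric G hq _ _ (G.radialPart u x r) (G.radialPart u x r)]
  simp only [radialComp]
  ring

theorem jet_sphereComp_single (a : Fin 4) (i : Fin 3) :
    G.JetScri u x 0 0 (fun _ => G.sphereComp (Pi.single a 1) 0 i) := by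
  have h1 := (JetO.const_mul (isBigO_const_zpow ((Pi.single a 1 : Fin 4 → ℝ) 0))
    ((hG.jet_shift u x i).mono (m := 0) (n := 0) (by norm_num) (by norm_num))).add
    (JetO.const (isBigO_const_zpow ((Pi.single a 1 : Fin 4 → ℝ) i.succ)))
  refine h1.congr (Eventually.of_forall fun r => Eventually.of_forall fun q => ?_)
  simp only [sphereComp]
  ring

theorem jet_metric_single_L (a : Fin 4) : G.JetScri u x 2 1 (fun _ q =>
    metricPair G.metric (Pi.single a 1) (nullL x) q + (Pi.single a 1 : Fin 4 → ℝ) 0) := by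
  have h1 : G.JetScri u x 2 1 _ := hG.jet_quadratic u x (hG.jet_sphereComp_single u x a)
    (hG.jet_sphereComp_nullL u x) le_rfl (by norm_num) (by norm_num) (by norm_num)
  have h2 : G.JetScri u x 2 1 (fun _ q => (coef G.U q - 1) * radialComp (nullL x) q
      + (radialComp (nullL x) q - 1)) :=
    ((hG.jet_U u x).mul (hG.jet_radialComp_nullL' u x) (by norm_num) (by norm_num)
      (by norm_num)).add ((hG.jet_radialComp_nullL u x).mono (by norm_num) (by norm_num))
  have h3 := JetO.const_mul (isBigO_const_zpow ((Pi.single a 1 : Fin 4 → ℝ) 0)) h2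
  refine (h1.sub h3).congr ?_
  filter_upwards [eventually_spatial_ne_zero u x] with r hr
  filter_upwards [hr] with q hq
  rw [metricPair_metric G hq _ _ 0 1]
  simp only [nullL, radialComp, Fin.cons_zero, Fin.cons_succ]
  ring

theorem jet_metric_single_Lbar (a : Fin 4) : G.JetScri u x 1 1 (fun r q =>
    metricPair G.metric (Pi.single a 1) (G.nullLbar u r x) q
      + ((Pi.single a 1 : Fin 4 → ℝ) 0 * (G.nullLbar u r x 0 + G.radialPart u x r)
        + G.nullLbar u r x 0 * ∑ i : Fin 3, (Pi.single a 1 : Fin 4 → ℝ) i.succ * x.1 i)) := by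
  have hX := hG.isBigO_nullLbar u x 0
  have hc := isBigO_const_zpow ((Pi.single a 1 : Fin 4 → ℝ) 0)
  have h1 : G.JetScri u x 1 1 _ := hG.jet_quadratic u x (hG.jet_sphereComp_single u x a)
    (hG.jet_sphereComp_nullLbar u x) le_rfl (by norm_num) (by norm_num) (by norm_num)
  have h2 : G.JetScri u x 1 1 (fun r q => (coef G.U q - 1) * coef G.V q + (coef G.V q - 1)) :=
    ((hG.jet_U u x).mul (hG.jet_coef_V u x) (by norm_num) (by norm_num) (by norm_num)).add
      (hG.jet_V u x)
  have h3 : G.JetScri u x 1 1 (fun r q => (coef G.U q - 1) * radialComp (G.nullLbar u r x) q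
      + (radialComp (G.nullLbar u r x) q - G.radialPart u x r)) :=
    ((hG.jet_U u x).mul (hG.jet_radialComp_nullLbar' u x) (by norm_num) (by norm_num)
      (by norm_num)).add ((hG.jet_radialComp_nullLbar u x).mono (by norm_num) (by norm_num))
  have h4 : G.JetScri u x 1 1 (fun _ q => ∑ i : Fin 3, (Pi.single a 1 : Fin 4 → ℝ) i.succ *
      (coef G.U q * (dirCoef i q - x.1 i) + (coef G.U q - 1) * x.1 i)) :=
    JetO.sum fun i => JetO.const_mul (isBigO_const_zpow _)
      (((hG.jet_coef_U u x).mul ((hG.jet_dir u x i).mono (m := 1) (n := 1) (by norm_num) le_rfl)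
        (by norm_num) (by norm_num) (by norm_num)).add ((hG.jet_U u x).mul (l' := 0)
          (JetO.const (isBigO_const_zpow (x.1 i))) (by norm_num) (by norm_num) (by norm_num)))
  refine (((h1.sub (JetO.const_mul hc (JetO.const_mul hX h2))).sub (JetO.const_mul hc h3)).sub
    (JetO.const_mul hX h4)).congr ?_
  filter_upwards [eventually_spatial_ne_zero u x] with r hr
  filter_upwards [hr] with q hq
  rw [metricPair_metric G hq _ _ 0 (G.radialPart u x r)]
  simp only [radialComp, Fin.sum_univ_three]
  ring

end HasNullInfinityData

end BondiSachsMetric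

end

noncomputable section

open BondiSachsMetric

theorem secondDeriv_const_mul {F : (Fin 4 → ℝ) → ℝ} {p : Fin 4 → ℝ} (hF : ContDiffAt ℝ 2 F p) (c : ℝ)
    (v w : Fin 4 → ℝ) : secondDeriv (fun q => c * F q) p v w = c * secondDeriv F p v w := by
  rw [secondDeriv_mul contDiffAt_const hF, secondDeriv_const]
  simp

theorem metricPair_comm {g : (Fin 4 → ℝ) → Matrix (Fin 4) (Fin 4) ℝ}
    (hs : ∀ q a b, g q a b = g q b a) (v w : Fin 4 → ℝ) : metricPair g v w = metricPair g w v := by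
  funext q
  simp only [metricPair]
  rw [Finset.sum_comm]
  refine Finset.sum_congr rfl fun b _ => Finset.sum_congr rfl fun a _ => ?_
  rw [hs, mul_comm (v a)]

/-! ### The curvature of a Bondi-Sachs metric near null infinity -/

namespace BondiSachsMetric
variable {G : BondiSachsMetric}

/-- The limit of the components of a Bondi-Sachs metric at null infinity. -/
def limitMetric (x : S2) : Matrix (Fin 4) (Fin 4) ℝ :=
  Matrix.of (Fin.cons (Fin.cons (-1) fun j => -x.1 j)
    fun i => Fin.cons (-x.1 i) fun j => roundMetric x i j)

/-- The inverse of the limit of the components of a Bondi-Sachs metric at null infinity. -/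
def limitInverse (x : S2) : Matrix (Fin 4) (Fin 4) ℝ :=
  Matrix.of (Fin.cons (Fin.cons 0 fun j => -x.1 j)
    fun i => Fin.cons (-x.1 i) fun j => kron i j)

/-- The limit is the Minkowski metric in the coordinates `(u, y)`. Its explicit inverse shows that
it is nondegenerate, which bounds the inverse metric for large `r`. -/
theorem limitMetric_mul_limitInverse (x : S2) : limitMetric x * limitInverse x = 1 := by
  have h := S2.sum_sq x
  ext a b
  rw [Matrix.mul_apply, Fin.sum_univ_succ]
  refine Fin.cases ?_ (fun i => ?_) a <;> refine Fin.cases ?_ (fun j => ?_) b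
  · simpa [limitMetric, limitInverse] using h
  · simp [limitMetric, limitInverse, kron, (Fin.succ_ne_zero j).symm]
  · simpa [limitMetric, limitInverse, Matrix.one_apply] using sum_roundMetric_mul_coord x i
  · simp [limitMetric, limitInverse, kron, Matrix.one_apply, roundMetric]

theorem det_limitMetric_ne_zero (x : S2) : (limitMetric x).det ≠ 0 :=
  (Matrix.isUnit_det_of_right_inverse (limitMetric_mul_limitInverse x)).ne_zero

namespace HasNullInfinityData
variable {D : NullInfinityData} (hG : G.HasNullInfinityData D) (u : ℝ) (x : S2)
include hG

theorem eventually_contDiffAt_metric :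
    ∀ᶠ r in atTop, ∀ a b, ContDiffAt ℝ 2 (fun q => G.metric q a b) (point u r x) := by
  rw [eventually_all]
  intro a
  rw [eventually_all]
  intro b
  have h1 : G.JetScri u x 0 0 _ := hG.jet_quadratic u x (hG.jet_sphereComp_single u x a)
    (hG.jet_sphereComp_single u x b) le_rfl (by norm_num) (by norm_num) (by norm_num)
  have hn : ∀ᶠ r in atTop, ∀ i, ContDiffAt ℝ 2 (dirCoef i) (point u r x) := by
    filter_upwards [eventually_gt_atTop 0] with r hr i
    exact contDiffAt_dirCoef i hr
  filter_upwards [h1.smooth, (hG.jet_coef_U u x).smooth, (hG.jet_coef_V u x).smooth, hn,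
    eventually_spatial_ne_zero u x] with r h1 h2 h3 h4 h5
  rw [← metricPair_single a b]
  refine ContDiffAt.congr_of_eventuallyEq ?_ (h5.mono fun q hq => metricPair_metric G hq _ _ 0 0)
  exact ((((h2.mul h3).neg.mul contDiffAt_const).mul contDiffAt_const).sub (h2.mul
    ((contDiffAt_const.mul (ContDiffAt.sum fun i _ => contDiffAt_const.mul (h4 i))).add
      ((ContDiffAt.sum fun i _ => contDiffAt_const.mul (h4 i)).mul contDiffAt_const)))).add h1

theorem tendsto_metricPair (v w : Fin 4 → ℝ) :
    Tendsto (fun r => metricPair G.metric v w (point u r x)) atTop (𝓝 (-(1 * 1) * v 0 * w 0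
      - 1 * (v 0 * (∑ i, w i.succ * x.1 i) + (∑ i, v i.succ * x.1 i) * w 0)
      + ∑ i, ∑ j, roundMetric x i j * v i.succ * w j.succ)) := by
  have hs : ∀ (v : Fin 4 → ℝ) i,
      Tendsto (fun r : ℝ => v i.succ + r * G.W u r⁻¹ x i * v 0) atTop (𝓝 (v i.succ)) := by
    intro v i
    have := ((tendsto_of_isBigO le_rfl (hG.isBigO_rW u x i)).mul_const (v 0)).const_add (v i.succ)
    simpa using this
  have h1 := (((((hG.tendsto_U u x).mul (hG.tendsto_V u x)).neg.mul_const (v 0)).mul_const (w 0)).sub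
    ((hG.tendsto_U u x).mul_const (v 0 * (∑ i, w i.succ * x.1 i) + (∑ i, v i.succ * x.1 i) * w 0))).add
    (tendsto_finsetSum Finset.univ fun i _ => tendsto_finsetSum Finset.univ fun j _ =>
      ((hG.tendsto_h u x i j).mul (hs v i)).mul (hs w j))
  refine h1.congr' ?_
  filter_upwards [eventually_gt_atTop 0] with r hr
  have h2 : spatial (point u r x) ≠ 0 := by
    rw [spatial_point]
    exact smul_ne_zero hr.ne' (S2.coe_ne_zero x)
  rw [metricPair_metric G h2 _ _ 0 0]
  simp only [coef_point hr, dirCoef_point _ hr, sphereComp, shift, spatial_point, norm_smul,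
    S2.norm_coe, Real.norm_of_nonneg hr.le, zero_mul, sub_zero, mul_one]

theorem tendsto_metric :
    Tendsto (fun r => G.metric (point u r x)) atTop (𝓝 (limitMetric x)) := by
  refine tendsto_pi_nhds.2 fun a => tendsto_pi_nhds.2 fun b => ?_
  have h := hG.tendsto_metricPair u x (Pi.single a 1) (Pi.single b 1)
  rw [metricPair_single] at h
  convert h using 2
  refine Fin.cases ?_ (fun i => ?_) a <;> refine Fin.cases ?_ (fun j => ?_) b
  · simp [limitMetric]
  · simp [limitMetric, Pi.single_apply]
  · simp [limitMetric, Pi.single_apply]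
  · simp [limitMetric, Pi.single_apply]

theorem isBigO_inv_metric (a b : Fin 4) :
    (fun r => (G.metric (point u r x))⁻¹ a b) =O[atTop] fun r : ℝ => r ^ (-(0 : ℤ)) := by
  have h1 := hG.tendsto_metric u x
  have h2 : Tendsto (fun r => (G.metric (point u r x)).det) atTop (𝓝 (limitMetric x).det) :=
    ((continuous_id.matrix_det).tendsto _).comp h1
  have h3 : Tendsto (fun r => (G.metric (point u r x)).adjugate a b) atTop
      (𝓝 ((limitMetric x).adjugate a b)) :=
    (((continuous_id.matrix_adjugate).matrix_elem a b).tendsto _).comp h1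
  refine (isBigO_of_tendsto ((h2.inv₀ (det_limitMetric_ne_zero x)).mul h3)).congr_left fun r => ?_
  simp [Matrix.inv_def]

theorem eventually_det_metric_ne_zero :
    ∀ᶠ r in atTop, (G.metric (point u r x)).det ≠ 0 :=
  (((continuous_id.matrix_det).tendsto _).comp (hG.tendsto_metric u x)).eventually_ne
    (det_limitMetric_ne_zero x)

/-- The three estimates that follow have orders 3, 1 and 2 for `LL`, `L̲L̲` and `L̲L`. The curvature
contains the products of orders `1 + 3` and `2 + 2`, both beyond `r⁻³`. -/
theorem isBigO_christoffelLow_LL (a : Fin 4) :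
    (fun r => christoffelLow G.metric (Pi.single a 1) (nullL x) (nullL x) (point u r x))
      =O[atTop] fun r : ℝ => r ^ (-(3 : ℤ)) := by
  have h1 := (hG.jet_metric_single_L u x a).dY
  have h2 := (hG.jet_metric_LL u x).dAll a
  -- Limits of metric components are constant for each fixed `r` and drop out under differentiation.
  simp only [fderiv_add_const] at h1
  exact ((h1.add h1).sub h2).const_mul_left _

theorem isBigO_christoffelLow_LbarLbar (a : Fin 4) :
    (fun r => christoffelLow G.metric (Pi.single a 1) (G.nullLbar u r x) (G.nullLbar u r x)
      (point u r x)) =O[atTop] fun r : ℝ => r ^ (-(1 : ℤ)) := by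
  have h1 := (hG.jet_metric_single_Lbar u x a).dX
  have hX := hG.isBigO_nullLbar u x 0
  have h3 : G.JetScri u x 1 1 (fun r q => metricPair G.metric (G.nullLbar u r x) (G.nullLbar u r x) q
      + (G.nullLbar u r x 0 * G.nullLbar u r x 0
        + 2 * G.nullLbar u r x 0 * G.radialPart u x r)) := by
    refine (((hG.jet_metric_LbarLbar u x).mono (by norm_num) (by norm_num)).sub (JetO.const_mul hX
      (JetO.const_mul hX (hG.jet_V u x)))).congr
      (Eventually.of_forall fun r => Eventually.of_forall fun q => ?_)
    ring
  have h2 := h3.dAll a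
  simp only [fderiv_add_const] at h1 h2
  exact ((h1.add h1).sub h2).const_mul_left _

theorem isBigO_christoffelLow_LbarL (a : Fin 4) :
    (fun r => christoffelLow G.metric (Pi.single a 1) (G.nullLbar u r x) (nullL x)
      (point u r x)) =O[atTop] fun r : ℝ => r ^ (-(2 : ℤ)) := by
  have h1 := (hG.jet_metric_single_Lbar u x a).dY
  have h2 := (hG.jet_metric_single_L u x a).dX
  have h3 : G.JetScri u x 2 2 (fun r q => metricPair G.metric (G.nullLbar u r x) (nullL x) q
      + G.nullLbar u r x 0) := by
    refine (((hG.jet_metric_LbarL u x).mono (by norm_num) (by norm_num)).sub (JetO.const_mul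
      (hG.isBigO_nullLbar u x 0) (hG.jet_U u x))).congr
      (Eventually.of_forall fun r => Eventually.of_forall fun q => ?_)
    ring
  have h4 := h3.dAll a
  simp only [fderiv_add_const] at h1 h2 h4
  exact ((h2.add h1).sub h4).const_mul_left _

/-- In `riemann_eq` the connection terms and `g(L, L)` contribute `O(r⁻⁴)`. The two remaining metric
components reduce to `-L̲⁰ U` and `-(L̲⁰)² V`, with `L̲⁰` frozen. -/
theorem isBigO_riemann : (fun r => riemann G.metric (point u r x) (G.nullLbar u r x) (nullL x)
      (G.nullLbar u r x) (nullL x)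
      - (1 / 2 * (G.nullLbar u r x 0 * G.nullLbar u r x 0)
          * secondDeriv (coef G.V) (point u r x) (nullL x) (nullL x)
        - G.nullLbar u r x 0 * secondDeriv (coef G.U) (point u r x) (G.nullLbar u r x) (nullL x)))
      =O[atTop] fun r : ℝ => r ^ (-(4 : ℤ)) := by
  have h1 := (hG.jet_metric_LbarL u x).dXY
  have h2 := (hG.jet_metric_LL u x).dXX
  have h3 := (hG.jet_metric_LbarLbar u x).dYY
  have h4 : (fun r => ∑ d, ∑ f, (G.metric (point u r x))⁻¹ d f *
      (christoffelLow G.metric (Pi.single d 1) (G.nullLbar u r x) (G.nullLbar u r x) (point u r x)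
        * christoffelLow G.metric (Pi.single f 1) (nullL x) (nullL x) (point u r x)))
      =O[atTop] fun r : ℝ => r ^ (-(4 : ℤ)) :=
    Asymptotics.IsBigO.fun_sum fun d _ => Asymptotics.IsBigO.fun_sum fun f _ =>
      isBigO_mul_zpow (hG.isBigO_inv_metric u x d f) (isBigO_mul_zpow
        (hG.isBigO_christoffelLow_LbarLbar u x d) (hG.isBigO_christoffelLow_LL u x f)
        (c := 4) (by norm_num)) (by norm_num)
  have h5 : (fun r => ∑ d, ∑ f, (G.metric (point u r x))⁻¹ d f *
      (christoffelLow G.metric (Pi.single d 1) (G.nullLbar u r x) (nullL x) (point u r x)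
        * christoffelLow G.metric (Pi.single f 1) (G.nullLbar u r x) (nullL x) (point u r x)))
      =O[atTop] fun r : ℝ => r ^ (-(4 : ℤ)) :=
    Asymptotics.IsBigO.fun_sum fun d _ => Asymptotics.IsBigO.fun_sum fun f _ =>
      isBigO_mul_zpow (hG.isBigO_inv_metric u x d f) (isBigO_mul_zpow
        (hG.isBigO_christoffelLow_LbarL u x d) (hG.isBigO_christoffelLow_LbarL u x f)
        (c := 4) (by norm_num)) (by norm_num)
  refine EventuallyEq.trans_isBigO ?_ ((((h1.sub (h2.const_mul_left (1 / 2))).sub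
    ((h3.trans (isBigO_zpow (b := 4) (by norm_num))).const_mul_left (1 / 2))).sub h4).add h5)
  filter_upwards [hG.eventually_contDiffAt_metric u x, hG.eventually_det_metric_ne_zero u x,
    (hG.jet_coef_U u x).smooth, (hG.jet_coef_V u x).smooth] with r hg hdet hU hV
  have e1 : ∀ z, christoffelLow G.metric z (nullL x) (G.nullLbar u r x) (point u r x)
      = christoffelLow G.metric z (G.nullLbar u r x) (nullL x) (point u r x) := by
    intro z
    simp only [christoffelLow, metricPair_comm G.metric_symm (nullL x) (G.nullLbar u r x)]
    ring
  rw [riemann_eq hg G.metric_symm hdet]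
  simp only [e1]
  rw [secondDeriv_add (contDiffAt_metricPair hg _ _) (contDiffAt_const.mul hU),
    secondDeriv_const_mul hU, secondDeriv_add ((contDiffAt_metricPair hg _ _).add
    (contDiffAt_const.mul hV)) contDiffAt_const, secondDeriv_const,
    secondDeriv_add (contDiffAt_metricPair hg _ _) (contDiffAt_const.mul hV),
    secondDeriv_const_mul hV]
  ring

end HasNullInfinityData

end BondiSachsMetric

end

/-! ### The leading curvature coefficient at null infinity -/

noncomputable section

open BondiSachsMetric

section Model
variable {u r : ℝ} {x : S2}

theorem secondDeriv_coef_inv {F : ℝ → S2 → ℝ}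
    (h : ∀ᶠ r in atTop, ContDiffAt ℝ 2 (coef fun u s x => F u x * s) (point u r x)) :
    ∀ᶠ r in atTop, secondDeriv (coef fun u s x => F u x * s) (point u r x) (nullL x) (nullL x)
      = 2 * F u x * (r ^ 3)⁻¹ := by
  filter_upwards [h, eventually_gt_atTop 0] with r h hr
  refine secondDeriv_nullL h (φ := fun ρ => F u x * -(ρ ^ 2)⁻¹) ?_ ?_
  · filter_upwards [eventually_differentiableAt_point h, lt_mem_nhds hr] with ρ h1 h2
    refine fderiv_eq_of_line (φ := fun t => F u x * (ρ + t)⁻¹) h1 ?_ ?_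
    · have h3 : Tendsto (fun t : ℝ => ρ + t) (𝓝 0) (𝓝 ρ) := by
        have h1 : Continuous fun t : ℝ => ρ + t := by fun_prop
        simpa using h1.tendsto 0
      filter_upwards [h3.eventually (lt_mem_nhds h2)] with t ht
      rw [point_add_nullL, coef_point ht]
    · have h3 : HasDerivAt (fun t : ℝ => (ρ + t)⁻¹) (-((ρ + 0) ^ 2)⁻¹) 0 :=
        (hasDerivAt_inv (by simpa using h2.ne')).comp_const_add ρ 0
      simpa using h3.const_mul (F u x)
  · refine (((hasDerivAt_pow 2 r).inv (pow_ne_zero 2 hr.ne')).neg.const_mul (F u x)).congr_deriv ?_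
    field_simp
    ring

theorem secondDeriv_coef_inv_sq {F : ℝ → S2 → ℝ} {F' : ℝ} (hF : HasDerivAt (fun t => F t x) F' u)
    (h : ∀ᶠ r in atTop, ContDiffAt ℝ 2 (coef fun u s x => F u x * (s * s)) (point u r x)) :
    ∀ᶠ r in atTop, secondDeriv (coef fun u s x => F u x * (s * s)) (point u r x) (Pi.single 0 1)
      (nullL x) = -(2 * F' * (r ^ 3)⁻¹) := by
  filter_upwards [h, eventually_gt_atTop 0] with r h hr
  refine secondDeriv_nullL h (φ := fun ρ => F' * (ρ ^ 2)⁻¹) ?_ ?_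
  · filter_upwards [eventually_differentiableAt_point h, lt_mem_nhds hr] with ρ h1 h2
    refine fderiv_eq_of_line (φ := fun t => F (u + t) x * (ρ ^ 2)⁻¹) h1 ?_ ?_
    · refine Eventually.of_forall fun t => ?_
      simp only [point_add_single, coef_point h2]
      ring
    · have h3 : HasDerivAt (fun t => F t x) F' (u + 0) := by simpa using hF
      exact (h3.comp_const_add u 0).mul_const _
  · refine (((hasDerivAt_pow 2 r).inv (pow_ne_zero 2 hr.ne')).const_mul F').congr_deriv ?_
    field_simp
    ring

end Model

namespace BondiSachsMetric.HasNullInfinityData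
variable {G : BondiSachsMetric} {D : NullInfinityData} (hG : G.HasNullInfinityData D)
  (hD : D.IsVacuum) (u : ℝ) (x : S2)
include hG hD

/-- Adding back `2 m / r` leaves a function of order 2, whose second radial derivative is `O(r⁻⁴)`;
the explicit term is differentiated by hand. -/
theorem isBigO_secondDeriv_V : (fun r => secondDeriv (coef G.V) (point u r x) (nullL x) (nullL x)
      + 4 * D.m u x * (r ^ 3)⁻¹) =O[atTop] fun r : ℝ => r ^ (-(4 : ℤ)) := by
  have hm : SmoothAtScri (fun u s x => D.m u x * s) u x :=
    hD.smooth_m.smoothAtScri.mul smoothAtScri_s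
  have h1 : G.JetScri u x 2 2 (fun _ => coef fun u s x => G.V u s x - 1 + 2 * (D.m u x * s)) := by
    refine jetO_coef (k := 2) ?_ ?_ (hG.isBigO_nullLbar u x)
    · exact (ContDiffAt.sub (G.smooth_V u x) contDiffAt_const).add
        (contDiffAt_const.mul hm)
    · intro u' x'
      simpa only [mul_assoc] using hG.isBigO_V2 u' x'
  refine EventuallyEq.trans_isBigO ?_ h1.dYY
  filter_upwards [secondDeriv_coef_inv hm.contDiffAt_coef, hm.contDiffAt_coef,
    (hG.jet_V u x).smooth, (hG.jet_coef_V u x).smooth] with r h2 h3 h4 h5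
  have e : (coef fun u s x => G.V u s x - 1 + 2 * (D.m u x * s))
      = fun q => (coef G.V q - 1) + 2 * coef (fun u s x => D.m u x * s) q := rfl
  rw [e, secondDeriv_add h4 (contDiffAt_const.mul h3), secondDeriv_const_mul h3, h2,
    secondDeriv_sub_const]
  ring

theorem isBigO_secondDeriv_U :
    (fun r => secondDeriv (coef G.U) (point u r x) (G.nullLbar u r x) (nullL x)
      - G.nullLbar u r x 0 * (1 / 4 * contract (D.C u x) (D.news u x)) * (r ^ 3)⁻¹)
      =O[atTop] fun r : ℝ => r ^ (-(4 : ℤ)) := by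
  have hc : CylinderSmooth fun u x => contract (D.C u x) (D.C u x) :=
    CylinderSmooth.contract hD.smooth_C hD.smooth_C
  have hc' : HasDerivAt (fun t => contract (D.C t x) (D.C t x))
      (2 * contract (D.C u x) (D.news u x)) u := by
    have h := HasDerivAt.fun_sum (u := Finset.univ) fun i (_ : i ∈ Finset.univ) =>
      HasDerivAt.fun_sum (u := Finset.univ) fun j (_ : j ∈ Finset.univ) =>
        (hD.hasDerivAt_C u x i j).fun_mul (hD.hasDerivAt_C u x i j)
    refine h.congr_deriv ?_
    simp only [contract, Finset.mul_sum]
    refine Finset.sum_congr rfl fun i _ => Finset.sum_congr rfl fun j _ => ?_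
    ring
  have hm : SmoothAtScri (fun u s x => contract (D.C u x) (D.C u x) * (s * s)) u x :=
    hc.smoothAtScri.mul (smoothAtScri_s.mul smoothAtScri_s)
  have h1 : G.JetScri u x 3 3 (fun _ => coef fun u s x => G.U u s x - 1
      + 1 / 16 * (contract (D.C u x) (D.C u x) * (s * s))) := by
    refine jetO_coef (k := 3) ?_ ?_ (hG.isBigO_nullLbar u x)
    · exact (ContDiffAt.sub (G.smooth_U u x) contDiffAt_const).add
        (contDiffAt_const.mul hm)
    · intro u' x'
      simpa only [mul_assoc] using hG.isBigO_U3 u' x'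
  -- The spatial part of `L̲` acting on `|C|² / r²` gains a factor `1/r`, as does the radial
  -- derivative, so only the `∂_u` part of `L̲` survives at order `r⁻³`.
  have h2 : (fun r => secondDeriv (coef fun u s x => contract (D.C u x) (D.C u x) * (s * s))
      (point u r x) (Fin.cons 0 fun i => G.nullLbar u r x i.succ) (nullL x))
      =O[atTop] fun r : ℝ => r ^ (-(4 : ℤ)) := by
    refine hm.secondDeriv_coef (k := 2) (m := 1) (m' := 1) (w := fun _ => nullL x) ?_ ?_ ?_
      (by norm_num)
    · intro u' x'
      refine ((isBigO_inv_pow 2).const_mul_left (contract (D.C u' x') (D.C u' x'))).congr_left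
        fun r => ?_
      ring
    · intro c
      refine Fin.cases ?_ (fun j => ?_) c
      · simpa [scaledVec] using Asymptotics.isBigO_zero _ _
      · exact isBigO_mul_zpow isBigO_inv_zpow (hG.isBigO_nullLbar u x j.succ) (by norm_num)
    · intro c
      refine Fin.cases ?_ (fun j => ?_) c
      · simpa [scaledVec, nullL] using Asymptotics.isBigO_zero _ _
      · exact isBigO_mul_zpow isBigO_inv_zpow (isBigO_const_zpow (x.1 j)) (by norm_num)
  refine EventuallyEq.trans_isBigO ?_ (h1.dXY.sub (h2.const_mul_left (1 / 16)))
  filter_upwards [secondDeriv_coef_inv_sq hc' hm.contDiffAt_coef, hm.contDiffAt_coef,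
    (hG.jet_U u x).smooth] with r h2 h3 h4
  have e : (coef fun u s x => G.U u s x - 1 + 1 / 16 * (contract (D.C u x) (D.C u x) * (s * s)))
      = fun q => (coef G.U q - 1)
        + 1 / 16 * coef (fun u s x => contract (D.C u x) (D.C u x) * (s * s)) q := rfl
  have e2 : G.nullLbar u r x = G.nullLbar u r x 0 • Pi.single 0 1
      + Fin.cons 0 fun i => G.nullLbar u r x i.succ := by
    funext a
    refine Fin.cases ?_ (fun i => ?_) a <;> simp
  have e3 : secondDeriv (coef fun u s x => contract (D.C u x) (D.C u x) * (s * s)) (point u r x)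
      (G.nullLbar u r x) (nullL x) = G.nullLbar u r x 0 *
        secondDeriv (coef fun u s x => contract (D.C u x) (D.C u x) * (s * s)) (point u r x)
          (Pi.single 0 1) (nullL x)
        + secondDeriv (coef fun u s x => contract (D.C u x) (D.C u x) * (s * s)) (point u r x)
          (Fin.cons 0 fun i => G.nullLbar u r x i.succ) (nullL x) := by
    conv_lhs => rw [e2]
    simp only [secondDeriv, map_add, map_smul, add_apply, smul_apply, smul_eq_mul]
  rw [e, secondDeriv_add h4 (contDiffAt_const.mul h3), secondDeriv_const_mul h3,
    secondDeriv_sub_const, e3, h2]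
  ring

/-- The rescaled curvature component at null infinity is `-2 m - 1/4 C_{AB} N^{AB}`. -/
theorem tendsto_rho : Tendsto (fun r : ℝ => r ^ 3 * G.rho u r x) atTop
    (𝓝 (-2 * D.m u x - 1 / 4 * contract (D.C u x) (D.news u x))) := by
  set c := contract (D.C u x) (D.news u x) with hc
  have hX := hG.isBigO_nullLbar u x 0
  have hX2 : (fun r => G.nullLbar u r x 0 * G.nullLbar u r x 0) =O[atTop]
      fun r : ℝ => r ^ (-(0 : ℤ)) := isBigO_mul_zpow hX hX (by norm_num)
  have h1 := ((hG.isBigO_riemann u x).add (isBigO_mul_zpow (hX2.const_mul_left (1 / 2))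
    (hG.isBigO_secondDeriv_V hD u x) (c := 4) (by norm_num))).sub
    (isBigO_mul_zpow hX (hG.isBigO_secondDeriv_U hD u x) (c := 4) (by norm_num))
  have h3 : (fun r : ℝ => r ^ 3) =O[atTop] fun r : ℝ => r ^ (-(-3 : ℤ)) := by
    simpa using Asymptotics.isBigO_refl (fun r : ℝ => r ^ 3) atTop
  have h4 := tendsto_of_isBigO le_rfl (isBigO_mul_zpow h3 h1 (c := 1) (by norm_num))
  have h5 := hG.tendsto_nullLbar_zero u x
  -- A quarter of `1/2 · (-4 m) - 1/4 c` is `-1/2 m - 1/16 c`; it multiplies `(L̲⁰)²`, which tends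
  -- to 4.
  have h6 := ((h5.mul h5).const_mul (-(1 / 2) * D.m u x - 1 / 16 * c)).add (h4.const_mul (1 / 4))
  have e : (-(1 / 2) * D.m u x - 1 / 16 * c) * (2 * 2) + 1 / 4 * 0
      = -2 * D.m u x - 1 / 4 * c := by ring
  rw [e] at h6
  refine h6.congr' ?_
  filter_upwards [eventually_gt_atTop 0] with r hr
  rw [rho]
  have : r ^ 3 * (r ^ 3)⁻¹ = 1 := mul_inv_cancel₀ (by positivity)
  linear_combination (G.nullLbar u r x 0 * G.nullLbar u r x 0)
    * (1 / 2 * D.m u x + 1 / 16 * c) * this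

end BondiSachsMetric.HasNullInfinityData

end

/-! ### Limits of the curvature in retarded time and the main theorem -/

noncomputable section

theorem tendsto_decay {ε : ℝ} (hε : 0 < ε) {l : Filter ℝ} (hl : Tendsto abs l atTop) :
    Tendsto (decay ε) l (𝓝 0) :=
  (tendsto_rpow_neg_atTop (by linarith : 0 < 1 + ε)).comp (tendsto_atTop_add_const_left l 1 hl)

theorem IsMode.const_mul {n : ℕ} {f : S2 → ℝ} (hf : IsMode n f) (c : ℝ) :
    IsMode n (fun x => c * f x) :=
  ⟨contDiffOn_const.mul hf.1, fun x => by
    rw [lap_const_mul, hf.2]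
    ring⟩

theorem SupportedLeOne.const_mul {f : S2 → ℝ} (hf : SupportedLeOne f) (c : ℝ) :
    SupportedLeOne (fun x => c * f x) := by
  obtain ⟨f₀, f₁, h₀, h₁, h⟩ := hf
  exact ⟨_, _, h₀.const_mul c, h₁.const_mul c, fun x => by simp only [h, mul_add]⟩

namespace NullInfinityData
variable {D : NullInfinityData} {ε : ℝ}

/-- The shear stays bounded because the news is integrable in time, and the news itself tends to
zero. -/
theorem IsVacuum.tendsto_contract_news (hD : D.IsVacuum) (hε : 0 < ε) (hN : D.NewsDecay ε) (x : S2)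
    {l : Filter ℝ} (hl : Tendsto abs l atTop) :
    Tendsto (fun u => contract (D.C u x) (D.news u x)) l (𝓝 0) := by
  have h : ∀ i j, Tendsto (fun u => D.C u x i j * D.news u x i j) l (𝓝 0) := by
    intro i j
    obtain ⟨K, hK⟩ := (hD.gradBound_C hε hN i j).bound
    obtain ⟨K', hK'⟩ := (hD.gradBound_news hε hN i j).bound
    have h1 : Tendsto (fun u => D.news u x i j) l (𝓝 0) :=
      squeeze_zero_norm (fun u => hK' u trivial x) (by simpa using (tendsto_decay hε hl).const_mul K')
    refine squeeze_zero_norm (a := fun u => K * ‖D.news u x i j‖) (fun u => ?_)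
      (by simpa using h1.norm.const_mul K)
    rw [norm_mul]
    exact mul_le_mul_of_nonneg_right (by simpa using hK u trivial x) (norm_nonneg _)
  simpa [contract] using tendsto_finsetSum Finset.univ fun i _ =>
    tendsto_finsetSum Finset.univ fun j _ => h i j

end NullInfinityData

end

theorem mainTheorem3 (D : NullInfinityData) (hD : D.IsVacuum) (ε : ℝ) (hε : 0 < ε)
    (hN : D.NewsDecay ε) :
    ∃ mp mm : S2 → ℝ,
      -- the limits `m(±)` of the mass aspect exist and are continuously differentiable
      SphereContDiff 1 mp ∧ SphereContDiff 1 mm ∧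
      (∀ x, Tendsto (fun u => D.m u x) atTop (𝓝 (mp x))) ∧
      (∀ x, Tendsto (fun u => D.m u x) atBot (𝓝 (mm x))) ∧
      -- every smooth supertranslation acts on the data
      (∀ f : S2 → ℝ, SphereContDiff ∞ f → ∃ D' : NullInfinityData, D.IsSupertranslate f D') ∧
      -- the total flux exists and changes by `-2 ∫ f Y^A ∇_A (m(+) - m(-))`
      (∀ (k : Fin 3) (f : S2 → ℝ) (D' : NullInfinityData), SphereContDiff ∞ f →
        D.IsSupertranslate f D' →
        ∃ Φ Φ' : ℝ, HasTotalFlux (D.angularMomentum k) Φ ∧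
          HasTotalFlux (D'.angularMomentum k) Φ' ∧
          Φ' - Φ = sphereIntegral (fun x =>
            -2 * f x * ∑ a, rotField k x a * grad (fun z => mp z - mm z) x a)) ∧
      -- the total flux is supertranslation invariant iff `m(+) - m(-)` has only modes `ℓ ≤ 1`
      (D.FluxSupertranslationInvariant ↔ SupportedLeOne (fun x => mp x - mm x)) ∧
      -- the sufficient condition in terms of the rescaled curvature component `P`
      (∀ G : BondiSachsMetric, G.HasNullInfinityData D →
        ∃ (P : ℝ → S2 → ℝ) (Pp Pm : S2 → ℝ), G.HasRescaledRho P ∧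
          (∀ x, Tendsto (fun u => P u x) atTop (𝓝 (Pp x))) ∧
          (∀ x, Tendsto (fun u => P u x) atBot (𝓝 (Pm x))) ∧
          (SupportedLeOne (fun x => Pp x - Pm x) → SupportedLeOne (fun x => mp x - mm x))) := by
  obtain ⟨mp, mm, hp, hm, tp, tm, hh⟩ := hD.exists_mass_limits hε hN
  have h1 : SphereContDiff 1 (fun x => mp x - mm x) := ContDiffOn.sub hp hm
  refine ⟨mp, mm, hp, hm, tp, tm, fun f hf => ⟨_, hD.isSupertranslate hf⟩, ?_,
    hD.fluxSupertranslationInvariant_iff hε hN h1 hh, ?_⟩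
  · intro k f D' hf hS
    obtain ⟨Φ, Φ', h2, h3, h4⟩ := hD.exists_flux hε hN hh hf hS k
    refine ⟨Φ, Φ', h2, h3, ?_⟩
    rw [h4, sphereIntegral_mul_rotDeriv h1 hf.smooth_one, mul_neg, ← neg_mul,
      ← sphereIntegral_const_mul]
    simp only [rotDeriv, mul_assoc]
  · intro G hG
    have hlim : ∀ {l : Filter ℝ} {y : ℝ} {x : S2}, Tendsto abs l atTop →
        Tendsto (fun u => D.m u x) l (𝓝 y) →
        Tendsto (fun u => -2 * D.m u x - 1 / 4 * contract (D.C u x) (D.news u x)) l (𝓝 (-2 * y)) := by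
      intro l y x hl hy
      simpa only [mul_zero, sub_zero] using (hy.const_mul (-2)).sub
        ((hD.tendsto_contract_news hε hN x hl).const_mul (1 / 4))
    refine ⟨fun u x => -2 * D.m u x - 1 / 4 * contract (D.C u x) (D.news u x),
      fun x => -2 * mp x, fun x => -2 * mm x, fun u x => hG.tendsto_rho hD u x,
      fun x => hlim tendsto_abs_atTop_atTop (tp x), fun x => hlim tendsto_abs_atBot_atTop (tm x),
      fun h => ?_⟩
    -- The limits are `P(±) = -2 m(±)`, so the change of `m` is `-1/2` times that of `P`.
    convert h.const_mul (-(1 / 2)) using 2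
    ring
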